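/- \textbf{Setting.} Strings are over $\Sigma=\{0,1\}$; a partial mapping on triples of strings is \emph{FPT-computable} with respect to $(\pi_1,\pi_2)$ if some algorithm computes it, on each $x=(u,u',y)$ in its domain, within time $f(u,u')\,p(|x|)$, with $f$ computable and $p$ a polynomial. A \emph{measure} is a mapping $m:\Sigma^*\times\Sigma^*\to\mathbb N$ for which there are a computable $f$ and a polynomial $p$ with $m(s,y)\le |y|\le f(s)\,p(m(s,y))$ for all $s,y$. For a language of pairs $Q\subseteq\Sigma^*\times\Sigma^*$, the triple $(C,m,r)$ is an \emph{accordion reduction} with respect to $Q$ if $C\subseteq\Sigma^*\times\Sigma^*$ is computably enumerable, $m$ is a measure, $r$ is a partial mapping $\Sigma^*\times\Sigma^*\times\Sigma^*\to\Sigma^*$ with domain $C\times\Sigma^*$ that is FPT-computable with respect to $(\pi_1,\pi_2)$, there is a partial computable $B:\Sigma^*\times\Sigma^*\to\mathbb N$ with domain $C$ such that $m(u',r(u,u',y))\le B(u,u')\,m(u,y)$ for all $(u,u')\in C$ and $y\in\Sigma^*$, and $(u,y)\in Q\Leftrightarrow(u',r(u,u',y))\in Q$ for all $(u,u')\in C$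 and $y\in\Sigma^*$. \textbf{Logic.} Formulas are multi-sorted, relational, first-order and without equality; they are built from atoms by $\neg,\wedge,\vee,\exists,\forall$, each variable has a fixed sort, and $\bigwedge,\bigvee$ are over non-empty lists and are read up to bracketing. A signature consists of a finite non-empty set $\mathcal S$ of sorts and finitely many relation symbols with arities in $\mathcal S^*$; structures are finite, with a non-empty universe $B_s$ for each sort $s\in\mathcal S$. A sentence is encoded together with its signature; a structure is encoded by the sizes of its universes in unary and by the truth tables of its relations. $\mathrm{MC}_s$ is the language of the pairs $(\phi,\mathbf B)$ where $\phi$ is a sentence, $\mathbf B$ a structure on its signature, and $\mathbf B\models\phi$. Fix $k\in\mathbb N$. A sentence has \emph{arity at most $k$} if all relation symbols of its signature have arity of length at most $k$. For a finite set $V$ of variables, $QV$ abbreviates the quantification $Qv_1\cdots Qv_n$ of its elements, in any order. A formula is \emph{loose} if no variable is quantified twice, no variable is both quantified and free, and no relation symbol appears twice; it is \emph{positive} if it contains no negation. A set $E$ of sets of variables is \emph{$X$-connected} if the graph on $E$ in which $e,e'$ are adjacent iff $X\cap e\cap e'\ne\emptyset$ is connected. Atoms and negated atoms are $\exists$-layered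 and $\forall$-layered; if $\phi_1,\dots,\phi_n$ are $\forall$-layered (respectively $\exists$-layered), $X\subseteq\bigcup_i\mathrm{free}(\phi_i)$, and $\{\mathrm{free}(\phi_1),\dots,\mathrm{free}(\phi_n)\}$ is $X$-connected, then $\exists X\bigwedge_i\phi_i$ is $\exists$-layered (respectively, $\forall X\bigvee_i\phi_i$ is $\forall$-layered). A formula is \emph{friendly} if it is loose, positive, and $\exists$-layered or $\forall$-layered. A \emph{simple formula} is a friendly formula of the form $\exists V(\bigwedge_i\alpha_i)$ or $\forall V(\bigvee_i\alpha_i)$ with all $\alpha_i$ atoms. A \emph{sentence based on} a simple formula $QV\chi$ is a simple sentence obtained from it by replacing each atom $R(w_1,\dots,w_j)$ with an atom whose set of variables is $\{w_1,\dots,w_j\}\cap V$. Let $C$ be the set of pairs $(\psi,\phi)$ of friendly sentences of arity at most $k$ such that, for some simple subformula $\phi'=QV\chi$ of $\phi$, one of the following holds: (1) $\psi$ is a sentence based on $\phi'$; (2) $Q=\exists$ and $\psi$ is obtained from $\phi$ by replacing $\phi'$ with $\bigvee_{i=1}^m E_i(v_{i1},v_{i2})$, where $\{v_{11},v_{12}\},\dots,\{v_{m1},v_{m2}\}$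 lists the two-element subsets of $\mathrm{free}(\phi')$ and each $E_i$ is a relation symbol that does not appear elsewhere in $\psi$; (3) $Q=\forall$ and $\psi$ is obtained from $\phi$ by replacing $\phi'$ with $\bigwedge_{i=1}^m E_i(v_{i1},v_{i2})$, with the $E_i$ and $v_{ij}$ as in (2). Let $M(\phi,\mathbf B)=\max_{s\in\mathcal S}|B_s|$ when $\phi$ is a sentence of arity at most $k$ and $\mathbf B$ is a structure on its signature $(\sigma,\mathcal S)$; on all other pairs of strings $(s,y)$ let $M(s,y)=|y|$. \textbf{Theorem.} For each $k\in\mathbb N$ there exists a partial mapping $r:\Sigma^*\times\Sigma^*\times\Sigma^*\to\Sigma^*$ such that $(C,M,r)$ is an accordion reduction with respect to $\mathrm{MC}_s$; moreover, for $(\psi,\phi)\in C$ and each structure $\mathbf A$ on the signature of $\psi$, $r(\psi,\phi,\mathbf A)$ is a structure on the signature of $\phi$. -/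

import Mathlib

namespace Accordion

/-! ### Strings, FPT-computability, measures, accordion reductions -/

/-- Strings over the alphabet `{0, 1}`. -/
abbrev Str := List Bool

/-- The length of a triple of strings is the length of this word, which is also what a machine
receives as its input: the three strings, separated by a blank `none`. -/
def tripleWord (x : Str × Str × Str) : List (Option Bool) :=
  x.1.map some ++ none :: (x.2.1.map some ++ none :: x.2.2.map some)

/-- A partial mapping `r` is FPT-computable with respect to the parameterization `κ`: there are
a computable function `f`, a polynomial `p` and one algorithm (a multi-stack Turing machine) which
on each `x` in the domain of `r` outputs `r x` within `f (κ x) * p |x|` steps. There is no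
requirement on inputs outside the domain. -/
def FPTComputable {α K : Type} [Primcodable K] (word : α → List (Option Bool)) (κ : α → K)
    (r : α →. Str) : Prop :=
  ∃ (f : K → ℕ) (p : Polynomial ℕ) (M : Turing.TM2ComputableAux (Option Bool) Bool),
    Computable f ∧
    ∀ x, ∀ z ∈ r x,
      Nonempty (Turing.TM2OutputsInTime M.tm ((word x).map M.inputAlphabet.invFun)
        (some (z.map M.outputAlphabet.invFun)) (f (κ x) * p.eval (word x).length))

/-- Measures: `m (s, y) ≤ |y| ≤ f s * p (m (s, y))` with `f` computable and `p` a polynomial. -/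
def IsMeasure (m : Str × Str → ℕ) : Prop :=
  ∃ (f : Str → ℕ) (p : Polynomial ℕ), Computable f ∧
    ∀ s y, m (s, y) ≤ y.length ∧ y.length ≤ f s * p.eval (m (s, y))

/-- `(C, m, r)` is an accordion reduction with respect to the language of pairs `Q`. -/
structure IsAccordionReduction (Q C : Set (Str × Str)) (m : Str × Str → ℕ)
    (r : Str × Str × Str →. Str) : Prop where
  enumerable : REPred (fun c => c ∈ C)
  measure : IsMeasure m
  dom : ∀ u u' y, (r (u, u', y)).Dom ↔ (u, u') ∈ C
  fpt : FPTComputable tripleWord (fun x => (x.1, x.2.1)) r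
  measureLinear : ∃ B : Str × Str →. ℕ, Partrec B ∧ (∀ c, (B c).Dom ↔ c ∈ C) ∧
    ∀ u u' y, ∀ b ∈ B (u, u'), ∀ z ∈ r (u, u', y), m (u', z) ≤ b * m (u, y)
  correct : ∀ u u' y, ∀ z ∈ r (u, u', y), ((u, y) ∈ Q ↔ (u', z) ∈ Q)

/-! ### Multi-sorted relational first-order logic without equality -/

/-- A variable `(x, s)` with name `x` and sort `s`. -/
abbrev Var := ℕ × ℕ

/-- Formulas; `atom R [v₁, …, vₖ]` is the atom `R(v₁, …, vₖ)`. -/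
inductive Formula : Type
  | atom (R : ℕ) (args : List Var) : Formula
  | neg (φ : Formula) : Formula
  | and (φ ψ : Formula) : Formula
  | or (φ ψ : Formula) : Formula
  | ex (v : Var) (φ : Formula) : Formula
  | all (v : Var) (φ : Formula) : Formula

namespace Formula

/-- The free variables. -/
def free : Formula → Finset Var
  | atom _ args => args.toFinset
  | neg φ => φ.free
  | and φ ψ => φ.free ∪ ψ.free
  | or φ ψ => φ.free ∪ ψ.free
  | ex v φ => φ.free.erase v
  | all v φ => φ.free.erase v

/-- The quantified variables, one entry for each quantifier occurrence. -/
def quantified : Formula → List Var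
  | atom _ _ => []
  | neg φ => φ.quantified
  | and φ ψ => φ.quantified ++ ψ.quantified
  | or φ ψ => φ.quantified ++ ψ.quantified
  | ex v φ => v :: φ.quantified
  | all v φ => v :: φ.quantified

/-- The relation symbols, one entry for each occurrence. -/
def symbols : Formula → List ℕ
  | atom R _ => [R]
  | neg φ => φ.symbols
  | and φ ψ => φ.symbols ++ ψ.symbols
  | or φ ψ => φ.symbols ++ ψ.symbols
  | ex _ φ => φ.symbols
  | all _ φ => φ.symbols

/-- A formula without negation. -/
def Positive : Formula → Prop
  | atom _ _ => True
  | neg _ => False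
  | and φ ψ => φ.Positive ∧ ψ.Positive
  | or φ ψ => φ.Positive ∧ ψ.Positive
  | ex _ φ => φ.Positive
  | all _ φ => φ.Positive

/-- No variable is quantified twice, and none is both quantified and free. -/
def VariableLoose (φ : Formula) : Prop :=
  φ.quantified.Nodup ∧ ∀ v ∈ φ.quantified, v ∉ φ.free

/-- No relation symbol appears more than once. -/
def SymbolLoose (φ : Formula) : Prop := φ.symbols.Nodup

def Loose (φ : Formula) : Prop := φ.VariableLoose ∧ φ.SymbolLoose

def IsAtom (φ : Formula) : Prop := ∃ R args, φ = atom R args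

end Formula

/-- A set of sorts and a set of relation symbols `R` with arities `w ∈ S*`, entered as `(R, w)`. -/
structure Signature where
  sorts : List ℕ
  rels : List (ℕ × List ℕ)

/-- There is at least one sort, sorts and symbols are listed once, and arities use listed sorts. -/
structure Signature.WellFormed (σ : Signature) : Prop where
  sorts_ne : σ.sorts ≠ []
  sorts_nodup : σ.sorts.Nodup
  rels_nodup : (σ.rels.map Prod.fst).Nodup
  arity_sorts : ∀ R w, (R, w) ∈ σ.rels → ∀ s ∈ w, s ∈ σ.sorts

/-- The formula is a formula over the signature `σ`. -/
def Formula.Over (σ : Signature) : Formula → Prop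
  | atom R args => (R, args.map Prod.snd) ∈ σ.rels
  | neg φ => φ.Over σ
  | and φ ψ => φ.Over σ ∧ ψ.Over σ
  | or φ ψ => φ.Over σ ∧ ψ.Over σ
  | ex v φ => v.2 ∈ σ.sorts ∧ φ.Over σ
  | all v φ => v.2 ∈ σ.sorts ∧ φ.Over σ

/-- A formula together with its signature. -/
structure SigFormula where
  sig : Signature
  form : Formula

/-- A sentence over a signature. -/
structure SigFormula.IsSentence (φ : SigFormula) : Prop where
  wf : φ.sig.WellFormed
  isOver : φ.form.Over φ.sig
  closed : φ.form.free = ∅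

/-- All relation symbols of the signature have arity of length at most `k`. -/
def SigFormula.ArityLE (φ : SigFormula) (k : ℕ) : Prop :=
  ∀ R w, (R, w) ∈ φ.sig.rels → w.length ≤ k

/-- A finite multi-sorted structure: the universe of sort `s` is `{0, …, card s - 1}`, and `rel R`
is the characteristic function of the interpretation of `R`. Only the values on the sorts of the
signature, and on the tuples from `tuples` below, are used. -/
structure Struc where
  card : ℕ → ℕ
  rel : ℕ → List ℕ → Bool

/-- `A` is a structure on `σ` with non-empty universes. -/
def Struc.On (A : Struc) (σ : Signature) : Prop := ∀ s ∈ σ.sorts, 0 < A.card s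

/-- Satisfaction under an assignment. -/
def Formula.Sat (A : Struc) : (Var → ℕ) → Formula → Prop
  | g, atom R args => A.rel R (args.map g) = true
  | g, neg φ => ¬ φ.Sat A g
  | g, and φ ψ => φ.Sat A g ∧ ψ.Sat A g
  | g, or φ ψ => φ.Sat A g ∨ ψ.Sat A g
  | g, ex v φ => ∃ a < A.card v.2, φ.Sat A (Function.update g v a)
  | g, all v φ => ∀ a < A.card v.2, φ.Sat A (Function.update g v a)

/-- A structure is a model of a sentence; the assignment is immaterial. -/
def Struc.Models (A : Struc) (φ : Formula) : Prop := φ.Sat A (fun _ => 0)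

/-- The largest size of the universe of a sort of `σ`. -/
def Struc.maxCard (A : Struc) (σ : Signature) : ℕ := σ.sorts.toFinset.sup A.card

/-! ### Encodings as strings -/

/-- A list of numbers as a string, each number in unary and closed by `false`. -/
def natsStr (l : List ℕ) : Str := l.flatMap fun n => List.replicate n true ++ [false]

/-- Prefix notation. -/
def Formula.code : Formula → List ℕ
  | atom R args => 0 :: R :: args.length :: args.flatMap fun v => [v.1, v.2]
  | neg φ => 1 :: φ.code
  | and φ ψ => 2 :: (φ.code ++ ψ.code)
  | or φ ψ => 3 :: (φ.code ++ ψ.code)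
  | ex v φ => 4 :: v.1 :: v.2 :: φ.code
  | all v φ => 5 :: v.1 :: v.2 :: φ.code

def Signature.code (σ : Signature) : List ℕ :=
  σ.sorts.length :: (σ.sorts ++
    σ.rels.length :: σ.rels.flatMap fun R => R.1 :: R.2.length :: R.2)

/-- The encoding of a sentence includes its signature. -/
def SigFormula.encode (φ : SigFormula) : Str := natsStr (φ.sig.code ++ φ.form.code)

/-- The elements of `B_w = B_{w₁} × ⋯ × B_{wₖ}` in lexicographic order. -/
def tuples (card : ℕ → ℕ) : List ℕ → List (List ℕ)
  | [] => [[]]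
  | s :: w => (List.range (card s)).flatMap fun a => (tuples card w).map (a :: ·)

/-- The encoding of a structure on `σ`: the sizes of the universes in unary, then, for each relation
symbol `R` of arity `w`, the table of the truth values of `R` on the tuples in `B_w`. -/
def Struc.encode (σ : Signature) (A : Struc) : Str :=
  natsStr (σ.sorts.map A.card) ++ σ.rels.flatMap fun R => (tuples A.card R.2).map (A.rel R.1)

/-- Multi-sorted model checking. -/
def MCs : Set (Str × Str) :=
  {c | ∃ (φ : SigFormula) (A : Struc), φ.IsSentence ∧ A.On φ.sig ∧
    c = (φ.encode, A.encode φ.sig) ∧ A.Models φ.form}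

/-- `c` encodes a sentence `φ` of arity at most `k`, and a structure `A` on its signature. -/
def Encodes (k : ℕ) (c : Str × Str) (φ : SigFormula) (A : Struc) : Prop :=
  φ.IsSentence ∧ φ.ArityLE k ∧ A.On φ.sig ∧ c = (φ.encode, A.encode φ.sig)

open Classical in
/-- The measure `M(φ, A) = max_s |A_s|` on pairs of a sentence of arity at most `k` and a structure
on its signature (see `maxSortSize_eq`); string pairs not of this form get the length of the
second component. -/
noncomputable def maxSortSize (k : ℕ) (c : Str × Str) : ℕ :=
  if h : ∃ d : SigFormula × Struc, Encodes k c d.1 d.2 then h.choose.2.maxCard h.choose.1.sig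
  else c.2.length

/-! ### Layered, friendly and simple formulas -/

/-- The two quantifiers. -/
inductive Quant : Type
  | ex : Quant
  | all : Quant

namespace Quant

/-- The other quantifier. -/
def dual : Quant → Quant
  | ex => all
  | all => ex

/-- `∃ v φ` or `∀ v φ`. -/
def bind : Quant → Var → Formula → Formula
  | ex => Formula.ex
  | all => Formula.all

/-- `Q v₁ … Q vₙ φ`. -/
def binds (q : Quant) (V : List Var) (φ : Formula) : Formula := V.foldr q.bind φ

/-- `φ ∧ ψ` for `∃` and `φ ∨ ψ` for `∀`. -/
def junct : Quant → Formula → Formula → Formula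
  | ex => Formula.and
  | all => Formula.or

end Quant

/-- `χ` is `⋀ᵢ φᵢ` (for `∃`) or `⋁ᵢ φᵢ` (for `∀`) for the non-empty list `φ₁, …, φₙ`, in any
bracketing. -/
inductive JunctionOf (q : Quant) : List Formula → Formula → Prop
  | single (φ : Formula) : JunctionOf q [φ] φ
  | append {L₁ L₂ : List Formula} {χ₁ χ₂ : Formula} (h₁ : JunctionOf q L₁ χ₁)
      (h₂ : JunctionOf q L₂ χ₂) : JunctionOf q (L₁ ++ L₂) (q.junct χ₁ χ₂)

/-- A set of edges is `S`-connected: the graph whose vertices are the edges, two of them being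
adjacent if they have a common element in `S`, is connected. -/
def EdgesConnected (S : Finset Var) (E : Finset (Finset Var)) : Prop :=
  (SimpleGraph.fromRel fun e e' : {e // e ∈ E} => (S ∩ e.1 ∩ e'.1).Nonempty).Connected

/-- The inductive construction of the `q`-layered formulas. -/
inductive LayeredBy : Quant → Formula → Prop
  | atom (q : Quant) (R : ℕ) (args : List Var) : LayeredBy q (.atom R args)
  | negAtom (q : Quant) (R : ℕ) (args : List Var) : LayeredBy q (.neg (.atom R args))
  | block (q : Quant) (X : List Var) (L : List Formula) (χ : Formula)
      (layered : ∀ φ ∈ L, LayeredBy q.dual φ)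
      (subset : ∀ x ∈ X, ∃ φ ∈ L, x ∈ φ.free)
      (connected : EdgesConnected X.toFinset (L.map Formula.free).toFinset)
      (junction : JunctionOf q L χ) : LayeredBy q (q.binds X χ)

/-- `∃`-layered or `∀`-layered formulas. -/
def Layered (φ : Formula) : Prop := φ.VariableLoose ∧ ∃ q, LayeredBy q φ

/-- Loose, positive and layered. -/
def Friendly (φ : Formula) : Prop := φ.Loose ∧ φ.Positive ∧ Layered φ

/-- `φ` is a simple formula `∃ V (⋀ᵢ αᵢ)` (for `q = ∃`) or `∀ V (⋁ᵢ αᵢ)` (for `q = ∀`). -/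
def SimpleForm (q : Quant) (V : List Var) (φ : Formula) : Prop :=
  Friendly φ ∧ ∃ L χ, (∀ α ∈ L, α.IsAtom) ∧ JunctionOf q L χ ∧ φ = q.binds V χ

/-- `ψ` results from `φ` by replacing each atom `R(w₁, …, wₖ)` with an atom whose variables are
the elements of `{w₁, …, wₖ} ∩ V`. -/
inductive AtomsRestricted (V : Finset Var) : Formula → Formula → Prop
  | atom (R R' : ℕ) (args args' : List Var) (h : args'.toFinset = args.toFinset ∩ V) :
      AtomsRestricted V (.atom R args) (.atom R' args')
  | neg {φ ψ} (h : AtomsRestricted V φ ψ) : AtomsRestricted V (.neg φ) (.neg ψ)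
  | and {φ₁ φ₂ ψ₁ ψ₂} (h₁ : AtomsRestricted V φ₁ ψ₁) (h₂ : AtomsRestricted V φ₂ ψ₂) :
      AtomsRestricted V (.and φ₁ φ₂) (.and ψ₁ ψ₂)
  | or {φ₁ φ₂ ψ₁ ψ₂} (h₁ : AtomsRestricted V φ₁ ψ₁) (h₂ : AtomsRestricted V φ₂ ψ₂) :
      AtomsRestricted V (.or φ₁ φ₂) (.or ψ₁ ψ₂)
  | ex (v : Var) {φ ψ} (h : AtomsRestricted V φ ψ) : AtomsRestricted V (.ex v φ) (.ex v ψ)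
  | all (v : Var) {φ ψ} (h : AtomsRestricted V φ ψ) : AtomsRestricted V (.all v φ) (.all v ψ)

/-- `ψ` is a sentence based on the simple formula `φ' = Q V χ`. -/
def BasedOn (q : Quant) (V : List Var) (φ' ψ : Formula) : Prop :=
  SimpleForm q V ψ ∧ ψ.free = ∅ ∧ AtomsRestricted V.toFinset φ' ψ

/-- `Replaced φ' ψ' φ ψ`: `φ'` is a subformula of `φ`, and replacing (an occurrence of) it with `ψ'`
gives `ψ`. -/
inductive Replaced (φ' ψ' : Formula) : Formula → Formula → Prop
  | here : Replaced φ' ψ' φ' ψ'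
  | neg {φ ψ} (h : Replaced φ' ψ' φ ψ) : Replaced φ' ψ' (.neg φ) (.neg ψ)
  | andLeft {φ ψ} (θ : Formula) (h : Replaced φ' ψ' φ ψ) : Replaced φ' ψ' (.and φ θ) (.and ψ θ)
  | andRight {φ ψ} (θ : Formula) (h : Replaced φ' ψ' φ ψ) : Replaced φ' ψ' (.and θ φ) (.and θ ψ)
  | orLeft {φ ψ} (θ : Formula) (h : Replaced φ' ψ' φ ψ) : Replaced φ' ψ' (.or φ θ) (.or ψ θ)
  | orRight {φ ψ} (θ : Formula) (h : Replaced φ' ψ' φ ψ) : Replaced φ' ψ' (.or θ φ) (.or θ ψ)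
  | ex (v : Var) {φ ψ} (h : Replaced φ' ψ' φ ψ) : Replaced φ' ψ' (.ex v φ) (.ex v ψ)
  | all (v : Var) {φ ψ} (h : Replaced φ' ψ' φ ψ) : Replaced φ' ψ' (.all v φ) (.all v ψ)

/-- The formula `φ'` is a subformula of `φ`. -/
def Subformula (φ' φ : Formula) : Prop := Replaced φ' φ' φ φ

/-- `ψ'` is `⋁ᵢ Eᵢ(vᵢ₁, vᵢ₂)` (for `q = ∃`) or `⋀ᵢ Eᵢ(vᵢ₁, vᵢ₂)` (for `q = ∀`), where
`{v₁₁, v₁₂}, …, {vₘ₁, vₘ₂}` lists the two-element subsets of `F`. -/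
def PairJunction (q : Quant) (F : Finset Var) (ψ' : Formula) : Prop :=
  ∃ T : List (ℕ × Var × Var),
    (T.map fun t => ({t.2.1, t.2.2} : Finset Var)).Nodup ∧
    (∀ e : Finset Var, e ∈ (T.map fun t => ({t.2.1, t.2.2} : Finset Var)) ↔
      e ∈ F.powersetCard 2) ∧
    JunctionOf q.dual (T.map fun t => Formula.atom t.1 [t.2.1, t.2.2]) ψ'

/-- The relation between the formulas of the two friendly sentences of a pair in the set `C`. That
the symbols `Eᵢ` are fresh is part of the looseness of the friendly sentence `ψ`. -/
def Related (ψ φ : Formula) : Prop :=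
  ∃ q V φ', SimpleForm q V φ' ∧ Subformula φ' φ ∧
    (BasedOn q V φ' ψ ∨ ∃ ψ', PairJunction q φ'.free ψ' ∧ Replaced φ' ψ' φ ψ)

/-- The set `C`, for friendly sentences of arity at most `k`. -/
def pairSet (k : ℕ) : Set (Str × Str) :=
  {c | ∃ ψ φ : SigFormula,
    (ψ.IsSentence ∧ Friendly ψ.form ∧ ψ.ArityLE k) ∧
    (φ.IsSentence ∧ Friendly φ.form ∧ φ.ArityLE k) ∧
    Related ψ.form φ.form ∧ c = (ψ.encode, φ.encode)}

/-! ### The encodings are unambiguous, so `maxSortSize` is what it should be -/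

theorem natsStr_cons_append_inj {m n : ℕ} {s t : Str}
    (h : (List.replicate m true ++ [false]) ++ s = (List.replicate n true ++ [false]) ++ t) :
    m = n ∧ s = t := by
  induction m generalizing n with
  | zero =>
    cases n with
    | zero => simpa using h
    | succ n => simp [List.replicate_succ] at h
  | succ m ih =>
    cases n with
    | zero => simp [List.replicate_succ] at h
    | succ n =>
      have h' := ih (n := n) (by simpa [List.replicate_succ] using h)
      exact ⟨by rw [h'.1], h'.2⟩

theorem natsStr_append_inj {l m : List ℕ} {s t : Str} (hl : l.length = m.length)
    (h : natsStr l ++ s = natsStr m ++ t) : l = m ∧ s = t := by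
  induction l generalizing m with
  | nil =>
    cases m with
    | nil => simpa [natsStr] using h
    | cons _ _ => simp at hl
  | cons a l ih =>
    cases m with
    | nil => simp at hl
    | cons b m =>
      have h1 := natsStr_cons_append_inj (m := a) (n := b) (s := natsStr l ++ s)
        (t := natsStr m ++ t) (by simpa [natsStr] using h)
      have h2 := ih (by simpa using hl) h1.2
      exact ⟨by rw [h1.1, h2.1], h2.2⟩

theorem natsStr_injective : Function.Injective natsStr := by
  intro l
  induction l with
  | nil =>
    intro m h
    cases m with
    | nil => rfl
    | cons b m => simp [natsStr] at h
  | cons a l ih =>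
    intro m h
    cases m with
    | nil => simp [natsStr] at h
    | cons b m =>
      have h1 := natsStr_cons_append_inj (m := a) (n := b) (s := natsStr l)
        (t := natsStr m) (by simpa [natsStr] using h)
      rw [h1.1, ih h1.2]

theorem flatMap_append_inj {α : Type} {c : α → List ℕ}
    (hc : ∀ a b s t, c a ++ s = c b ++ t → a = b ∧ s = t) :
    ∀ (l m : List α) (s t : List ℕ), l.length = m.length →
      l.flatMap c ++ s = m.flatMap c ++ t → l = m ∧ s = t := by
  intro l
  induction l with
  | nil =>
    intro m s t hl h
    cases m with
    | nil => simpa using h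
    | cons _ _ => simp at hl
  | cons a l ih =>
    intro m s t hl h
    cases m with
    | nil => simp at hl
    | cons b m =>
      have h1 := hc a b (l.flatMap c ++ s) (m.flatMap c ++ t) (by simpa using h)
      have h2 := ih m s t (by simpa using hl) h1.2
      exact ⟨by rw [h1.1, h2.1], h2.2⟩

theorem Formula.code_append_inj : ∀ (φ ψ : Formula) (s t : List ℕ),
    φ.code ++ s = ψ.code ++ t → φ = ψ ∧ s = t := by
  intro φ
  induction φ with
  | atom R args =>
    intro ψ s t h
    cases ψ with
    | atom R' args' =>
      simp only [code, List.cons_append, List.cons.injEq, true_and] at h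
      have := flatMap_append_inj (c := fun v : Var => [v.1, v.2])
        (fun a b s t h => by
          simp only [List.cons_append, List.nil_append, List.cons.injEq] at h
          exact ⟨Prod.ext h.1 h.2.1, h.2.2⟩) args args' s t h.2.1 h.2.2
      exact ⟨by rw [h.1, this.1], this.2⟩
    | _ => simp [code] at h
  | neg φ ih =>
    intro ψ s t h
    cases ψ with
    | neg ψ =>
      have := ih ψ s t (by simpa [code] using h)
      exact ⟨by rw [this.1], this.2⟩
    | _ => simp [code] at h
  | and φ₁ φ₂ ih₁ ih₂ =>
    intro ψ s t h
    cases ψ with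
    | and ψ₁ ψ₂ =>
      have h1 := ih₁ ψ₁ (φ₂.code ++ s) (ψ₂.code ++ t) (by simpa [code] using h)
      have h2 := ih₂ ψ₂ s t h1.2
      exact ⟨by rw [h1.1, h2.1], h2.2⟩
    | _ => simp [code] at h
  | or φ₁ φ₂ ih₁ ih₂ =>
    intro ψ s t h
    cases ψ with
    | or ψ₁ ψ₂ =>
      have h1 := ih₁ ψ₁ (φ₂.code ++ s) (ψ₂.code ++ t) (by simpa [code] using h)
      have h2 := ih₂ ψ₂ s t h1.2
      exact ⟨by rw [h1.1, h2.1], h2.2⟩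
    | _ => simp [code] at h
  | ex v φ ih =>
    intro ψ s t h
    cases ψ with
    | ex w ψ =>
      simp only [code, List.cons_append, List.cons.injEq, true_and] at h
      have := ih ψ s t h.2.2
      exact ⟨by rw [this.1, Prod.ext h.1 h.2.1], this.2⟩
    | _ => simp [code] at h
  | all v φ ih =>
    intro ψ s t h
    cases ψ with
    | all w ψ =>
      simp only [code, List.cons_append, List.cons.injEq, true_and] at h
      have := ih ψ s t h.2.2
      exact ⟨by rw [this.1, Prod.ext h.1 h.2.1], this.2⟩
    | _ => simp [code] at h

theorem Signature.code_append_inj (σ τ : Signature) (s t : List ℕ)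
    (h : σ.code ++ s = τ.code ++ t) : σ = τ ∧ s = t := by
  obtain ⟨S, L⟩ := σ
  obtain ⟨S', L'⟩ := τ
  simp only [code, List.cons_append, List.append_assoc, List.cons.injEq] at h
  have h1 := List.append_inj h.2 h.1
  simp only [List.cons.injEq] at h1
  have h2 := flatMap_append_inj (c := fun R : ℕ × List ℕ => R.1 :: R.2.length :: R.2)
    (fun a b s t h => by
      simp only [List.cons_append, List.cons.injEq] at h
      have := List.append_inj h.2.2 h.2.1
      exact ⟨Prod.ext h.1 this.1, this.2⟩) L L' s t h1.2.1 h1.2.2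
  exact ⟨by rw [h1.1, h2.1], h2.2⟩

theorem SigFormula.encode_injective : Function.Injective SigFormula.encode := by
  rintro ⟨σ, φ⟩ ⟨τ, ψ⟩ h
  have h1 := Signature.code_append_inj σ τ _ _ (natsStr_injective h)
  have h2 := Formula.code_append_inj φ ψ [] [] (by simpa using h1.2)
  rw [h1.1, h2.1]

theorem maxSortSize_eq {k : ℕ} {c : Str × Str} {φ : SigFormula} {A : Struc}
    (h : Encodes k c φ A) : maxSortSize k c = A.maxCard φ.sig := by
  have hex : ∃ d : SigFormula × Struc, Encodes k c d.1 d.2 := ⟨(φ, A), h⟩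
  rw [maxSortSize, dif_pos hex]
  have hc := hex.choose_spec
  generalize hex.choose = d at hc ⊢
  obtain ⟨ψ, B⟩ := d
  have he := (hc.2.2.2).symm.trans h.2.2.2
  simp only [Prod.mk.injEq] at he
  obtain rfl := SigFormula.encode_injective he.1
  have hs := (natsStr_append_inj (by simp) he.2).1
  rw [List.map_inj_left] at hs
  exact Finset.sup_congr rfl fun s hs' => hs s (by simpa using hs')

end Accordion

/-! The heart is a construction which turns a structure A for ψ into a structure B for φ. Let M be
the sum of the universe sizes of A. All universes of B have the same size N, a multiple of M by the
number of atoms of ψ plus one. An element x of B stands, wherever an element of sort s of A is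
expected, for the residue of x modulo the size of that universe. Residues reach every element of A,
so quantifiers over B and over A have the same effect (`sat_of_restricted`, `sat_of_replaced`).

If ψ is a sentence based on the simple subformula φ', the relations in φ' are copied from ψ and
ignore the entries outside V. All other relations are constant: true beside a conjunction on the way
down to φ', false beside a disjunction. As φ is positive and no symbol is repeated, φ then has the
truth value of φ', which is that of ψ (`sat_of_subformula`, `models_based`).

If φ' = ∃V ⋀ αᵢ was replaced with ⋁ Eⱼ(vⱼ₁, vⱼ₂), each quantified variable is meant to hold one
common number t = M j + c: the index j of a disjunct, and a guess c for the value of vⱼ₁. The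
relation of an atom requires that all its quantified entries equal t, that vⱼ₁ has the residue c if
it occurs in the atom, and that Eⱼ(c, vⱼ₂) holds if vⱼ₂ occurs in it. No atom needs to see both
variables. V-connectedness of the layered formula φ' forces the atoms to agree on t, except possibly
atoms with the same variable set, for which one choice of t serves (`Linked`, `SimpleForm.linked`).
So φ' holds exactly if some disjunct does (`sat_pair`, `models_pair`). The case of ∀ is the same for
complements; `Quant.flip` treats both at once. The measure grows by a factor depending only on ψ.

For computability, formulas are coded bijectively by numbers, and all syntactic notions are shown to
be primitive recursive. The point is that ∃-layered and ∀-layered coincide, and that layeredness is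
decided by canonical decompositions into blocks and parts (`lay_iff`). Hence C is decidable, and a
finite description of B in terms of A, the `Plan`, is a primitive recursive function of (ψ, φ).

For the time bound, structured stack programs are translated to Turing machines (`Exec.simulate`).
Programs on unary registers compute each primitive recursive function within a primitive recursive
time (`PrimRuns.of_primrec`); this provides the factor f. Evaluating a plan on the encoding of A is
polynomial in the unary code of the plan and the input length (`Reader.polyEmits_result`), because
arities are at most k. The two phases are combined in `exists_machine`. A third string which encodes
no structure is mapped to the empty string, which encodes none either. -/

namespace Accordion

/-! ### Stack programs and their translation to Turing machines -/

/-- Structured programs on stacks numbered by `ℕ`, and a write-only output stack. `case r p` and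
`loop r p` pop from the stack `r` and branch on the popped symbol; `loop` iterates until the stack
is empty. -/
inductive Prog : Type
  | skip : Prog
  | push (r : ℕ) (a : Option Bool) : Prog
  | emit (b : Bool) : Prog
  | seq (p q : Prog) : Prog
  | case (r : ℕ) (p : Option (Option Bool) → Prog) : Prog
  | loop (r : ℕ) (p : Option Bool → Prog) : Prog

/-- The contents of the stacks. -/
structure PState where
  reg : ℕ → List (Option Bool)
  out : List Bool

/-- `s` with the stack `r` replaced by `l`. -/
def PState.set (s : PState) (r : ℕ) (l : List (Option Bool)) : PState :=
  ⟨Function.update s.reg r l, s.out⟩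

/-- `Exec p s t s'`: the program `p` leads from `s` to `s'` in `t` steps. -/
inductive Exec : Prog → PState → ℕ → PState → Prop
  | skip (s : PState) : Exec .skip s 1 s
  | push (r : ℕ) (a : Option Bool) (s : PState) : Exec (.push r a) s 1 (s.set r (a :: s.reg r))
  | emit (b : Bool) (s : PState) : Exec (.emit b) s 1 ⟨s.reg, b :: s.out⟩
  | seq {p q : Prog} {s s' s'' : PState} {t t' : ℕ} (h : Exec p s t s') (h' : Exec q s' t' s'') :
      Exec (.seq p q) s (t + t') s''
  | case {r : ℕ} {p : Option (Option Bool) → Prog} {s s' : PState} {t : ℕ}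
      (h : Exec (p (s.reg r).head?) (s.set r (s.reg r).tail) t s') : Exec (.case r p) s (t + 1) s'
  | loopNil {r : ℕ} {p : Option Bool → Prog} {s : PState} (h : s.reg r = []) :
      Exec (.loop r p) s 1 s
  | loopCons {r : ℕ} {p : Option Bool → Prog} {s s' s'' : PState} {t t' : ℕ} {a : Option Bool}
      {l : List (Option Bool)} (hr : s.reg r = a :: l) (h : Exec (p a) (s.set r l) t s')
      (h' : Exec (.loop r p) s' t' s'') : Exec (.loop r p) s (t + t' + 1) s''

namespace Prog

/-- A strict bound for the stacks in use. -/
def width : Prog → ℕ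
  | skip => 0
  | push r _ => r + 1
  | emit _ => 0
  | seq p q => max p.width q.width
  | case r p => max (r + 1) (Finset.univ.sup fun o => (p o).width)
  | loop r p => max (r + 1) (Finset.univ.sup fun a => (p a).width)

/-- Program positions. -/
def Lab : Prog → Type
  | skip => Unit
  | push _ _ => Unit
  | emit _ => Unit
  | seq p q => p.Lab ⊕ q.Lab
  | case _ p => Option (Σ o, (p o).Lab)
  | loop _ p => Option (Σ a, (p a).Lab)

noncomputable instance labFintype : (p : Prog) → Fintype p.Lab
  | skip => inferInstanceAs (Fintype Unit)
  | push _ _ => inferInstanceAs (Fintype Unit)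
  | emit _ => inferInstanceAs (Fintype Unit)
  | seq p q =>
    have := labFintype p
    have := labFintype q
    inferInstanceAs (Fintype (p.Lab ⊕ q.Lab))
  | case _ p =>
    have := fun o => labFintype (p o)
    inferInstanceAs (Fintype (Option (Σ o, (p o).Lab)))
  | loop _ p =>
    have := fun a => labFintype (p a)
    inferInstanceAs (Fintype (Option (Σ a, (p a).Lab)))

/-- The first position. -/
def entry : (p : Prog) → p.Lab
  | skip => ()
  | push _ _ => ()
  | emit _ => ()
  | seq p _ => .inl p.entry
  | case _ _ => none
  | loop _ _ => none

/-- The stack alphabets of the machine: `none` is the output stack. -/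
abbrev Alph (N : ℕ) : Option (Fin (N + 1)) → Type
  | none => Bool
  | some _ => Option Bool

/-- The statement at a position of `p`, where `ι` embeds the positions of `p` into the labels of
the machine, and `e` is the label at which the execution continues after `p`. -/
def stmt (N : ℕ) {Λ : Type} : (p : Prog) → (p.Lab → Λ) → Λ → p.Lab →
    Turing.TM2.Stmt (Alph N) Λ (Option (Option Bool))
  | skip, _, e, _ => .goto fun _ => e
  | push r a, _, e, _ => .push (some (Fin.ofNat (N + 1) r)) (fun _ => a) (.goto fun _ => e)
  | emit b, _, e, _ => .push none (fun _ => b) (.goto fun _ => e)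
  | seq p q, ι, e, l => match l with
    | .inl l => p.stmt N (fun l => ι (.inl l)) (ι (.inr q.entry)) l
    | .inr l => q.stmt N (fun l => ι (.inr l)) e l
  | case r p, ι, e, l => match l with
    | none => .pop (some (Fin.ofNat (N + 1) r)) (fun _ o => o)
        (.goto fun s => ι (some ⟨s, (p s).entry⟩))
    | some ⟨o, l⟩ => (p o).stmt N (fun l => ι (some ⟨o, l⟩)) e l
  | loop r p, ι, e, l => match l with
    | none => .pop (some (Fin.ofNat (N + 1) r)) (fun _ o => o)
        (.goto fun s => match s with
          | none => e
          | some a => ι (some ⟨a, (p a).entry⟩))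
    | some ⟨a, l⟩ => (p a).stmt N (fun l => ι (some ⟨a, l⟩)) (ι none) l

end Prog

/-- The stacks of the machine. -/
def PState.stk (N : ℕ) (s : PState) : ∀ k, List (Prog.Alph N k)
  | none => s.out
  | some i => s.reg i

theorem PState.stk_set {N r : ℕ} (h : r < N + 1) (s : PState) (l : List (Option Bool)) :
    (s.set r l).stk N = Function.update (s.stk N) (some (Fin.ofNat (N + 1) r)) l := by
  funext k
  cases k with
  | none => rw [Function.update_of_ne (by simp)]; rfl
  | some i =>
    by_cases hi : i = Fin.ofNat (N + 1) r
    · subst hi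
      simp [PState.stk, PState.set, Nat.mod_eq_of_lt h]
    · rw [Function.update_of_ne (by simpa using hi)]
      have : (i : ℕ) ≠ r := fun h' => hi (by ext; simp [h', Nat.mod_eq_of_lt h])
      simp [PState.stk, PState.set, this]

theorem PState.stk_out {N : ℕ} (s : PState) (l : List Bool) :
    (PState.mk s.reg l).stk N = Function.update (s.stk N) none l := by
  funext k
  cases k with
  | none => simp [PState.stk]
  | some i => rw [Function.update_of_ne (by simp)]; rfl

theorem PState.stk_ofNat {N r : ℕ} (h : r < N + 1) (s : PState) :
    s.stk N (some (Fin.ofNat (N + 1) r)) = s.reg r := by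
  simp [PState.stk, Nat.mod_eq_of_lt h]

/-- The machine simulates the program step by step. -/
theorem Exec.simulate {N : ℕ} {Λ : Type}
    (m : Λ → Turing.TM2.Stmt (Prog.Alph N) Λ (Option (Option Bool)))
    {p : Prog} {s s' : PState} {t : ℕ} (h : Exec p s t s') :
    ∀ (ι : p.Lab → Λ) (e : Λ), (∀ l, m (ι l) = p.stmt N ι e l) → p.width ≤ N + 1 →
      ∀ v, ∃ v', (flip bind (Turing.TM2.step m))^[t] (some ⟨some (ι p.entry), v, s.stk N⟩) =
        some ⟨some e, v', s'.stk N⟩ := by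
  induction h with
  | skip s =>
    intro ι e hm _ v
    exact ⟨v, by simp [flip, Turing.TM2.step, hm, Prog.stmt, Turing.TM2.stepAux]⟩
  | push r a s =>
    intro ι e hm hw v
    refine ⟨v, ?_⟩
    simp only [Prog.width] at hw
    simp [flip, Turing.TM2.step, hm, Prog.stmt, Turing.TM2.stepAux, PState.stk_set hw]
    rw [← PState.stk_ofNat hw s]; rfl
  | emit b s =>
    intro ι e hm hw v
    refine ⟨v, ?_⟩
    simp [flip, Turing.TM2.step, hm, Prog.stmt, Turing.TM2.stepAux, PState.stk_out]
    rfl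
  | @seq p q s s' s'' t t' h h' ih ih' =>
    intro ι e hm hw v
    simp only [Prog.width, max_le_iff] at hw
    obtain ⟨v₁, h₁⟩ := ih (fun l => ι (.inl l)) (ι (.inr (Prog.entry _))) (fun l => hm (.inl l)) hw.1 v
    obtain ⟨v₂, h₂⟩ := ih' (fun l => ι (.inr l)) e (fun l => hm (.inr l)) hw.2 v₁
    refine ⟨v₂, ?_⟩
    rw [Nat.add_comm t t', Function.iterate_add_apply]
    exact (congrArg _ h₁).trans h₂
  | @case r p s s' t h ih =>
    intro ι e hm hw v
    simp only [Prog.width, max_le_iff] at hw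
    obtain ⟨v₁, h₁⟩ := ih (fun l => ι (some ⟨_, l⟩)) e (fun l => hm (some ⟨_, l⟩))
      (le_trans (Finset.le_sup (f := fun o => (p o).width) (Finset.mem_univ _)) hw.2)
      (s.reg r).head?
    refine ⟨v₁, ?_⟩
    rw [Function.iterate_add_apply]
    refine Eq.trans (congrArg _ ?_) h₁
    have h0 := hm (Prog.entry (.case r p))
    simp only [Function.iterate_one, flip, Option.bind_eq_bind, Option.bind_some,
      Turing.TM2.step, h0, PState.stk_set (r := r) hw.1]
    rw [← PState.stk_ofNat (r := r) hw.1]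
    rfl
  | @loopNil r p s h =>
    intro ι e hm hw v
    simp only [Prog.width, max_le_iff] at hw
    refine ⟨none, ?_⟩
    have h0 := hm (Prog.entry (.loop r p))
    -- A pop from the empty stack leaves it empty, so the exit test of a loop does not change the
    -- stacks.
    have h1 : s.set r [] = s := by
      rw [← h, PState.set, Function.update_eq_self]
    have h2 := PState.stk_set (r := r) hw.1 s []
    rw [h1] at h2
    simp only [Function.iterate_one, flip, Option.bind_eq_bind, Option.bind_some,
      Turing.TM2.step, h0]
    simp only [Prog.entry, Prog.stmt, Turing.TM2.stepAux]
    rw [PState.stk_ofNat (r := r) hw.1, h, List.tail_nil, ← h2]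
    rfl
  | @loopCons r p s s' s'' t t' a l hr h h' ih ih' =>
    intro ι e hm hw v
    have ih' := ih' ι e hm hw
    simp only [Prog.width, max_le_iff] at hw
    obtain ⟨v₁, h₁⟩ := ih (fun l => ι (some ⟨_, l⟩)) (ι none) (fun l => hm (some ⟨_, l⟩))
      (le_trans (Finset.le_sup (f := fun o => (p o).width) (Finset.mem_univ _)) hw.2)
      (some a)
    obtain ⟨v₂, h₂⟩ := ih' v₁
    refine ⟨v₂, ?_⟩
    rw [Function.iterate_add_apply, Nat.add_comm t t', Function.iterate_add_apply]
    refine Eq.trans (congrArg _ (Eq.trans (congrArg _ ?_) h₁)) h₂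
    have h0 := hm (Prog.entry (.loop r p))
    simp only [Function.iterate_one, flip, Option.bind_eq_bind, Option.bind_some,
      Turing.TM2.step, h0]
    simp only [Prog.entry, Prog.stmt, Turing.TM2.stepAux]
    rw [PState.stk_ofNat (r := r) hw.1, hr, PState.stk_set (r := r) hw.1]
    rfl

/-- The machine which executes `p`, with input stack `0`. -/
noncomputable def Prog.machine (p : Prog) : Turing.TM2ComputableAux (Option Bool) Bool where
  tm :=
    { K := Option (Fin (p.width + 1))
      k₀ := some 0
      k₁ := none
      Γ := Prog.Alph p.width
      Λ := Option p.Lab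
      main := some p.entry
      σ := Option (Option Bool)
      initialState := none
      m := fun l => match l with
        | none => .load (fun _ => none) .halt
        | some l => p.stmt p.width some none l
      Γk₀Fin := inferInstanceAs (Fintype (Option Bool)) }
  inputAlphabet := Equiv.refl _
  outputAlphabet := Equiv.refl _

/-- The extra step is the one at the label `none`, which resets the internal state before halting. A
halting configuration has to agree exactly with the prescribed one, which is also why all stacks but
the output have to be empty at the end. -/
theorem Prog.machine_outputs {p : Prog} {w : List (Option Bool)} {z : List Bool} {t : ℕ}
    (h : Exec p ⟨Function.update (fun _ => []) 0 w, []⟩ t ⟨fun _ => [], z⟩) {T : ℕ} (ht : t + 1 ≤ T) :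
    Nonempty (Turing.TM2OutputsInTime p.machine.tm (w.map p.machine.inputAlphabet.invFun)
        (some (z.map p.machine.outputAlphabet.invFun)) T) := by
  obtain ⟨v', hv⟩ := h.simulate (N := p.width) p.machine.tm.m some none (fun l => rfl) (by omega) none
  refine ⟨⟨⟨1 + t, ?_⟩, by simpa [add_comm] using ht⟩⟩
  rw [Function.iterate_add_apply]
  have e1 : Turing.initList p.machine.tm (w.map p.machine.inputAlphabet.invFun) =
      (⟨some (some p.entry), none,
        (PState.mk (Function.update (fun _ => []) 0 w) []).stk p.width⟩ : p.machine.tm.Cfg) := by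
    simp only [Turing.initList]
    congr 1
    funext k
    match k with
    | none => rfl
    | some i =>
      by_cases hi : i = 0
      · subst hi
        simp [PState.stk, machine]
        rfl
      · have : (i : ℕ) ≠ 0 := fun h' => hi (by ext; simpa using h')
        simp [PState.stk, machine, this, hi]
  have e2 : Turing.haltList p.machine.tm (z.map p.machine.outputAlphabet.invFun) =
      (⟨none, none, (PState.mk (fun _ => []) z).stk p.width⟩ : p.machine.tm.Cfg) := by
    simp only [Turing.haltList]
    congr 1
    funext k
    match k with
    | none =>
      simp [PState.stk, machine]
      rfl
    | some i => rfl
  rw [e1, Option.map_some, e2]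
  refine Eq.trans (congrArg _ hv) ?_
  rfl

end Accordion

namespace Accordion

/-! ### Programs on registers for natural numbers -/

/-- Execution in at most `T` steps. -/
def ExecLE (p : Prog) (s : PState) (T : ℕ) (s' : PState) : Prop := ∃ t ≤ T, Exec p s t s'

theorem ExecLE.mono {p : Prog} {s s' : PState} {T T' : ℕ} (h : ExecLE p s T s') (hT : T ≤ T') :
    ExecLE p s T' s' :=
  let ⟨t, ht, h⟩ := h
  ⟨t, ht.trans hT, h⟩

theorem ExecLE.seq {p q : Prog} {s s' s'' : PState} {T T' : ℕ} (h : ExecLE p s T s')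
    (h' : ExecLE q s' T' s'') : ExecLE (.seq p q) s (T + T') s'' :=
  let ⟨t, ht, h⟩ := h
  let ⟨t', ht', h'⟩ := h'
  ⟨t + t', by omega, h.seq h'⟩

theorem ExecLE.skip (s : PState) : ExecLE .skip s 1 s := ⟨1, le_rfl, .skip s⟩

theorem ExecLE.emit (b : Bool) (s : PState) : ExecLE (.emit b) s 1 ⟨s.reg, b :: s.out⟩ :=
  ⟨1, le_rfl, .emit b s⟩

theorem ExecLE.push (r : ℕ) (a : Option Bool) (s : PState) :
    ExecLE (.push r a) s 1 (s.set r (a :: s.reg r)) := ⟨1, le_rfl, .push r a s⟩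

theorem ExecLE.case {r : ℕ} {p : Option (Option Bool) → Prog} {s s' : PState} {T : ℕ}
    (h : ExecLE (p (s.reg r).head?) (s.set r (s.reg r).tail) T s') :
    ExecLE (.case r p) s (T + 1) s' :=
  let ⟨t, ht, h⟩ := h
  ⟨t + 1, by omega, h.case⟩

/-- A loop on a stack. -/
theorem ExecLE.loop {r T : ℕ} {p : Option Bool → Prog} (F : List (Option Bool) → PState)
    (hF : ∀ l, (F l).reg r = l) :
    ∀ l : List (Option Bool), (∀ a l', a :: l' <:+ l → ExecLE (p a) ((F (a :: l')).set r l') T (F l')) →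
      ExecLE (.loop r p) (F l) (l.length * (T + 1) + 1) (F [])
  | [], _ => ⟨1, by simp, .loopNil (hF [])⟩
  | a :: l, h => by
    obtain ⟨t, ht, h₁⟩ := h a l List.suffix_rfl
    obtain ⟨t', ht', h₂⟩ := ExecLE.loop F hF l fun a' l' hl => h a' l' (hl.trans (List.suffix_cons a l))
    refine ⟨t + t' + 1, ?_, .loopCons (hF _) h₁ h₂⟩
    simp only [List.length_cons]
    nlinarith

/-- The state with the input word `w`, the auxiliary stack `aux`, and the number `v i` in unary on
the stack `i + 2`. -/
def St (w aux : List (Option Bool)) (v : ℕ → ℕ) (out : List Bool) : PState where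
  reg := fun
    | 0 => w
    | 1 => aux
    | i + 2 => List.replicate (v i) none
  out := out

theorem St.set_num (w aux : List (Option Bool)) (v : ℕ → ℕ) (out : List Bool) (x n : ℕ) :
    (St w aux v out).set (x + 2) (List.replicate n none) = St w aux (Function.update v x n) out := by
  simp only [PState.set, St]
  congr 1
  funext i
  match i with
  | 0 => rw [Function.update_of_ne (by omega)]
  | 1 => rw [Function.update_of_ne (by omega)]
  | i + 2 =>
    by_cases h : i = x
    · subst h
      simp
    · rw [Function.update_of_ne (by omega)]
      simp [Function.update_of_ne h]

theorem St.set_inp (w w' aux : List (Option Bool)) (v : ℕ → ℕ) (out : List Bool) :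
    (St w aux v out).set 0 w' = St w' aux v out := by
  simp only [PState.set, St]
  congr 1
  funext i
  match i with
  | 0 => simp
  | 1 => rw [Function.update_of_ne (by omega)]
  | i + 2 => rw [Function.update_of_ne (by omega)]

theorem St.set_aux (w aux aux' : List (Option Bool)) (v : ℕ → ℕ) (out : List Bool) :
    (St w aux v out).set 1 aux' = St w aux' v out := by
  simp only [PState.set, St]
  congr 1
  funext i
  match i with
  | 0 => rw [Function.update_of_ne (by omega)]
  | 1 => simp
  | i + 2 => rw [Function.update_of_ne (by omega)]

/-- The registers from `b` on contain the list `l`, followed by zeros. -/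
def regs (b : ℕ) (v : ℕ → ℕ) (l : List ℕ) : ℕ → ℕ := fun i => if i < b then v i else l.getD (i - b) 0

theorem regs_apply (b : ℕ) (v : ℕ → ℕ) (l : List ℕ) (j : ℕ) : regs b v l (b + j) = l.getD j 0 := by
  simp [regs]

theorem update_regs (b : ℕ) (v : ℕ → ℕ) (l : List ℕ) {j : ℕ} (hj : j < l.length) (x : ℕ) :
    Function.update (regs b v l) (b + j) x = regs b v (l.set j x) := by
  funext i
  by_cases h : i = b + j
  · subst h
    simp [regs, hj]
  · rw [Function.update_of_ne h]
    simp only [regs]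
    split_ifs with hi
    · rfl
    · rw [List.getD_eq_getElem?_getD, List.getD_eq_getElem?_getD, List.getElem?_set_ne (by omega)]

/-- Registers before an offset become part of the background valuation. This is what allows a
program to run behind registers in use. -/
theorem regs_append (b : ℕ) (v : ℕ → ℕ) (l l' : List ℕ) :
    regs b v (l ++ l') = regs (b + l.length) (regs b v l) l' := by
  funext i
  simp only [regs, List.getD_eq_getElem?_getD]
  split_ifs with h1 h2 h3
  · rfl
  · omega
  · rw [List.getElem?_append_left (by omega)]
  · rw [List.getElem?_append_right (by omega), Nat.sub_sub]

/-- The registers behind the listed ones are zero anyway, so scratch registers can be added to a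
list and dropped from it freely. -/
theorem regs_append_zeros (b : ℕ) (v : ℕ → ℕ) (l : List ℕ) (n : ℕ) :
    regs b v (l ++ List.replicate n 0) = regs b v l := by
  funext i
  simp only [regs]
  split_ifs with h
  · rfl
  · simp only [List.getD_eq_getElem?_getD]
    rcases lt_or_ge (i - b) l.length with h1 | h1
    · rw [List.getElem?_append_left h1]
    · rw [List.getElem?_append_right h1, List.getElem?_replicate, List.getElem?_eq_none h1]
      split_ifs <;> rfl

section raw

variable {w aux : List (Option Bool)} {v : ℕ → ℕ} {out : List Bool} {b : ℕ}

namespace Prog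

def inc (x : ℕ) : Prog := .push (x + 2) none

/-- Runs `p` if the register `x` is positive, after decreasing it, and `q` otherwise. -/
def ifPos (x : ℕ) (p q : Prog) : Prog := .case (x + 2) fun
  | some _ => p
  | none => q

def repeatNum (x : ℕ) (p : Prog) : Prog := .loop (x + 2) fun _ => p

def clear (x : ℕ) : Prog := repeatNum x .skip

def move (x y : ℕ) : Prog := repeatNum x (inc y)

/-- Adds the register `x` to the register `y`; `s` is used and has to be empty. -/
def copy (x y s : ℕ) : Prog := .seq (repeatNum x (.seq (inc y) (inc s))) (move s x)

/-- Subtracts the register `x` from the register `y`, and clears `x`. -/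
def subtract (x y : ℕ) : Prog := repeatNum x (ifPos y .skip .skip)

end Prog

theorem exec_inc (x : ℕ) :
    ExecLE (.inc x) (St w aux v out) 1 (St w aux (Function.update v x (v x + 1)) out) := by
  rw [← St.set_num]
  exact .push _ _ _

theorem exec_ifPos_succ {x n T : ℕ} {p q : Prog} {s : PState} (hx : v x = n + 1)
    (h : ExecLE p (St w aux (Function.update v x n) out) T s) :
    ExecLE (.ifPos x p q) (St w aux v out) (T + 1) s := by
  refine .case ?_
  have : (St w aux v out).reg (x + 2) = none :: List.replicate n none := by
    simp [St, hx, List.replicate_succ]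
  rw [this, List.tail_cons, St.set_num]
  exact h

theorem exec_ifPos_zero {x T : ℕ} {p q : Prog} {s : PState} (hx : v x = 0)
    (h : ExecLE q (St w aux v out) T s) :
    ExecLE (.ifPos x p q) (St w aux v out) (T + 1) s := by
  refine .case ?_
  have : (St w aux v out).reg (x + 2) = [] := by simp [St, hx]
  rw [this, List.tail_nil]
  have := St.set_num w aux v out x 0
  rw [List.replicate_zero] at this
  rw [this, ← hx, Function.update_eq_self]
  exact h

/-- A loop on a register. The state in which `k` iterations remain is `F k`. -/
theorem exec_repeat_state {x c T : ℕ} {p : Prog} (F : ℕ → PState)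
    (hF : ∀ k ≤ c, (F k).reg (x + 2) = List.replicate k none)
    (h : ∀ k < c, ExecLE p ((F (k + 1)).set (x + 2) (List.replicate k none)) T (F k)) :
    ExecLE (.repeatNum x p) (F c) (c * (T + 1) + 1) (F 0) := by
  induction c with
  | zero => exact ⟨1, by simp, .loopNil (by simp [hF])⟩
  | succ c ih =>
    obtain ⟨t, ht, h₁⟩ := h c (by omega)
    obtain ⟨t', ht', h₂⟩ := ih (fun k hk => hF k (by omega)) fun k hk => h k (by omega)
    refine ⟨t + t' + 1, by nlinarith, .loopCons (a := none) (l := List.replicate c none) ?_ h₁ h₂⟩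
    simp [hF, List.replicate_succ]

theorem exec_repeat {x c T : ℕ} {p : Prog} (F : ℕ → ℕ → ℕ) (out : ℕ → List Bool)
    (hF : ∀ k, F k x = k)
    (h : ∀ k < c, ExecLE p (St w aux (Function.update (F (k + 1)) x k) (out (k + 1))) T
      (St w aux (F k) (out k))) :
    ExecLE (.repeatNum x p) (St w aux (F c) (out c)) (c * (T + 1) + 1) (St w aux (F 0) (out 0)) :=
  exec_repeat_state (fun k => St w aux (F k) (out k)) (fun k _ => by simp [St, hF]) fun k hk => by
    rw [St.set_num]
    exact h k hk

theorem exec_clear (x : ℕ) :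
    ExecLE (.clear x) (St w aux v out) (2 * v x + 1) (St w aux (Function.update v x 0) out) := by
  have := exec_repeat (w := w) (aux := aux) (x := x) (c := v x) (T := 1) (p := .skip)
    (fun k => Function.update v x k) (fun _ => out) (by simp) (fun k _ => by
      simp only [Function.update_idem]
      exact .skip _)
  rw [Function.update_eq_self] at this
  exact this.mono (by omega)

theorem exec_move {x y : ℕ} (hxy : x ≠ y) :
    ExecLE (.move x y) (St w aux v out) (2 * v x + 1)
      (St w aux (Function.update (Function.update v x 0) y (v y + v x)) out) := by
  -- With `k` iterations left, `v x - k` units have been transferred.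
  have := exec_repeat (w := w) (aux := aux) (x := x) (c := v x) (T := 1) (p := .inc y)
    (fun k => Function.update (Function.update v x k) y (v y + (v x - k))) (fun _ => out)
    (by simp [hxy]) (fun k hk => by
      convert exec_inc y using 2
      funext i
      simp only [Function.update_apply]
      split_ifs <;> first | rfl | omega)
  simp only [Nat.sub_self, Nat.sub_zero, Nat.add_zero, Function.update_eq_self] at this
  exact this.mono (by omega)

theorem exec_copy {x y s : ℕ} (hxy : x ≠ y) (hxs : x ≠ s) (hys : y ≠ s) (hs : v s = 0) :
    ExecLE (.copy x y s) (St w aux v out) (5 * v x + 2)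
      (St w aux (Function.update v y (v y + v x)) out) := by
  -- The first loop empties `x` into both `y` and `s`, the second one refills `x` from `s`.
  have h1 := exec_repeat (w := w) (aux := aux) (x := x) (c := v x) (T := 2)
    (p := .seq (.inc y) (.inc s))
    (fun k => Function.update (Function.update (Function.update v x k) y (v y + (v x - k))) s (v x - k))
    (fun _ => out)
    (by simp [hxy, hxs]) (fun k hk => by
      refine ExecLE.seq (T := 1) (T' := 1) (exec_inc y) ?_
      convert exec_inc s using 2
      funext i
      simp only [Function.update_apply]
      split_ifs <;> first | rfl | omega | (simp_all; done) | (simp_all; omega))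
  have h2 := exec_move (w := w) (aux := aux) (out := out) (v := Function.update (Function.update
    (Function.update v x 0) y (v y + v x)) s (v x)) (x := s) (y := x) (Ne.symm hxs)
  have h3 : Function.update (Function.update (Function.update v x (v x)) y (v y + (v x - v x))) s
      (v x - v x) = v := by
    funext i
    simp only [Function.update_apply]
    split_ifs <;> simp_all
  rw [h3] at h1
  simp only [Nat.sub_zero] at h1
  have h4 := (h1.seq h2).mono (T' := 5 * v x + 2) (by simp; omega)
  rw [Prog.copy]
  convert h4 using 2
  funext i
  simp only [Function.update_apply]
  split_ifs <;> simp_all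

/-- The subtraction is truncated because the test on an empty `y` changes nothing. -/
theorem exec_subtract {x y : ℕ} (hxy : x ≠ y) :
    ExecLE (.subtract x y) (St w aux v out) (3 * v x + 1)
      (St w aux (Function.update (Function.update v x 0) y (v y - v x)) out) := by
  have := exec_repeat (w := w) (aux := aux) (x := x) (c := v x) (T := 2)
    (p := .ifPos y .skip .skip)
    (fun k => Function.update (Function.update v x k) y (v y - (v x - k))) (fun _ => out)
    (by simp [hxy]) (fun k hk => by
      rcases Nat.eq_zero_or_pos (v y - (v x - (k + 1))) with h0 | h0
      · refine exec_ifPos_zero (T := 1) (by simp [Function.update_apply, hxy.symm, h0]) ?_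
        convert ExecLE.skip _ using 2
        funext i
        simp only [Function.update_apply]
        split_ifs <;> first | rfl | omega
      · refine exec_ifPos_succ (T := 1) (n := v y - (v x - k)) ?_ ?_
        · simp [Function.update_apply, hxy.symm]
          omega
        · convert ExecLE.skip _ using 2
          funext i
          simp only [Function.update_apply]
          split_ifs <;> first | rfl | omega)
  simp only [Nat.sub_self, Nat.sub_zero, Function.update_eq_self] at this
  exact this.mono (by omega)

/-! Register programs at the registers from `b` on, with contents `l`. -/

variable {l : List ℕ}

/-- The state with input word `w` and registers `l` from `b` on. -/
abbrev RS (w : List (Option Bool)) (b : ℕ) (v : ℕ → ℕ) (out : List Bool) (l : List ℕ) : PState :=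
  St w [] (regs b v l) out

theorem rs_inc (j : ℕ) (hj : j < l.length) : ExecLE (.inc (b + j)) (RS w b v out l) 1
    (RS w b v out (l.set j (l.getD j 0 + 1))) := by
  have := exec_inc (w := w) (aux := []) (v := regs b v l) (out := out) (b + j)
  rwa [update_regs _ _ _ hj, regs_apply] at this

theorem rs_clear (j : ℕ) (hj : j < l.length) :
    ExecLE (.clear (b + j)) (RS w b v out l) (2 * l.getD j 0 + 1) (RS w b v out (l.set j 0)) := by
  have := exec_clear (w := w) (aux := []) (v := regs b v l) (out := out) (b + j)
  rwa [update_regs _ _ _ hj, regs_apply] at this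

theorem rs_move (i j : ℕ) (hij : i ≠ j) (hi : i < l.length) (hj : j < l.length) :
    ExecLE (.move (b + i) (b + j)) (RS w b v out l) (2 * l.getD i 0 + 1)
      (RS w b v out ((l.set i 0).set j (l.getD j 0 + l.getD i 0))) := by
  have := exec_move (w := w) (aux := []) (v := regs b v l) (out := out) (x := b + i) (y := b + j)
    (by omega)
  rwa [update_regs _ _ _ hi, update_regs _ _ _ (by simpa), regs_apply, regs_apply] at this

theorem rs_copy (i j s : ℕ) (hij : i ≠ j) (his : i ≠ s) (hjs : j ≠ s) (hj : j < l.length)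
    (hs : l.getD s 0 = 0) :
    ExecLE (.copy (b + i) (b + j) (b + s)) (RS w b v out l) (5 * l.getD i 0 + 2)
      (RS w b v out (l.set j (l.getD j 0 + l.getD i 0))) := by
  have := exec_copy (w := w) (aux := []) (v := regs b v l) (out := out) (x := b + i) (y := b + j)
    (s := b + s) (by omega) (by omega) (by omega) (by rw [regs_apply, hs])
  rwa [update_regs _ _ _ hj, regs_apply, regs_apply] at this

theorem rs_subtract (i j : ℕ) (hij : i ≠ j) (hi : i < l.length) (hj : j < l.length) :
    ExecLE (.subtract (b + i) (b + j)) (RS w b v out l) (3 * l.getD i 0 + 1)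
      (RS w b v out ((l.set i 0).set j (l.getD j 0 - l.getD i 0))) := by
  have := exec_subtract (w := w) (aux := []) (v := regs b v l) (out := out) (x := b + i)
    (y := b + j) (by omega)
  rwa [update_regs _ _ _ hi, update_regs _ _ _ (by simpa), regs_apply, regs_apply] at this

theorem rs_ifPos_succ (j : ℕ) (hj : j < l.length) {n T : ℕ} {p q : Prog} {s : PState}
    (hx : l.getD j 0 = n + 1) (h : ExecLE p (RS w b v out (l.set j n)) T s) :
    ExecLE (.ifPos (b + j) p q) (RS w b v out l) (T + 1) s := by
  refine exec_ifPos_succ (n := n) (by rw [regs_apply, hx]) ?_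
  rwa [update_regs _ _ _ hj]

theorem rs_ifPos_zero (j : ℕ) {T : ℕ} {p q : Prog} {s : PState}
    (hx : l.getD j 0 = 0) (h : ExecLE q (RS w b v out l) T s) :
    ExecLE (.ifPos (b + j) p q) (RS w b v out l) (T + 1) s :=
  exec_ifPos_zero (by rw [regs_apply, hx]) h

theorem rs_repeat (j : ℕ) {c T : ℕ} {p : Prog} (F : ℕ → List ℕ) (out : ℕ → List Bool)
    (hl : ∀ k, j < (F k).length) (hF : ∀ k, (F k).getD j 0 = k)
    (h : ∀ k < c, ExecLE p (RS w b v (out (k + 1)) ((F (k + 1)).set j k)) T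
      (RS w b v (out k) (F k))) :
    ExecLE (.repeatNum (b + j) p) (RS w b v (out c) (F c)) (c * (T + 1) + 1)
      (RS w b v (out 0) (F 0)) :=
  exec_repeat (fun k => regs b v (F k)) out (fun k => by rw [regs_apply, hF]) fun k hk => by
    rw [update_regs _ _ _ (hl _)]
    exact h k hk

theorem rs_zeros (n : ℕ) : RS w b v out (l ++ List.replicate n 0) = RS w b v out l := by
  rw [RS, RS, regs_append_zeros]

theorem rs_append (l' : List ℕ) :
    RS w b v out (l ++ l') = RS w (b + l.length) (regs b v l) out l' := by
  rw [RS, RS, regs_append]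

end raw
end Accordion

namespace Accordion
open Encodable

/-! ### Register programs for the pairing function and its inverse. -/

section pairing

variable {w : List (Option Bool)} {v : ℕ → ℕ} {out : List Bool} {b : ℕ}

namespace Prog

def seqs : List Prog → Prog
  | [] => .skip
  | p :: l => .seq p (seqs l)

/-- Pairs the registers `b` and `b + 1`. -/
def pair (b : ℕ) : Prog := seqs [
  copy (b + 0) (b + 2) (b + 4), copy (b + 1) (b + 3) (b + 4), subtract (b + 2) (b + 3),
  ifPos (b + 3)
    (seqs [clear (b + 3), copy (b + 1) (b + 2) (b + 4),
      repeatNum (b + 2) (copy (b + 1) (b + 3) (b + 4)), move (b + 3) (b + 0), clear (b + 1)])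
    (seqs [copy (b + 0) (b + 2) (b + 4), repeatNum (b + 2) (copy (b + 0) (b + 1) (b + 4)),
      move (b + 1) (b + 0)])]

/-- Unpairs the register `b` into `b` and `b + 1`. -/
def unpair (b : ℕ) : Prog := seqs [
  repeatNum (b + 0) (ifPos (b + 3) (inc (b + 2)) (seqs [inc (b + 1), clear (b + 2),
    copy (b + 1) (b + 3) (b + 4), copy (b + 1) (b + 3) (b + 4)])),
  clear (b + 3), copy (b + 1) (b + 3) (b + 4), copy (b + 2) (b + 0) (b + 4),
  subtract (b + 0) (b + 3),
  ifPos (b + 3)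
    (seqs [clear (b + 3), move (b + 2) (b + 0)])
    (seqs [copy (b + 1) (b + 0) (b + 4), subtract (b + 1) (b + 2), move (b + 2) (b + 1)])]

end Prog

theorem ExecLE.seqs_nil (s : PState) : ExecLE (.seqs []) s 1 s := .skip s

theorem ExecLE.seqs_cons {p : Prog} {l : List Prog} {s s' s'' : PState} {T T' : ℕ}
    (h : ExecLE p s T s') (h' : ExecLE (.seqs l) s' T' s'') :
    ExecLE (.seqs (p :: l)) s (T + T') s'' := h.seq h'

/-- `Nat.pair a c` is c² + a if a < c, and a² + a + c otherwise. The truncated difference c - a in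
the fourth register decides between the two, and squares are computed by repeated copying. -/
theorem exec_pair (a c : ℕ) : ExecLE (.pair b) (RS w b v out [a, c, 0, 0, 0])
    (50 * (a + c + 1) ^ 2) (RS w b v out [Nat.pair a c, 0, 0, 0, 0]) := by
  have h1 : ExecLE (.copy (b + 0) (b + 2) (b + 4)) (RS w b v out [a, c, 0, 0, 0]) (5 * a + 2)
      (RS w b v out [a, c, a, 0, 0]) := by
    simpa using rs_copy (l := [a, c, 0, 0, 0]) 0 2 4 (by simp) (by simp) (by simp) (by simp) rfl
  have h2 : ExecLE (.copy (b + 1) (b + 3) (b + 4)) (RS w b v out [a, c, a, 0, 0]) (5 * c + 2)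
      (RS w b v out [a, c, a, c, 0]) := by
    simpa using rs_copy (l := [a, c, a, 0, 0]) 1 3 4 (by simp) (by simp) (by simp) (by simp) rfl
  have h3 : ExecLE (.subtract (b + 2) (b + 3)) (RS w b v out [a, c, a, c, 0]) (3 * a + 1)
      (RS w b v out [a, c, 0, c - a, 0]) := by
    simpa using rs_subtract (l := [a, c, a, c, 0]) 2 3 (by simp) (by simp) (by simp)
  rcases lt_or_ge a c with hac | hac
  -- The test has already taken one unit from this register.
  · have k1 : ExecLE (.clear (b + 3)) (RS w b v out [a, c, 0, c - a - 1, 0]) (2 * (c - a - 1) + 1)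
        (RS w b v out [a, c, 0, 0, 0]) := by
      simpa using rs_clear (l := [a, c, 0, c - a - 1, 0]) 3 (by simp)
    have k2 : ExecLE (.copy (b + 1) (b + 2) (b + 4)) (RS w b v out [a, c, 0, 0, 0]) (5 * c + 2)
        (RS w b v out [a, c, c, 0, 0]) := by
      simpa using rs_copy (l := [a, c, 0, 0, 0]) 1 2 4 (by simp) (by simp) (by simp) (by simp) rfl
    have k3 : ExecLE (.repeatNum (b + 2) (.copy (b + 1) (b + 3) (b + 4)))
        (RS w b v out [a, c, c, 0, 0]) (c * (5 * c + 2 + 1) + 1)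
        (RS w b v out [a, c, 0, c * c, 0]) := by
      have := rs_repeat (w := w) (b := b) (v := v) 2 (c := c) (T := 5 * c + 2)
        (p := .copy (b + 1) (b + 3) (b + 4))
        (fun k => [a, c, k, c * (c - k), 0]) (fun _ => out) (by simp) (by simp) (fun k hk => by
          have := rs_copy (w := w) (b := b) (v := v) (out := out)
            (l := [a, c, k, c * (c - (k + 1)), 0]) 1 3 4 (by simp) (by simp) (by simp) (by simp) rfl
          have e : c * (c - (k + 1)) + c = c * (c - k) := by
            rw [← Nat.mul_succ]
            congr 1
            omega
          simpa [e] using this)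
      simpa using this
    have k4 : ExecLE (.move (b + 3) (b + 0)) (RS w b v out [a, c, 0, c * c, 0]) (2 * (c * c) + 1)
        (RS w b v out [a + c * c, c, 0, 0, 0]) := by
      simpa using rs_move (l := [a, c, 0, c * c, 0]) 3 0 (by simp) (by simp) (by simp)
    have k5 : ExecLE (.clear (b + 1)) (RS w b v out [a + c * c, c, 0, 0, 0]) (2 * c + 1)
        (RS w b v out [a + c * c, 0, 0, 0, 0]) := by
      simpa using rs_clear (l := [a + c * c, c, 0, 0, 0]) 1 (by simp)
    have e : Nat.pair a c = a + c * c := by rw [Nat.pair, if_pos hac, add_comm]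
    rw [e]
    refine (h1.seqs_cons (h2.seqs_cons (h3.seqs_cons (ExecLE.seqs_cons (rs_ifPos_succ 3 (by simp)
      (n := c - a - 1) ?_ (k1.seqs_cons (k2.seqs_cons (k3.seqs_cons (k4.seqs_cons
        (k5.seqs_cons (.seqs_nil _))))))) (.seqs_nil _))))).mono ?_
    · show c - a = _
      omega
    · have := Nat.sub_le (c - a) 1
      have := Nat.sub_le c a
      nlinarith
  · have k1 : ExecLE (.copy (b + 0) (b + 2) (b + 4)) (RS w b v out [a, c, 0, c - a, 0]) (5 * a + 2)
        (RS w b v out [a, c, a, 0, 0]) := by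
      rw [Nat.sub_eq_zero_of_le hac]
      exact h1
    have k2 : ExecLE (.repeatNum (b + 2) (.copy (b + 0) (b + 1) (b + 4)))
        (RS w b v out [a, c, a, 0, 0]) (a * (5 * a + 2 + 1) + 1)
        (RS w b v out [a, c + a * a, 0, 0, 0]) := by
      have := rs_repeat (w := w) (b := b) (v := v) 2 (c := a) (T := 5 * a + 2)
        (p := .copy (b + 0) (b + 1) (b + 4))
        (fun k => [a, c + a * (a - k), k, 0, 0]) (fun _ => out) (by simp) (by simp) (fun k hk => by
          have := rs_copy (w := w) (b := b) (v := v) (out := out)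
            (l := [a, c + a * (a - (k + 1)), k, 0, 0]) 0 1 4 (by simp) (by simp) (by simp) (by simp)
            rfl
          have e : c + a * (a - (k + 1)) + a = c + a * (a - k) := by
            rw [add_assoc, ← Nat.mul_succ]
            congr 2
            omega
          simpa [e] using this)
      simpa using this
    have k3 : ExecLE (.move (b + 1) (b + 0)) (RS w b v out [a, c + a * a, 0, 0, 0])
        (2 * (c + a * a) + 1) (RS w b v out [a + (c + a * a), 0, 0, 0, 0]) := by
      simpa using rs_move (l := [a, c + a * a, 0, 0, 0]) 1 0 (by simp) (by simp) (by simp)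
    have e : Nat.pair a c = a + (c + a * a) := by rw [Nat.pair, if_neg (by omega)]; ring
    rw [e]
    refine (h1.seqs_cons (h2.seqs_cons (h3.seqs_cons (ExecLE.seqs_cons (rs_ifPos_zero 3 ?_
      (k1.seqs_cons (k2.seqs_cons (k3.seqs_cons (.seqs_nil _))))) (.seqs_nil _))))).mono ?_
    · show c - a = 0
      omega
    · nlinarith

theorem exec_unpair (n : ℕ) : ExecLE (.unpair b) (RS w b v out [n, 0, 0, 0, 0])
    (200 * (n + 1) ^ 2) (RS w b v out [n.unpair.1, n.unpair.2, 0, 0, 0]) := by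
  set s := n.sqrt with hs
  set j := n - s * s with hj
  have hsn : s ≤ n := Nat.sqrt_le_self n
  have hjn : j ≤ n := Nat.sub_le _ _
  have h1 : ExecLE (.repeatNum (b + 0) (.ifPos (b + 3) (.inc (b + 2)) (.seqs [.inc (b + 1),
      .clear (b + 2), .copy (b + 1) (b + 3) (b + 4), .copy (b + 1) (b + 3) (b + 4)])))
      (RS w b v out [n, 0, 0, 0, 0]) (n * (30 * (n + 1) + 1) + 1)
      (RS w b v out [0, s, j, 2 * s - j, 0]) := by
    -- After m = n - k rounds the registers hold s = ⌊√m⌋, the offset m - s², and the countdown 2s -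
    -- (m - s²), which reaches zero just before the next square.
    have := rs_repeat (w := w) (b := b) (v := v) 0 (c := n) (T := 30 * (n + 1))
      (p := .ifPos (b + 3) (.inc (b + 2)) (.seqs [.inc (b + 1),
        .clear (b + 2), .copy (b + 1) (b + 3) (b + 4), .copy (b + 1) (b + 3) (b + 4)]))
      (fun k => [k, (n - k).sqrt, (n - k) - (n - k).sqrt * (n - k).sqrt,
        2 * (n - k).sqrt - ((n - k) - (n - k).sqrt * (n - k).sqrt), 0])
      (fun _ => out) (by simp) (by simp) (fun k hk => by
        obtain ⟨m, hm⟩ : ∃ m, n - (k + 1) = m := ⟨_, rfl⟩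
        have hm' : n - k = m + 1 := by omega
        simp only [hm, hm', List.set_cons_zero]
        have hmn : m ≤ n := by omega
        obtain ⟨r, hr⟩ : ∃ r, m.sqrt = r := ⟨_, rfl⟩
        have hr1 : r * r ≤ m := hr ▸ Nat.sqrt_le m
        have hr2 : m ≤ r * r + r + r := hr ▸ Nat.sqrt_le_add m
        have hr3 : r ≤ m := hr ▸ Nat.sqrt_le_self m
        rw [hr]
        rcases Nat.eq_zero_or_pos (2 * r - (m - r * r)) with h0 | h0
        -- An exhausted countdown means m = r² + 2r, so m + 1 is the next square. The offset is
        -- cleared, and two copies restart the countdown at 2(r + 1).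
        · have e : (m + 1).sqrt = r + 1 := by
            symm
            rw [Nat.eq_sqrt]
            constructor <;> nlinarith [show m = r * r + 2 * r by omega]
          rw [e]
          have e1 : m + 1 - (r + 1) * (r + 1) = 0 := by
            have : (r + 1) * (r + 1) = r * r + 2 * r + 1 := by ring
            omega
          have e2 : 2 * (r + 1) - 0 = 0 + (r + 1) + (r + 1) := by omega
          rw [e1, e2, h0]
          have k1 : ExecLE (.inc (b + 1)) (RS w b v out [k, r, m - r * r, 0, 0]) 1
              (RS w b v out [k, r + 1, m - r * r, 0, 0]) := by
            simpa using rs_inc (l := [k, r, m - r * r, 0, 0]) 1 (by simp)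
          have k2 : ExecLE (.clear (b + 2)) (RS w b v out [k, r + 1, m - r * r, 0, 0])
              (2 * (m - r * r) + 1) (RS w b v out [k, r + 1, 0, 0, 0]) := by
            simpa using rs_clear (l := [k, r + 1, m - r * r, 0, 0]) 2 (by simp)
          have k3 (x : ℕ) : ExecLE (.copy (b + 1) (b + 3) (b + 4)) (RS w b v out [k, r + 1, 0, x, 0])
              (5 * (r + 1) + 2) (RS w b v out [k, r + 1, 0, x + (r + 1), 0]) := by
            simpa using rs_copy (l := [k, r + 1, 0, x, 0]) 1 3 4 (by simp) (by simp) (by simp)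
              (by simp) rfl
          refine (rs_ifPos_zero 3 rfl (k1.seqs_cons (k2.seqs_cons ((k3 _).seqs_cons
            ((k3 _).seqs_cons (.seqs_nil _)))))).mono ?_
          have := Nat.sub_le m (r * r)
          linarith
        · have e : (m + 1).sqrt = r := by
            symm
            rw [Nat.eq_sqrt]
            constructor
            · omega
            · have : (r + 1) * (r + 1) = r * r + 2 * r + 1 := by ring
              omega
          rw [e]
          refine (rs_ifPos_succ 3 (by simp) (n := 2 * r - (m + 1 - r * r)) ?_ (T := 1) ?_).mono
            (by omega)
          · simp
            omega
          · have := rs_inc (w := w) (b := b) (v := v) (out := out)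
              (l := [k, r, m - r * r, 2 * r - (m + 1 - r * r), 0]) 2 (by simp)
            have e1 : m - r * r + 1 = m + 1 - r * r := by omega
            simpa [e1] using this)
    simpa [← hs, ← hj] using this
  have h2 : ExecLE (.clear (b + 3)) (RS w b v out [0, s, j, 2 * s - j, 0]) (2 * (2 * s - j) + 1)
      (RS w b v out [0, s, j, 0, 0]) := by
    simpa using rs_clear (l := [0, s, j, 2 * s - j, 0]) 3 (by simp)
  have h3 : ExecLE (.copy (b + 1) (b + 3) (b + 4)) (RS w b v out [0, s, j, 0, 0]) (5 * s + 2)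
      (RS w b v out [0, s, j, s, 0]) := by
    simpa using rs_copy (l := [0, s, j, 0, 0]) 1 3 4 (by simp) (by simp) (by simp) (by simp) rfl
  have h4 : ExecLE (.copy (b + 2) (b + 0) (b + 4)) (RS w b v out [0, s, j, s, 0]) (5 * j + 2)
      (RS w b v out [j, s, j, s, 0]) := by
    simpa using rs_copy (l := [0, s, j, s, 0]) 2 0 4 (by simp) (by simp) (by simp) (by simp) rfl
  have h5 : ExecLE (.subtract (b + 0) (b + 3)) (RS w b v out [j, s, j, s, 0]) (3 * j + 1)
      (RS w b v out [0, s, j, s - j, 0]) := by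
    simpa using rs_subtract (l := [j, s, j, s, 0]) 0 3 (by simp) (by simp) (by simp)
  have e : n.unpair = if j < s then (j, s) else (s, j - s) := rfl
  have hsub := Nat.sub_le (2 * s) j
  have hsub' := Nat.sub_le s j
  rcases lt_or_ge j s with hjs | hjs
  · rw [e, if_pos hjs]
    have k1 : ExecLE (.clear (b + 3)) (RS w b v out [0, s, j, s - j - 1, 0]) (2 * (s - j - 1) + 1)
        (RS w b v out [0, s, j, 0, 0]) := by
      simpa using rs_clear (l := [0, s, j, s - j - 1, 0]) 3 (by simp)
    have k2 : ExecLE (.move (b + 2) (b + 0)) (RS w b v out [0, s, j, 0, 0]) (2 * j + 1)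
        (RS w b v out [j, s, 0, 0, 0]) := by
      simpa using rs_move (l := [0, s, j, 0, 0]) 2 0 (by simp) (by simp) (by simp)
    refine (h1.seqs_cons (h2.seqs_cons (h3.seqs_cons (h4.seqs_cons (h5.seqs_cons
      (ExecLE.seqs_cons (rs_ifPos_succ 3 (by simp) (n := s - j - 1) ?_ (k1.seqs_cons
        (k2.seqs_cons (.seqs_nil _)))) (.seqs_nil _))))))).mono ?_
    · show s - j = _
      omega
    · have := Nat.sub_le (s - j) 1
      nlinarith
  · rw [e, if_neg (by omega)]
    have k1 : ExecLE (.copy (b + 1) (b + 0) (b + 4)) (RS w b v out [0, s, j, s - j, 0]) (5 * s + 2)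
        (RS w b v out [s, s, j, 0, 0]) := by
      rw [Nat.sub_eq_zero_of_le hjs]
      simpa using rs_copy (l := [0, s, j, 0, 0]) 1 0 4 (by simp) (by simp) (by simp) (by simp) rfl
    have k2 : ExecLE (.subtract (b + 1) (b + 2)) (RS w b v out [s, s, j, 0, 0]) (3 * s + 1)
        (RS w b v out [s, 0, j - s, 0, 0]) := by
      simpa using rs_subtract (l := [s, s, j, 0, 0]) 1 2 (by simp) (by simp) (by simp)
    have k3 : ExecLE (.move (b + 2) (b + 1)) (RS w b v out [s, 0, j - s, 0, 0]) (2 * (j - s) + 1)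
        (RS w b v out [s, j - s, 0, 0, 0]) := by
      simpa using rs_move (l := [s, 0, j - s, 0, 0]) 2 1 (by simp) (by simp) (by simp)
    refine (h1.seqs_cons (h2.seqs_cons (h3.seqs_cons (h4.seqs_cons (h5.seqs_cons
      (ExecLE.seqs_cons (rs_ifPos_zero 3 ?_ (k1.seqs_cons
        (k2.seqs_cons (k3.seqs_cons (.seqs_nil _))))) (.seqs_nil _))))))).mono ?_
    · show s - j = 0
      omega
    · have := Nat.sub_le j s
      nlinarith

end pairing

end Accordion

namespace Accordion
open Encodable

/-! ### Programs for functions between encodable types -/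

/-- Input words. -/
abbrev Word := List (Option Bool)

section
variable {α β γ δ : Type} [Encodable α] [Encodable β] [Encodable γ] [Encodable δ]

/-- The programs `P b` compute `f`, in place, on the register `b`, within time `t`. -/
def Runs (P : ℕ → Prog) (f : Word → α → β) (t : Word → α → ℕ) : Prop :=
  ∀ w b v out a, ExecLE (P b) (RS w b v out [encode a]) (t w a) (RS w b v out [encode (f w a)])

/-- The programs `P b` write `f` on the output stack, and clear the register `b`. -/
def Emits (P : ℕ → Prog) (f : Word → α → List Bool) (t : Word → α → ℕ) : Prop :=
  ∀ w b v out a, ExecLE (P b) (RS w b v out [encode a]) (t w a) (RS w b v (f w a ++ out) [0])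


/-- Programs see nothing but codes, so one program serves all functions with the same effect on
codes, whatever their types are. -/
theorem Runs.of_encode {P : ℕ → Prog} {f : Word → α → β} {t : Word → α → ℕ} (h : Runs P f t)
    {g : Word → γ → δ} (e : γ → α) (he : ∀ a, encode (e a) = encode a)
    (hg : ∀ w a, encode (f w (e a)) = encode (g w a)) : Runs P g fun w a => t w (e a) := by
  intro w b v out a
  have := h w b v out (e a)
  rwa [he, hg] at this

/-- Running `P` behind the registers `l`. -/
theorem Runs.at {P : ℕ → Prog} {f : Word → α → β} {t : Word → α → ℕ} (h : Runs P f t) (w : Word)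
    (b : ℕ) (v : ℕ → ℕ) (out : List Bool) (l : List ℕ) (a : α) (n : ℕ) :
    ExecLE (P (b + l.length)) (RS w b v out (l ++ encode a :: List.replicate n 0)) (t w a)
      (RS w b v out (l ++ encode (f w a) :: List.replicate n 0)) := by
  have e (x : ℕ) : l ++ x :: List.replicate n 0 = (l ++ [x]) ++ List.replicate n 0 := by simp
  rw [e, e, rs_zeros, rs_zeros, rs_append, rs_append]
  exact h w _ _ out a

theorem Emits.at {P : ℕ → Prog} {f : Word → α → List Bool} {t : Word → α → ℕ} (h : Emits P f t)
    (w : Word) (b : ℕ) (v : ℕ → ℕ) (out : List Bool) (l : List ℕ) (a : α) (n : ℕ) :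
    ExecLE (P (b + l.length)) (RS w b v out (l ++ encode a :: List.replicate n 0)) (t w a)
      (RS w b v (f w a ++ out) (l ++ 0 :: List.replicate n 0)) := by
  have e (x : ℕ) : l ++ x :: List.replicate n 0 = (l ++ [x]) ++ List.replicate n 0 := by simp
  rw [e, e, rs_zeros, rs_zeros, rs_append, rs_append]
  exact h w _ _ out a

theorem exec_pair_at (w : Word) (b : ℕ) (v : ℕ → ℕ) (out : List Bool) (l : List ℕ) (x y n : ℕ) :
    ExecLE (.pair (b + l.length)) (RS w b v out (l ++ x :: y :: List.replicate n 0))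
      (50 * (x + y + 1) ^ 2) (RS w b v out (l ++ Nat.pair x y :: 0 :: List.replicate n 0)) := by
  have e (x y : ℕ) : l ++ x :: y :: List.replicate n 0 = (l ++ [x, y]) ++ List.replicate n 0 := by
    simp
  have e' (x y : ℕ) : RS w b v out (l ++ x :: y :: List.replicate n 0) =
      RS w b v out (l ++ [x, y] ++ List.replicate 3 0) := by
    rw [e, rs_zeros, rs_zeros]
  rw [e', e', List.append_assoc, List.append_assoc]
  have := exec_pair (w := w) (b := b + l.length) (v := regs b v l) (out := out) x y
  rwa [← rs_append, ← rs_append] at this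

theorem exec_unpair_at (w : Word) (b : ℕ) (v : ℕ → ℕ) (out : List Bool) (x n : ℕ) :
    ExecLE (.unpair b) (RS w b v out (x :: List.replicate (n + 1) 0))
      (200 * (x + 1) ^ 2) (RS w b v out (x.unpair.1 :: x.unpair.2 :: List.replicate n 0)) := by
  have e (x y : ℕ) : x :: y :: List.replicate n 0 = [x, y] ++ List.replicate n 0 := by
    simp
  have e' (x y : ℕ) : RS w b v out (x :: y :: List.replicate n 0) =
      RS w b v out ([x, y] ++ List.replicate 3 0) := by
    rw [e, rs_zeros, rs_zeros]
  rw [List.replicate_succ, e', e']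
  exact exec_unpair x

theorem rs_pad {w : Word} {b : ℕ} {v : ℕ → ℕ} {out : List Bool} (l : List ℕ) (n : ℕ) :
    RS w b v out l = RS w b v out (l ++ List.replicate n 0) := (rs_zeros n).symm

theorem Runs.id : Runs (fun _ => .skip) (fun _ (a : α) => a) fun _ _ => 1 :=
  fun _ _ _ _ _ => .skip _

theorem Runs.comp {P Q : ℕ → Prog} {f : Word → α → β} {g : Word → β → γ} {t : Word → α → ℕ}
    {t' : Word → β → ℕ} (hg : Runs Q g t') (hf : Runs P f t) :
    Runs (fun b => .seq (P b) (Q b)) (fun w a => g w (f w a)) fun w a => t w a + t' w (f w a) :=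
  fun w b v out a => (hf w b v out a).seq (hg w b v out (f w a))

theorem Runs.succ : Runs (fun b => .inc (b + 0)) (fun _ (n : ℕ) => n + 1) fun _ _ => 1 :=
  fun w b v out n => by simpa using rs_inc (w := w) (b := b) (v := v) (out := out) (l := [n]) 0 (by simp)

theorem Runs.constNat (n : ℕ) : Runs (fun b => .seqs (.clear (b + 0) :: List.replicate n (.inc (b + 0))))
    (fun _ (_ : α) => n) fun _ a => 2 * encode a + n + 2 := by
  intro w b v out a
  have h1 := rs_clear (w := w) (b := b) (v := v) (out := out) (l := [encode a]) 0 (by simp)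
  have h2 : ∀ m k : ℕ, ExecLE (.seqs (List.replicate m (.inc (b + 0)))) (RS w b v out [k]) (m + 1)
      (RS w b v out [k + m]) := by
    intro m
    induction m with
    | zero => exact fun k => .skip _
    | succ m ih =>
      intro k
      have h3 := rs_inc (w := w) (b := b) (v := v) (out := out) (l := [k]) 0 (by simp)
      have h4 := h3.seqs_cons (ih (k + 1))
      rw [List.replicate_succ]
      convert h4 using 1
      · omega
      · rw [add_assoc, add_comm 1]
  have := h1.seqs_cons (h2 n 0)
  simp only [List.getD_cons_zero, zero_add] at this
  exact this.mono (by beta_reduce; omega)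

theorem Runs.const (x : β) : Runs (fun b => .seqs (.clear (b + 0) :: List.replicate (encode x) (.inc (b + 0))))
    (fun _ (_ : α) => x) fun _ a => 2 * encode a + encode x + 2 :=
  (Runs.constNat (α := α) (encode x)).of_encode (fun a => a) (fun _ => rfl) fun _ _ => rfl

/-- The code of the symbol at a position of the input word. -/
def symCode : Option (Option Bool) → ℕ
  | some (some false) => 0
  | some (some true) => 1
  | some none => 2
  | none => 3

namespace Prog

def restore : Prog := .loop 1 (.push 0)

def sym (b : ℕ) : Prog := seqs [
  repeatNum (b + 0) (.case 0 fun
    | some a => .push 1 a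
    | none => .skip),
  .case 0 fun
    | some a => .seq (.push 0 a) (seqs (List.replicate (symCode (some a)) (inc (b + 0))))
    | none => seqs (List.replicate 3 (inc (b + 0))),
  restore]

def len (b : ℕ) : Prog := seqs [clear (b + 0), .loop 0 fun a => .seq (.push 1 a) (inc (b + 0)), restore]

/-- Computes the pair of the values of `P` and `Q`. -/
def both (P Q : ℕ → Prog) (b : ℕ) : Prog := seqs [
  copy (b + 0) (b + 1) (b + 2), P (b + 1), copy (b + 0) (b + 2) (b + 3), Q (b + 2), clear (b + 0),
  move (b + 1) (b + 0), move (b + 2) (b + 1), pair (b + 0)]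

/-- Primitive recursion. -/
def prec (P Q : ℕ → Prog) (b : ℕ) : Prog := seqs [
  unpair b, copy (b + 0) (b + 3) (b + 4), P (b + 3),
  repeatNum (b + 1) (seqs [copy (b + 0) (b + 4) (b + 5), copy (b + 2) (b + 5) (b + 6),
    move (b + 3) (b + 6), pair (b + 5), pair (b + 4), Q (b + 4), move (b + 4) (b + 3), inc (b + 2)]),
  clear (b + 0), clear (b + 2), move (b + 3) (b + 0)]

end Prog

theorem exec_incs (w aux : Word) (b : ℕ) (v : ℕ → ℕ) (out : List Bool) (m k : ℕ) :
    ExecLE (.seqs (List.replicate m (.inc (b + 0)))) (St w aux (regs b v [k]) out) (m + 1)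
      (St w aux (regs b v [k + m]) out) := by
  induction m generalizing k with
  | zero => exact .skip _
  | succ m ih =>
    have h3 := exec_inc (w := w) (aux := aux) (v := regs b v [k]) (out := out) (b + 0)
    rw [update_regs _ _ _ (by simp), regs_apply] at h3
    have h4 := h3.seqs_cons (ih (k + 1))
    rw [List.replicate_succ]
    convert h4 using 1
    · omega
    · rw [add_assoc, add_comm 1]

theorem exec_restore (w aux : Word) (v : ℕ → ℕ) (out : List Bool) (h : aux.reverse <+: w) :
    ExecLE .restore (St (w.drop aux.length) aux v out) (2 * aux.length + 1) (St w [] v out) := by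
  have := ExecLE.loop (r := 1) (T := 1) (p := .push 0)
    (fun l => St (w.drop l.length) l v out) (fun l => rfl) aux (fun a l hl => by
      have h1 : ExecLE (.push 0 a) (St (w.drop (l.length + 1)) l v out) 1 _ := .push 0 a _
      rw [St.set_inp] at h1
      rw [St.set_aux]
      have h2 : (a :: l).reverse <+: w := (List.reverse_prefix.2 hl).trans h
      obtain ⟨r, rfl⟩ := h2
      have e : ((a :: l).reverse ++ r).drop l.length = a :: r := by
        simp
      have e' : ((a :: l).reverse ++ r).drop (l.length + 1) = r := by
        simp [List.drop_append]
      simp only [List.length_cons] at h1 ⊢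
      rw [e'] at h1 ⊢
      rw [e]
      exact h1)
  exact this.mono (by omega)

/-- Only the first `i` symbols travel to the auxiliary stack and back, so the bound does not involve
the length of the word. Behind the end of the word the pops are void, and the answer is the code 3.
-/
theorem Runs.sym : Runs (fun b => .sym b) (fun w (i : ℕ) => symCode w[i]?) fun _ i => 10 * i + 20 := by
  intro w b v out i
  have h1 : ExecLE (.repeatNum (b + 0) (.case 0 fun
      | some a => .push 1 a
      | none => .skip)) (RS w b v out [i]) (i * (2 + 1) + 1)
      (St (w.drop i) (w.take i).reverse (regs b v [0]) out) := by
    have := exec_repeat_state (x := b + 0) (c := i) (T := 2)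
      (p := (.case 0 fun
        | some a => .push 1 a
        | none => .skip))
      (fun k => St (w.drop (i - k)) (w.take (i - k)).reverse (regs b v [k]) out)
      (fun k _ => by
        show List.replicate (regs b v [k] (b + 0)) none = _
        rw [regs_apply]
        rfl) (fun k hk => by
        have e := update_regs b v [k + 1] (j := 0) (by simp) k
        rw [St.set_num, show Function.update (regs b v [k + 1]) b k = regs b v [k] from e]
        refine .case (T := 1) ?_
        obtain ⟨m, hm⟩ : ∃ m, i - (k + 1) = m := ⟨_, rfl⟩
        have hm' : i - k = m + 1 := by omega
        rw [hm, hm', St.set_inp]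
        show ExecLE (match (w.drop m).head? with
          | some a => .push 1 a
          | none => .skip) (St (w.drop m).tail _ _ _) _ _
        rw [List.tail_drop, List.head?_drop, List.take_add_one]
        rcases w[m]? with _ | a
        · simpa using ExecLE.skip _
        · have := ExecLE.push 1 a (St (w.drop (m + 1)) (w.take m).reverse (regs b v [k]) out)
          rw [St.set_aux, show (St (w.drop (m + 1)) (w.take m).reverse (regs b v [k]) out).reg 1 =
            (w.take m).reverse from rfl] at this
          simpa using this)
    simpa using this
  have h2 : ExecLE (.case 0 fun
      | some a => .seq (.push 0 a) (.seqs (List.replicate (symCode (some a)) (.inc (b + 0))))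
      | none => .seqs (List.replicate 3 (.inc (b + 0))))
      (St (w.drop i) (w.take i).reverse (regs b v [0]) out) 6
      (St (w.drop i) (w.take i).reverse (regs b v [symCode w[i]?]) out) := by
    refine .case (T := 5) ?_
    rw [St.set_inp]
    show ExecLE (match (w.drop i).head? with
      | some a => .seq (.push 0 a) (.seqs (List.replicate (symCode (some a)) (.inc (b + 0))))
      | none => .seqs (List.replicate 3 (.inc (b + 0)))) (St (w.drop i).tail _ _ _) _ _
    rw [List.head?_drop]
    rcases hi : w[i]? with _ | a
    · have hl : w.drop i = [] := by
        rw [List.drop_eq_nil_iff]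
        exact List.getElem?_eq_none_iff.1 hi
      rw [hl]
      exact (exec_incs _ _ _ _ _ 3 0).mono (by omega)
    · have h3 := ExecLE.push 0 a (St (w.drop i).tail (w.take i).reverse (regs b v [0]) out)
      rw [St.set_inp] at h3
      have hl : a :: (w.drop i).tail = w.drop i := by
        have : (w.drop i).head? = some a := by rw [List.head?_drop, hi]
        exact List.cons_head?_tail this
      have h4 := h3.seq (exec_incs _ _ _ _ _ (symCode (some a)) 0)
      simp only [St] at h4 ⊢
      rw [hl, zero_add] at h4
      refine h4.mono ?_
      have : symCode (some a) ≤ 3 := by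
        rcases a with _ | _ | _ <;> decide
      omega
  have h3 := exec_restore w (w.take i).reverse (regs b v [symCode w[i]?]) out
    (by simpa using List.take_prefix i w)
  have e : w.drop (w.take i).reverse.length = w.drop i := by
    rw [List.length_reverse, List.length_take]
    rcases le_total i w.length with hi | hi
    · rw [min_eq_left hi]
    · rw [min_eq_right hi, List.drop_eq_nil_of_le hi, List.drop_length]
  rw [e] at h3
  refine (h1.seqs_cons (h2.seqs_cons (h3.seqs_cons (.seqs_nil _)))).mono ?_
  rw [List.length_reverse, List.length_take]
  have := min_le_left i w.length
  beta_reduce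
  omega

theorem Runs.len : Runs (fun b => .len b) (fun w (_ : α) => w.length)
    fun w a => 2 * encode a + 10 * w.length + 20 := by
  intro w b v out a
  have h1 := rs_clear (w := w) (b := b) (v := v) (out := out) (l := [encode a]) 0 (by simp)
  have h2 := ExecLE.loop (r := 0) (T := 2) (p := fun a => .seq (.push 1 a) (.inc (b + 0)))
    (fun l => St l (w.take (w.length - l.length)).reverse (regs b v [w.length - l.length]) out)
    (fun l => rfl) w (fun a l hl => by
      rw [St.set_inp]
      obtain ⟨r, rfl⟩ := hl
      have h3 := ExecLE.push 1 a (St l r.reverse (regs b v [r.length]) out)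
      rw [St.set_aux] at h3
      have h4 := exec_inc (w := l) (aux := a :: r.reverse) (v := regs b v [r.length]) (out := out)
        (b + 0)
      rw [update_regs _ _ _ (by simp), regs_apply] at h4
      have h5 := h3.seq h4
      have e1 : (r ++ a :: l).length - (a :: l).length = r.length := by simp
      have e2 : (r ++ a :: l).length - l.length = r.length + 1 := by simp; omega
      have e3 : (r ++ a :: l).take r.length = r := List.take_left
      have e4 : (r ++ a :: l).take (r.length + 1) = r ++ [a] := by
        rw [List.take_add_one, e3]
        simp
      rw [e1, e2, e3, e4, List.reverse_append]
      exact h5)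
  have h3 := exec_restore w w.reverse (regs b v [w.length]) out (by simp)
  rw [List.length_reverse, List.drop_length] at h3
  simp only [Nat.sub_self, List.take_zero, List.reverse_nil, List.length_nil, Nat.sub_zero,
    List.take_length] at h2
  refine (h1.seqs_cons (h2.seqs_cons (h3.seqs_cons (.seqs_nil _)))).mono ?_
  simp
  omega

theorem Runs.fst : Runs (fun b => .seq (.unpair b) (.clear (b + 1))) (fun _ (p : α × β) => p.1)
    fun _ p => 300 * (encode p + 1) ^ 2 := by
  intro w b v out p
  have h1 := exec_unpair_at w b v out (encode p) 0
  have h2 := rs_clear (w := w) (b := b) (v := v) (out := out)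
    (l := [(encode p).unpair.1, (encode p).unpair.2]) 1 (by simp)
  rw [rs_pad _ 1, rs_pad [encode p.1] 1]
  have e1 : (encode p).unpair.1 = encode p.1 := by rw [Encodable.encode_prod_val, Nat.unpair_pair]
  have h3 := h1.seq h2
  simp only [List.set_cons_succ, List.set_cons_zero, e1] at h3
  refine h3.mono ?_
  have := Nat.unpair_right_le (encode p)
  simp
  nlinarith

theorem Runs.snd : Runs (fun b => .seq (.unpair b) (.seq (.clear (b + 0)) (.move (b + 1) (b + 0))))
    (fun _ (p : α × β) => p.2) fun _ p => 300 * (encode p + 1) ^ 2 := by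
  intro w b v out p
  have h1 := exec_unpair_at w b v out (encode p) 0
  have h2 := rs_clear (w := w) (b := b) (v := v) (out := out)
    (l := [(encode p).unpair.1, (encode p).unpair.2]) 0 (by simp)
  have h2' := rs_move (w := w) (b := b) (v := v) (out := out)
    (l := [0, (encode p).unpair.2]) 1 0 (by simp) (by simp) (by simp)
  rw [rs_pad _ 1, rs_pad [encode p.2] 1]
  have e1 : (encode p).unpair.2 = encode p.2 := by rw [Encodable.encode_prod_val, Nat.unpair_pair]
  have h3 := h1.seq (h2.seq h2')
  simp only [List.set_cons_succ, List.set_cons_zero, e1, List.getD_cons_zero, zero_add,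
    List.getD_cons_succ] at h3
  refine h3.mono ?_
  have := Nat.unpair_right_le (encode p)
  have := Nat.unpair_left_le (encode p)
  rw [e1] at *
  nlinarith

theorem Runs.pair {P Q : ℕ → Prog} {f : Word → α → β} {g : Word → α → γ} {t t' : Word → α → ℕ}
    (hf : Runs P f t) (hg : Runs Q g t') :
    Runs (.both P Q) (fun w a => (f w a, g w a))
      fun w a => t w a + t' w a + 100 * (encode a + encode (f w a) + encode (g w a) + 1) ^ 2 := by
  intro w b v out a
  obtain ⟨x, hx⟩ : ∃ x, encode a = x := ⟨_, rfl⟩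
  obtain ⟨y, hy⟩ : ∃ x, encode (f w a) = x := ⟨_, rfl⟩
  obtain ⟨z, hz⟩ : ∃ x, encode (g w a) = x := ⟨_, rfl⟩
  have h1 := rs_copy (w := w) (b := b) (v := v) (out := out) (l := [x, 0, 0, 0]) 0 1 2
    (by simp) (by simp) (by simp) (by simp) rfl
  have h2 := hf.at w b v out [x] a 2
  have h3 := rs_copy (w := w) (b := b) (v := v) (out := out) (l := [x, y, 0, 0]) 0 2 3
    (by simp) (by simp) (by simp) (by simp) rfl
  have h4 := hg.at w b v out [x, y] a 1
  have h5 := rs_clear (w := w) (b := b) (v := v) (out := out) (l := [x, y, z, 0]) 0 (by simp)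
  have h6 := rs_move (w := w) (b := b) (v := v) (out := out) (l := [0, y, z, 0]) 1 0 (by simp)
    (by simp) (by simp)
  have h7 := rs_move (w := w) (b := b) (v := v) (out := out) (l := [y, 0, z, 0]) 2 1 (by simp)
    (by simp) (by simp)
  have h8 := exec_pair_at w b v out [] y z 2
  simp only [hx, hy, hz, List.set_cons_zero, List.set_cons_succ, List.getD_cons_zero, zero_add,
    List.getD_cons_succ, List.length_cons, List.length_nil, List.cons_append, List.nil_append]
    at h1 h2 h3 h4 h5 h6 h7 h8
  rw [rs_pad _ 3, rs_pad [encode (f w a, g w a)] 3, Encodable.encode_prod_val, hx, hy, hz]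
  refine (h1.seqs_cons (h2.seqs_cons (h3.seqs_cons (h4.seqs_cons (h5.seqs_cons (h6.seqs_cons
    (h7.seqs_cons (h8.seqs_cons (.seqs_nil _))))))))).mono ?_
  nlinarith

/-- The values of a primitive recursion. -/
def recVal (f : Word → α → β) (g : Word → α × (ℕ × β) → β) (w : Word) (a : α) (n : ℕ) : β :=
  Nat.rec (f w a) (fun y IH => g w (a, (y, IH))) n

/-- One round of the loop in `Prog.prec`. The registers hold the argument, the loop counter, the
index and the current value; the argument of `Q` is assembled behind them. `B` bounds the values
before and after the round, and `D` the cost of the two nested pairings. -/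
theorem exec_prec_step {Q : ℕ → Prog} {g : Word → α × (ℕ × β) → β} {t' : Word → α × (ℕ × β) → ℕ}
    (hg : Runs Q g t') (w : Word) (b : ℕ) (v : ℕ → ℕ) (out : List Bool) (a : α) (m k : ℕ) (r : β)
    {x y B D T : ℕ} (hx : encode a = x) (hxy : x ≤ y) (hmn : m ≤ y) (hr1 : encode r ≤ B)
    (hr2 : encode (g w (a, (m, r))) ≤ B) (hD : (y + (y + B + 1) ^ 2 + 1) ^ 2 = D)
    (hT' : t' w (a, (m, r)) ≤ T) :
    ExecLE (.seqs [.copy (b + 0) (b + 4) (b + 5), .copy (b + 2) (b + 5) (b + 6),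
      .move (b + 3) (b + 6), .pair (b + 5), .pair (b + 4), Q (b + 4), .move (b + 4) (b + 3),
      .inc (b + 2)]) (RS w b v out [x, k, m, encode r, 0, 0, 0]) (T + 200 * D)
      (RS w b v out [x, k, m + 1, encode (g w (a, (m, r))), 0, 0, 0]) := by
  have k1 := rs_copy (w := w) (b := b) (v := v) (out := out)
    (l := [x, k, m, encode r, 0, 0, 0]) 0 4 5 (by simp) (by simp) (by simp) (by simp) rfl
  have k2 := rs_copy (w := w) (b := b) (v := v) (out := out)
    (l := [x, k, m, encode r, x, 0, 0]) 2 5 6 (by simp) (by simp) (by simp) (by simp) rfl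
  have k3 := rs_move (w := w) (b := b) (v := v) (out := out)
    (l := [x, k, m, encode r, x, m, 0]) 3 6 (by simp) (by simp) (by simp)
  have k4 := exec_pair_at w b v out [x, k, m, 0, x] m (encode r) 0
  have k5 := exec_pair_at w b v out [x, k, m, 0] x (Nat.pair m (encode r)) 1
  have k6 := hg.at w b v out [x, k, m, 0] (a, (m, r)) 2
  have k7 := rs_move (w := w) (b := b) (v := v) (out := out)
    (l := [x, k, m, 0, encode (g w (a, (m, r))), 0, 0]) 4 3 (by simp) (by simp) (by simp)
  have k8 := rs_inc (w := w) (b := b) (v := v) (out := out)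
    (l := [x, k, m, encode (g w (a, (m, r))), 0, 0, 0]) 2 (by simp)
  have e2 : encode (a, (m, r)) = Nat.pair x (Nat.pair m (encode r)) := by
    rw [Encodable.encode_prod_val, Encodable.encode_prod_val, hx, Encodable.encode_nat]
  simp only [List.set_cons_zero, List.set_cons_succ, List.getD_cons_zero, zero_add, e2,
    List.getD_cons_succ, List.length_cons, List.length_nil, List.cons_append, List.nil_append,
    List.replicate_zero, List.replicate_succ, Nat.reduceAdd] at k1 k2 k3 k4 k5 k6 k7 k8
  refine (k1.seqs_cons (k2.seqs_cons (k3.seqs_cons (k4.seqs_cons (k5.seqs_cons (k6.seqs_cons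
    (k7.seqs_cons (k8.seqs_cons (.seqs_nil _))))))))).mono ?_
  -- A pairing is at most quadratic, which accounts for the inner square in `D`.
  have hp : Nat.pair m (encode r) ≤ (y + B + 1) ^ 2 := by
    have h9 := Nat.pair_lt_max_add_one_sq m (encode r)
    refine h9.le.trans (Nat.pow_le_pow_left ?_ 2)
    have := max_le_add_of_nonneg (zero_le : 0 ≤ m) (zero_le : 0 ≤ encode r)
    omega
  have b1 : (m + encode r + 1) ^ 2 ≤ D := by
    rw [← hD]
    refine Nat.pow_le_pow_left ?_ 2
    nlinarith
  have b2 : (x + Nat.pair m (encode r) + 1) ^ 2 ≤ D := by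
    rw [← hD]
    refine Nat.pow_le_pow_left ?_ 2
    omega
  have b3 : y + B + 1 ≤ D := by
    rw [← hD]
    nlinarith [Nat.zero_le y, Nat.zero_le B]
  nlinarith

/-- The time is controlled by arbitrary bounds `A` on the values met and `T` on the times of the
single rounds. Polynomial bounds yield polynomial time, and primitive recursive bounds yield
primitive recursive time. -/
theorem Runs.prec {P Q : ℕ → Prog} {f : Word → α → β} {g : Word → α × (ℕ × β) → β}
    {t : Word → α → ℕ} {t' : Word → α × (ℕ × β) → ℕ} (hf : Runs P f t) (hg : Runs Q g t')
    (A T : Word → α × ℕ → ℕ) (hA : ∀ w a n, ∀ i ≤ n, encode (recVal f g w a i) ≤ A w (a, n))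
    (hT : ∀ w a n, ∀ i < n, t' w (a, (i, recVal f g w a i)) ≤ T w (a, n)) :
    Runs (.prec P Q) (fun w (p : α × ℕ) => recVal f g w p.1 p.2)
      fun w p => t w p.1 + p.2 * (T w p + 1) +
        1000 * (p.2 + 1) * (encode p + (encode p + A w p + 1) ^ 2 + 1) ^ 2 := by
  rintro w b v out ⟨a, n⟩
  obtain ⟨x, hx⟩ : ∃ x, encode a = x := ⟨_, rfl⟩
  obtain ⟨y, hy⟩ : ∃ y, encode (a, n) = y := ⟨_, rfl⟩
  have h1 := exec_unpair_at w b v out y 5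
  have e1 : y.unpair = (x, n) := by
    rw [← hy, Encodable.encode_prod_val, Nat.unpair_pair, hx, Encodable.encode_nat]
  have hxy : x ≤ y := by
    have := Nat.unpair_left_le y
    rwa [e1] at this
  have hny : n ≤ y := by
    have := Nat.unpair_right_le y
    rwa [e1] at this
  have hfA : encode (f w a) ≤ A w (a, n) := hA w a n 0 (by omega)
  have h2 := rs_copy (w := w) (b := b) (v := v) (out := out) (l := [x, n, 0, 0, 0, 0, 0]) 0 3 4
    (by simp) (by simp) (by simp) (by simp) rfl
  have h3 := hf.at w b v out [x, n, 0] a 3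
  obtain ⟨B, hB⟩ : ∃ B, A w (a, n) = B := ⟨_, rfl⟩
  rw [hB] at hfA
  obtain ⟨D, hD⟩ : ∃ D, (y + (y + B + 1) ^ 2 + 1) ^ 2 = D := ⟨_, rfl⟩
  -- The loop counter `k` runs down while the index `n - k` runs up.
  have h4 := rs_repeat (w := w) (b := b) (v := v) 1 (c := n) (T := T w (a, n) + 200 * D)
    (p := .seqs [.copy (b + 0) (b + 4) (b + 5), .copy (b + 2) (b + 5) (b + 6),
      .move (b + 3) (b + 6), .pair (b + 5), .pair (b + 4), Q (b + 4), .move (b + 4) (b + 3),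
      .inc (b + 2)])
    (fun k => [x, k, n - k, encode (recVal f g w a (n - k)), 0, 0, 0]) (fun _ => out) (by simp)
    (by simp) (fun k hk => by
      obtain ⟨m, hm⟩ : ∃ m, n - (k + 1) = m := ⟨_, rfl⟩
      have hm' : n - k = m + 1 := by omega
      simp only [hm, hm', List.set_cons_zero, List.set_cons_succ]
      have hr2 := hA w a n (m + 1) (by omega)
      rw [hB] at hr2
      exact exec_prec_step hg w b v out a m k _ hx hxy (by omega) (hB ▸ hA w a n m (by omega)) hr2 hD
        (hT w a n m (by omega)))
  have h5 := rs_clear (w := w) (b := b) (v := v) (out := out)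
    (l := [x, 0, n, encode (recVal f g w a n), 0, 0, 0]) 0 (by simp)
  have h6 := rs_clear (w := w) (b := b) (v := v) (out := out)
    (l := [0, 0, n, encode (recVal f g w a n), 0, 0, 0]) 2 (by simp)
  have h7 := rs_move (w := w) (b := b) (v := v) (out := out)
    (l := [0, 0, 0, encode (recVal f g w a n), 0, 0, 0]) 3 0 (by simp) (by simp) (by simp)
  have e0 : recVal f g w a 0 = f w a := rfl
  simp only [hx, e1, e0, List.set_cons_zero, List.set_cons_succ, List.getD_cons_zero, zero_add,
    List.getD_cons_succ, List.length_cons, List.length_nil, List.cons_append, List.nil_append,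
    List.replicate_zero, List.replicate_succ, Nat.reduceAdd, Nat.sub_zero, Nat.sub_self]
    at h1 h2 h3 h4 h5 h6 h7
  rw [rs_pad _ 6, rs_pad [encode _] 6, hy]
  refine (h1.seqs_cons (h2.seqs_cons (h3.seqs_cons (h4.seqs_cons (h5.seqs_cons (h6.seqs_cons
    (h7.seqs_cons (.seqs_nil _)))))))).mono ?_
  have hn := hA w a n n le_rfl
  rw [hB] at hn
  dsimp only
  rw [hy, hB, hD]
  have b3 : y + B + 1 ≤ D := by
    rw [← hD]
    nlinarith [Nat.zero_le y, Nat.zero_le B]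
  have b4 : (y + 1) ^ 2 ≤ D := by
    rw [← hD]
    refine Nat.pow_le_pow_left ?_ 2
    nlinarith [Nat.zero_le y, Nat.zero_le B]
  have b5 : n * (T w (a, n) + 200 * D + 1) = n * (T w (a, n) + 1) + 200 * (n * D) := by ring
  have b6 : 1000 * (n + 1) * D = 1000 * (n * D) + 1000 * D := by ring
  rw [b5, b6]
  omega

end
end Accordion

namespace Accordion
open Encodable

section
variable {α β γ δ : Type} [Encodable α] [Encodable β] [Encodable γ] [Encodable δ]

/-! ### Writing output -/


theorem Emits.nil : Emits (fun b => .clear (b + 0)) (fun _ (_ : α) => [])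
    fun _ a => 2 * encode a + 1 := by
  intro w b v out a
  simpa using rs_clear (w := w) (b := b) (v := v) (out := out) (l := [encode a]) 0 (by simp)


theorem Emits.bit {P : ℕ → Prog} {f : Word → α → Bool} {t : Word → α → ℕ} (hf : Runs P f t) :
    Emits (fun b => .seq (P b) (.ifPos (b + 0) (.emit true) (.emit false)))
      (fun w a => [f w a]) fun w a => t w a + 2 := by
  intro w b v out a
  refine (hf w b v out a).seq ?_
  have h (x : Bool) : ExecLE (.emit x) (RS w b v out [0]) 1 (RS w b v (x :: out) [0]) :=
    .emit x (RS w b v out [0])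
  dsimp only
  rcases f w a with _ | _
  · exact rs_ifPos_zero (l := [0]) 0 rfl (h false)
  · exact rs_ifPos_succ (l := [1]) 0 (by simp) (n := 0) rfl (h true)

/-- The output is a stack, so the second string has to be written before the first. -/
theorem Emits.append {P Q : ℕ → Prog} {f g : Word → α → List Bool} {t t' : Word → α → ℕ}
    (hf : Emits P f t) (hg : Emits Q g t') :
    Emits (fun b => .seqs [.copy (b + 0) (b + 1) (b + 2), Q (b + 1), P (b + 0)])
      (fun w a => f w a ++ g w a) fun w a => t w a + t' w a + (5 * encode a + 3) := by
  intro w b v out a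
  obtain ⟨x, hx⟩ : ∃ x, encode a = x := ⟨_, rfl⟩
  have h1 := rs_copy (w := w) (b := b) (v := v) (out := out) (l := [x, 0, 0]) 0 1 2
    (by simp) (by simp) (by simp) (by simp) rfl
  have h2 := hg.at w b v out [x] a 1
  have h3 := hf.at w b v (g w a ++ out) [] a 2
  simp only [hx, List.set_cons_zero, List.set_cons_succ, List.getD_cons_zero, zero_add,
    List.getD_cons_succ, List.length_cons, List.length_nil, List.cons_append, List.nil_append]
    at h1 h2 h3
  rw [rs_pad _ 2, rs_pad [0] 2, hx, List.append_assoc]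
  refine (h1.seqs_cons (h2.seqs_cons (h3.seqs_cons (.seqs_nil _)))).mono ?_
  dsimp only
  omega

theorem Emits.cond {C P Q : ℕ → Prog} {c : Word → α → Bool} {f g : Word → α → List Bool}
    {t t₁ t₂ : Word → α → ℕ} (hc : Runs C c t) (hf : Emits P f t₁) (hg : Emits Q g t₂) :
    Emits (fun b => .seqs [.copy (b + 0) (b + 1) (b + 2), C (b + 1),
        .ifPos (b + 1) (P (b + 0)) (Q (b + 0))])
      (fun w a => bif c w a then f w a else g w a)
      fun w a => t w a + t₁ w a + t₂ w a + (5 * encode a + 4) := by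
  intro w b v out a
  obtain ⟨x, hx⟩ : ∃ x, encode a = x := ⟨_, rfl⟩
  have h1 := rs_copy (w := w) (b := b) (v := v) (out := out) (l := [x, 0, 0]) 0 1 2
    (by simp) (by simp) (by simp) (by simp) rfl
  have h2 := hc.at w b v out [x] a 1
  have h3 := hf.at w b v out [] a 2
  have h4 := hg.at w b v out [] a 2
  simp only [hx, List.set_cons_zero, List.set_cons_succ, List.getD_cons_zero, zero_add,
    List.getD_cons_succ, List.length_cons, List.length_nil, List.cons_append, List.nil_append]
    at h1 h2 h3 h4
  rw [rs_pad _ 2, rs_pad [0] 2, hx]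
  dsimp only
  rcases hcw : c w a with _ | _
  · rw [hcw] at h2
    refine (h1.seqs_cons (h2.seqs_cons (ExecLE.seqs_cons (rs_ifPos_zero (p := P (b + 0)) 1 rfl h4)
      (.seqs_nil _)))).mono ?_
    omega
  · rw [hcw] at h2
    refine (h1.seqs_cons (h2.seqs_cons (ExecLE.seqs_cons (rs_ifPos_succ (q := Q (b + 0)) 1
      (by simp) (n := 0) rfl h3) (.seqs_nil _)))).mono ?_
    omega

theorem Emits.flatMap {P Q : ℕ → Prog} {h : Word → α → ℕ} {f : Word → α × ℕ → List Bool}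
    {t : Word → α → ℕ} {t' : Word → α × ℕ → ℕ} (hh : Runs P h t) (hf : Emits Q f t')
    (T : Word → α → ℕ) (hT : ∀ w a, ∀ i < h w a, t' w (a, i) ≤ T w a) :
    Emits (fun b => .seqs [.copy (b + 0) (b + 1) (b + 2), P (b + 1),
        .repeatNum (b + 1) (.seqs [.copy (b + 0) (b + 2) (b + 4), .copy (b + 1) (b + 3) (b + 4),
          .pair (b + 2), Q (b + 2)]), .clear (b + 0)])
      (fun w a => (List.range (h w a)).flatMap fun i => f w (a, i))
      fun w a => t w a + h w a * T w a +
        100 * (h w a + 1) * (encode a + h w a + 1) ^ 2 := by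
  intro w b v out a
  obtain ⟨x, hx⟩ : ∃ x, encode a = x := ⟨_, rfl⟩
  obtain ⟨n, hn⟩ : ∃ n, h w a = n := ⟨_, rfl⟩
  have h1 := rs_copy (w := w) (b := b) (v := v) (out := out) (l := [x, 0, 0, 0, 0]) 0 1 2
    (by simp) (by simp) (by simp) (by simp) rfl
  have h2 := hh.at w b v out [x] a 3
  -- When `k` iterations remain, the strings for the indices from `k` on are on the output stack. As
  -- the counter decreases before the body runs, its value is the index of the next string to be
  -- written.
  have h3 := rs_repeat (w := w) (b := b) (v := v) 1 (c := n)
    (T := T w a + 75 * (x + n + 1) ^ 2)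
    (p := .seqs [.copy (b + 0) (b + 2) (b + 4), .copy (b + 1) (b + 3) (b + 4),
          .pair (b + 2), Q (b + 2)])
    (fun k => [x, k, 0, 0, 0])
    (fun k => (((List.range n).drop k).flatMap fun i => f w (a, i)) ++ out) (by simp)
    (by simp) (fun k hk => by
      have e : (List.range n).drop k = k :: (List.range n).drop (k + 1) := by
        rw [List.drop_eq_getElem_cons (by simpa using hk), List.getElem_range]
      rw [e, List.flatMap_cons, List.append_assoc]
      generalize ((List.range n).drop (k + 1)).flatMap (fun i => f w (a, i)) ++ out = out'
      have k1 := rs_copy (w := w) (b := b) (v := v) (out := out') (l := [x, k, 0, 0, 0]) 0 2 4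
        (by simp) (by simp) (by simp) (by simp) rfl
      have k2 := rs_copy (w := w) (b := b) (v := v) (out := out') (l := [x, k, x, 0, 0]) 1 3 4
        (by simp) (by simp) (by simp) (by simp) rfl
      have k3 := exec_pair_at w b v out' [x, k] x k 1
      have k4 := hf.at w b v out' [x, k] (a, k) 2
      have e : encode (a, k) = Nat.pair x k := by
        rw [Encodable.encode_prod_val, hx, Encodable.encode_nat]
      simp only [List.set_cons_zero, List.set_cons_succ, List.getD_cons_zero, zero_add, e,
        List.getD_cons_succ, List.length_cons, List.length_nil, List.cons_append, List.nil_append,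
        List.replicate_zero, List.replicate_succ, Nat.reduceAdd] at k1 k2 k3 k4 ⊢
      refine (k1.seqs_cons (k2.seqs_cons (k3.seqs_cons (k4.seqs_cons (.seqs_nil _))))).mono ?_
      have := hT w a k (by omega)
      have b1 : (x + k + 1) ^ 2 ≤ (x + n + 1) ^ 2 := Nat.pow_le_pow_left (by omega) 2
      have b2 : x + n + 1 ≤ (x + n + 1) ^ 2 := Nat.le_self_pow (by omega) _
      omega)
  have h4 := rs_clear (w := w) (b := b) (v := v)
    (out := ((List.range n).flatMap fun i => f w (a, i)) ++ out) (l := [x, 0, 0, 0, 0]) 0 (by simp)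
  have e : (List.range n).drop n = [] := List.drop_eq_nil_of_le (by simp)
  simp only [hx, hn, e, List.flatMap_nil, List.nil_append, List.drop_zero, Encodable.encode_nat,
    List.set_cons_zero, List.set_cons_succ, List.getD_cons_zero, zero_add,
    List.getD_cons_succ, List.length_cons, List.length_nil, List.cons_append,
    List.replicate_zero, List.replicate_succ, Nat.reduceAdd] at h1 h2 h3 h4
  rw [rs_pad _ 4, rs_pad [0] 4, hx]
  dsimp only
  rw [hn, hx]
  refine (h1.seqs_cons (h2.seqs_cons (h3.seqs_cons (h4.seqs_cons (.seqs_nil _))))).mono ?_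
  have b2 : x + n + 1 ≤ (x + n + 1) ^ 2 := Nat.le_self_pow (by omega) _
  generalize (x + n + 1) ^ 2 = D at *
  have e1 : n * (T w a + 75 * D + 1) = n * T w a + 75 * (n * D) + n := by ring
  have e2 : 100 * (n + 1) * D = 100 * (n * D) + 100 * D := by ring
  rw [e1, e2]
  generalize n * T w a = E
  generalize n * D = G
  omega

/-! ### Polynomial time -/

/-- Polynomially bounded. -/
def PolyBdd (t : Word → α → ℕ) : Prop := ∃ c, ∀ w a, t w a ≤ (encode a + w.length + 2) ^ c

theorem PolyBdd.mono {t t' : Word → α → ℕ} (h : PolyBdd t') (ht : ∀ w a, t w a ≤ t' w a) :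
    PolyBdd t :=
  let ⟨c, hc⟩ := h
  ⟨c, fun w a => (ht w a).trans (hc w a)⟩

theorem PolyBdd.const (n : ℕ) : PolyBdd fun _ (_ : α) => n :=
  ⟨n, fun _ _ => (Nat.lt_two_pow_self).le.trans (Nat.pow_le_pow_left (by omega) n)⟩

theorem PolyBdd.add {t t' : Word → α → ℕ} (h : PolyBdd t) (h' : PolyBdd t') :
    PolyBdd fun w a => t w a + t' w a := by
  obtain ⟨c, hc⟩ := h
  obtain ⟨c', hc'⟩ := h'
  refine ⟨c + c' + 1, fun w a => ?_⟩
  have h1 := (hc w a).trans (Nat.pow_le_pow_right (by omega) (Nat.le_add_right c c'))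
  have h2 := (hc' w a).trans (Nat.pow_le_pow_right (by omega) (Nat.le_add_left c' c))
  rw [pow_succ]
  nlinarith [Nat.zero_le (encode a + w.length)]

theorem PolyBdd.mul {t t' : Word → α → ℕ} (h : PolyBdd t) (h' : PolyBdd t') :
    PolyBdd fun w a => t w a * t' w a := by
  obtain ⟨c, hc⟩ := h
  obtain ⟨c', hc'⟩ := h'
  exact ⟨c + c', fun w a => by rw [pow_add]; exact Nat.mul_le_mul (hc w a) (hc' w a)⟩

theorem PolyBdd.pow {t : Word → α → ℕ} (h : PolyBdd t) (n : ℕ) : PolyBdd fun w a => t w a ^ n := by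
  obtain ⟨c, hc⟩ := h
  exact ⟨c * n, fun w a => by rw [pow_mul]; exact Nat.pow_le_pow_left (hc w a) n⟩

theorem PolyBdd.enc : PolyBdd fun _ (a : α) => encode a := ⟨1, fun w a => by rw [pow_one]; dsimp only; omega⟩

theorem PolyBdd.len : PolyBdd fun w (_ : α) => w.length := ⟨1, fun w a => by rw [pow_one]; dsimp only; omega⟩

theorem PolyBdd.comp {t : Word → β → ℕ} {f : Word → α → β} (h : PolyBdd t)
    (hf : PolyBdd fun w a => encode (f w a)) : PolyBdd fun w a => t w (f w a) := by
  obtain ⟨c, hc⟩ := h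
  exact ((hf.add .len).add (.const 2)).pow c |>.mono fun w a => hc w (f w a)

theorem encode_pair_le (a : α) (b : β) : encode (a, b) ≤ (encode a + encode b + 1) ^ 2 := by
  rw [Encodable.encode_prod_val]
  refine (Nat.pair_lt_max_add_one_sq _ _).le.trans (Nat.pow_le_pow_left ?_ 2)
  have := max_le_add_of_nonneg (zero_le : 0 ≤ encode a) (zero_le : 0 ≤ encode b)
  omega

theorem PolyBdd.pair {f : Word → α → β} {g : Word → α → γ} (hf : PolyBdd fun w a => encode (f w a))
    (hg : PolyBdd fun w a => encode (g w a)) : PolyBdd fun w a => encode (f w a, g w a) :=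
  (((hf.add hg).add (.const 1)).pow 2).mono fun _ _ => encode_pair_le _ _

/-- Computable in polynomial time (for unary codes). -/
def Poly (f : Word → α → β) : Prop :=
  ∃ P t, Runs P f t ∧ PolyBdd t ∧ PolyBdd fun w a => encode (f w a)

/-- Strings which can be written in polynomial time. -/
def PolyEmits (f : Word → α → List Bool) : Prop := ∃ P t, Emits P f t ∧ PolyBdd t

namespace Poly

theorem of_eq {f g : Word → α → β} (hf : Poly f) (h : ∀ w a, f w a = g w a) : Poly g :=
  (funext fun w => funext fun a => h w a : f = g) ▸ hf

theorem of_encode {f : Word → α → β} (hf : Poly f) {g : Word → γ → δ} (e : γ → α)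
    (he : ∀ a, encode (e a) = encode a) (hg : ∀ w a, encode (f w (e a)) = encode (g w a)) :
    Poly g := by
  obtain ⟨P, t, h, ⟨c, hc⟩, ⟨c', hc'⟩⟩ := hf
  refine ⟨P, _, h.of_encode e he hg, ⟨c, fun w a => ?_⟩, ⟨c', fun w a => ?_⟩⟩
  · rw [← he]
    exact hc _ _
  · show encode (g w a) ≤ _
    rw [← he, ← hg]
    exact hc' _ _

theorem id : Poly fun _ (a : α) => a := ⟨_, _, .id, .const 1, .enc⟩

theorem comp {g : Word → β → γ} {f : Word → α → β} (hg : Poly g) (hf : Poly f) :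
    Poly fun w a => g w (f w a) := by
  obtain ⟨P, t, h, ht, hv⟩ := hf
  obtain ⟨Q, t', h', ht', hv'⟩ := hg
  exact ⟨_, _, h'.comp h, ht.add (ht'.comp hv), hv'.comp hv⟩

theorem const (x : β) : Poly fun _ (_ : α) => x :=
  ⟨_, _, .const x, (((PolyBdd.const 2).mul .enc).add (.const _)).add (.const 2), .const _⟩

theorem fst' : Poly fun _ (p : α × β) => p.1 := by
  refine ⟨_, _, .fst, (PolyBdd.const 300).mul ((PolyBdd.enc.add (.const 1)).pow 2),
    PolyBdd.enc.mono fun _ p => ?_⟩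
  rw [Encodable.encode_prod_val]
  exact Nat.left_le_pair _ _

theorem snd' : Poly fun _ (p : α × β) => p.2 := by
  refine ⟨_, _, .snd, (PolyBdd.const 300).mul ((PolyBdd.enc.add (.const 1)).pow 2),
    PolyBdd.enc.mono fun _ p => ?_⟩
  rw [Encodable.encode_prod_val]
  exact Nat.right_le_pair _ _

theorem fst {f : Word → α → β × γ} (hf : Poly f) : Poly fun w a => (f w a).1 := fst'.comp hf

theorem snd {f : Word → α → β × γ} (hf : Poly f) : Poly fun w a => (f w a).2 := snd'.comp hf

theorem pair {f : Word → α → β} {g : Word → α → γ} (hf : Poly f) (hg : Poly g) :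
    Poly fun w a => (f w a, g w a) := by
  obtain ⟨P, t, h, ht, hv⟩ := hf
  obtain ⟨Q, t', h', ht', hv'⟩ := hg
  exact ⟨_, _, h.pair h', (ht.add ht').add ((PolyBdd.const 100).mul
    ((((PolyBdd.enc.add hv).add hv').add (.const 1)).pow 2)), hv.pair hv'⟩

theorem succ {f : Word → α → ℕ} (hf : Poly f) : Poly fun w a => f w a + 1 :=
  comp (g := fun _ n => n + 1) ⟨_, _, .succ, .const 1, PolyBdd.enc.add (.const 1)⟩ hf

theorem sym {f : Word → α → ℕ} (hf : Poly f) : Poly fun w a => symCode w[f w a]? :=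
  comp (g := fun w n => symCode w[n]?) ⟨_, _, .sym,
    ((PolyBdd.const 10).mul .enc).add (.const 20), (PolyBdd.const 3).mono fun w a => by
      show symCode _ ≤ 3
      rcases w[a]? with _ | _ | _ | _ <;> simp [symCode]⟩ hf

theorem len : Poly fun w (_ : α) => w.length :=
  ⟨_, _, .len, (((PolyBdd.const 2).mul .enc).add ((PolyBdd.const 10).mul .len)).add (.const 20),
    .len⟩

theorem valBdd {f : Word → α → β} (hf : Poly f) : PolyBdd fun w a => encode (f w a) :=
  let ⟨_, _, _, _, h⟩ := hf
  h

/-- Recursion with polynomially bounded values. -/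
theorem iter (val : Word → α → ℕ → β) {h : Word → α → ℕ} {g : Word → α × (ℕ × β) → β}
    (hh : Poly h) (h0 : Poly fun w a => val w a 0) (hg : Poly g)
    (hs : ∀ w a i, val w a (i + 1) = g w (a, (i, val w a i)))
    (hb : ∃ B : Word → α → ℕ, PolyBdd B ∧ ∀ w a, ∀ i ≤ h w a, encode (val w a i) ≤ B w a) :
    Poly fun w a => val w a (h w a) := by
  obtain ⟨P, t, h0, ht, hv⟩ := h0
  obtain ⟨Q, t', hg, ht', hv'⟩ := hg
  obtain ⟨P', t'', hp, hpt, hpv⟩ := id.pair hh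
  obtain ⟨B, hB, hb⟩ := hb
  have hval : ∀ w a i, recVal (fun w a => val w a 0) g w a i = val w a i := by
    intro w a i
    induction i with
    | zero => rfl
    | succ i ih => rw [hs, ← ih]; rfl
  -- The bounds are the exact maxima along the recursion. They need to be polynomial only for
  -- recursions of length `h w a`, where `hb` applies.
  have hr := Runs.prec h0 hg
    (fun w p => (Finset.range (p.2 + 1)).sup fun i => encode (val w p.1 i))
    (fun w p => (Finset.range p.2).sup fun i => t' w (p.1, (i, val w p.1 i)))
    (fun w a n i hi => by
      rw [hval]
      exact Finset.le_sup (f := fun i => encode (val w a i)) (by simpa using Nat.lt_succ_of_le hi))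
    (fun w a n i hi => by
      rw [hval]
      exact Finset.le_sup (f := fun i => t' w (a, (i, val w a i))) (by simpa using hi))
  simp only [hval] at hr
  refine ⟨_, _, hr.comp hp, ?_, hB.mono fun w a => hb w a _ le_rfl⟩
  have hA : PolyBdd fun w a => (Finset.range (h w a + 1)).sup fun i => encode (val w a i) :=
    hB.mono fun w a => Finset.sup_le fun i hi => hb w a i (by
      rw [Finset.mem_range] at hi
      omega)
  have hT : PolyBdd fun w a => (Finset.range (h w a)).sup fun i => t' w (a, (i, val w a i)) := by
    obtain ⟨c, hc⟩ := ht'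
    refine PolyBdd.mono (t' := fun w a => (((encode a + ((h w a + B w a) + 1) ^ 2) + 1) ^ 2 +
      w.length + 2) ^ c) ?_ fun w a => Finset.sup_le fun i hi => (hc w _).trans ?_
    · exact ((((PolyBdd.enc.add (((hh.valBdd.add hB).add (.const 1)).pow 2)).add (.const 1)).pow
        2).add .len).add (.const 2) |>.pow c
    · rw [Finset.mem_range] at hi
      refine Nat.pow_le_pow_left ?_ c
      have h1 := encode_pair_le a (i, val w a i)
      have h2 := encode_pair_le i (val w a i)
      have h3 : (encode i + encode (val w a i) + 1) ^ 2 ≤ ((h w a + B w a) + 1) ^ 2 := by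
        refine Nat.pow_le_pow_left ?_ 2
        have := hb w a i hi.le
        rw [Encodable.encode_nat]
        omega
      have h4 : (encode a + encode (i, val w a i) + 1) ^ 2 ≤
          ((encode a + ((h w a + B w a) + 1) ^ 2) + 1) ^ 2 := Nat.pow_le_pow_left (by omega) 2
      omega
  exact hpt.add ((ht.add (hh.valBdd.mul (hT.add (.const 1)))).add
    (((PolyBdd.const 1000).mul (hh.valBdd.add (.const 1))).mul
      (((hpv.add (((hpv.add hA).add (.const 1)).pow 2)).add (.const 1)).pow 2)))

end Poly
end
end Accordion

namespace Accordion
open Encodable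

/-! ### Closure of polynomial time under arithmetic, bounded quantifiers and list operations. -/

section
variable {α β γ δ : Type} [Encodable α] [Encodable β] [Encodable γ] [Encodable δ]

namespace Poly

theorem add {f g : Word → α → ℕ} (hf : Poly f) (hg : Poly g) : Poly fun w a => f w a + g w a :=
  iter (fun w a i => f w a + i) (g := fun _ p => p.2.2 + 1) hg hf id.snd.snd.succ
    (fun _ _ _ => rfl) ⟨_, hf.valBdd.add hg.valBdd, fun w a i hi => Nat.add_le_add_left hi _⟩

theorem mul {f g : Word → α → ℕ} (hf : Poly f) (hg : Poly g) : Poly fun w a => f w a * g w a :=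
  iter (fun w a i => f w a * i) (g := fun w p => p.2.2 + f w p.1) hg (const 0)
    (id.snd.snd.add (hf.comp id.fst)) (fun _ _ _ => rfl)
    ⟨_, hf.valBdd.mul hg.valBdd, fun w a i hi => Nat.mul_le_mul_left _ hi⟩

theorem pred {f : Word → α → ℕ} (hf : Poly f) : Poly fun w a => f w a - 1 :=
  iter (fun _ _ i => i - 1) (g := fun _ p => p.2.1) hf (const 0) id.snd.fst
    (fun _ _ _ => rfl) ⟨_, hf.valBdd, fun w a i hi => (Nat.sub_le i 1).trans hi⟩

theorem sub {f g : Word → α → ℕ} (hf : Poly f) (hg : Poly g) : Poly fun w a => f w a - g w a :=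
  iter (fun w a i => f w a - i) (g := fun _ p => p.2.2 - 1) hg hf id.snd.snd.pred
    (fun _ _ _ => rfl) ⟨_, hf.valBdd, fun w a i _ => Nat.sub_le _ _⟩

/-- A recursion whose length is the code of the condition, that is 0 or 1: it starts with the value
for `false` and replaces it at most once. -/
theorem cond {c : Word → α → Bool} {f g : Word → α → β} (hc : Poly c) (hf : Poly f) (hg : Poly g) :
    Poly fun w a => bif c w a then f w a else g w a := by
  have h : Poly fun w a => encode (c w a) := hc.of_encode (fun a => a) (fun _ => rfl) fun _ _ => rfl
  refine (iter (fun w a i => if i = 0 then g w a else f w a) (g := fun w p => f w p.1) h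
    (by simpa using hg) (hf.comp id.fst) (fun _ _ _ => by simp)
    ⟨_, hf.valBdd.add hg.valBdd, fun w a i _ => ?_⟩).of_eq fun w a => ?_
  · split_ifs <;> omega
  · rcases c w a <;> simp

theorem ofNat {c : Word → α → Bool} {f : Word → α → ℕ} (hf : Poly f)
    (h : ∀ w a, f w a = if c w a then 1 else 0) : Poly c :=
  hf.of_encode (fun a => a) (fun _ => rfl) fun w a => by
    rw [h]
    rcases c w a <;> rfl

theorem toNat {c : Word → α → Bool} (hc : Poly c) : Poly fun w a => if c w a then 1 else 0 :=
  (hc.cond (const 1) (const 0)).of_eq fun w a => by rcases c w a <;> rfl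

theorem not {c : Word → α → Bool} (hc : Poly c) : Poly fun w a => !c w a :=
  (hc.cond (const false) (const true)).of_eq fun w a => by rcases c w a <;> rfl

theorem and {c d : Word → α → Bool} (hc : Poly c) (hd : Poly d) : Poly fun w a => c w a && d w a :=
  (hc.cond hd (const false)).of_eq fun w a => by rcases c w a <;> rfl


theorem xor {c d : Word → α → Bool} (hc : Poly c) (hd : Poly d) : Poly fun w a => c w a ^^ d w a :=
  (hc.cond hd.not hd).of_eq fun w a => by rcases c w a <;> rcases d w a <;> rfl

theorem le {f g : Word → α → ℕ} (hf : Poly f) (hg : Poly g) : Poly fun w a => decide (f w a ≤ g w a) :=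
  ofNat ((const 1).sub (hf.sub hg)) fun w a => by
    simp only [decide_eq_true_eq]
    split_ifs <;> omega

theorem lt {f g : Word → α → ℕ} (hf : Poly f) (hg : Poly g) : Poly fun w a => decide (f w a < g w a) :=
  (hf.succ.le hg).of_eq fun _ _ => rfl

theorem eq {f g : Word → α → ℕ} (hf : Poly f) (hg : Poly g) : Poly fun w a => decide (f w a = g w a) :=
  ((hf.le hg).and (hg.le hf)).of_eq fun w a => by
    rw [Bool.eq_iff_iff]
    simp only [Bool.and_eq_true, decide_eq_true_eq]
    omega


theorem min {f g : Word → α → ℕ} (hf : Poly f) (hg : Poly g) : Poly fun w a => min (f w a) (g w a) :=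
  (hf.sub (hf.sub hg)).of_eq fun w a => by omega

/-- Bounded sums. -/
theorem sum {h : Word → α → ℕ} {f : Word → α × ℕ → ℕ} (hh : Poly h) (hf : Poly f) :
    Poly fun w a => ∑ i ∈ Finset.range (h w a), f w (a, i) := by
  refine iter (fun w a n => ∑ i ∈ Finset.range n, f w (a, i))
    (g := fun w p => p.2.2 + f w (p.1, p.2.1)) hh ((const 0).of_eq fun _ _ => by simp)
    (id.snd.snd.add (hf.comp (id.fst.pair id.snd.fst)))
    (fun w a n => Finset.sum_range_succ _ _) ?_
  obtain ⟨c, hc⟩ := hf.valBdd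
  refine ⟨fun w a => h w a * ((encode a + h w a + 1) ^ 2 + w.length + 2) ^ c,
    hh.valBdd.mul ((((((PolyBdd.enc.add hh.valBdd).add (.const 1)).pow 2).add .len).add
      (.const 2)).pow c), fun w a n hn => ?_⟩
  rw [Encodable.encode_nat]
  have : ∀ i ∈ Finset.range n, f w (a, i) ≤ ((encode a + h w a + 1) ^ 2 + w.length + 2) ^ c := by
    intro i hi
    rw [Finset.mem_range] at hi
    refine (hc w (a, i)).trans (Nat.pow_le_pow_left ?_ c)
    have h1 := encode_pair_le a i
    have h2 : (encode a + encode i + 1) ^ 2 ≤ (encode a + h w a + 1) ^ 2 := by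
      refine Nat.pow_le_pow_left ?_ 2
      rw [Encodable.encode_nat]
      omega
    omega
  refine (Finset.sum_le_card_nsmul _ _ _ this).trans ?_
  rw [Finset.card_range, smul_eq_mul]
  exact Nat.mul_le_mul_right _ hn

/-- The predicate holds throughout if the number of failures is zero. -/
theorem all {h : Word → α → ℕ} {p : Word → α × ℕ → Bool} (hh : Poly h) (hp : Poly p) :
    Poly fun w a => decide (∀ i < h w a, p w (a, i) = true) :=
  ((sum hh hp.not.toNat).eq (const 0)).of_eq fun w a => by
    rw [Bool.eq_iff_iff]
    simp [Finset.sum_eq_zero_iff]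

theorem any {h : Word → α → ℕ} {p : Word → α × ℕ → Bool} (hh : Poly h) (hp : Poly p) :
    Poly fun w a => decide (∃ i < h w a, p w (a, i) = true) :=
  (all hh hp.not).not.of_eq fun w a => by
    rw [Bool.eq_iff_iff]
    simp

/-- Counting the indices below a threshold returns the threshold. Quotients, lengths of lists, the
length of the prefix and the lengths of runs in the input are all found in this way. -/
theorem sum_range_ite_lt (n m : ℕ) (p : ℕ → Bool) (h : ∀ i, p i = true ↔ i < m) (hm : m ≤ n) :
    ∑ i ∈ Finset.range n, (if p i = true then 1 else 0) = m := by
  simp only [h, Finset.sum_ite, Finset.sum_const_zero, Finset.sum_const, smul_eq_mul, mul_one,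
    add_zero]
  have e : (Finset.range n).filter (fun i => i < m) = Finset.range m := by
    ext i
    simp only [Finset.mem_filter, Finset.mem_range]
    omega
  rw [e, Finset.card_range]

/-- The quotient is the number of i with (i + 1) g ≤ f; the condition 1 ≤ g makes it 0 when the
divisor is 0. -/
theorem div {f g : Word → α → ℕ} (hf : Poly f) (hg : Poly g) : Poly fun w a => f w a / g w a := by
  have h := sum hf (((const 1).le (hg.comp id.fst)).and
    ((id.snd.succ.mul (hg.comp id.fst)).le (hf.comp id.fst))).toNat
  refine h.of_eq fun w a => sum_range_ite_lt _ _ _ (fun i => ?_) (Nat.div_le_self _ _)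
  rcases Nat.eq_zero_or_pos (g w a) with h0 | hd
  · simp [h0]
  · rw [Nat.lt_iff_add_one_le, Nat.le_div_iff_mul_le hd]
    simp
    omega

theorem mod {f g : Word → α → ℕ} (hf : Poly f) (hg : Poly g) : Poly fun w a => f w a % g w a :=
  (hf.sub (hg.mul (hf.div hg))).of_eq fun w a => (Nat.mod_eq_sub _ _).symm

/-- Powers with bounded exponents. -/
theorem pow {f g : Word → α → ℕ} (hf : Poly f) (hg : Poly g) (k : ℕ) (hk : ∀ w a, g w a ≤ k) :
    Poly fun w a => f w a ^ g w a := by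
  refine iter (fun w a n => f w a ^ n) (g := fun w p => p.2.2 * f w p.1) hg
    ((const 1).of_eq fun _ _ => by simp) (id.snd.snd.mul (hf.comp id.fst))
    (fun w a n => pow_succ _ _) ⟨_, (hf.valBdd.add (.const 1)).pow k, fun w a n hn => ?_⟩
  exact (Nat.pow_le_pow_left (Nat.le_succ _) n).trans
    (Nat.pow_le_pow_right (Nat.succ_pos _) (hn.trans (hk w a)))

/-! Lists -/

theorem cons {f : Word → α → β} {g : Word → α → List β} (hf : Poly f) (hg : Poly g) :
    Poly fun w a => f w a :: g w a := by
  have h : Poly fun w a => encode (f w a, g w a) + 1 :=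
    ((hf.pair hg).of_encode (g := fun w a => encode (f w a, g w a)) (fun a => a) (fun _ => rfl)
      fun _ _ => rfl).succ
  exact h.of_encode (fun a => a) (fun _ => rfl) fun w a => by
    rw [Encodable.encode_list_cons, Encodable.encode_prod_val]
    rfl

theorem isEmpty {f : Word → α → List β} (hf : Poly f) : Poly fun w a => (f w a).isEmpty := by
  have h : Poly fun w a => encode (f w a) := hf.of_encode (fun a => a) (fun _ => rfl) fun _ _ => rfl
  refine (h.eq (const 0)).of_eq fun w a => ?_
  rcases f w a with _ | ⟨x, l⟩
  · rfl
  · simp [Encodable.encode_list_cons]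

/-- The code of a non-empty list is one more than the pair of the codes of head and tail. For the
empty list, with code 0, predecessor and unpairing return 0 again. -/
theorem tail {f : Word → α → List β} (hf : Poly f) : Poly fun w a => (f w a).tail := by
  have h : Poly fun w a => encode (f w a) - 1 :=
    (hf.of_encode (g := fun w a => encode (f w a)) (fun a => a) (fun _ => rfl) fun _ _ => rfl).pred
  have h2 : Poly fun (_ : Word) (n : ℕ) => n.unpair.2 :=
    (snd' (α := ℕ) (β := ℕ)).of_encode Nat.unpair (fun a => by
      rw [Encodable.encode_prod_val]
      exact Nat.pair_unpair a) fun _ _ => rfl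
  exact (h2.comp h).of_encode (fun a => a) (fun _ => rfl) fun w a => by
    rcases f w a with _ | ⟨x, l⟩
    · rfl
    · simp [Encodable.encode_list_cons]

/-- On the empty list the program returns 0, so the default must be the value with code 0. -/
theorem headD {f : Word → α → List β} (hf : Poly f) (d : β) (hd : encode d = 0) :
    Poly fun w a => (f w a).headD d := by
  have h : Poly fun w a => encode (f w a) - 1 :=
    (hf.of_encode (g := fun w a => encode (f w a)) (fun a => a) (fun _ => rfl) fun _ _ => rfl).pred
  have h2 : Poly fun (_ : Word) (n : ℕ) => n.unpair.1 :=
    (fst' (α := ℕ) (β := ℕ)).of_encode Nat.unpair (fun a => by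
      rw [Encodable.encode_prod_val]
      exact Nat.pair_unpair a) fun _ _ => rfl
  exact (h2.comp h).of_encode (fun a => a) (fun _ => rfl) fun w a => by
    rcases f w a with _ | ⟨x, l⟩
    · simp [hd]
    · simp [Encodable.encode_list_cons]

theorem encode_tail_le (l : List β) : encode l.tail ≤ encode l := by
  rcases l with _ | ⟨x, l⟩
  · exact le_rfl
  · rw [List.tail_cons, Encodable.encode_list_cons]
    exact (Nat.right_le_pair _ _).trans (Nat.le_succ _)

theorem encode_drop_le (l : List β) (i : ℕ) : encode (l.drop i) ≤ encode l := by
  induction i with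
  | zero => simp
  | succ i ih =>
    rw [← List.tail_drop]
    exact (encode_tail_le _).trans ih

theorem drop {f : Word → α → List β} {g : Word → α → ℕ} (hf : Poly f) (hg : Poly g) :
    Poly fun w a => (f w a).drop (g w a) :=
  iter (fun w a i => (f w a).drop i) (g := fun _ p => p.2.2.tail) hg (hf.of_eq fun _ _ => by simp)
    id.snd.snd.tail (fun w a i => by rw [List.tail_drop])
    ⟨_, hf.valBdd, fun w a i _ => encode_drop_le _ _⟩

theorem getD {f : Word → α → List β} {g : Word → α → ℕ} (hf : Poly f) (hg : Poly g) (d : β)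
    (hd : encode d = 0) : Poly fun w a => (f w a).getD (g w a) d :=
  ((hf.drop hg).headD d hd).of_eq fun w a => by
    rw [List.headD_eq_head?_getD, List.head?_drop, List.getD_eq_getElem?_getD]

/-- The number of non-empty suffixes; the length is at most the code, which bounds the range of the
count. -/
theorem length {f : Word → α → List β} (hf : Poly f) : Poly fun w a => (f w a).length := by
  have h : Poly fun w a => encode (f w a) := hf.of_encode (fun a => a) (fun _ => rfl) fun _ _ => rfl
  refine (sum h ((hf.comp id.fst).drop id.snd).isEmpty.not.toNat).of_eq fun w a => ?_
  refine sum_range_ite_lt _ _ _ (fun i => ?_) (Encodable.length_le_encode _)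
  simp [List.isEmpty_iff, List.drop_eq_nil_iff]

/-- Quantification over the elements of a list. -/
theorem list_all {f : Word → α → List β} {p : Word → α × β → Bool} (hf : Poly f) (hp : Poly p) (d : β)
    (hd : encode d = 0) : Poly fun w a => (f w a).all fun x => p w (a, x) :=
  (all hf.length (hp.comp (id.fst.pair ((hf.comp id.fst).getD id.snd d hd)))).of_eq fun w a => by
    rw [Bool.eq_iff_iff]
    simp only [decide_eq_true_eq, List.all_eq_true, List.mem_iff_getElem]
    constructor
    · rintro h x ⟨i, hi, rfl⟩
      have := h i hi
      rwa [List.getD_eq_getElem _ _ hi] at this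
    · intro h i hi
      rw [List.getD_eq_getElem _ _ hi]
      exact h _ ⟨i, hi, rfl⟩

end Poly


theorem PolyEmits.nil : PolyEmits fun _ (_ : α) => [] :=
  ⟨_, _, .nil, ((PolyBdd.const 2).mul .enc).add (.const 1)⟩

theorem PolyEmits.bit {f : Word → α → Bool} (hf : Poly f) : PolyEmits fun w a => [f w a] :=
  let ⟨_, _, h, ht, _⟩ := hf
  ⟨_, _, .bit h, ht.add (.const 2)⟩


theorem PolyEmits.append {f g : Word → α → List Bool} (hf : PolyEmits f) (hg : PolyEmits g) :
    PolyEmits fun w a => f w a ++ g w a :=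
  let ⟨_, _, h, ht⟩ := hf
  let ⟨_, _, h', ht'⟩ := hg
  ⟨_, _, h.append h', (ht.add ht').add (((PolyBdd.const 5).mul .enc).add (.const 3))⟩

theorem PolyEmits.cond {c : Word → α → Bool} {f g : Word → α → List Bool} (hc : Poly c)
    (hf : PolyEmits f) (hg : PolyEmits g) : PolyEmits fun w a => bif c w a then f w a else g w a :=
  let ⟨_, _, hc, htc, _⟩ := hc
  let ⟨_, _, h, ht⟩ := hf
  let ⟨_, _, h', ht'⟩ := hg
  ⟨_, _, .cond hc h h', ((htc.add ht).add ht').add (((PolyBdd.const 5).mul .enc).add (.const 4))⟩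

theorem PolyEmits.flatMap {h : Word → α → ℕ} {f : Word → α × ℕ → List Bool} (hh : Poly h)
    (hf : PolyEmits f) : PolyEmits fun w a => (List.range (h w a)).flatMap fun i => f w (a, i) := by
  obtain ⟨P, t, hh, ht, hv⟩ := hh
  obtain ⟨Q, t', hf, c, hc⟩ := hf
  refine ⟨_, _, Emits.flatMap hh hf (fun w a => ((encode a + h w a + 1) ^ 2 + w.length + 2) ^ c)
    (fun w a i hi => (hc w _).trans (Nat.pow_le_pow_left ?_ c)), ?_⟩
  · have h1 := encode_pair_le a i
    have h2 : (encode a + encode i + 1) ^ 2 ≤ (encode a + h w a + 1) ^ 2 := by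
      refine Nat.pow_le_pow_left ?_ 2
      rw [Encodable.encode_nat]
      omega
    omega
  · have hv : PolyBdd h := hv
    have hD := ((PolyBdd.enc (α := α)).add hv).add (.const 1)
    exact (ht.add (hv.mul ((((hD.pow 2).add .len).add (.const 2)).pow c))).add
      (((PolyBdd.const 100).mul (hv.add (.const 1))).mul (hD.pow 2))

/-! ### Primitive recursive functions -/

/-- Computed by programs within a primitive recursive time bound. -/
def PrimRuns (f : ℕ → ℕ) : Prop :=
  ∃ P t T, Runs P (fun _ n => f n) t ∧ Primrec T ∧ ∀ w n, t w n ≤ T n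

/-- Induction on the derivation, with the time bound carried along as a primitive recursive
function. It is independent of the input word, which is present on its stack but not consulted. -/
theorem PrimRuns.of_primrec {f : ℕ → ℕ} (hf : Nat.Primrec f) : PrimRuns f := by
  induction hf with
  | zero => exact ⟨_, _, fun n => 2 * n + 0 + 2, .constNat 0,
      Primrec.nat_add.comp (Primrec.nat_add.comp (Primrec.nat_mul.comp (.const 2) .id) (.const 0))
        (.const 2), fun _ _ => le_rfl⟩
  | succ => exact ⟨_, _, fun _ => 1, .succ, .const 1, fun _ _ => le_rfl⟩
  | left => exact ⟨_, _, fun n => 300 * ((n + 1) * (n + 1)),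
      (Runs.fst (α := ℕ) (β := ℕ)).of_encode Nat.unpair (fun a => by
      rw [Encodable.encode_prod_val]
      exact Nat.pair_unpair a) fun _ _ => rfl,
      Primrec.nat_mul.comp (.const 300) (Primrec.nat_mul.comp .succ .succ), fun w n => by
        have e : encode n.unpair = n := by
          rw [Encodable.encode_prod_val]
          exact Nat.pair_unpair n
        simp only [e, pow_two, le_refl]⟩
  | right => exact ⟨_, _, fun n => 300 * ((n + 1) * (n + 1)),
      (Runs.snd (α := ℕ) (β := ℕ)).of_encode Nat.unpair (fun a => by
      rw [Encodable.encode_prod_val]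
      exact Nat.pair_unpair a) fun _ _ => rfl,
      Primrec.nat_mul.comp (.const 300) (Primrec.nat_mul.comp .succ .succ), fun w n => by
        have e : encode n.unpair = n := by
          rw [Encodable.encode_prod_val]
          exact Nat.pair_unpair n
        simp only [e, pow_two, le_refl]⟩
  | @pair f g pf pg hf hg =>
    obtain ⟨P, t, T, h, hT, ht⟩ := hf
    obtain ⟨Q, t', T', h', hT', ht'⟩ := hg
    have hF := Primrec.nat_iff.2 pf
    have hG := Primrec.nat_iff.2 pg
    have hS : Primrec fun n => n + f n + g n + 1 :=
      Primrec.succ.comp (Primrec.nat_add.comp (Primrec.nat_add.comp .id hF) hG)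
    refine ⟨_, _, fun n => T n + T' n + 100 * ((n + f n + g n + 1) * (n + f n + g n + 1)),
      (h.pair h').of_encode (fun a => a) (fun _ => rfl)
      (fun w a => by rw [Encodable.encode_prod_val]; rfl),
      Primrec.nat_add.comp (Primrec.nat_add.comp hT hT') (Primrec.nat_mul.comp (.const 100)
        (Primrec.nat_mul.comp hS hS)), fun w n => ?_⟩
    have := ht w n
    have := ht' w n
    simp only [Encodable.encode_nat, pow_two]
    omega
  | @comp f g pf pg hf hg =>
    obtain ⟨P, t, T, h, hT, ht⟩ := hf
    obtain ⟨Q, t', T', h', hT', ht'⟩ := hg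
    exact ⟨_, _, fun n => T' n + T (g n), h.comp h', Primrec.nat_add.comp hT'
      (hT.comp (Primrec.nat_iff.2 pg)), fun w n => Nat.add_le_add (ht' w n) (ht w _)⟩
  | @prec f g pf pg hf hg =>
    obtain ⟨P, t, T, h, hT, ht⟩ := hf
    obtain ⟨Q, t', T', h', hT', ht'⟩ := hg
    have hF := Primrec.nat_iff.2 pf
    have hG := Primrec.nat_iff.2 pg
    have h'' : Runs Q (fun _ (p : ℕ × (ℕ × ℕ)) => g (Nat.pair p.1 (Nat.pair p.2.1 p.2.2)))
        fun w p => t' w (encode p) :=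
      h'.of_encode encode (fun _ => rfl) fun w p => by
        rw [Encodable.encode_prod_val, Encodable.encode_prod_val]
        rfl
    let val : ℕ → ℕ → ℕ := fun z n =>
      Nat.rec (motive := fun _ => ℕ) (f z) (fun y IH => g (Nat.pair z (Nat.pair y IH))) n
    have hval : Primrec₂ val := by
      refine Primrec.nat_rec (g := fun z q => g (Nat.pair z (Nat.pair q.1 q.2))) hF
        (Primrec.comp hG ?_)
      exact Primrec₂.natPair.comp .fst (Primrec₂.natPair.comp (Primrec.fst.comp .snd)
        (Primrec.snd.comp .snd))
    -- Sums replace maxima over the earlier stages: they are still bounds, and they are given by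
    -- primitive recursions.
    let A : ℕ × ℕ → ℕ := fun p =>
      Nat.rec (motive := fun _ => ℕ) (val p.1 0) (fun y IH => IH + val p.1 (y + 1)) p.2
    let D : ℕ × ℕ → ℕ := fun p =>
      Nat.rec (motive := fun _ => ℕ) 0 (fun y IH => IH + T' (Nat.pair p.1 (Nat.pair y (val p.1 y)))) p.2
    have hA : Primrec A := by
      refine Primrec.nat_rec' (h := fun p q => q.2 + val p.1 (q.1 + 1)) .snd (hval.comp .fst (.const 0)) ?_
      exact Primrec.nat_add.comp (Primrec.snd.comp .snd)
        (hval.comp (Primrec.fst.comp .fst) (Primrec.succ.comp (Primrec.fst.comp .snd)))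
    have hD : Primrec D := by
      refine Primrec.nat_rec' (h := fun p q => q.2 + T' (Nat.pair p.1 (Nat.pair q.1 (val p.1 q.1))))
        .snd (.const 0) ?_
      refine Primrec.nat_add.comp (Primrec.snd.comp .snd) (hT'.comp ?_)
      exact Primrec₂.natPair.comp (Primrec.fst.comp .fst) (Primrec₂.natPair.comp
        (Primrec.fst.comp .snd) (hval.comp (Primrec.fst.comp .fst) (Primrec.fst.comp .snd)))
    have hAle : ∀ z n, ∀ i ≤ n, val z i ≤ A (z, n) := by
      intro z n
      induction n with
      | zero =>
        intro i hi
        rw [Nat.le_zero.1 hi]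
        exact le_rfl
      | succ n ih =>
        intro i hi
        rcases Nat.lt_or_ge n i with h | h
        · rw [show i = n + 1 by omega]
          exact Nat.le_add_left _ _
        · exact (ih i h).trans (Nat.le_add_right _ _)
    have hDle : ∀ z n, ∀ i < n, T' (Nat.pair z (Nat.pair i (val z i))) ≤ D (z, n) := by
      intro z n
      induction n with
      | zero =>
        intro i hi
        omega
      | succ n ih =>
        intro i hi
        rcases Nat.lt_or_ge i n with h | h
        · exact (ih i h).trans (Nat.le_add_right _ _)
        · rw [show i = n by omega]
          exact Nat.le_add_left _ _
    have hr := Runs.prec h h'' (fun _ p => A p) (fun _ p => D p) (fun w z n => hAle z n)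
      fun w z n i hi => by
        rw [Encodable.encode_prod_val, Encodable.encode_prod_val]
        exact (ht' w _).trans (hDle z n i hi)
    have hS : Primrec fun n : ℕ => n + (n + A n.unpair + 1) * (n + A n.unpair + 1) + 1 := by
      have h1 : Primrec fun n : ℕ => n + A n.unpair + 1 :=
        Primrec.succ.comp (Primrec.nat_add.comp .id (hA.comp .unpair))
      exact Primrec.succ.comp (Primrec.nat_add.comp .id (Primrec.nat_mul.comp h1 h1))
    have hN : Primrec fun n : ℕ => n.unpair.2 := Primrec.snd.comp .unpair
    refine ⟨_, _, fun n => T n.unpair.1 + n.unpair.2 * (D n.unpair + 1) +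
      1000 * (n.unpair.2 + 1) * ((n + (n + A n.unpair + 1) * (n + A n.unpair + 1) + 1) *
        (n + (n + A n.unpair + 1) * (n + A n.unpair + 1) + 1)),
      hr.of_encode Nat.unpair (fun a => by
      rw [Encodable.encode_prod_val]
      exact Nat.pair_unpair a) fun w n => rfl, ?_, fun w n => ?_⟩
    · exact Primrec.nat_add.comp (Primrec.nat_add.comp (hT.comp (Primrec.fst.comp .unpair))
        (Primrec.nat_mul.comp hN (Primrec.succ.comp (hD.comp .unpair))))
        (Primrec.nat_mul.comp (Primrec.nat_mul.comp (.const 1000) (Primrec.succ.comp hN))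
          (Primrec.nat_mul.comp hS hS))
    · have e : encode n.unpair = n := by
        rw [Encodable.encode_prod_val]
        exact Nat.pair_unpair n
      have := ht w n.unpair.1
      simp only [e, pow_two]
      omega

end
end Accordion

namespace Accordion
open Encodable

/-! ### The input word -/

/-- The number of blanks among the first `n` symbols. -/
def blanks (w : Word) (n : ℕ) : ℕ := ∑ j ∈ Finset.range n, if decide (symCode w[j]? = 2) = true then 1 else 0

/-- The position of the second blank. -/
def prefixLen (w : Word) : ℕ :=
  ∑ i ∈ Finset.range w.length, if decide (blanks w (i + 1) ≤ 1) = true then 1 else 0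

/-- The codes of the first `n` symbols. -/
def syms (w : Word) (n : ℕ) : List ℕ := (List.range n).map fun j => symCode w[j]?

theorem Poly.blanks {α : Type} [Encodable α] {f : Word → α → ℕ} (hf : Poly f) :
    Poly fun w a => blanks w (f w a) :=
  Poly.sum hf (f := fun w p => if decide (symCode w[p.2]? = 2) = true then 1 else 0)
    ((id.snd.sym.eq (const 2)).toNat)

theorem Poly.prefixLen {α : Type} [Encodable α] : Poly fun w (_ : α) => prefixLen w :=
  Poly.sum .len (f := fun w p => if decide (Accordion.blanks w (p.2 + 1) ≤ 1) = true then 1 else 0)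
    (((Poly.blanks id.snd.succ).le (const 1)).toNat)

theorem blanks_eq_count (w : Word) (n : ℕ) : blanks w n = (w.take n).count none := by
  induction n with
  | zero => simp [blanks]
  | succ n ih =>
    rw [blanks, Finset.sum_range_succ, ← blanks, ih, List.take_add_one, List.count_append]
    congr 1
    rcases w[n]? with _ | _ | _ | _ <;> simp [symCode]

theorem symbol_count (u : Str) : (u.map some : Word).count none = 0 := by
  rw [List.count_eq_zero]
  simp

/-- A position lies before the second blank exactly if the word up to and including it has at most
one blank, so these positions can be counted. -/
theorem prefixLen_tripleWord (u u' y : Str) :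
    prefixLen (tripleWord (u, u', y)) = u.length + u'.length + 1 := by
  refine Poly.sum_range_ite_lt _ _ _ (fun i => ?_) ?_
  · rw [decide_eq_true_eq, blanks_eq_count]
    have e : tripleWord (u, u', y) =
        ((u.map some ++ none :: u'.map some) ++ [none]) ++ y.map some := by simp [tripleWord]
    have e' : (u.map some ++ none :: u'.map some : Word).length = u.length + u'.length + 1 := by
      simp
      omega
    have c : (u.map some ++ none :: u'.map some : Word).count none = 1 := by
      rw [List.count_append, List.count_cons, symbol_count, symbol_count]
      rfl
    rcases Nat.lt_or_ge i (u.length + u'.length + 1) with hi | hi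
    · refine iff_of_true ?_ hi
      rw [e, List.append_assoc, List.take_append_of_le_length (by omega)]
      exact ((List.take_sublist _ _).count_le _).trans c.le
    · refine iff_of_false (not_le.2 ?_) (by omega)
      rw [e, List.take_append, List.take_of_length_le (by rw [List.length_append, e']; simpa using hi),
        List.count_append, List.count_append, c]
      simp
      omega
  · simp [tripleWord]

/-- The codes of the symbols of the first two strings of a triple, with the blank. -/
def prefixCode (x : Str × Str) : List ℕ :=
  x.1.map (fun b => cond b 1 0) ++ 2 :: x.2.map fun b => cond b 1 0

theorem syms_tripleWord (u u' y : Str) :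
    syms (tripleWord (u, u', y)) (prefixLen (tripleWord (u, u', y))) = prefixCode (u, u') := by
  rw [prefixLen_tripleWord]
  have e : prefixCode (u, u') =
      (u.map some ++ none :: u'.map some : Word).map fun a => symCode (some a) := by
    simp only [prefixCode, List.map_append, List.map_cons, List.map_map]
    congr 1
    · refine List.map_congr_left fun b _ => ?_
      cases b <;> rfl
    · congr 1
      refine List.map_congr_left fun b _ => ?_
      cases b <;> rfl
  rw [e]
  refine List.ext_getElem (by simp [syms]; omega) fun i h1 h2 => ?_
  have h2' : i < (u.map some ++ none :: u'.map some : Word).length := by simpa using h2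
  have e : tripleWord (u, u', y) =
    (u.map some ++ none :: u'.map some) ++ (none :: y.map some) := by simp [tripleWord]
  simp only [syms, List.getElem_map, List.getElem_range]
  rw [e, List.getElem?_append_left h2', List.getElem?_eq_getElem h2']

/-- Recovers the strings from `prefixCode`. -/
def prefixDecode (l : List ℕ) : Str × Str :=
  ((l.take (l.idxOf 2)).map fun n => decide (n = 1),
    (l.drop (l.idxOf 2 + 1)).map fun n => decide (n = 1))

theorem prefixDecode_prefixCode (x : Str × Str) : prefixDecode (prefixCode x) = x := by
  obtain ⟨u, v⟩ := x
  have h : ∀ u : Str, (u.map fun b => cond b 1 0).map (fun n => decide (n = 1)) = u := by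
    intro u
    rw [List.map_map]
    conv_rhs => rw [← List.map_id u]
    refine List.map_congr_left fun b _ => ?_
    cases b <;> rfl
  have h2 : 2 ∉ u.map fun b => cond b 1 0 := by
    simp only [List.mem_map, not_exists, not_and]
    intro b _
    cases b <;> decide
  have h1 : (prefixCode (u, v)).idxOf 2 = (u.map fun b => cond b 1 0).length := by
    rw [prefixCode, List.idxOf_append_of_notMem h2]
    simp
  rw [prefixDecode, h1]
  simp only [prefixCode]
  rw [List.take_left', List.drop_append, List.drop_of_length_le (by omega)]
  · simp only [h, Nat.add_sub_cancel_left, List.drop_succ_cons, List.drop_zero, List.nil_append]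
  · rfl

theorem primrec_prefixDecode : Primrec prefixDecode := by
  have hm : Primrec₂ fun (_ : List ℕ) (n : ℕ) => decide (n = 1) :=
    ((Primrec.eq (α := ℕ)).comp Primrec.snd (.const 1)).decide
  have hi : Primrec fun l : List ℕ => l.idxOf 2 := Primrec.list_idxOf.comp (.const 2) .id
  exact (Primrec.list_map (Primrec.list_take.comp hi .id) hm).pair
    (Primrec.list_map (Primrec.list_drop.comp (Primrec.succ.comp hi) .id) hm)

theorem primrec_prefixCode : Primrec prefixCode := by
  have hm : Primrec₂ fun (_ : Str × Str) (b : Bool) => cond b 1 0 :=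
    Primrec.cond Primrec.snd (.const 1) (.const 0)
  exact Primrec.list_append.comp (Primrec.list_map .fst hm)
    (Primrec.list_cons.comp (.const 2) (Primrec.list_map .snd hm))

/-- The code of a list of symbols is not polynomially bounded in the length of the word, so this is
no instance of `Poly`. The time is polynomial once that code is admitted in the bound. This
suffices, because for a triple the code depends on the first two strings only, and is charged to the
factor f. -/
theorem exists_runs_syms : ∃ P t c, Runs P (fun w (_ : ℕ) => syms w (prefixLen w)) t ∧
    ∀ w, t w 0 ≤ (encode (syms w (prefixLen w)) + w.length + 2) ^ c := by
  obtain ⟨P, t, h0, ht, hv⟩ := Poly.const (α := ℕ) ([] : List ℕ)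
  obtain ⟨Q, t', hg, ht', hv'⟩ :
      Poly fun w (p : ℕ × (ℕ × List ℕ)) => symCode w[prefixLen w - (p.2.1 + 1)]? :: p.2.2 :=
    .cons (.sym (Poly.prefixLen.sub Poly.id.snd.fst.succ)) Poly.id.snd.snd
  obtain ⟨P', t'', hp, hpt, hpv⟩ := (Poly.id (α := ℕ)).pair Poly.prefixLen
  -- The list is built from its end: all intermediate values are suffixes of it, and the code of a
  -- suffix is at most the code of the list.
  have hval : ∀ w a, ∀ i ≤ prefixLen w, recVal (fun _ (_ : ℕ) => ([] : List ℕ))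
      (fun w (p : ℕ × (ℕ × List ℕ)) => symCode w[prefixLen w - (p.2.1 + 1)]? :: p.2.2) w a i =
        (syms w (prefixLen w)).drop (prefixLen w - i) := by
    intro w a i hi
    induction i with
    | zero =>
      rw [Nat.sub_zero, List.drop_of_length_le (by simp [syms])]
      rfl
    | succ i ih =>
      rw [List.drop_eq_getElem_cons (by simp [syms]; omega),
        show prefixLen w - (i + 1) + 1 = prefixLen w - i by omega, ← ih (by omega)]
      simp only [syms, List.getElem_map, List.getElem_range]
      rfl
  have hr := Runs.prec h0 hg
    (fun w p => (Finset.range (p.2 + 1)).sup fun i => encode (recVal (fun _ (_ : ℕ) => ([] : List ℕ))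
      (fun w (p : ℕ × (ℕ × List ℕ)) => symCode w[prefixLen w - (p.2.1 + 1)]? :: p.2.2) w p.1 i))
    (fun w p => (Finset.range p.2).sup fun i => t' w (p.1, (i, recVal (fun _ (_ : ℕ) => ([] : List ℕ))
      (fun w (p : ℕ × (ℕ × List ℕ)) => symCode w[prefixLen w - (p.2.1 + 1)]? :: p.2.2) w p.1 i)))
    (fun w a n i hi => by
      exact Finset.le_sup (f := fun i => encode (recVal (fun _ (_ : ℕ) => ([] : List ℕ))
      (fun w (p : ℕ × (ℕ × List ℕ)) => symCode w[prefixLen w - (p.2.1 + 1)]? :: p.2.2) w a i))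
        (by simpa using Nat.lt_succ_of_le hi))
    (fun w a n i hi => by
      exact Finset.le_sup (f := fun i => t' w (a, (i, recVal (fun _ (_ : ℕ) => ([] : List ℕ))
      (fun w (p : ℕ × (ℕ × List ℕ)) => symCode w[prefixLen w - (p.2.1 + 1)]? :: p.2.2) w a i)))
        (by simpa using hi))
  have hz : PolyBdd fun (w : Word) (_ : ℕ) => encode (0 : ℕ) := .const 0
  have hN : PolyBdd fun (w : Word) (_ : ℕ) => prefixLen w :=
    (Poly.prefixLen (α := ℕ)).valBdd
  obtain ⟨d, hd⟩ := ht'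
  -- The polynomial bounds are stated with an extra number `U`, for which the code of the whole list
  -- is substituted at the end.
  have hT : PolyBdd fun (w : Word) (U : ℕ) =>
      (((0 + ((prefixLen w + U) + 1) ^ 2) + 1) ^ 2 + w.length + 2) ^ d :=
    ((((((PolyBdd.const 0).add (((hN.add .enc).add (.const 1)).pow 2)).add (.const 1)).pow
      2).add .len).add (.const 2)).pow d
  obtain ⟨c, hc⟩ := (hpt.comp hz).add (((ht.comp hz).add (hN.mul (hT.add (.const 1)))).add
    (((PolyBdd.const 1000).mul (hN.add (.const 1))).mul
      ((((hpv.comp hz).add ((((hpv.comp hz).add PolyBdd.enc).add (.const 1)).pow 2)).add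
        (.const 1)).pow 2)))
  have hfin := (hr.comp hp).of_encode (g := fun w (_ : ℕ) => syms w (prefixLen w)) (fun a => a)
    (fun _ => rfl) fun w a => by
      dsimp only
      rw [hval w a _ le_rfl]
      simp
  refine ⟨_, _, c, hfin, fun w => le_trans ?_ (hc w (encode (syms w (prefixLen w))))⟩
  · refine Nat.add_le_add_left (Nat.add_le_add (Nat.add_le_add_left (Nat.mul_le_mul_left _
      (Nat.add_le_add_right (Finset.sup_le fun i hi => (hd w _).trans ?_) _)) _)
      (Nat.mul_le_mul_left _ (Nat.pow_le_pow_left (Nat.add_le_add_right (Nat.add_le_add_left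
        (Nat.pow_le_pow_left (Nat.add_le_add_right (Nat.add_le_add_left
          (Finset.sup_le fun i hi => ?_) _) _) _) _) _) _))) _
    · rw [Finset.mem_range] at hi
      refine Nat.pow_le_pow_left ?_ d
      rw [hval w _ i hi.le]
      obtain ⟨r, hr⟩ : ∃ r, (syms w (prefixLen w)).drop (prefixLen w - i) = r := ⟨_, rfl⟩
      have hb : encode r ≤ encode (syms w (prefixLen w)) := hr ▸ Poly.encode_drop_le _ _
      rw [hr]
      have h1 := encode_pair_le (0 : ℕ) (i, r)
      have h2 := encode_pair_le i r
      have h3 : (encode i + encode r + 1) ^ 2 ≤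
          ((prefixLen w + encode (syms w (prefixLen w))) + 1) ^ 2 := by
        refine Nat.pow_le_pow_left ?_ 2
        rw [Encodable.encode_nat]
        omega
      have h4 : (encode 0 + encode (i, r) + 1) ^ 2 ≤
          ((0 + ((prefixLen w + encode (syms w (prefixLen w))) + 1) ^ 2) + 1) ^ 2 :=
        Nat.pow_le_pow_left (by rw [Encodable.encode_nat]; omega) 2
      show encode ((0 : ℕ), (i, r)) + w.length + 2 ≤ _
      omega
    · rw [Finset.mem_range] at hi
      rw [hval w _ i (by omega)]
      exact Poly.encode_drop_le _ _

theorem exec_clear_input (w : Word) (out : List Bool) :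
    ExecLE (.loop 0 fun _ => .skip) (St w [] (fun _ => 0) out) (w.length * 2 + 1)
      (St [] [] (fun _ => 0) out) :=
  ExecLE.loop (fun l => St l [] (fun _ => 0) out) (fun _ => rfl) w fun a l' _ => by
    rw [St.set_inp]
    exact .skip _

theorem regs_zero (b : ℕ) : regs b (fun _ => 0) [0] = fun _ => 0 := by
  funext i
  unfold regs
  split_ifs
  · rfl
  · rcases i - b with _ | n <;> simp

/-- The code of `some z` exceeds that of `z` by one; the predecessor removes the option which
`decode` introduces. -/
theorem primRuns_of_primrec {β γ : Type} [Primcodable β] [Primcodable γ] {D : β → γ} (hD : Primrec D) :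
    ∃ P t T, Runs P (fun _ l => D l) t ∧ Primrec T ∧ ∀ w a, t w a ≤ T a := by
  have h : Nat.Primrec fun n => (encode ((decode (α := β) n).map D)) - 1 :=
    Nat.Primrec.pred.comp (Primrec.nat_iff.1 (Primrec.encode.comp (Primrec.option_map Primrec.decode
      (hD.comp Primrec.snd))))
  obtain ⟨P, t, T, hr, hT, ht⟩ := PrimRuns.of_primrec h
  refine ⟨P, _, fun a => T (encode a), hr.of_encode encode (fun _ => rfl) fun w a => ?_,
    hT.comp Primrec.encode, fun w a => ht _ _⟩
  simp [Encodable.encodek]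

/-- A primitive recursive function of the first two strings, followed by a polynomial-time program. -/
theorem exists_machine {γ : Type} [Primcodable γ] {D : Str × Str → γ} (hD : Primrec D)
    {F : Word → γ → List Bool} (hF : PolyEmits F) :
    ∃ (f : Str × Str → ℕ) (p : Polynomial ℕ) (M : Turing.TM2ComputableAux (Option Bool) Bool),
      Computable f ∧ ∀ u u' y,
        Nonempty (Turing.TM2OutputsInTime M.tm ((tripleWord (u, u', y)).map M.inputAlphabet.invFun)
          (some ((F (tripleWord (u, u', y)) (D (u, u'))).map M.outputAlphabet.invFun))
          (f (u, u') * p.eval (tripleWord (u, u', y)).length)) := by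
  obtain ⟨P₁, t₁, c₁, h₁, ht₁⟩ := exists_runs_syms
  obtain ⟨P₂, t₂, T₂, h₂, hT₂, ht₂⟩ := primRuns_of_primrec (hD.comp primrec_prefixDecode)
  obtain ⟨P₃, t₃, h₃, c₃, ht₃⟩ := hF
  -- The summands account for reading the first two strings, for computing `D`, for writing the
  -- output, and for clearing the input and halting.
  refine ⟨fun x => (encode (prefixCode x) + 2) ^ c₁ + T₂ (prefixCode x) + (encode (D x) + 2) ^ c₃ + 2,
    (Polynomial.X + 2) ^ (c₁ + c₃ + 1),
    (Prog.seq (P₁ 0) (.seq (P₂ 0) (.seq (P₃ 0) (.loop 0 fun _ => .skip)))).machine, ?_, fun u u' y => ?_⟩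
  · have hp : ∀ c, Primrec fun n : ℕ => (n + 2) ^ c := by
      intro c
      induction c with
      | zero => simpa using Primrec.const 1
      | succ c ih =>
        simp only [pow_succ]
        exact Primrec.nat_mul.comp ih (Primrec.nat_add.comp .id (.const 2))
    exact (Primrec.nat_add.comp (Primrec.nat_add.comp (Primrec.nat_add.comp
      ((hp c₁).comp (Primrec.encode.comp primrec_prefixCode)) (hT₂.comp primrec_prefixCode))
      ((hp c₃).comp (Primrec.encode.comp hD))) (.const 2)).to_comp
  · obtain ⟨w, hw⟩ : ∃ w, tripleWord (u, u', y) = w := ⟨_, rfl⟩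
    have e₁ : syms w (prefixLen w) = prefixCode (u, u') := hw ▸ syms_tripleWord u u' y
    have k₁ := (h₁ w 0 (fun _ => 0) [] 0).mono (ht₁ w)
    simp only [e₁] at k₁
    have k₂ := (h₂ w 0 (fun _ => 0) [] (prefixCode (u, u'))).mono (ht₂ w _)
    simp only [prefixDecode_prefixCode] at k₂
    have k₃ := (h₃ w 0 (fun _ => 0) [] (D (u, u'))).mono (ht₃ w _)
    have k₄ := exec_clear_input w (F w (D (u, u')) ++ [])
    rw [Encodable.encode_nat] at k₁
    simp only [RS, regs_zero] at k₁ k₂ k₃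
    obtain ⟨t, ht, k⟩ := k₁.seq (k₂.seq (k₃.seq k₄))
    rw [hw]
    have ein : St w [] (fun _ => 0) [] = ⟨Function.update (fun _ => []) 0 w, []⟩ := by
      simp only [St, PState.mk.injEq, and_true]
      funext i
      match i with
      | 0 => rfl
      | 1 => rfl
      | i + 2 => rfl
    have eout : St [] [] (fun _ => 0) (F w (D (u, u')) ++ []) = ⟨fun _ => [], F w (D (u, u'))⟩ := by
      simp only [St, List.append_nil, PState.mk.injEq, and_true]
      funext i
      match i with
      | 0 => rfl
      | 1 => rfl
      | i + 2 => rfl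
    rw [ein, eout] at k
    refine Prog.machine_outputs k ?_
    simp only [Polynomial.eval_pow, Polynomial.eval_add, Polynomial.eval_X, Polynomial.eval_ofNat]
    -- From x + n + 2 ≤ (x + 2)(n + 2): the parameter is separated from the input length.
    have hb : ∀ x c, (x + w.length + 2) ^ c ≤ (x + 2) ^ c * (w.length + 2) ^ c := by
      intro x c
      rw [← mul_pow]
      exact Nat.pow_le_pow_left (by nlinarith) c
    have l2 : 1 ≤ w.length + 2 := by omega
    have b₁ := (hb (encode (prefixCode (u, u'))) c₁).trans (Nat.mul_le_mul_left _
      (Nat.pow_le_pow_right l2 (show c₁ ≤ c₁ + c₃ + 1 by omega)))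
    have b₃ := (hb (encode (D (u, u'))) c₃).trans (Nat.mul_le_mul_left _
      (Nat.pow_le_pow_right l2 (show c₃ ≤ c₁ + c₃ + 1 by omega)))
    have b₄ : w.length + 2 ≤ (w.length + 2) ^ (c₁ + c₃ + 1) := Nat.le_self_pow (by omega) _
    generalize (w.length + 2) ^ (c₁ + c₃ + 1) = Z at *
    have b₂ : T₂ (prefixCode (u, u')) ≤ T₂ (prefixCode (u, u')) * Z :=
      Nat.le_mul_of_pos_right _ (by omega)
    rw [add_mul, add_mul, add_mul]
    omega

end Accordion

namespace Accordion
open Encodable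

/-! ### Evaluating a plan on the third string of the input word -/

/-- Tests of the form `b p mod n_s = c`, and tests of a relation on a tuple of entries of `b` and `c`. -/
abbrev Clause := List (ℕ × ℕ) × List (ℕ × List ℕ)

/-- The number of entries, a negation mark, the entries with the value `t`, and the clauses. -/
abbrev Rule := (ℕ × Bool) × (List ℕ × List Clause)

/-- The number of sorts and the arities, as lists of positions of sorts, of the given structure; the number
of sorts, the factor for the sizes, and the rules of the relations of the new structure. -/
abbrev Plan := (ℕ × List (List ℕ)) × ((ℕ × ℕ) × List Rule)

/-- The clause holds for the tuple `b` of `len` entries and the value `c`. -/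
def clauseHolds (cd : ℕ → ℕ) (lk : ℕ → (ℕ → ℕ) → Bool) (ng : Bool) (len : ℕ) (b : ℕ → ℕ) (c : ℕ) (κ : Clause) : Bool :=
  (κ.1.all fun e => decide (b e.2 % cd e.1 = c)) &&
    κ.2.all fun l => ng ^^ lk l.1 fun q =>
      bif decide (l.2.getD q 0 < len) then b (l.2.getD q 0) else c

/-- The truth value of the relation with the given rule on the tuple `b`. -/
def ruleBit (cd : ℕ → ℕ) (lk : ℕ → (ℕ → ℕ) → Bool) (M N : ℕ) (ρ : Rule) (b : ℕ → ℕ) : Bool :=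
  ρ.1.2 ^^ decide (∃ t < N, ((ρ.2.1.all fun p => decide (b p = t)) &&
    (decide (t / M < ρ.2.2.length) &&
      clauseHolds cd lk ρ.1.2 ρ.1.1 b (t % M) (ρ.2.2.getD (t / M) ([], [])))) = true)

/-! ### Reading the encoding of a structure and writing the new one, in polynomial time. -/

namespace Reader

/-- The symbol at a position of the third string. -/
def at_ (w : Word) (j : ℕ) : ℕ := symCode w[prefixLen w + 1 + j]?

/-- The number of consecutive symbols `true` from a position on. -/
def run (w : Word) (s : ℕ) : ℕ :=
  ∑ i ∈ Finset.range w.length,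
    if decide (∀ j < i + 1, decide (at_ w (s + j) = 1) = true) = true then 1 else 0

/-- The position of the `n`-th number of the third string. -/
def start (w : Word) : ℕ → ℕ
  | 0 => 0
  | n + 1 => start w n + run w (start w n) + 1

/-- The `n`-th number of the third string. -/
def card (w : Word) (i : ℕ) : ℕ := run w (start w i)

/-- The product of the sizes of the universes for at most `k` entries of `ar`. -/
def volume (k : ℕ) (w : Word) (ar : List ℕ) (i n : ℕ) : ℕ :=
  Nat.rec 1 (fun q r => r * card w (ar.getD (i + q) 0)) (min n k)

/-- The position of the table of the `n`-th relation. -/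
def table (k : ℕ) (w : Word) (σ : ℕ × List (List ℕ)) (n : ℕ) : ℕ :=
  start w σ.1 + ∑ R ∈ Finset.range n, volume k w (σ.2.getD R []) 0 (σ.2.getD R []).length

/-- The truth value of the `R`-th relation. -/
def lookup (k : ℕ) (w : Word) (σ : ℕ × List (List ℕ)) (R : ℕ) (f : ℕ → ℕ) : Bool :=
  decide (at_ w (table k w σ R + ∑ p ∈ Finset.range (σ.2.getD R []).length,
    f p % card w ((σ.2.getD R []).getD p 0) *
      volume k w (σ.2.getD R []) (p + 1) ((σ.2.getD R []).length - (p + 1))) = 1)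

/-- The third string is the encoding of a structure. -/
def valid (k : ℕ) (w : Word) (σ : ℕ × List (List ℕ)) : Bool :=
  decide (∀ i < σ.1, (decide (at_ w (start w i + card w i) = 0) && decide (1 ≤ card w i)) = true) &&
    decide (w.length = prefixLen w + 1 + table k w σ σ.2.length)

/-- The sum of the sizes of the universes. -/
def total (w : Word) (n : ℕ) : ℕ := ∑ i ∈ Finset.range n, card w i

/-- The sizes of the universes of the new structure. -/
def size (w : Word) (P : Plan) : ℕ := P.2.1.2 * total w P.1.1

/-- The truth value of a relation of the new structure on the `i`-th tuple. -/
def bit (k : ℕ) (w : Word) (P : Plan) (ρ : Rule) (i : ℕ) : Bool :=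
  ruleBit (card w) (lookup k w P.1) (total w P.1.1) (size w P) ρ
    fun p => bif decide (p < ρ.1.1) then i / size w P ^ min (ρ.1.1 - (p + 1)) k % size w P else 0

/-- The encoding of the new structure. -/
def result (k : ℕ) (w : Word) (P : Plan) : List Bool :=
  bif valid k w P.1 then
    ((List.range P.2.1.1).flatMap fun _ => (List.range (size w P)).flatMap (fun _ => [true]) ++ [false]) ++
      (List.range P.2.2.length).flatMap fun r =>
        (List.range (size w P ^ min (P.2.2.getD r ((0, false), [], [])).1.1 k)).flatMap fun i =>
          [bit k w P (P.2.2.getD r ((0, false), [], [])) i]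
  else []

section
variable {α : Type} [Encodable α]

theorem poly_at {f : Word → α → ℕ} (hf : Poly f) : Poly fun w a => at_ w (f w a) :=
  Poly.sym (f := fun w a => prefixLen w + 1 + f w a) ((Poly.prefixLen.add (.const 1)).add hf)

theorem poly_run {f : Word → α → ℕ} (hf : Poly f) : Poly fun w a => run w (f w a) := by
  have hq : Poly fun w (q : (α × ℕ) × ℕ) => f w q.1.1 + q.2 :=
    (hf.comp (Poly.id.fst.fst)).add Poly.id.snd
  have hp : Poly fun w (q : (α × ℕ) × ℕ) => decide (at_ w (f w q.1.1 + q.2) = 1) :=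
    (poly_at hq).eq (.const 1)
  have hs : Poly fun (_ : Word) (p : α × ℕ) => p.2 + 1 := Poly.id.snd.succ
  have hl : Poly fun w (_ : α) => w.length := Poly.len
  have hr := hl.sum (hs.all hp).toNat
  refine hr.of_eq fun w a => ?_
  rw [run]

theorem run_le (w : Word) (s : ℕ) : run w s ≤ w.length := by
  refine (Finset.sum_le_card_nsmul _ _ 1 fun i _ => ?_).trans (by simp)
  split_ifs <;> simp

theorem start_le (w : Word) (n : ℕ) : start w n ≤ n * (w.length + 1) := by
  induction n with
  | zero => simp [start]
  | succ n ih =>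
    have := run_le w (start w n)
    rw [start, add_mul]
    omega

theorem poly_start {f : Word → α → ℕ} (hf : Poly f) : Poly fun w a => start w (f w a) :=
  Poly.iter (fun w _ n => start w n) (g := fun w p => p.2.2 + run w p.2.2 + 1) hf (Poly.const 0)
    (Poly.id.snd.snd.add (poly_run Poly.id.snd.snd)).succ (fun _ _ _ => rfl)
    ⟨_, hf.valBdd.mul (PolyBdd.len.add (.const 1)), fun w _ n hn =>
      (start_le w n).trans (Nat.mul_le_mul_right _ hn)⟩

theorem poly_card {f : Word → α → ℕ} (hf : Poly f) : Poly fun w a => card w (f w a) :=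
  poly_run (poly_start hf)

/-- The cap `k` on the number of factors, each at most the length of the word, makes the product
polynomially bounded. -/
theorem poly_volume (k : ℕ) {ar : Word → α → List ℕ} {i n : Word → α → ℕ} (har : Poly ar) (hi : Poly i)
    (hn : Poly n) : Poly fun w a => volume k w (ar w a) (i w a) (n w a) := by
  refine Poly.iter (fun w a m => Nat.rec 1 (fun q r => r * card w ((ar w a).getD (i w a + q) 0)) m)
    (g := fun w p => p.2.2 * card w ((ar w p.1).getD (i w p.1 + p.2.1) 0)) (hn.min (.const k))
    (Poly.const 1) (Poly.id.snd.snd.mul (poly_card ((har.comp Poly.id.fst).getD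
      ((hi.comp Poly.id.fst).add Poly.id.snd.fst) 0 rfl))) (fun _ _ _ => rfl)
    ⟨_, (PolyBdd.len.add (.const 1)).pow k, fun w a m hm => ?_⟩
  have : ∀ m : ℕ, (Nat.rec 1 (fun q r => r * card w ((ar w a).getD (i w a + q) 0)) m : ℕ) ≤
      (w.length + 1) ^ m := by
    intro m
    induction m with
    | zero => simp
    | succ m ih => exact Nat.mul_le_mul ih ((run_le _ _).trans (Nat.le_succ _))
  exact (this m).trans (Nat.pow_le_pow_right (Nat.succ_pos _) (hm.trans (min_le_right _ _)))

theorem poly_table (k : ℕ) {σ : Word → α → ℕ × List (List ℕ)} {n : Word → α → ℕ} (hσ : Poly σ)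
    (hn : Poly n) : Poly fun w a => table k w (σ w a) (n w a) := by
  have hR : Poly fun w (p : α × ℕ) => (σ w p.1).2.getD p.2 [] :=
    (hσ.comp Poly.id.fst).snd.getD Poly.id.snd [] rfl
  exact (poly_start hσ.fst).add (Poly.sum hn (f := fun w p =>
    volume k w ((σ w p.1).2.getD p.2 []) 0 ((σ w p.1).2.getD p.2 []).length)
      (poly_volume k hR (.const 0) hR.length))

theorem poly_lookup (k : ℕ) {σ : Word → α → ℕ × List (List ℕ)} {R : Word → α → ℕ}
    {f : Word → α → ℕ → ℕ} (hσ : Poly σ) (hR : Poly R) (hf : Poly fun w (p : α × ℕ) => f w p.1 p.2) :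
    Poly fun w a => lookup k w (σ w a) (R w a) (f w a) := by
  have har : Poly fun w a => (σ w a).2.getD (R w a) [] := hσ.snd.getD hR [] rfl
  have har' : Poly fun w (p : α × ℕ) => (σ w p.1).2.getD (R w p.1) [] := har.comp Poly.id.fst
  exact (poly_at ((poly_table k hσ hR).add (Poly.sum har.length (f := fun w p =>
    f w p.1 p.2 % card w (((σ w p.1).2.getD (R w p.1) []).getD p.2 0) *
      volume k w ((σ w p.1).2.getD (R w p.1) []) (p.2 + 1)
        (((σ w p.1).2.getD (R w p.1) []).length - (p.2 + 1)))
    ((hf.mod (poly_card (har'.getD Poly.id.snd 0 rfl))).mul (poly_volume k har' Poly.id.snd.succ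
      (har'.length.sub Poly.id.snd.succ)))))).eq (.const 1)

theorem poly_valid (k : ℕ) {σ : Word → α → ℕ × List (List ℕ)} (hσ : Poly σ) :
    Poly fun w a => valid k w (σ w a) := by
  refine Poly.and (Poly.all hσ.fst (p := fun w p =>
    decide (at_ w (start w p.2 + card w p.2) = 0) && decide (1 ≤ card w p.2)) ?_) ?_
  · exact ((poly_at ((poly_start Poly.id.snd).add (poly_card Poly.id.snd))).eq (.const 0)).and
      ((Poly.const 1).le (poly_card Poly.id.snd))
  · exact Poly.len.eq ((Poly.prefixLen.add (.const 1)).add (poly_table k hσ hσ.snd.length))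

theorem poly_total {n : Word → α → ℕ} (hn : Poly n) : Poly fun w a => total w (n w a) :=
  Poly.sum hn (f := fun w p => card w p.2) (poly_card Poly.id.snd)

theorem poly_size {P : Word → α → Plan} (hP : Poly P) : Poly fun w a => size w (P w a) :=
  hP.snd.fst.snd.mul (poly_total hP.fst.fst)

theorem poly_clauseHolds (k : ℕ) {σ : Word → α → ℕ × List (List ℕ)} {ng : Word → α → Bool}
    {len c : Word → α → ℕ} {b : Word → α → ℕ → ℕ} {κ : Word → α → Clause} (hσ : Poly σ) (hng : Poly ng) (hlen : Poly len)
    (hb : Poly fun w (p : α × ℕ) => b w p.1 p.2) (hc : Poly c) (hκ : Poly κ) :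
    Poly fun w a => clauseHolds (card w) (lookup k w (σ w a)) (ng w a) (len w a) (b w a) (c w a) (κ w a) := by
  refine Poly.and (Poly.list_all hκ.fst (p := fun w (p : α × (ℕ × ℕ)) =>
      decide (b w p.1 p.2.2 % card w p.2.1 = c w p.1)) ?_ (0, 0) rfl)
    (Poly.list_all hκ.snd (p := fun w (p : α × (ℕ × List ℕ)) =>
      ng w p.1 ^^ lookup k w (σ w p.1) p.2.1 fun q =>
      bif decide (p.2.2.getD q 0 < len w p.1) then b w p.1 (p.2.2.getD q 0) else c w p.1) ?_ (0, []) rfl)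
  · exact ((hb.comp (Poly.id.fst.pair Poly.id.snd.snd)).mod (poly_card Poly.id.snd.fst)).eq
      (hc.comp Poly.id.fst)
  · have hx : Poly fun (_ : Word) (p : (α × (ℕ × List ℕ)) × ℕ) => p.1.2.2.getD p.2 0 :=
      Poly.id.fst.snd.snd.getD Poly.id.snd 0 rfl
    have h1 : Poly fun w (p : (α × (ℕ × List ℕ)) × ℕ) => b w p.1.1 (p.1.2.2.getD p.2 0) :=
      hb.comp (f := fun _ (p : (α × (ℕ × List ℕ)) × ℕ) => (p.1.1, p.1.2.2.getD p.2 0))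
        (Poly.id.fst.fst.pair hx)
    have h2 : Poly fun w (p : (α × (ℕ × List ℕ)) × ℕ) => c w p.1.1 := hc.comp Poly.id.fst.fst
    have h3 : Poly fun w (p : (α × (ℕ × List ℕ)) × ℕ) => len w p.1.1 := hlen.comp Poly.id.fst.fst
    have h4 := (hx.lt h3).cond h1 h2
    have h5 : Poly fun w (p : α × (ℕ × List ℕ)) => σ w p.1 := hσ.comp Poly.id.fst
    have h6 : Poly fun (_ : Word) (p : α × (ℕ × List ℕ)) => p.2.1 := Poly.id.snd.fst
    exact (hng.comp (f := fun _ (p : α × (ℕ × List ℕ)) => p.1) Poly.id.fst).xor (poly_lookup k h5 h6 h4)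

theorem poly_ruleBit (k : ℕ) {σ : Word → α → ℕ × List (List ℕ)} {M N : Word → α → ℕ}
    {b : Word → α → ℕ → ℕ} {ρ : Word → α → Rule} (hσ : Poly σ) (hM : Poly M) (hN : Poly N)
    (hρ : Poly ρ) (hb : Poly fun w (p : α × ℕ) => b w p.1 p.2) :
    Poly fun w a => ruleBit (card w) (lookup k w (σ w a)) (M w a) (N w a) (ρ w a) (b w a) := by
  have hρ' : Poly fun w (p : α × ℕ) => ρ w p.1 := hρ.comp Poly.id.fst
  have hM' : Poly fun w (p : α × ℕ) => M w p.1 := hM.comp Poly.id.fst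
  have hb' : Poly fun w (p : (α × ℕ) × ℕ) => b w p.1.1 p.2 :=
    hb.comp (Poly.id.fst.fst.pair Poly.id.snd)
  refine hρ.fst.snd.xor (Poly.any hN (p := fun w p =>
    ((ρ w p.1).2.1.all fun q => decide (b w p.1 q = p.2)) &&
    (decide (p.2 / M w p.1 < (ρ w p.1).2.2.length) &&
      clauseHolds (card w) (lookup k w (σ w p.1)) (ρ w p.1).1.2 (ρ w p.1).1.1 (b w p.1) (p.2 % M w p.1)
        ((ρ w p.1).2.2.getD (p.2 / M w p.1) ([], [])))) (Poly.and ?_ (Poly.and ?_ ?_)))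
  · exact Poly.list_all hρ'.snd.fst (p := fun w (q : (α × ℕ) × ℕ) => decide (b w q.1.1 q.2 = q.1.2))
      (hb'.eq Poly.id.fst.snd) 0 rfl
  · exact (Poly.id.snd.div hM').lt hρ'.snd.snd.length
  · exact poly_clauseHolds k (hσ.comp Poly.id.fst) hρ'.fst.snd hρ'.fst.fst hb' (Poly.id.snd.mod hM')
      (hρ'.snd.snd.getD (Poly.id.snd.div hM') ([], []) rfl)

theorem poly_bit (k : ℕ) {P : Word → α → Plan} {ρ : Word → α → Rule} {i : Word → α → ℕ} (hP : Poly P)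
    (hρ : Poly ρ) (hi : Poly i) : Poly fun w a => bit k w (P w a) (ρ w a) (i w a) := by
  have hN : Poly fun w (p : α × ℕ) => size w (P w p.1) := poly_size (hP.comp Poly.id.fst)
  have hl : Poly fun w (p : α × ℕ) => (ρ w p.1).1.1 := (hρ.comp Poly.id.fst).fst.fst
  have hb := (Poly.id.snd.lt hl).cond (((hi.comp Poly.id.fst).div (hN.pow
    ((hl.sub Poly.id.snd.succ).min (.const k)) k fun _ _ => min_le_right _ _)).mod hN) (.const 0)
  exact poly_ruleBit k hP.fst (poly_total hP.fst.fst) (poly_size hP) hρ hb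

/-- The number of tuples of a relation is polynomial because exponents are capped by the constant
`k`. The plan is part of the argument, so the bound is polynomial also in its unary code. -/
theorem polyEmits_result (k : ℕ) : PolyEmits fun w (P : Plan) => result k w P := by
  refine PolyEmits.cond (poly_valid k Poly.id.fst) (PolyEmits.append (PolyEmits.flatMap
    Poly.id.snd.fst.fst (f := fun w (p : Plan × ℕ) =>
      (List.range (size w p.1)).flatMap (fun _ => [true]) ++ [false]) ?_)
    (PolyEmits.flatMap Poly.id.snd.snd.length (f := fun w (p : Plan × ℕ) =>
      (List.range (size w p.1 ^ min (p.1.2.2.getD p.2 ((0, false), [], [])).1.1 k)).flatMap fun i =>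
        [bit k w p.1 (p.1.2.2.getD p.2 ((0, false), [], [])) i]) ?_)) .nil
  · exact (PolyEmits.flatMap (poly_size Poly.id.fst) (f := fun _ _ => [true]) (.bit (.const true))).append
      (.bit (.const false))
  · have hρ : Poly fun (_ : Word) (p : Plan × ℕ) => p.1.2.2.getD p.2 ((0, false), [], []) :=
      Poly.id.fst.snd.snd.getD Poly.id.snd _ rfl
    exact PolyEmits.flatMap ((poly_size Poly.id.fst).pow (hρ.fst.fst.min (.const k)) k
      fun _ _ => min_le_right _ _) (f := fun w (q : (Plan × ℕ) × ℕ) =>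
        [bit k w q.1.1 (q.1.1.2.2.getD q.1.2 ((0, false), [], [])) q.2])
      (.bit (poly_bit k Poly.id.fst.fst (hρ.comp Poly.id.fst) Poly.id.snd))

end
end Reader
end Accordion

namespace Accordion

/-! ### Tables of relations -/

/-- In a concatenation, the block with index `n` begins after the total length of the preceding
blocks. It is used for the tables in an encoding and for the tuples with a given first entry. -/
theorem getElem?_flatMap_table {α β : Type} (f : α → List β) (l : List α) (n : ℕ) (hn : n < l.length) (j : ℕ)
    (hj : j < (f l[n]).length) :
    (l.flatMap f)[((l.take n).map fun x => (f x).length).sum + j]? = (f l[n])[j]? := by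
  induction l generalizing n with
  | nil => simp at hn
  | cons x l ih =>
    rw [List.flatMap_cons]
    rcases n with _ | n
    · simp only [List.getElem_cons_zero] at hj
      simp [List.getElem?_append_left hj]
    · simp only [List.getElem_cons_succ] at hj
      have := ih n (by simpa using hn) hj
      rw [List.take_succ_cons, List.map_cons, List.sum_cons, add_assoc, List.getElem?_append_right (by omega),
        Nat.add_sub_cancel_left, this]
      simp

theorem length_tuples (cd : ℕ → ℕ) (w : List ℕ) : (tuples cd w).length = (w.map cd).prod := by
  induction w with
  | nil => rfl
  | cons s w ih => simp [tuples, List.length_flatMap, ih]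


theorem nodup_tuples (cd : ℕ → ℕ) (w : List ℕ) : (tuples cd w).Nodup := by
  induction w with
  | nil => simp [tuples]
  | cons s w ih =>
    rw [tuples, List.nodup_flatMap]
    refine ⟨fun a _ => ih.map (List.cons_injective), ?_⟩
    refine List.nodup_range.imp fun {a b} hab => ?_
    rw [Function.onFun, List.disjoint_left]
    rintro t h1 h2
    simp only [List.mem_map] at h1 h2
    obtain ⟨t1, _, rfl⟩ := h1
    obtain ⟨t2, _, h⟩ := h2
    exact hab (List.cons.inj h).1.symm

theorem tuples_congr {cd cd' : ℕ → ℕ} {g : ℕ → ℕ} {w : List ℕ} (h : ∀ s ∈ w, cd' (g s) = cd s) :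
    tuples cd' (w.map g) = tuples cd w := by
  induction w with
  | nil => rfl
  | cons s w ih =>
    rw [List.map_cons, tuples, tuples, h s (by simp), ih fun s hs => h s (by simp [hs])]

/-- The position of a tuple in the list of all tuples. -/
def tupleIndex (cd : ℕ → ℕ) : List ℕ → List ℕ → ℕ
  | s :: w, b => b.headD 0 * (w.map cd).prod + tupleIndex cd w b.tail
  | [], _ => 0

/-- In lexicographic order, the position of a tuple is its value in the mixed radix given by the
sizes of the universes, with the first entry as the most significant digit. -/
theorem getElem?_tuples {cd : ℕ → ℕ} {w b : List ℕ} (h : List.Forall₂ (fun x s => x < cd s) b w) :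
    tupleIndex cd w b < (w.map cd).prod ∧ (tuples cd w)[tupleIndex cd w b]? = some b := by
  induction h with
  | nil => simp [tupleIndex, tuples]
  | @cons x s b w hx _ ih =>
    simp only [tupleIndex, List.headD_cons, List.tail_cons, List.map_cons, List.prod_cons]
    refine ⟨?_, ?_⟩
    · nlinarith [ih.1]
    · have := getElem?_flatMap_table (fun a => (tuples cd w).map (a :: ·)) (List.range (cd s)) x
        (by simpa using hx) (tupleIndex cd w b) (by simpa [length_tuples] using ih.1)
      rw [tuples]
      simp only [List.getElem_range, List.length_map, List.map_const', List.sum_replicate,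
        length_tuples, List.getElem?_map, ih.2, List.length_take, List.length_range, smul_eq_mul,
        min_eq_left hx.le, Option.map_some] at this
      exact this

theorem tupleIndex_eq_sum (cd : ℕ → ℕ) (f : ℕ → ℕ) (w : List ℕ) :
    tupleIndex cd w ((List.range w.length).map f) =
      ∑ p ∈ Finset.range w.length, f p * ((w.drop (p + 1)).map cd).prod := by
  induction w generalizing f with
  | nil => simp [tupleIndex]
  | cons s w ih =>
    rw [List.length_cons, Finset.sum_range_succ', List.range_succ_eq_map, tupleIndex]
    simp only [List.map_cons, List.headD_cons, List.tail_cons, List.map_map]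
    rw [ih, add_comm]
    rfl

/-- The digits of a number, as a tuple. -/
def digitTuple (N len i : ℕ) : List ℕ := (List.range len).map fun p => i / N ^ (len - (p + 1)) % N

theorem range_mul (n m : ℕ) :
    List.range (n * m) = (List.range n).flatMap fun a => (List.range m).map (a * m + ·) := by
  induction n with
  | zero => simp
  | succ n ih =>
    rw [add_mul, one_mul, List.range_add, ih, List.range_succ, List.flatMap_append]
    simp

/-- If all universes have `N` elements, the lexicographic list of the tuples consists of the
base-`N` expansions of 0, 1, 2, … with leading zeros. -/
theorem tuples_const (N : ℕ) (w : List ℕ) :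
    tuples (fun _ => N) w = (List.range (N ^ w.length)).map (digitTuple N w.length) := by
  induction w with
  | nil => simp [tuples, digitTuple]
  | cons s w ih =>
    rw [tuples, List.length_cons, pow_succ', range_mul, List.map_flatMap, ih]
    refine List.flatMap_congr fun a ha => ?_
    rw [List.map_map, List.map_map]
    refine List.map_congr_left fun j hj => ?_
    rw [List.mem_range] at ha hj
    have hN : 0 < N ^ w.length := by omega
    simp only [Function.comp, digitTuple, List.range_succ_eq_map, List.map_cons, List.map_map,
      zero_add, Nat.add_sub_cancel]
    congr 1
    · rw [mul_comm, Nat.mul_add_div hN, Nat.div_eq_of_lt hj, add_zero, Nat.mod_eq_of_lt ha]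
    · refine List.map_congr_left fun p hp => ?_
      rw [List.mem_range] at hp
      simp only [Function.comp, Nat.succ_eq_add_one, Nat.add_sub_add_right]
      obtain ⟨d, hd⟩ : ∃ d, w.length = d + (p + 1) := ⟨w.length - (p + 1), by omega⟩
      have e : N ^ w.length = N ^ d * (N * N ^ p) := by rw [hd]; ring
      rw [show w.length - (p + 1) = d by omega]
      have hd0 : 0 < N ^ d := Nat.pos_of_ne_zero fun h => by simp [e, h] at hN
      rw [e, show a * (N ^ d * (N * N ^ p)) + j = N ^ d * (N * (a * N ^ p)) + j by ring,
        Nat.mul_add_div hd0, Nat.mul_add_mod]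

theorem exists_map_eq {α β : Type} [DecidableEq α] [Inhabited β] {l : List α} (hl : l.Nodup) {z : List β}
    (h : z.length = l.length) : ∃ f : α → β, l.map f = z := by
  refine ⟨fun a => z.getD (l.idxOf a) default, List.ext_getElem (by simp [h]) fun i h1 h2 => ?_⟩
  have h1' : i < l.length := by simpa using h1
  rw [List.getElem_map, hl.idxOf_getElem i h1', List.getD_eq_getElem _ _ h2]

/-- Any bit string of the right length is a sequence of tables. Tuples are listed without
repetition, so a table defines a relation, and distinct symbols can be interpreted independently. -/
theorem exists_tables (cd : ℕ → ℕ) (l : List (ℕ × List ℕ)) (hl : (l.map Prod.fst).Nodup) (z : List Bool)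
    (hz : z.length = (l.map fun R => (R.2.map cd).prod).sum) :
    ∃ rel : ℕ → List ℕ → Bool, z = l.flatMap fun R => (tuples cd R.2).map (rel R.1) := by
  induction l generalizing z with
  | nil => exact ⟨fun _ _ => false, by simpa using hz⟩
  | cons R l ih =>
    rw [List.map_cons, List.nodup_cons] at hl
    rw [List.map_cons, List.sum_cons] at hz
    obtain ⟨f, hf⟩ := exists_map_eq (nodup_tuples cd R.2) (z := z.take (R.2.map cd).prod) (by
      rw [List.length_take, length_tuples]
      omega)
    obtain ⟨rel, hrel⟩ := ih hl.2 (z.drop (R.2.map cd).prod) (by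
      rw [List.length_drop]
      omega)
    refine ⟨Function.update rel R.1 f, ?_⟩
    rw [List.flatMap_cons, Function.update_self, hf]
    conv_lhs => rw [← List.take_append_drop (R.2.map cd).prod z, hrel]
    congr 1
    refine List.flatMap_congr fun S hS => ?_
    rw [Function.update_of_ne]
    rintro h
    exact hl.1 (h ▸ List.mem_map_of_mem hS)

end Accordion

namespace Accordion
namespace Reader

/-! ### Correctness of the reader on encodings, and recognition of encodings. -/

section
variable {u u' y : Str}

theorem at_tripleWord (j : ℕ) : at_ (tripleWord (u, u', y)) j = symCode (y[j]?.map some) := by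
  rw [at_, prefixLen_tripleWord]
  have e : tripleWord (u, u', y) =
      (u.map some ++ none :: (u'.map some ++ [none])) ++ y.map some := by simp [tripleWord]
  rw [e, List.getElem?_append_right (by simp; omega)]
  congr 1
  rw [← List.getElem?_map]
  congr 1
  simp
  omega

theorem at_eq_one (j : ℕ) : at_ (tripleWord (u, u', y)) j = 1 ↔ y[j]? = some true := by
  rw [at_tripleWord]
  rcases y[j]? with _ | _ | _ <;> simp [symCode]

theorem at_eq_zero (j : ℕ) : at_ (tripleWord (u, u', y)) j = 0 ↔ y[j]? = some false := by
  rw [at_tripleWord]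
  rcases y[j]? with _ | _ | _ <;> simp [symCode]

theorem takeWhile_lt_iff (l : List Bool) (i : ℕ) :
    (∀ j < i + 1, l[j]? = some true) ↔ i < (l.takeWhile id).length := by
  induction l generalizing i with
  | nil => simpa using ⟨0, by omega⟩
  | cons b l ih =>
    rcases b with _ | _
    · simpa using ⟨0, by omega, by simp⟩
    · rcases i with _ | i
      · simp
      · simp only [List.takeWhile_cons, id, if_true, List.length_cons, Nat.add_lt_add_iff_right, ← ih i]
        constructor
        · intro h j hj
          simpa using h (j + 1) (by omega)
        · intro h j hj
          rcases j with _ | j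
          · rfl
          · simpa using h j (by omega)

theorem run_tripleWord (s : ℕ) :
    run (tripleWord (u, u', y)) s = ((y.drop s).takeWhile id).length := by
  refine Poly.sum_range_ite_lt _ _ _ (fun i => ?_) ?_
  · rw [← takeWhile_lt_iff]
    simp [at_eq_one, List.getElem?_drop]
  · refine ((List.takeWhile_sublist _).length_le).trans ?_
    simp [tripleWord]
    omega

theorem takeWhile_replicate (n : ℕ) (z : List Bool) :
    ((List.replicate n true ++ [false] ++ z).takeWhile id).length = n := by
  induction n with
  | zero => simp
  | succ n ih =>
    rw [List.replicate_succ, List.cons_append, List.cons_append, List.takeWhile_cons]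
    simpa using ih

theorem drop_start {l : List ℕ} {z : Str} (hy : y = natsStr l ++ z) (i : ℕ) (hi : i ≤ l.length) :
    y.drop (start (tripleWord (u, u', y)) i) = natsStr (l.drop i) ++ z ∧
      start (tripleWord (u, u', y)) i + (natsStr (l.drop i)).length = (natsStr l).length := by
  induction i with
  | zero => simp [start, hy]
  | succ i ih =>
    obtain ⟨h, h'⟩ := ih (by omega)
    have e : natsStr (l.drop i) = List.replicate l[i] true ++ [false] ++ natsStr (l.drop (i + 1)) := by
      rw [List.drop_eq_getElem_cons (by omega)]
      rfl
    rw [e, List.append_assoc] at h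
    have hr : run (tripleWord (u, u', y)) (start (tripleWord (u, u', y)) i) = l[i] := by
      rw [run_tripleWord, h, takeWhile_replicate]
    rw [start, hr]
    refine ⟨?_, ?_⟩
    · rw [add_assoc, ← List.drop_drop, h, List.drop_left' (by simp)]
    · rw [e] at h'
      simp only [List.length_append, List.length_replicate, List.length_singleton] at h'
      omega

theorem card_eq {l : List ℕ} {z : Str} (hy : y = natsStr l ++ z) (i : ℕ) (hi : i < l.length) :
    card (tripleWord (u, u', y)) i = l[i] ∧
      at_ (tripleWord (u, u', y)) (start (tripleWord (u, u', y)) i + card (tripleWord (u, u', y)) i) = 0 := by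
  have h := (drop_start (u := u) (u' := u') hy i hi.le).1
  have e : natsStr (l.drop i) = List.replicate l[i] true ++ [false] ++ natsStr (l.drop (i + 1)) := by
    rw [List.drop_eq_getElem_cons hi]
    rfl
  rw [e, List.append_assoc] at h
  have hr : card (tripleWord (u, u', y)) i = l[i] := by
    rw [card, run_tripleWord, h, takeWhile_replicate]
  refine ⟨hr, ?_⟩
  rw [at_eq_zero, hr, ← List.getElem?_drop, h, List.append_assoc, List.getElem?_append_right (by simp)]
  simp

theorem eq_of_takeWhile (x : List Bool) (h : x[(x.takeWhile id).length]? = some false) :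
    x = natsStr [(x.takeWhile id).length] ++ x.drop ((x.takeWhile id).length + 1) := by
  induction x with
  | nil => simp at h
  | cons b x ih =>
    rcases b with _ | _
    · simp [natsStr]
    · simp only [List.takeWhile_cons, id, if_true, List.length_cons, List.getElem?_cons_succ] at h
      have := ih h
      simp only [natsStr, List.flatMap_cons, List.flatMap_nil, List.append_nil, List.append_assoc,
        List.takeWhile_cons, id, if_true, List.length_cons, List.replicate_succ, List.cons_append,
        List.drop_succ_cons] at this ⊢
      rw [← this]

/-- The converse direction, for recognising encodings: if each of the first `n` runs is closed by
`false`, the string begins with a sequence of unary numbers which are the lengths of these runs. -/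
theorem eq_natsStr (n : ℕ) (h : ∀ i < n, at_ (tripleWord (u, u', y))
      (start (tripleWord (u, u', y)) i + card (tripleWord (u, u', y)) i) = 0) :
    y = natsStr ((List.range n).map (card (tripleWord (u, u', y)))) ++
      y.drop (start (tripleWord (u, u', y)) n) ∧
    (natsStr ((List.range n).map (card (tripleWord (u, u', y))))).length = start (tripleWord (u, u', y)) n := by
  induction n with
  | zero => simp [start, natsStr]
  | succ n ih =>
    obtain ⟨e, e'⟩ := ih fun i hi => h i (by omega)
    have hn := h n (by omega)
    rw [at_eq_zero, ← List.getElem?_drop] at hn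
    have hc : card (tripleWord (u, u', y)) n =
        ((y.drop (start (tripleWord (u, u', y)) n)).takeWhile id).length := run_tripleWord _
    rw [List.range_succ, List.map_append, natsStr, List.flatMap_append, ← natsStr, List.append_assoc]
    constructor
    · conv_lhs => rw [e]
      congr 1
      rw [start, ← card, add_assoc, ← List.drop_drop, List.map_singleton, hc]
      rw [hc] at hn
      exact eq_of_takeWhile _ hn
    · rw [List.length_append, e', start, ← card]
      simp
      omega

/-- The arities of a signature, with sorts given by their positions. -/
def positions (σ : Signature) : ℕ × List (List ℕ) :=
  (σ.sorts.length, σ.rels.map fun R => R.2.map fun s => σ.sorts.idxOf s)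

/-- For arities of length at most `k` the cap has no effect, and the volume is the number of tuples
of the remaining entries. -/
theorem volume_eq (k : ℕ) (w : Word) (ar : List ℕ) (i : ℕ) (h : ar.length ≤ k) :
    volume k w ar i (ar.length - i) = ((ar.drop i).map (card w)).prod := by
  rw [volume, min_eq_left (by omega)]
  have : ∀ m ≤ ar.length - i, (Nat.rec 1 (fun q r => r * card w (ar.getD (i + q) 0)) m : ℕ) =
      (((ar.drop i).take m).map (card w)).prod := by
    intro m hm
    induction m with
    | zero => simp
    | succ m ih =>
      rw [List.take_add_one, List.map_append, List.prod_append, ← ih (by omega),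
        List.getElem?_drop, List.getElem?_eq_getElem (by omega)]
      simp only [Option.toList_some, List.map_cons, List.map_nil, List.prod_cons, List.prod_nil, mul_one]
      rw [List.getD_eq_getElem _ _ (by omega)]
  rw [this _ le_rfl, List.take_of_length_le (by simp)]

theorem volume_zero_eq (k : ℕ) (w : Word) (ar : List ℕ) (h : ar.length ≤ k) :
    volume k w ar 0 ar.length = (ar.map (card w)).prod := volume_eq k w ar 0 h

variable {σ : Signature} {A : Struc} {k : ℕ}

theorem positions_getD {R : ℕ} (hR : R < σ.rels.length) :
    (positions σ).2.getD R [] = σ.rels[R].2.map fun s => σ.sorts.idxOf s := by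
  rw [positions, List.getD_eq_getElem _ _ (by simpa using hR), List.getElem_map]

theorem table_eq (w : Word) (hk : ∀ R ∈ σ.rels, R.2.length ≤ k) (n : ℕ) (hn : n ≤ σ.rels.length) :
    table k w (positions σ) n = start w σ.sorts.length +
      ((σ.rels.take n).map fun R => ((R.2.map fun s => σ.sorts.idxOf s).map (card w)).prod).sum := by
  rw [table]
  congr 1
  induction n with
  | zero => simp
  | succ n ih =>
    have hn' : n < σ.rels.length := by omega
    rw [Finset.sum_range_succ, ih (by omega), List.take_add_one, List.map_append, List.sum_append,
      List.getElem?_eq_getElem hn', positions_getD hn']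
    congr 1
    rw [volume_zero_eq _ _ _ (by simpa using hk _ (List.getElem_mem hn'))]
    simp

theorem card_idxOf (hy : y = A.encode σ) {s : ℕ} (hs : s ∈ σ.sorts) :
    card (tripleWord (u, u', y)) (σ.sorts.idxOf s) = A.card s := by
  have hi : σ.sorts.idxOf s < σ.sorts.length := List.idxOf_lt_length_of_mem hs
  rw [(card_eq hy _ (by simpa using hi)).1]
  simp

theorem start_eq (hy : y = A.encode σ) :
    start (tripleWord (u, u', y)) σ.sorts.length = (natsStr (σ.sorts.map A.card)).length := by
  have := (drop_start (u := u) (u' := u') hy σ.sorts.length (by simp)).2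
  rw [List.drop_of_length_le (by simp)] at this
  exact this

theorem prod_idxOf (hy : y = A.encode σ) {w : List ℕ} (hw : ∀ s ∈ w, s ∈ σ.sorts) :
    ((w.map fun s => σ.sorts.idxOf s).map (card (tripleWord (u, u', y)))).prod = (w.map A.card).prod := by
  rw [List.map_map]
  congr 1
  exact List.map_congr_left fun s hs => card_idxOf hy (hw s hs)

/-- The bit for a tuple lies behind the universe sizes, behind the tables of the preceding
relations, and at the lexicographic position of the tuple. Entries are reduced modulo the sizes of
the universes, so any numbers may be looked up. -/
theorem lookup_eq (hσ : σ.WellFormed) (hA : A.On σ) (hy : y = A.encode σ)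
    (hk : ∀ R ∈ σ.rels, R.2.length ≤ k) {R : ℕ} (hR : R < σ.rels.length) (f : ℕ → ℕ) :
    lookup k (tripleWord (u, u', y)) (positions σ) R f =
      A.rel σ.rels[R].1 ((List.range σ.rels[R].2.length).map fun p =>
        f p % A.card (σ.rels[R].2.getD p 0)) := by
  have hmem := List.getElem_mem hR
  have hw : ∀ R ∈ σ.rels, ∀ s ∈ R.2, s ∈ σ.sorts := fun R hR => hσ.arity_sorts R.1 R.2 hR
  obtain ⟨w, hwd⟩ : ∃ w, σ.rels[R].2 = w := ⟨_, rfl⟩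
  have hws : ∀ s ∈ w, s ∈ σ.sorts := hwd ▸ hw _ hmem
  have hwk : w.length ≤ k := hwd ▸ hk _ hmem
  obtain ⟨b, hb⟩ : ∃ b, (List.range w.length).map (fun p => f p % A.card (w.getD p 0)) = b := ⟨_, rfl⟩
  have hbF : List.Forall₂ (fun x s => x < A.card s) b w := by
    rw [List.forall₂_iff_get]
    refine ⟨by simp [← hb], fun i h1 h2 => ?_⟩
    simp only [← hb, List.get_eq_getElem, List.getElem_map, List.getElem_range]
    rw [List.getD_eq_getElem _ _ h2]
    exact Nat.mod_lt _ (hA _ (hws _ (List.getElem_mem h2)))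
  obtain ⟨hlt, hget⟩ := getElem?_tuples hbF
  rw [lookup, positions_getD hR, hwd, hb, Bool.eq_iff_iff, decide_eq_true_eq, at_eq_one,
    table_eq _ hk R hR.le, start_eq hy]
  have es : ((σ.rels.take R).map fun R => ((R.2.map fun s => σ.sorts.idxOf s).map
      (card (tripleWord (u, u', y)))).prod) =
      (σ.rels.take R).map fun R => ((tuples A.card R.2).map (A.rel R.1)).length := by
    refine List.map_congr_left fun S hS => ?_
    rw [prod_idxOf hy (hw S (List.mem_of_mem_take hS)), List.length_map, length_tuples]
  -- The weight of an entry is the product of the sizes for the entries to its right, so the sum is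
  -- the lexicographic index.
  have ei : ∑ p ∈ Finset.range (w.map fun s => σ.sorts.idxOf s).length,
      f p % card (tripleWord (u, u', y)) ((w.map fun s => σ.sorts.idxOf s).getD p 0) *
        volume k (tripleWord (u, u', y)) (w.map fun s => σ.sorts.idxOf s) (p + 1)
          ((w.map fun s => σ.sorts.idxOf s).length - (p + 1)) = tupleIndex A.card w b := by
    rw [← hb, tupleIndex_eq_sum, List.length_map]
    refine Finset.sum_congr rfl fun p hp => ?_
    rw [Finset.mem_range] at hp
    have := volume_eq k (tripleWord (u, u', y)) (w.map fun s => σ.sorts.idxOf s) (p + 1) (by simpa using hwk)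
    rw [List.length_map] at this
    rw [this, ← List.map_drop, prod_idxOf hy fun s hs => hws s (List.mem_of_mem_drop hs),
      List.getD_eq_getElem _ _ (by simpa using hp), List.getElem_map,
      card_idxOf hy (hws _ (List.getElem_mem hp)), List.getD_eq_getElem _ _ hp]
  rw [es, ei]
  conv_lhs => rw [hy, Struc.encode]
  rw [add_assoc, List.getElem?_append_right (by omega), Nat.add_sub_cancel_left,
    getElem?_flatMap_table _ _ _ hR _ (by rw [hwd]; simpa [length_tuples] using hlt), hwd,
    List.getElem?_map, hget]
  simp

theorem length_encode (A : Struc) (σ : Signature) : (A.encode σ).length =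
    (natsStr (σ.sorts.map A.card)).length + (σ.rels.map fun R => (R.2.map A.card).prod).sum := by
  simp [Struc.encode, List.length_flatMap, length_tuples]

theorem valid_encode (hσ : σ.WellFormed) (hA : A.On σ) (hy : y = A.encode σ)
    (hk : ∀ R ∈ σ.rels, R.2.length ≤ k) : valid k (tripleWord (u, u', y)) (positions σ) = true := by
  simp only [valid, Bool.and_eq_true, decide_eq_true_eq]
  refine ⟨fun i hi => ?_, ?_⟩
  · have hi : i < (σ.sorts.map A.card).length := by simpa [positions] using hi
    obtain ⟨h1, h2⟩ := card_eq (u := u) (u' := u') hy i hi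
    refine ⟨h2, ?_⟩
    rw [h1, List.getElem_map]
    exact hA _ (List.getElem_mem _)
  · have e : (positions σ).2.length = σ.rels.length := by simp [positions]
    rw [e, table_eq _ hk _ le_rfl, start_eq hy, prefixLen_tripleWord, List.take_length]
    have es : (σ.rels.map fun R => ((R.2.map fun s => σ.sorts.idxOf s).map
        (card (tripleWord (u, u', y)))).prod) = σ.rels.map fun R => (R.2.map A.card).prod :=
      List.map_congr_left fun S hS => prod_idxOf hy (hσ.arity_sorts S.1 S.2 hS)
    have hl := length_encode A σ
    rw [← hy] at hl
    rw [es, ← hl]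
    simp [tripleWord]
    omega

/-- The tests establish that the string starts with positive unary numbers, one for each sort, and
that the rest has exactly the total length of the tables. By `exists_tables`, nothing else is
required of an encoding. -/
theorem exists_struc (hσ : σ.WellFormed) (hk : ∀ R ∈ σ.rels, R.2.length ≤ k)
    (h : valid k (tripleWord (u, u', y)) (positions σ) = true) :
    ∃ A : Struc, A.On σ ∧ y = A.encode σ := by
  simp only [valid, Bool.and_eq_true, decide_eq_true_eq] at h
  obtain ⟨h1, h2⟩ := h
  have e : (positions σ).2.length = σ.rels.length := by simp [positions]
  rw [e, table_eq _ hk _ le_rfl, prefixLen_tripleWord, List.take_length] at h2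
  obtain ⟨h3, h4⟩ := eq_natsStr σ.sorts.length fun i hi => (h1 i hi).1
  let cd : ℕ → ℕ := fun s => card (tripleWord (u, u', y)) (σ.sorts.idxOf s)
  have es : σ.sorts.map cd = (List.range σ.sorts.length).map (card (tripleWord (u, u', y))) := by
    refine List.ext_getElem (by simp) fun i hi _ => ?_
    simp [cd, hσ.sorts_nodup.idxOf_getElem]
  have hl : (tripleWord (u, u', y)).length = u.length + u'.length + 1 + 1 + y.length := by
    simp [tripleWord]
    omega
  obtain ⟨rel, hrel⟩ := exists_tables cd σ.rels hσ.rels_nodup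
    (y.drop (start (tripleWord (u, u', y)) σ.sorts.length)) (by
      rw [List.length_drop]
      rw [hl] at h2
      simp only [List.map_map] at h2
      have : (σ.rels.map fun R => (R.2.map cd).prod) = σ.rels.map fun R =>
        (R.2.map (card (tripleWord (u, u', y)) ∘ fun s => σ.sorts.idxOf s)).prod := rfl
      rw [this]
      omega)
  refine ⟨⟨cd, rel⟩, fun s hs => (h1 _ (List.idxOf_lt_length_of_mem hs)).2, ?_⟩
  rw [Struc.encode]
  simp only
  rw [es, ← hrel]
  exact h3

end
end Reader

/-- The structure given by rules. -/
def ruleStruc (σ : Signature) (rules : List Rule) (cd : ℕ → ℕ) (lk : ℕ → (ℕ → ℕ) → Bool) (M N : ℕ) : Struc where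
  card _ := N
  rel R b := ruleBit cd lk M N (rules.getD ((σ.rels.map Prod.fst).idxOf R) ((0, false), [], []))
    fun p => b.getD p 0

theorem flatMap_eq_range {α β : Type} (l : List α) (f : α → List β) (g : ℕ → List β)
    (h : ∀ i (hi : i < l.length), g i = f l[i]) : (List.range l.length).flatMap g = l.flatMap f := by
  induction l generalizing g with
  | nil => rfl
  | cons x l ih =>
    rw [List.length_cons, List.range_succ_eq_map, List.flatMap_cons, List.flatMap_cons,
      h 0 (by simp), List.getElem_cons_zero, List.flatMap_map]
    congr 1
    exact ih _ fun i hi => by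
      rw [h (i + 1) (by simpa using hi), List.getElem_cons_succ]

/-- Within the arity bound the caps in `result` and `bit` have no effect, and the arguments of `bit`
are the digits of the position in the table. -/
theorem Reader.result_eq {k : ℕ} {w : Word} {P : Plan} {σ : Signature} (hσ : σ.WellFormed)
    (hk : ∀ R ∈ σ.rels, R.2.length ≤ k) (hs : P.2.1.1 = σ.sorts.length)
    (hr : P.2.2.length = σ.rels.length)
    (hl : ∀ i (hi : i < σ.rels.length), (P.2.2.getD i ((0, false), [], [])).1.1 = σ.rels[i].2.length)
    (hv : valid k w P.1 = true) :
    result k w P = (ruleStruc σ P.2.2 (card w) (lookup k w P.1) (total w P.1.1) (size w P)).encode σ := by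
  rw [result, hv, cond_true, Struc.encode, hs, hr]
  congr 1
  · rw [natsStr, List.flatMap_map]
    refine flatMap_eq_range _ _ _ fun i hi => ?_
    congr 1
    show _ = List.replicate (size w P) true
    generalize size w P = n
    induction n with
    | zero => rfl
    | succ n ih => rw [List.range_succ, List.flatMap_append, ih, List.replicate_succ']; rfl
  · refine flatMap_eq_range _ _ _ fun i hi => ?_
    have hlk := hk _ (List.getElem_mem hi)
    have hix : (σ.rels.map Prod.fst).idxOf σ.rels[i].1 = i := by
      have h1 : i < (σ.rels.map Prod.fst).length := by simpa using hi
      have := hσ.rels_nodup.idxOf_getElem i h1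
      rwa [List.getElem_map] at this
    show _ = (tuples (fun _ => size w P) σ.rels[i].2).map fun b => ruleBit (card w) (lookup k w P.1)
      (total w P.1.1) (size w P) (P.2.2.getD ((σ.rels.map Prod.fst).idxOf σ.rels[i].1) ((0, false), [], []))
        fun p => b.getD p 0
    rw [hix, tuples_const, List.map_map, hl i hi, min_eq_left hlk, ← List.map_eq_flatMap]
    refine List.map_congr_left fun j hj => ?_
    rw [Function.comp, bit, hl i hi]
    congr 1
    funext p
    rw [digitTuple]
    rcases Nat.lt_or_ge p σ.rels[i].2.length with hp | hp
    · rw [List.getD_eq_getElem _ _ (by simpa using hp), List.getElem_map, List.getElem_range,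
        min_eq_left (by omega), decide_eq_true hp, cond_true]
    · rw [List.getD_eq_default _ _ (by simpa using hp), decide_eq_false (by omega), cond_false]

end Accordion

namespace Accordion

/-! ### Layered formulas -/

namespace Formula

/-- The atoms, from left to right. -/
def atoms : Formula → List (ℕ × List Var)
  | atom R args => [(R, args)]
  | neg φ => φ.atoms
  | and φ ψ => φ.atoms ++ ψ.atoms
  | or φ ψ => φ.atoms ++ ψ.atoms
  | ex _ φ => φ.atoms
  | all _ φ => φ.atoms

theorem map_fst_atoms (φ : Formula) : φ.atoms.map Prod.fst = φ.symbols := by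
  induction φ <;> simp_all [atoms, symbols]

theorem atoms_ne_nil (φ : Formula) : φ.atoms ≠ [] := by
  induction φ <;> simp_all [atoms]

end Formula

section
variable {q : Quant} {L : List Formula} {χ : Formula}

theorem JunctionOf.ne_nil (h : JunctionOf q L χ) : L ≠ [] := by
  induction h <;> simp_all

theorem Quant.atoms_junct (q : Quant) (φ ψ : Formula) : (q.junct φ ψ).atoms = φ.atoms ++ ψ.atoms := by
  cases q <;> rfl

theorem Quant.free_junct (q : Quant) (φ ψ : Formula) : (q.junct φ ψ).free = φ.free ∪ ψ.free := by
  cases q <;> rfl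

theorem Quant.quantified_junct (q : Quant) (φ ψ : Formula) :
    (q.junct φ ψ).quantified = φ.quantified ++ ψ.quantified := by
  cases q <;> rfl

theorem Quant.atoms_binds (q : Quant) (V : List Var) (φ : Formula) : (q.binds V φ).atoms = φ.atoms := by
  induction V with
  | nil => rfl
  | cons v V ih => cases q <;> exact ih

theorem Quant.quantified_binds (q : Quant) (V : List Var) (φ : Formula) :
    (q.binds V φ).quantified = V ++ φ.quantified := by
  induction V with
  | nil => rfl
  | cons v V ih => cases q <;> exact congrArg (v :: ·) ih

theorem Quant.free_binds (q : Quant) (V : List Var) (φ : Formula) :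
    (q.binds V φ).free = φ.free \ V.toFinset := by
  induction V with
  | nil => simp [Quant.binds]
  | cons v V ih =>
    have : (q.binds (v :: V) φ).free = (q.binds V φ).free.erase v := by cases q <;> rfl
    rw [this, ih]
    ext x
    simp only [Finset.mem_erase, Finset.mem_sdiff, List.toFinset_cons, Finset.mem_insert]
    tauto

theorem JunctionOf.atoms (h : JunctionOf q L χ) : χ.atoms = L.flatMap Formula.atoms := by
  induction h with
  | single φ => simp
  | append _ _ h1 h2 => rw [Quant.atoms_junct, h1, h2, List.flatMap_append]

theorem JunctionOf.mem_free (h : JunctionOf q L χ) (v : Var) : v ∈ χ.free ↔ ∃ φ ∈ L, v ∈ φ.free := by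
  induction h with
  | single φ => simp
  | append _ _ h1 h2 =>
    rw [Quant.free_junct, Finset.mem_union, h1, h2]
    simp only [List.mem_append, or_and_right, exists_or]

theorem JunctionOf.quantified (h : JunctionOf q L χ) : χ.quantified = L.flatMap Formula.quantified := by
  induction h with
  | single φ => simp
  | append _ _ h1 h2 => rw [Quant.quantified_junct, h1, h2, List.flatMap_append]

/-- All atoms have the same set of variables. -/
def Uniform (θ : Formula) : Prop := ∀ a ∈ θ.atoms, a.2.toFinset = θ.free

/-- Without common variables to use there are no adjacent edges, and a connected graph without
adjacency has only one vertex. -/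
theorem EdgesConnected.eq_of_empty {E : Finset (Finset Var)} (h : EdgesConnected ∅ E) {e e' : Finset Var}
    (he : e ∈ E) (he' : e' ∈ E) : e = e' := by
  obtain ⟨w⟩ := h.preconnected ⟨e, he⟩ ⟨e', he'⟩
  rcases w with _ | ⟨hadj, _⟩
  · rfl
  · simp [SimpleGraph.fromRel_adj] at hadj

/-- In a quantifier-free layered formula all blocks have X = ∅, so connectedness makes the parts
have equal sets of free variables, down to the atoms. -/
theorem LayeredBy.uniform {θ : Formula} (h : LayeredBy q θ) (hθ : θ.quantified = []) : Uniform θ := by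
  induction h with
  | atom q R args => simp [Uniform, Formula.atoms, Formula.free]
  | negAtom q R args => simp [Uniform, Formula.atoms, Formula.free]
  | block q X L χ _ _ hc hj ih =>
    rw [Quant.quantified_binds, List.append_eq_nil_iff] at hθ
    obtain ⟨rfl, hχ⟩ := hθ
    rw [hj.quantified, List.flatMap_eq_nil_iff] at hχ
    intro a ha
    simp only [Quant.binds, List.foldr_nil] at ha ⊢
    rw [hj.atoms, List.mem_flatMap] at ha
    obtain ⟨φ, hφ, ha⟩ := ha
    rw [ih φ hφ (hχ φ hφ) a ha]
    ext v
    rw [hj.mem_free]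
    refine ⟨fun hv => ⟨φ, hφ, hv⟩, ?_⟩
    rintro ⟨ψ, hψ, hv⟩
    rwa [hc.eq_of_empty (e := φ.free) (e' := ψ.free)]
    · simpa using ⟨φ, hφ, rfl⟩
    · simpa using ⟨ψ, hψ, rfl⟩

/-- A labelling which is constant on overlapping atoms is constant, except possibly on atoms with the
same variables. -/
def Linked (V : List Var) (as : List (ℕ × List Var)) : Prop :=
  ∀ t : ℕ × List Var → ℕ, (∀ a ∈ as, ∀ b ∈ as, ∀ v ∈ V, v ∈ a.2 → v ∈ b.2 → t a = t b) →
    ∀ a ∈ as, ∀ b ∈ as, t a = t b ∨ a.2.toFinset = b.2.toFinset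

theorem Linked.mono {V V' : List Var} {as : List (ℕ × List Var)} (h : Linked V as) (hV : V ⊆ V') :
    Linked V' as :=
  fun t ht => h t fun a ha b hb v hv => ht a ha b hb v (hV hv)

/-- Follow a walk between the variable sets of two atoms. Each step passes through a variable in `X`
common to consecutive atoms and so preserves the label. Only a walk of length zero gives no
equality, and then the two sets coincide. -/
theorem linked_of_edgesConnected {X : List Var} {L : List Formula} (hL : ∀ φ ∈ L, Uniform φ)
    (hc : EdgesConnected X.toFinset (L.map Formula.free).toFinset) :
    Linked X (L.flatMap Formula.atoms) := by
  intro t ht a ha b hb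
  obtain ⟨φ, hφ, ha'⟩ := List.mem_flatMap.1 ha
  have hmem : ∀ a ∈ L.flatMap Formula.atoms, a.2.toFinset ∈ (L.map Formula.free).toFinset := by
    intro a ha
    obtain ⟨φ, hφ, ha'⟩ := List.mem_flatMap.1 ha
    rw [hL φ hφ a ha']
    simpa using ⟨φ, hφ, rfl⟩
  obtain ⟨w⟩ := hc.preconnected ⟨_, hmem b hb⟩ ⟨_, hmem a ha⟩
  generalize hx : (⟨_, hmem a ha⟩ : {e // e ∈ (L.map Formula.free).toFinset}) = x at w
  generalize hy : (⟨_, hmem b hb⟩ : {e // e ∈ (L.map Formula.free).toFinset}) = y at w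
  replace hx := congrArg Subtype.val hx
  replace hy := congrArg Subtype.val hy
  simp only at hx hy
  clear ha' hφ
  induction w generalizing b with
  | nil => exact Or.inr (hx.trans hy.symm)
  | @cons u v w hadj p ih =>
    have hadj' : (X.toFinset ∩ u.1 ∩ v.1).Nonempty := by
      rw [SimpleGraph.fromRel_adj] at hadj
      rcases hadj.2 with h | h
      · exact h
      · rwa [Finset.inter_right_comm] at h
    obtain ⟨y, hy'⟩ := hadj'
    simp only [Finset.mem_inter, List.mem_toFinset] at hy'
    obtain ⟨ψ, hψ, hv⟩ : ∃ ψ ∈ L, ψ.free = v.1 := by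
      have := v.2
      rwa [List.mem_toFinset, List.mem_map] at this
    obtain ⟨c, hc'⟩ := List.exists_mem_of_ne_nil _ ψ.atoms_ne_nil
    have hcL : c ∈ L.flatMap Formula.atoms := List.mem_flatMap.2 ⟨ψ, hψ, hc'⟩
    have hcv : c.2.toFinset = v.1 := by rw [← hv, hL ψ hψ c hc']
    have hyb : y ∈ b.2 := by
      rw [← List.mem_toFinset, hy]
      exact hy'.1.2
    have hyc : y ∈ c.2 := by
      rw [← List.mem_toFinset, hcv]
      exact hy'.2
    have e := ht b hb c hcL y hy'.1.1 hyb hyc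
    rcases ih c hcL hx hcv with h | h
    · exact Or.inl (h.trans e.symm)
    -- The rest of the walk only showed that `a` and `c` have the same variables. Then `a` contains
    -- `y` as well, and shares it with `b`.
    · have hya : y ∈ a.2 := by
        rw [← List.mem_toFinset, h, List.mem_toFinset]
        exact hyc
      exact Or.inl (ht a ha b hb y hy'.1.1 hya hyb)

/-- Since `χ` has no quantifiers, `V` exhausts the quantifiers of the formula, and `X` is an initial
segment of it. -/
theorem Quant.binds_eq {q : Quant} {V X : List Var} {χ χ' : Formula} (hχ : χ.quantified = [])
    (h : q.binds V χ = q.binds X χ') : ∃ V', V = X ++ V' ∧ χ' = q.binds V' χ := by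
  induction X generalizing V with
  | nil => exact ⟨V, rfl, h.symm⟩
  | cons x X ih =>
    rcases V with _ | ⟨v, V⟩
    · have := congrArg Formula.quantified h
      rw [quantified_binds, quantified_binds, hχ] at this
      simp at this
    · have : v = x ∧ q.binds V χ = q.binds X χ' := by
        cases q
        · simpa [Quant.binds, Quant.bind] using h
        · simpa [Quant.binds, Quant.bind] using h
      obtain ⟨V', rfl, h'⟩ := ih this.2
      exact ⟨V', by rw [this.1]; rfl, h'⟩

theorem JunctionOf.of_binds {q' : Quant} {V : List Var} (hV : V ≠ []) (h : JunctionOf q' L (q.binds V χ)) :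
    L = [q.binds V χ] := by
  generalize hθ : q.binds V χ = θ at h
  cases h with
  | single => rfl
  | append h1 h2 =>
    exfalso
    rcases V with _ | ⟨v, V⟩
    · exact hV rfl
    · cases q <;> cases q' <;> simp [Quant.binds, Quant.bind, Quant.junct] at hθ

/-- The quantifiers V need not come from one step of the layered construction, since a block may
have a single part which starts with the same quantifier. Outer steps of this kind only enlarge V.
The innermost one connects the quantifier-free parts, which are uniform. -/
theorem LayeredBy.linked {q' : Quant} {θ : Formula} (h : LayeredBy q' θ) {V : List Var} (hχ : χ.quantified = [])
    (hθ : θ = q.binds V χ) : Linked V θ.atoms := by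
  have huni : ∀ V : List Var, ∀ as : List (ℕ × List Var), (∀ a ∈ as, ∀ b ∈ as, a.2.toFinset = b.2.toFinset) →
      Linked V as := fun V as h t _ a ha b hb => Or.inr (h a ha b hb)
  induction h generalizing V with
  | atom _ R args => exact huni _ _ (by simp [Formula.atoms])
  | negAtom _ R args => exact huni _ _ (by simp [Formula.atoms])
  | block q' X L χ' hl hs hc hj ih =>
    rcases eq_or_ne V [] with rfl | hV
    · have := LayeredBy.uniform (.block q' X L χ' hl hs hc hj) (by rw [hθ]; exact hχ)
      exact huni _ _ fun a ha b hb => (this a ha).trans (this b hb).symm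
    · rcases X with _ | ⟨x, X⟩
      · change χ' = _ at hθ
        subst hθ
        have e := hj.of_binds hV
        exact ih (q.binds V χ) (by rw [e]; simp) rfl
      · have hq : q' = q := by
          rcases V with _ | ⟨v, V⟩
          · exact absurd rfl hV
          · cases q <;> cases q' <;> simp [Quant.binds, Quant.bind] at hθ ⊢
        subst hq
        obtain ⟨V', rfl, rfl⟩ := Quant.binds_eq hχ hθ.symm
        rw [Quant.atoms_binds]
        rcases eq_or_ne V' [] with rfl | hV'
        · change JunctionOf q' L χ at hj
          rw [List.append_nil]
          change Linked _ χ.atoms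
          rw [hj.atoms]
          rw [hj.quantified, List.flatMap_eq_nil_iff] at hχ
          exact linked_of_edgesConnected (fun φ hφ => (hl φ hφ).uniform (hχ φ hφ)) hc
        · have e := hj.of_binds hV'
          refine (ih _ (by rw [e]; simp) rfl).mono ?_
          exact List.subset_append_right _ _

theorem SimpleForm.linked {V : List Var} {φ : Formula} (h : SimpleForm q V φ) : Linked V φ.atoms := by
  obtain ⟨⟨_, _, _, _, hl⟩, L, χ, hL, hj, rfl⟩ := h
  refine hl.linked ?_ rfl
  rw [hj.quantified, List.flatMap_eq_nil_iff]
  intro φ hφ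
  obtain ⟨R, args, rfl⟩ := hL φ hφ
  rfl

end

/-! ### Satisfaction -/

/-- The claim for `∃`, its negation for `∀`. -/
def Quant.flip : Quant → Prop → Prop
  | .ex, P => P
  | .all, P => ¬ P

theorem sat_congr (A : Struc) (φ : Formula) {g h : Var → ℕ} (hgh : ∀ v ∈ φ.free, g v = h v) :
    φ.Sat A g ↔ φ.Sat A h := by
  induction φ generalizing g h with
  | atom R args =>
    simp only [Formula.Sat]
    rw [List.map_congr_left fun v hv => hgh v (by simpa [Formula.free] using hv)]
  | neg φ ih => exact not_congr (ih hgh)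
  | and φ ψ ih1 ih2 =>
    exact and_congr (ih1 fun v hv => hgh v (Finset.mem_union_left _ hv))
      (ih2 fun v hv => hgh v (Finset.mem_union_right _ hv))
  | or φ ψ ih1 ih2 =>
    exact or_congr (ih1 fun v hv => hgh v (Finset.mem_union_left _ hv))
      (ih2 fun v hv => hgh v (Finset.mem_union_right _ hv))
  | ex v φ ih =>
    refine exists_congr fun a => and_congr_right fun _ => ih fun x hx => ?_
    rcases eq_or_ne x v with rfl | hne
    · simp
    · rw [Function.update_of_ne hne, Function.update_of_ne hne]
      exact hgh x (Finset.mem_erase.2 ⟨hne, hx⟩)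
  | all v φ ih =>
    refine forall_congr' fun a => imp_congr_right fun _ => ih fun x hx => ?_
    rcases eq_or_ne x v with rfl | hne
    · simp
    · rw [Function.update_of_ne hne, Function.update_of_ne hne]
      exact hgh x (Finset.mem_erase.2 ⟨hne, hx⟩)

/-- Under `flip` a universal quantifier becomes the search for a counterexample, so that both
quantifiers take the existential form. -/
theorem flip_bind (q : Quant) (B : Struc) (g : Var → ℕ) (v : Var) (χ : Formula) :
    q.flip ((q.bind v χ).Sat B g) ↔
      ∃ a < B.card v.2, q.flip (χ.Sat B (Function.update g v a)) := by
  cases q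
  · rfl
  · simp [Quant.flip, Quant.bind, Formula.Sat]

theorem flip_binds (q : Quant) (B : Struc) (g : Var → ℕ) (V : List Var) (χ : Formula) :
    q.flip ((q.binds V χ).Sat B g) ↔ ∃ g' : Var → ℕ, (∀ v ∉ V, g' v = g v) ∧
      (∀ v ∈ V, g' v < B.card v.2) ∧ q.flip (χ.Sat B g') := by
  induction V generalizing g with
  | nil =>
    constructor
    · intro h
      exact ⟨g, fun _ _ => rfl, by simp, h⟩
    · rintro ⟨g', h, -, h'⟩
      obtain rfl : g' = g := funext fun v => h v (by simp)
      exact h'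
  | cons v V ih =>
    rw [show q.binds (v :: V) χ = q.bind v (q.binds V χ) from rfl, flip_bind]
    simp only [ih]
    constructor
    · rintro ⟨a, ha, g', h1, h2, h3⟩
      refine ⟨g', fun x hx => ?_, fun x hx => ?_, h3⟩
      · rw [List.mem_cons, not_or] at hx
        rw [h1 x hx.2, Function.update_of_ne hx.1]
      · by_cases hxV : x ∈ V
        · exact h2 x hxV
        · obtain rfl : x = v := by simpa [hxV] using hx
          rw [h1 x hxV, Function.update_self]
          exact ha
    · rintro ⟨g', h1, h2, h3⟩
      refine ⟨g' v, h2 v (by simp), g', fun x hx => ?_, fun x hx => h2 x (by simp [hx]), h3⟩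
      rcases eq_or_ne x v with rfl | hne
      · simp
      · rw [Function.update_of_ne hne]
        exact h1 x (by simp [hne, hx])

theorem flip_junction {q : Quant} {L : List Formula} {χ : Formula} (h : JunctionOf q L χ) (B : Struc)
    (g : Var → ℕ) : q.flip (χ.Sat B g) ↔ ∀ α ∈ L, q.flip (α.Sat B g) := by
  induction h with
  | single φ => simp
  | append _ _ h1 h2 =>
    simp only [List.forall_mem_append, ← h1, ← h2]
    cases q
    · rfl
    · simp [Quant.flip, Quant.junct, Formula.Sat]

theorem flip_junction_dual {q : Quant} {L : List Formula} {χ : Formula} (h : JunctionOf q.dual L χ) (B : Struc)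
    (g : Var → ℕ) : q.flip (χ.Sat B g) ↔ ∃ α ∈ L, q.flip (α.Sat B g) := by
  induction h with
  | single φ => simp
  | append _ _ h1 h2 =>
    simp only [List.mem_append, or_and_right, exists_or, ← h1, ← h2]
    cases q
    · rfl
    · simp only [Quant.flip, Quant.junct, Quant.dual, Formula.Sat]
      tauto

theorem Quant.flip_iff (q : Quant) {P Q : Prop} : (q.flip P ↔ q.flip Q) ↔ (P ↔ Q) := by
  cases q
  · rfl
  · exact not_iff_not

end Accordion

namespace Accordion

/-! ### The rules for the pairs of sentences -/

/-- The symbols which have to be true for a formula to be equivalent to a subformula with the symbol `R₀`. -/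
def Formula.trues (R₀ : ℕ) : Formula → List ℕ
  | atom _ _ => []
  | neg φ => φ.trues R₀
  | and φ ψ => bif decide (R₀ ∈ φ.symbols) then ψ.symbols ++ φ.trues R₀ else φ.symbols ++ ψ.trues R₀
  | or φ ψ => bif decide (R₀ ∈ φ.symbols) then φ.trues R₀ else ψ.trues R₀
  | ex _ φ => φ.trues R₀
  | all _ φ => φ.trues R₀

theorem Formula.trues_subset {R₀ R : ℕ} {φ : Formula} (h : R ∈ φ.trues R₀) : R ∈ φ.symbols := by
  induction φ with
  | atom _ _ => simp [trues] at h
  | neg φ ih => exact ih h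
  | and φ ψ ih1 ih2 =>
    rw [trues] at h
    rw [symbols, List.mem_append]
    rcases hd : decide (R₀ ∈ φ.symbols) with _ | _ <;> rw [hd] at h <;>
      simp only [cond_true, cond_false, List.mem_append] at h <;> tauto
  | or φ ψ ih1 ih2 =>
    rw [trues] at h
    rw [symbols, List.mem_append]
    rcases hd : decide (R₀ ∈ φ.symbols) with _ | _ <;> rw [hd] at h <;>
      simp only [cond_true, cond_false] at h <;> tauto
  | ex v φ ih => exact ih h
  | all v φ ih => exact ih h

/-- The position of a relation symbol. -/
def relIdx (rels : List (ℕ × List ℕ)) (R : ℕ) : ℕ := (rels.map Prod.fst).idxOf R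

/-- The atom of a list with a given symbol. -/
def findAtom (as as' : List (ℕ × List Var)) (R : ℕ) : ℕ × List Var :=
  as'.getD ((as.map Prod.fst).idxOf R) (0, [])

/-- The rule for a sentence based on a formula with the atoms `as`; the atoms of the sentence are `as'`. -/
def basedRule (rels : List (ℕ × List ℕ)) (as as' : List (ℕ × List Var)) (tr : List ℕ)
    (r : ℕ × List ℕ) : Rule :=
  bif decide (r.1 ∈ as.map Prod.fst) then
    ((r.2.length, false), [], [([], [(relIdx rels (findAtom as as' r.1).1,
      (findAtom as as' r.1).2.map fun v => (findAtom as as r.1).2.idxOf v)])])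
  else ((r.2.length, decide (r.1 ∈ tr)), [], [])

/-- The clause for the atom `E(v₁, v₂)` and a relation which appears with the arguments `args`. -/
def pairClause (sorts : List ℕ) (rels : List (ℕ × List ℕ)) (len : ℕ) (args : List Var)
    (E : ℕ × List Var) : Clause :=
  (((List.range len).filter fun p => decide (args.getD p (0, 0) = E.2.getD 0 (0, 0))).map fun p =>
      (sorts.idxOf (E.2.getD 0 (0, 0)).2, p),
    ((List.range len).filter fun p => decide (args.getD p (0, 0) = E.2.getD 1 (0, 0))).map fun p =>
      (relIdx rels E.1, [len, p]))

/-- The rule for the replacement of a formula with the atoms `as` and the quantified variables `V`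
by a formula with the atoms `as'`. -/
def pairRule (sorts : List ℕ) (rels : List (ℕ × List ℕ)) (ng : Bool) (V : List Var)
    (as as' : List (ℕ × List Var)) (r : ℕ × List ℕ) : Rule :=
  bif decide (r.1 ∈ as.map Prod.fst) then
    ((r.2.length, ng),
      (List.range r.2.length).filter fun p => decide ((findAtom as as r.1).2.getD p (0, 0) ∈ V),
      as'.map (pairClause sorts rels r.2.length (findAtom as as r.1).2))
  else ((r.2.length, false), [], [([], [(relIdx rels r.1, List.range r.2.length)])])

section
variable {σ : Signature} {A : Struc} {cd : ℕ → ℕ} {lk : ℕ → (ℕ → ℕ) → Bool} {M N : ℕ}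

theorem lookup_atom (hσ : σ.WellFormed)
    (hlk : ∀ (R : ℕ) (hR : R < σ.rels.length) (f : ℕ → ℕ), lk R f =
      A.rel σ.rels[R].1 ((List.range σ.rels[R].2.length).map fun p => f p % A.card (σ.rels[R].2.getD p 0)))
    {R : ℕ} {args : List Var} (h : (R, args.map Prod.snd) ∈ σ.rels) (f : ℕ → ℕ) :
    lk (relIdx σ.rels R) f = A.rel R ((List.range args.length).map fun p =>
      f p % A.card (args.getD p (0, 0)).2) := by
  obtain ⟨i, hi, e⟩ := List.mem_iff_getElem.1 h
  have hix : relIdx σ.rels R = i := by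
    have h1 : i < (σ.rels.map Prod.fst).length := by simpa using hi
    have := hσ.rels_nodup.idxOf_getElem i h1
    rwa [List.getElem_map, e] at this
  rw [hix, hlk i hi, e]
  simp only [List.length_map]
  congr 1
  refine List.map_congr_left fun p hp => ?_
  rw [List.mem_range] at hp
  rw [List.getD_eq_getElem _ _ (by simpa using hp), List.getD_eq_getElem _ _ hp, List.getElem_map]

/-- The rule which copies a relation. -/
theorem ruleBit_copy (hσ : σ.WellFormed)
    (hlk : ∀ (R : ℕ) (hR : R < σ.rels.length) (f : ℕ → ℕ), lk R f =
      A.rel σ.rels[R].1 ((List.range σ.rels[R].2.length).map fun p => f p % A.card (σ.rels[R].2.getD p 0)))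
    {R : ℕ} {args' : List Var} (h : (R, args'.map Prod.snd) ∈ σ.rels) (hM : 0 < M) (hN : 0 < N)
    {args : List Var} {len : ℕ} (hlen : args.length = len) {ps : List ℕ} (hps : ps.length = args'.length)
    (hp : ∀ p (hp : p < args'.length), ps.getD p 0 < len ∧ args.getD (ps.getD p 0) (0, 0) = args'[p])
    (g : Var → ℕ) :
    ruleBit cd lk M N ((len, false), [], [([], [(relIdx σ.rels R, ps)])]) (fun p => (args.map g).getD p 0) =
      A.rel R (args'.map fun v => g v % A.card v.2) := by
  have e : ∀ c, lk (relIdx σ.rels R) (fun q => bif decide (ps.getD q 0 < len) then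
      (args.map g).getD (ps.getD q 0) 0 else c) = A.rel R (args'.map fun v => g v % A.card v.2) := by
    intro c
    rw [lookup_atom hσ hlk h]
    congr 1
    refine List.ext_getElem (by simp) fun p h1 h2 => ?_
    have hp' : p < args'.length := by simpa using h2
    obtain ⟨k1, k2⟩ := hp p hp'
    simp only [List.getElem_map, List.getElem_range]
    have k3 : ps.getD p 0 < args.length := hlen ▸ k1
    have k4 : (args.map g).getD (ps.getD p 0) 0 = g args'[p] := by
      rw [List.getD_eq_getElem _ _ (by rwa [List.length_map]), List.getElem_map, ← k2,
        List.getD_eq_getElem _ _ k3]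
    rw [decide_eq_true k1, cond_true, k4, List.getD_eq_getElem _ _ hp']
  rw [Bool.eq_iff_iff]
  simp only [ruleBit, Bool.false_bne, decide_eq_true_eq, List.all_nil, Bool.true_and, Bool.and_eq_true,
    clauseHolds, Bool.false_xor]
  constructor
  · rintro ⟨t, ht, h1, h2⟩
    have h0 : t / M = 0 := by simpa using h1
    rw [h0] at h2
    simp only [List.getD_cons_zero, List.all_nil, Bool.true_and, List.all_cons, Bool.and_true] at h2
    rw [← e]
    exact h2.2
  · intro hA
    refine ⟨0, hN, by simp, ?_⟩
    simp only [Nat.zero_div, List.getD_cons_zero, List.all_nil, Bool.true_and, List.all_cons, Bool.and_true]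
    rw [← e] at hA
    exact ⟨trivial, hA⟩

end

theorem Formula.Over.mem_rels {σ : Signature} {φ : Formula} (h : φ.Over σ) {a : ℕ × List Var}
    (ha : a ∈ φ.atoms) : (a.1, a.2.map Prod.snd) ∈ σ.rels := by
  induction φ with
  | atom R args =>
    obtain rfl : a = (R, args) := by simpa [atoms] using ha
    exact h
  | neg φ ih => exact ih h ha
  | and φ ψ ih1 ih2 =>
    rw [atoms, List.mem_append] at ha
    exact ha.elim (ih1 h.1) (ih2 h.2)
  | or φ ψ ih1 ih2 =>
    rw [atoms, List.mem_append] at ha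
    exact ha.elim (ih1 h.1) (ih2 h.2)
  | ex v φ ih => exact ih h.2 ha
  | all v φ ih => exact ih h.2 ha


theorem Formula.Over.quantified {σ : Signature} {φ : Formula} (h : φ.Over σ) {v : Var}
    (hv : v ∈ φ.quantified) : v.2 ∈ σ.sorts := by
  induction φ with
  | atom R args => simp [Formula.quantified] at hv
  | neg φ ih => exact ih h hv
  | and φ ψ ih1 ih2 =>
    rw [Formula.quantified, List.mem_append] at hv
    exact hv.elim (ih1 h.1) (ih2 h.2)
  | or φ ψ ih1 ih2 =>
    rw [Formula.quantified, List.mem_append] at hv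
    exact hv.elim (ih1 h.1) (ih2 h.2)
  | ex v φ ih =>
    rcases List.mem_cons.1 hv with rfl | hv
    · exact h.1
    · exact ih h.2 hv
  | all v φ ih =>
    rcases List.mem_cons.1 hv with rfl | hv
    · exact h.1
    · exact ih h.2 hv

theorem Formula.mem_symbols {φ : Formula} {R : ℕ} : R ∈ φ.symbols ↔ ∃ args, (R, args) ∈ φ.atoms := by
  rw [← map_fst_atoms]
  simp

/-- As symbols are not repeated, the symbol of an atom determines its position, and so the
corresponding atom in the other list. -/
theorem findAtom_eq {as as' : List (ℕ × List Var)} (hn : (as.map Prod.fst).Nodup) {a a' : ℕ × List Var}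
    (h : (a, a') ∈ as.zip as') : findAtom as as a.1 = a ∧ findAtom as as' a.1 = a' := by
  obtain ⟨i, hi, e⟩ := List.mem_iff_getElem.1 h
  rw [List.length_zip] at hi
  have h1 : i < as.length := by omega
  have h2 : i < as'.length := by omega
  rw [List.getElem_zip, Prod.mk.injEq] at e
  have hix : (as.map Prod.fst).idxOf a.1 = i := by
    have h1 : i < (as.map Prod.fst).length := by simpa using h1
    have := hn.idxOf_getElem i h1
    rwa [List.getElem_map, e.1] at this
  rw [findAtom, findAtom, hix, List.getD_eq_getElem _ _ h1, List.getD_eq_getElem _ _ h2]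
  exact e

theorem mem_zip_self {α : Type} {l : List α} {a : α} (h : a ∈ l) : (a, a) ∈ l.zip l := by
  induction l with
  | nil => simp at h
  | cons x l ih =>
    rcases List.mem_cons.1 h with rfl | h
    · simp
    · exact List.mem_cons_of_mem _ (ih h)

theorem Replaced.atoms_sublist {φ' ψ' φ ψ : Formula} (h : Replaced φ' ψ' φ ψ) :
    φ'.atoms.Sublist φ.atoms ∧ ψ'.atoms.Sublist ψ.atoms := by
  induction h with
  | here => exact ⟨.refl _, .refl _⟩
  | neg _ ih => exact ih
  | andLeft θ _ ih => exact ⟨ih.1.trans (List.sublist_append_left _ _), ih.2.trans (List.sublist_append_left _ _)⟩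
  | andRight θ _ ih => exact ⟨ih.1.trans (List.sublist_append_right _ _), ih.2.trans (List.sublist_append_right _ _)⟩
  | orLeft θ _ ih => exact ⟨ih.1.trans (List.sublist_append_left _ _), ih.2.trans (List.sublist_append_left _ _)⟩
  | orRight θ _ ih => exact ⟨ih.1.trans (List.sublist_append_right _ _), ih.2.trans (List.sublist_append_right _ _)⟩
  | ex v _ ih => exact ih
  | all v _ ih => exact ih

theorem AtomsRestricted.length_atoms {V : Finset Var} {θ θ' : Formula} (h : AtomsRestricted V θ θ') :
    θ.atoms.length = θ'.atoms.length := by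
  induction h <;> simp_all [Formula.atoms]

/-! ### Transfer of satisfaction between the two structures. -/

section
variable {A B : Struc}

/-- Corresponding atoms have the same truth value. -/
def AtomsAgree (A B : Struc) (a a' : ℕ × List Var) : Prop :=
  ∀ g : Var → ℕ, B.rel a.1 (a.2.map g) = A.rel a'.1 (a'.2.map fun v => g v % A.card v.2)

theorem update_mod (A : Struc) (g : Var → ℕ) (v : Var) (a : ℕ) :
    (fun x => Function.update g v a x % A.card x.2) =
      Function.update (fun x => g x % A.card x.2) v (a % A.card v.2) := by
  funext x
  rcases eq_or_ne x v with rfl | hne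
  · simp
  · simp [Function.update_of_ne hne]

theorem exists_lt_mod {n N : ℕ} (hn : 0 < n) (hN : n ≤ N) (P : ℕ → Prop) :
    (∃ a < N, P (a % n)) ↔ ∃ a < n, P a :=
  ⟨fun ⟨a, _, h⟩ => ⟨a % n, Nat.mod_lt _ hn, h⟩, fun ⟨a, ha, h⟩ =>
    ⟨a, ha.trans_le hN, by rwa [Nat.mod_eq_of_lt ha]⟩⟩

/-- Values in the larger universes of `B` are read modulo the sizes of those of `A`. Reduction is
onto, so the quantifiers range over the same elements of `A`; atoms agree by assumption. -/
theorem sat_of_restricted {V : Finset Var} {θ θ' : Formula} (h : AtomsRestricted V θ θ')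
    (ha : ∀ p ∈ θ.atoms.zip θ'.atoms, AtomsAgree A B p.1 p.2)
    (hq : ∀ v ∈ θ.quantified, 0 < A.card v.2 ∧ A.card v.2 ≤ B.card v.2) (g : Var → ℕ) :
    θ.Sat B g ↔ θ'.Sat A fun v => g v % A.card v.2 := by
  induction h generalizing g with
  | atom R R' args args' h =>
    have := ha ((R, args), (R', args')) (by simp [Formula.atoms]) g
    simp only [Formula.Sat, this]
  | neg h ih => exact not_congr (ih ha hq g)
  | and h1 h2 ih1 ih2 =>
    rw [Formula.atoms, Formula.atoms, List.zip_append h1.length_atoms] at ha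
    simp only [Formula.quantified, List.forall_mem_append] at ha hq
    exact and_congr (ih1 ha.1 hq.1 g) (ih2 ha.2 hq.2 g)
  | or h1 h2 ih1 ih2 =>
    rw [Formula.atoms, Formula.atoms, List.zip_append h1.length_atoms] at ha
    simp only [Formula.quantified, List.forall_mem_append] at ha hq
    exact or_congr (ih1 ha.1 hq.1 g) (ih2 ha.2 hq.2 g)
  | @ex v φ ψ h ih =>
    simp only [Formula.quantified, List.forall_mem_cons] at hq
    simp only [Formula.Sat, ih ha hq.2, update_mod]
    exact exists_lt_mod hq.1.1 hq.1.2 fun a => ψ.Sat A (Function.update _ v a)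
  | @all v φ ψ h ih =>
    simp only [Formula.quantified, List.forall_mem_cons] at hq
    simp only [Formula.Sat, ih ha hq.2, update_mod]
    have := not_congr (exists_lt_mod hq.1.1 hq.1.2 fun a =>
      ¬ ψ.Sat A (Function.update (fun x => g x % A.card x.2) v a))
    simpa using this

theorem AtomsRestricted.refl (V : Finset Var) (θ : Formula) (h : ∀ a ∈ θ.atoms, ∀ v ∈ a.2, v ∈ V) :
    AtomsRestricted V θ θ := by
  induction θ with
  | atom R args =>
    refine .atom _ _ _ _ ?_
    ext v
    have := h (R, args) (by simp [Formula.atoms]) v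
    simp only [List.mem_toFinset, Finset.mem_inter]
    tauto
  | neg φ ih => exact .neg (ih h)
  | and φ ψ ih1 ih2 =>
    simp only [Formula.atoms, List.forall_mem_append] at h
    exact .and (ih1 h.1) (ih2 h.2)
  | or φ ψ ih1 ih2 =>
    simp only [Formula.atoms, List.forall_mem_append] at h
    exact .or (ih1 h.1) (ih2 h.2)
  | ex v φ ih => exact .ex v (ih h)
  | all v φ ih => exact .all v (ih h)

theorem sat_of_agree {θ : Formula} (ha : ∀ a ∈ θ.atoms, AtomsAgree A B a a)
    (hq : ∀ v ∈ θ.quantified, 0 < A.card v.2 ∧ A.card v.2 ≤ B.card v.2) (g : Var → ℕ) :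
    θ.Sat B g ↔ θ.Sat A fun v => g v % A.card v.2 := by
  refine sat_of_restricted (AtomsRestricted.refl (θ.atoms.flatMap Prod.snd).toFinset θ fun a ha v hv => ?_)
    (fun p hp => ?_) hq g
  · exact List.mem_toFinset.2 (List.mem_flatMap.2 ⟨a, ha, hv⟩)
  · obtain ⟨i, hi, e⟩ := List.mem_iff_getElem.1 hp
    rw [List.getElem_zip] at e
    rw [← e]
    exact ha _ (List.getElem_mem _)

/-- A positive formula with only true atoms is true, and dually, with only false atoms, false.
Universes must be non-empty for a witness of ∃ here, and for an instance of ∀ in the dual. -/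
theorem sat_of_true {θ : Formula} (hp : θ.Positive) (hB : ∀ s, 0 < B.card s)
    (h : ∀ R ∈ θ.symbols, ∀ b, B.rel R b = true) (g : Var → ℕ) : θ.Sat B g := by
  induction θ generalizing g with
  | atom R args => exact h R (by simp [Formula.symbols]) _
  | neg φ ih => exact hp.elim
  | and φ ψ ih1 ih2 =>
    simp only [Formula.symbols, List.forall_mem_append] at h
    exact ⟨ih1 hp.1 h.1 g, ih2 hp.2 h.2 g⟩
  | or φ ψ ih1 ih2 =>
    simp only [Formula.symbols, List.forall_mem_append] at h
    exact Or.inl (ih1 hp.1 h.1 g)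
  | ex v φ ih => exact ⟨0, hB _, ih hp h _⟩
  | all v φ ih => exact fun a _ => ih hp h _

theorem not_sat_of_false {θ : Formula} (hp : θ.Positive) (hB : ∀ s, 0 < B.card s)
    (h : ∀ R ∈ θ.symbols, ∀ b, B.rel R b = false) (g : Var → ℕ) : ¬ θ.Sat B g := by
  induction θ generalizing g with
  | atom R args =>
    rw [Formula.Sat, h R (by simp [Formula.symbols])]
    simp
  | neg φ ih => exact hp.elim
  | and φ ψ ih1 ih2 =>
    simp only [Formula.symbols, List.forall_mem_append] at h
    exact fun hs => ih1 hp.1 h.1 g hs.1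
  | or φ ψ ih1 ih2 =>
    simp only [Formula.symbols, List.forall_mem_append] at h
    exact fun hs => hs.elim (ih1 hp.1 h.1 g) (ih2 hp.2 h.2 g)
  | ex v φ ih => exact fun ⟨a, _, hs⟩ => ih hp h _ hs
  | all v φ ih => exact fun hs => ih hp h _ (hs 0 (hB _))

theorem Replaced.symbols_subset {φ' ψ' φ ψ : Formula} (h : Replaced φ' ψ' φ ψ) : φ'.symbols ⊆ φ.symbols := by
  rw [← Formula.map_fst_atoms, ← Formula.map_fst_atoms]
  exact (h.atoms_sublist.1.map _).subset

/-- On the way from `φ` to the occurrence of `φ'`, a sibling in a conjunction consists of true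
relations and one in a disjunction of false relations, so it has no influence. Quantifiers on the
way are vacuous, as `φ'` has a truth value `P` independent of the assignment. -/
theorem sat_of_subformula {φ' ψ' φ ψ : Formula} (h : Replaced φ' ψ' φ ψ) (hp : φ.Positive)
    (hn : φ.symbols.Nodup) (hB : ∀ s, 0 < B.card s) {R₀ : ℕ} (hR₀ : R₀ ∈ φ'.symbols)
    (hrel : ∀ R ∈ φ.symbols, R ∉ φ'.symbols → ∀ b, B.rel R b = decide (R ∈ φ.trues R₀)) {P : Prop}
    (hP : ∀ g, φ'.Sat B g ↔ P) (g : Var → ℕ) : φ.Sat B g ↔ P := by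
  induction h generalizing g with
  | here => exact hP g
  | neg _ _ => exact hp.elim
  | @andLeft φ ψ θ h ih =>
    rw [Formula.symbols, List.nodup_append] at hn
    have h0 : R₀ ∈ φ.symbols := h.symbols_subset hR₀
    simp only [Formula.trues, h0, decide_true, cond_true,
      List.mem_append] at hrel
    -- Looseness separates the symbols of the sibling from those around `φ'`, so they can be set
    -- independently.
    have hd : ∀ R ∈ φ.symbols, R ∉ θ.symbols := fun R hR hR' => hn.2.2 R hR R hR' rfl
    rw [Formula.Sat, ih hp.1 hn.1 (fun R hR hR' b => ?_) g, and_iff_left]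
    · refine sat_of_true hp.2 hB (fun R hR b => ?_) g
      rw [hrel R (by simp [Formula.symbols, hR]) (fun h' => hd R (h.symbols_subset h') hR)]
      simp [hR]
    · rw [hrel R (by simp [Formula.symbols, hR]) hR' b]
      simp [hd R hR]
  | @andRight φ ψ θ h ih =>
    rw [Formula.symbols, List.nodup_append] at hn
    have hd : ∀ R ∈ φ.symbols, R ∉ θ.symbols := fun R hR hR' => hn.2.2 R hR' R hR rfl
    have h0 : R₀ ∉ θ.symbols := hd R₀ (h.symbols_subset hR₀)
    simp only [Formula.trues, h0, decide_false, cond_false,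
      List.mem_append] at hrel
    rw [Formula.Sat, ih hp.2 hn.2.1 (fun R hR hR' b => ?_) g, and_iff_right]
    · refine sat_of_true hp.1 hB (fun R hR b => ?_) g
      rw [hrel R (by simp [Formula.symbols, hR]) (fun h' => hd R (h.symbols_subset h') hR)]
      simp [hR]
    · rw [hrel R (by simp [Formula.symbols, hR]) hR' b]
      simp [hd R hR]
  | @orLeft φ ψ θ h ih =>
    rw [Formula.symbols, List.nodup_append] at hn
    have h0 : R₀ ∈ φ.symbols := h.symbols_subset hR₀
    simp only [Formula.trues, h0, decide_true, cond_true] at hrel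
    have hd : ∀ R ∈ φ.symbols, R ∉ θ.symbols := fun R hR hR' => hn.2.2 R hR R hR' rfl
    rw [Formula.Sat, ih hp.1 hn.1 (fun R hR => hrel R (by simp [Formula.symbols, hR])) g, or_iff_left]
    refine not_sat_of_false hp.2 hB (fun R hR b => ?_) g
    rw [hrel R (by simp [Formula.symbols, hR]) (fun h' => hd R (h.symbols_subset h') hR)]
    have : R ∉ φ.trues R₀ := fun h' => hd R (Formula.trues_subset h') hR
    simp [this]
  | @orRight φ ψ θ h ih =>
    rw [Formula.symbols, List.nodup_append] at hn
    have hd : ∀ R ∈ φ.symbols, R ∉ θ.symbols := fun R hR hR' => hn.2.2 R hR' R hR rfl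
    have h0 : R₀ ∉ θ.symbols := hd R₀ (h.symbols_subset hR₀)
    simp only [Formula.trues, h0, decide_false, cond_false] at hrel
    rw [Formula.Sat, ih hp.2 hn.2.1 (fun R hR => hrel R (by simp [Formula.symbols, hR])) g, or_iff_right]
    refine not_sat_of_false hp.1 hB (fun R hR b => ?_) g
    rw [hrel R (by simp [Formula.symbols, hR]) (fun h' => hd R (h.symbols_subset h') hR)]
    have : R ∉ φ.trues R₀ := fun h' => hd R (Formula.trues_subset h') hR
    simp [this]
  | ex v h ih =>
    simp only [Formula.Sat, ih hp hn hrel]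
    exact ⟨fun ⟨_, _, h⟩ => h, fun h => ⟨0, hB _, h⟩⟩
  | all v h ih =>
    simp only [Formula.Sat, ih hp hn hrel]
    exact ⟨fun h => h 0 (hB _), fun h _ _ => h⟩

/-- Apart from the replaced place, the two formulas are identical and their atoms agree modulo the
sizes of universes. Since symbols are not repeated, atoms outside the occurrence do not involve the
symbols of `φ'`. -/
theorem sat_of_replaced {φ' ψ' φ ψ : Formula} (h : Replaced φ' ψ' φ ψ) (hn : φ.symbols.Nodup)
    (ha : ∀ a ∈ φ.atoms, a.1 ∉ φ'.symbols → a ∈ ψ.atoms → AtomsAgree A B a a)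
    (hq : ∀ v ∈ ψ.quantified, 0 < A.card v.2 ∧ A.card v.2 ≤ B.card v.2)
    (hP : ∀ g, φ'.Sat B g ↔ ψ'.Sat A fun v => g v % A.card v.2) (g : Var → ℕ) :
    φ.Sat B g ↔ ψ.Sat A fun v => g v % A.card v.2 := by
  induction h generalizing g with
  | here => exact hP g
  | neg h ih => exact not_congr (ih hn ha hq g)
  | andLeft θ h ih =>
    simp only [Formula.symbols, Formula.atoms, Formula.quantified, List.nodup_append,
      List.mem_append] at hn ha hq
    refine and_congr (ih hn.1 (fun a h1 h2 h3 => ha a (Or.inl h1) h2 (Or.inl h3)) (fun v hv => hq v (Or.inl hv)) g)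
      (sat_of_agree (fun a h1 => ha a (Or.inr h1) (fun h2 => ?_) (Or.inr h1)) (fun v hv => hq v (Or.inr hv)) g)
    exact hn.2.2 _ (h.symbols_subset h2) _ (Formula.mem_symbols.2 ⟨_, h1⟩) rfl
  | andRight θ h ih =>
    simp only [Formula.symbols, Formula.atoms, Formula.quantified, List.nodup_append,
      List.mem_append] at hn ha hq
    refine and_congr (sat_of_agree (fun a h1 => ha a (Or.inl h1) (fun h2 => ?_) (Or.inl h1)) (fun v hv => hq v (Or.inl hv)) g)
      (ih hn.2.1 (fun a h1 h2 h3 => ha a (Or.inr h1) h2 (Or.inr h3)) (fun v hv => hq v (Or.inr hv)) g)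
    exact hn.2.2 _ (Formula.mem_symbols.2 ⟨_, h1⟩) _ (h.symbols_subset h2) rfl
  | orLeft θ h ih =>
    simp only [Formula.symbols, Formula.atoms, Formula.quantified, List.nodup_append,
      List.mem_append] at hn ha hq
    refine or_congr (ih hn.1 (fun a h1 h2 h3 => ha a (Or.inl h1) h2 (Or.inl h3)) (fun v hv => hq v (Or.inl hv)) g)
      (sat_of_agree (fun a h1 => ha a (Or.inr h1) (fun h2 => ?_) (Or.inr h1)) (fun v hv => hq v (Or.inr hv)) g)
    exact hn.2.2 _ (h.symbols_subset h2) _ (Formula.mem_symbols.2 ⟨_, h1⟩) rfl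
  | orRight θ h ih =>
    simp only [Formula.symbols, Formula.atoms, Formula.quantified, List.nodup_append,
      List.mem_append] at hn ha hq
    refine or_congr (sat_of_agree (fun a h1 => ha a (Or.inl h1) (fun h2 => ?_) (Or.inl h1)) (fun v hv => hq v (Or.inl hv)) g)
      (ih hn.2.1 (fun a h1 h2 h3 => ha a (Or.inr h1) h2 (Or.inr h3)) (fun v hv => hq v (Or.inr hv)) g)
    exact hn.2.2 _ (Formula.mem_symbols.2 ⟨_, h1⟩) _ (h.symbols_subset h2) rfl
  | @ex v φ ψ h ih =>
    simp only [Formula.quantified, List.forall_mem_cons] at hq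
    simp only [Formula.Sat, ih hn ha hq.2, update_mod]
    exact exists_lt_mod hq.1.1 hq.1.2 fun a => ψ.Sat A (Function.update _ v a)
  | @all v φ ψ h ih =>
    simp only [Formula.quantified, List.forall_mem_cons] at hq
    simp only [Formula.Sat, ih hn ha hq.2, update_mod]
    have := not_congr (exists_lt_mod hq.1.1 hq.1.2 fun a =>
      ¬ ψ.Sat A (Function.update (fun x => g x % A.card x.2) v a))
    simpa using this

end
end Accordion

namespace Accordion

/-- The mark for `∀`. -/
def Quant.isAll : Quant → Bool
  | .ex => false
  | .all => true

theorem Quant.flip_xor (q : Quant) (b : Bool) :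
    ((q.isAll ^^ b) = true) ↔ q.flip (b = true) := by
  cases q <;> cases b <;> simp [Quant.flip, Quant.isAll]

theorem Quant.flip_flip (q : Quant) (P : Prop) [Decidable P] :
    q.flip ((q.isAll ^^ decide P) = true) ↔ P := by
  cases q <;> by_cases h : P <;> simp [Quant.flip, Quant.isAll, h]

theorem SimpleForm.quantified {q : Quant} {V : List Var} {φ : Formula} (h : SimpleForm q V φ) :
    φ.quantified = V := by
  obtain ⟨_, L, χ, hL, hj, rfl⟩ := h
  have : χ.quantified = [] := by
    rw [hj.quantified, List.flatMap_eq_nil_iff]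
    intro φ hφ
    obtain ⟨R, args, rfl⟩ := hL φ hφ
    rfl
  rw [Quant.quantified_binds, this, List.append_nil]

theorem SimpleForm.flip_sat {q : Quant} {V : List Var} {φ : Formula} (h : SimpleForm q V φ) (B : Struc)
    (g : Var → ℕ) : q.flip (φ.Sat B g) ↔ ∃ g' : Var → ℕ, (∀ v ∉ V, g' v = g v) ∧
      (∀ v ∈ V, g' v < B.card v.2) ∧ ∀ a ∈ φ.atoms, q.flip (B.rel a.1 (a.2.map g') = true) := by
  obtain ⟨_, L, χ, hL, hj, rfl⟩ := h
  rw [flip_binds, Quant.atoms_binds, hj.atoms]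
  simp only [flip_junction hj]
  refine exists_congr fun g' => and_congr_right fun _ => and_congr_right fun _ => ?_
  constructor
  · intro h a ha
    obtain ⟨α, hα, ha⟩ := List.mem_flatMap.1 ha
    obtain ⟨R, args, rfl⟩ := hL α hα
    obtain rfl : a = (R, args) := by simpa [Formula.atoms] using ha
    exact h _ hα
  · intro h α hα
    obtain ⟨R, args, rfl⟩ := hL α hα
    exact h (R, args) (List.mem_flatMap.2 ⟨_, hα, by simp [Formula.atoms]⟩)

theorem SimpleForm.mem_free {q : Quant} {V : List Var} {φ : Formula} (h : SimpleForm q V φ) {v : Var}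
    (hv : v ∈ φ.free) : v ∉ V ∧ ∃ a ∈ φ.atoms, v ∈ a.2 := by
  obtain ⟨_, L, χ, hL, hj, rfl⟩ := h
  rw [Quant.free_binds, Finset.mem_sdiff, hj.mem_free] at hv
  obtain ⟨⟨α, hα, hv⟩, hV⟩ := hv
  refine ⟨by simpa using hV, ?_⟩
  rw [Quant.atoms_binds, hj.atoms]
  obtain ⟨R, args, rfl⟩ := hL α hα
  exact ⟨(R, args), List.mem_flatMap.2 ⟨_, hα, by simp [Formula.atoms]⟩, by simpa [Formula.free] using hv⟩

/-! ### Correctness of the rule for replaced subformulas. -/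

section
variable {σ : Signature} {A B : Struc} {cd : ℕ → ℕ} {lk : ℕ → (ℕ → ℕ) → Bool} {M N : ℕ}

theorem List.getD_filter_range {len : ℕ} {P : ℕ → Bool} {Q : ℕ → Prop} :
    (∀ p ∈ (List.range len).filter P, Q p) ↔ ∀ p < len, P p = true → Q p := by
  simp [List.mem_filter]

/-- The tests range over the positions at which a variable of the pair occurs in the atom, and are
vacuous if it does not occur. The position `len` is out of range and thereby denotes the guess `c`.
-/
theorem clauseHolds_pairClause (hσ : σ.WellFormed) (hcd : ∀ s ∈ σ.sorts, cd (σ.sorts.idxOf s) = A.card s)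
    (hlk : ∀ (R : ℕ) (hR : R < σ.rels.length) (f : ℕ → ℕ), lk R f =
      A.rel σ.rels[R].1 ((List.range σ.rels[R].2.length).map fun p => f p % A.card (σ.rels[R].2.getD p 0)))
    (q : Quant) (e : ℕ × Var × Var) (he : (e.1, [e.2.1.2, e.2.2.2]) ∈ σ.rels) (args : List Var) (g : Var → ℕ)
    (c : ℕ) :
    clauseHolds cd lk q.isAll args.length (fun p => (args.map g).getD p 0) c
      (pairClause σ.sorts σ.rels args.length args (e.1, [e.2.1, e.2.2])) = true ↔
    (e.2.1 ∈ args → g e.2.1 % A.card e.2.1.2 = c) ∧ (e.2.2 ∈ args →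
      q.flip (A.rel e.1 [c % A.card e.2.1.2, g e.2.2 % A.card e.2.2.2] = true)) := by
  obtain ⟨E, v₁, v₂⟩ := e
  have hs := hσ.arity_sorts _ _ he
  simp only [List.mem_cons, List.not_mem_nil, or_false, forall_eq_or_imp, forall_eq] at hs
  have hget : ∀ p (hp : p < args.length), args.getD p (0, 0) = args[p] ∧ (args.map g).getD p 0 = g args[p] := by
    intro p hp
    rw [List.getD_eq_getElem _ _ hp, List.getD_eq_getElem _ _ (by simpa using hp), List.getElem_map]
    exact ⟨rfl, rfl⟩
  simp only [clauseHolds, pairClause, Bool.and_eq_true, List.all_eq_true, List.forall_mem_map,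
    List.getD_filter_range, decide_eq_true_eq, List.getD_cons_zero, List.getD_cons_succ, Quant.flip_xor]
  refine and_congr ?_ ?_
  · rw [hcd _ hs.1]
    constructor
    · intro h hv
      obtain ⟨p, hp, rfl⟩ := List.mem_iff_getElem.1 hv
      have := h p hp (hget p hp).1
      rwa [(hget p hp).2] at this
    · intro h p hp hv
      rw [(hget p hp).1] at hv
      rw [(hget p hp).2, hv]
      exact h (hv ▸ List.getElem_mem hp)
  · have key : ∀ p (hp : p < args.length), args[p] = v₂ → (lk (relIdx σ.rels E) fun q =>
        bif decide ([args.length, p].getD q 0 < args.length) then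
          (args.map g).getD ([args.length, p].getD q 0) 0 else c) =
        A.rel E [c % A.card v₁.2, g v₂ % A.card v₂.2] := by
      intro p hp hv
      rw [lookup_atom (args := [v₁, v₂]) hσ hlk (by simpa using he)]
      congr 1
      simp only [List.length_cons, List.length_nil, zero_add, Nat.reduceAdd,
        List.range_succ, List.range_zero, List.nil_append, List.cons_append, List.map_cons, List.map_nil,
        List.getD_cons_zero, List.getD_cons_succ, lt_irrefl, decide_false, cond_false, hp, decide_true,
        cond_true, (hget p hp).2, hv]
    constructor
    · intro h hv
      obtain ⟨p, hp, hv⟩ := List.mem_iff_getElem.1 hv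
      have := h p hp ((hget p hp).1.trans hv)
      rwa [key p hp hv] at this
    · intro h p hp hv
      rw [(hget p hp).1] at hv
      rw [key p hp hv]
      exact h (hv ▸ List.getElem_mem hp)

/-- For ∀ the negation mark of the rule cancels `flip`, so for both quantifiers the rule asks for a
common value `t` of the quantified entries of the atom whose clause, with index `t / M` and guess `t
% M`, is satisfied. -/
theorem flip_ruleBit_pair (hσ : σ.WellFormed) (hcd : ∀ s ∈ σ.sorts, cd (σ.sorts.idxOf s) = A.card s)
    (hlk : ∀ (R : ℕ) (hR : R < σ.rels.length) (f : ℕ → ℕ), lk R f =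
      A.rel σ.rels[R].1 ((List.range σ.rels[R].2.length).map fun p => f p % A.card (σ.rels[R].2.getD p 0)))
    (q : Quant) (V : List Var) (T : List (ℕ × Var × Var))
    (hT : ∀ e ∈ T, (e.1, [e.2.1.2, e.2.2.2]) ∈ σ.rels) (args : List Var) (g : Var → ℕ) :
    q.flip (ruleBit cd lk M N ((args.length, q.isAll),
      (List.range args.length).filter fun p => decide (args.getD p (0, 0) ∈ V),
      (T.map fun e => (e.1, [e.2.1, e.2.2])).map (pairClause σ.sorts σ.rels args.length args))
        (fun p => (args.map g).getD p 0) = true) ↔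
    ∃ t < N, (∀ v ∈ args, v ∈ V → g v = t) ∧ ∃ h : t / M < T.length,
      (T[t / M].2.1 ∈ args → g T[t / M].2.1 % A.card T[t / M].2.1.2 = t % M) ∧ (T[t / M].2.2 ∈ args →
        q.flip (A.rel T[t / M].1 [t % M % A.card T[t / M].2.1.2,
          g T[t / M].2.2 % A.card T[t / M].2.2.2] = true)) := by
  rw [ruleBit, Quant.flip_flip]
  refine exists_congr fun t => and_congr_right fun _ => ?_
  simp only [Bool.and_eq_true, List.all_eq_true, List.getD_filter_range, decide_eq_true_eq, List.length_map]
  refine and_congr ?_ ?_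
  · constructor
    · intro h v hv hV
      obtain ⟨p, hp, rfl⟩ := List.mem_iff_getElem.1 hv
      have := h p hp (by rwa [List.getD_eq_getElem _ _ hp])
      rwa [List.getD_eq_getElem _ _ (by simpa using hp), List.getElem_map] at this
    · intro h p hp hV
      rw [List.getD_eq_getElem _ _ hp] at hV
      rw [List.getD_eq_getElem _ _ (by simpa using hp), List.getElem_map]
      exact h _ (List.getElem_mem hp) hV
  · rw [← exists_prop]
    refine exists_congr fun hj => ?_
    rw [List.getD_eq_getElem _ _ (by simpa using hj), List.getElem_map, List.getElem_map]
    exact clauseHolds_pairClause hσ hcd hlk q _ (hT _ (List.getElem_mem hj)) args g _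

/-- The core of the construction, told for ∃. If all atoms hold, each has its own number `t`; shared
quantified variables and `Linked` reduce these to a single one. Its quotient selects a pair; an atom
with the first variable confirms the guess, and an atom with the second one provides the relation
for the guessed value. Conversely, a true disjunct with index `j` and first value `c` is coded as M
j + c in all quantified variables. -/
theorem sat_pair (hσ : σ.WellFormed) (hA : A.On σ) (hcd : ∀ s ∈ σ.sorts, cd (σ.sorts.idxOf s) = A.card s)
    (hlk : ∀ (R : ℕ) (hR : R < σ.rels.length) (f : ℕ → ℕ), lk R f =
      A.rel σ.rels[R].1 ((List.range σ.rels[R].2.length).map fun p => f p % A.card (σ.rels[R].2.getD p 0)))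
    (hM : ∀ s ∈ σ.sorts, A.card s ≤ M) {q : Quant} {V : List Var} {φ' ψ' : Formula}
    (hφ' : SimpleForm q V φ') (T : List (ℕ × Var × Var)) (hTF : ∀ e ∈ T, e.2.1 ∈ φ'.free ∧ e.2.2 ∈ φ'.free)
    (hψ' : JunctionOf q.dual (T.map fun t => Formula.atom t.1 [t.2.1, t.2.2]) ψ')
    (hT : ∀ e ∈ T, (e.1, [e.2.1.2, e.2.2.2]) ∈ σ.rels) (hN : T.length * M ≤ N) (hBN : ∀ s, B.card s = N)
    (hB : ∀ a ∈ φ'.atoms, ∀ g : Var → ℕ, B.rel a.1 (a.2.map g) =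
      ruleBit cd lk M N ((a.2.length, q.isAll),
      (List.range a.2.length).filter fun p => decide (a.2.getD p (0, 0) ∈ V),
      (T.map fun e => (e.1, [e.2.1, e.2.2])).map (pairClause σ.sorts σ.rels a.2.length a.2))
        (fun p => (a.2.map g).getD p 0)) (g : Var → ℕ) :
    φ'.Sat B g ↔ ψ'.Sat A fun v => g v % A.card v.2 := by
  rw [← q.flip_iff, hφ'.flip_sat, flip_junction_dual hψ']
  have hB' := fun (a : ℕ × List Var) (ha : a ∈ φ'.atoms) (g : Var → ℕ) =>
    (iff_of_eq (congrArg (fun x => q.flip (x = true)) (hB a ha g))).trans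
      (flip_ruleBit_pair (M := M) (N := N) hσ hcd hlk q V T hT a.2 g)
  simp only [List.mem_map, exists_exists_and_eq_and, Formula.Sat, List.map_cons, List.map_nil]
  constructor
  · rintro ⟨g', h1, h2, h3⟩
    -- Every atom comes with a number `t a` which is the value of all its quantified variables.
    have h4 := fun a : {a // a ∈ φ'.atoms} => (hB' a.1 a.2 g').1 (h3 a.1 a.2)
    choose t ht1 ht2 ht3 ht4 ht5 using h4
    obtain ⟨a₀, ha₀⟩ := List.exists_mem_of_ne_nil _ φ'.atoms_ne_nil
    have hlink := hφ'.linked (fun a => if h : a ∈ φ'.atoms then t ⟨a, h⟩ else 0) (by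
      intro a ha b hb v hv hva hvb
      simp only [dif_pos ha, dif_pos hb]
      rw [← ht2 ⟨a, ha⟩ v hva hv, ← ht2 ⟨b, hb⟩ v hvb hv])
    have hE := List.getElem_mem (ht3 ⟨a₀, ha₀⟩)
    have hj3 := ht3 ⟨a₀, ha₀⟩
    refine ⟨_, hE, ?_⟩
    -- A free variable occurs in an atom whose number is that of the fixed atom `a₀`: if its own
    -- atom has another number, that atom has the same variables as `a₀`, and `a₀` itself will do.
    have hor : ∀ v, v ∈ φ'.free → ∃ a : {a // a ∈ φ'.atoms}, v ∈ a.1.2 ∧ t a = t ⟨a₀, ha₀⟩ ∧ g' v = g v := by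
      intro v hv
      obtain ⟨hV, a, ha, hva⟩ := hφ'.mem_free hv
      have := hlink a ha a₀ ha₀
      simp only [dif_pos ha, dif_pos ha₀] at this
      rcases this with h | h
      · exact ⟨⟨a, ha⟩, hva, h, h1 v hV⟩
      · refine ⟨⟨a₀, ha₀⟩, ?_, rfl, h1 v hV⟩
        rw [← List.mem_toFinset, ← h, List.mem_toFinset]
        exact hva
    obtain ⟨a, hva, hta, hg⟩ := hor _ (hTF _ hE).1
    obtain ⟨b, hvb, htb, hg2⟩ := hor _ (hTF _ hE).2
    have k1 := ht4 a
    have k2 := ht5 b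
    simp only [hta] at k1
    simp only [htb] at k2
    have k1' := k1 hva
    have k2' := k2 hvb
    rw [hg] at k1'
    rw [hg2, ← k1', Nat.mod_mod] at k2'
    exact k2'
  · rintro ⟨e, he, h⟩
    obtain ⟨j, hj, hje⟩ := List.mem_iff_getElem.1 he
    have hs := hσ.arity_sorts _ _ (hT e he)
    simp only [List.mem_cons, List.not_mem_nil, or_false, forall_eq_or_imp, forall_eq] at hs
    -- The right guess is the element of `A` which the first variable of the pair stands for.
    obtain ⟨c, hc⟩ : ∃ c, g e.2.1 % A.card e.2.1.2 = c := ⟨_, rfl⟩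
    have hcA : c < A.card e.2.1.2 := hc ▸ Nat.mod_lt _ (hA _ hs.1)
    have hcM : c < M := hcA.trans_le (hM _ hs.1)
    have htN : M * j + c < N := by nlinarith
    have hdiv : (M * j + c) / M = j := by
      rw [Nat.mul_add_div (by omega), Nat.div_eq_of_lt hcM, add_zero]
    have hmod : (M * j + c) % M = c := by rw [Nat.mul_add_mod, Nat.mod_eq_of_lt hcM]
    -- All quantified variables receive the same value, and the free variables keep theirs, as they
    -- are not in `V`.
    classical
    have hg' : ∀ v ∈ φ'.free, (if v ∈ V then M * j + c else g v) = g v := fun v hv =>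
      if_neg (hφ'.mem_free hv).1
    refine ⟨fun v => if v ∈ V then M * j + c else g v, fun v hv => if_neg hv, fun v hv => ?_, fun a ha => ?_⟩
    · rw [hBN]
      simpa only [if_pos hv] using htN
    · refine (hB' a ha _).2 ⟨M * j + c, htN, fun v _ hV => if_pos hV, by rw [hdiv]; exact hj, ?_, ?_⟩
      · simp only [hdiv, hmod, hje]
        intro _
        rw [hg' _ (hTF e he).1, hc]
      · simp only [hdiv, hmod, hje]
        intro _
        rw [hg' _ (hTF e he).2, Nat.mod_eq_of_lt hcA, ← hc]
        exact h

theorem ruleStruc_rel (hσ : σ.WellFormed) (F : ℕ × List ℕ → Rule) {r : ℕ × List ℕ} (hr : r ∈ σ.rels)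
    (b : List ℕ) : (ruleStruc σ (σ.rels.map F) cd lk M N).rel r.1 b =
      ruleBit cd lk M N (F r) fun p => b.getD p 0 := by
  obtain ⟨i, hi, rfl⟩ := List.mem_iff_getElem.1 hr
  have hix : (σ.rels.map Prod.fst).idxOf σ.rels[i].1 = i := by
    have h1 : i < (σ.rels.map Prod.fst).length := by simpa using hi
    have := hσ.rels_nodup.idxOf_getElem i h1
    rwa [List.getElem_map] at this
  simp only [ruleStruc]
  rw [hix, List.getD_eq_getElem _ _ (by simpa using hi), List.getElem_map]

/-- Without clauses the existential part fails, so only the negation mark remains. -/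
theorem ruleBit_const (len : ℕ) (ng : Bool) (b : ℕ → ℕ) :
    ruleBit cd lk M N ((len, ng), [], []) b = ng := by
  have : ¬ ∃ t < N, ((([] : List ℕ).all fun p => decide (b p = t)) &&
    (decide (t / M < ([] : List Clause).length) &&
      clauseHolds cd lk ng len b (t % M) (([] : List Clause).getD (t / M) ([], [])))) = true := by simp
  simp only [ruleBit, this, decide_false, Bool.xor_false]

theorem AtomsRestricted.args {V : Finset Var} {θ θ' : Formula} (h : AtomsRestricted V θ θ') :
    ∀ p ∈ θ.atoms.zip θ'.atoms, p.2.2.toFinset = p.1.2.toFinset ∩ V := by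
  induction h with
  | atom R R' args args' h => simpa [Formula.atoms] using h
  | neg _ ih => exact ih
  | and h1 h2 ih1 ih2 =>
    rw [Formula.atoms, Formula.atoms, List.zip_append h1.length_atoms, List.forall_mem_append]
    exact ⟨ih1, ih2⟩
  | or h1 h2 ih1 ih2 =>
    rw [Formula.atoms, Formula.atoms, List.zip_append h1.length_atoms, List.forall_mem_append]
    exact ⟨ih1, ih2⟩
  | ex v _ ih => exact ih
  | all v _ ih => exact ih

end

/-! ### Equivalence of the two sentences in their structures. -/

section
variable {ψ φ : SigFormula} {A : Struc} {cd : ℕ → ℕ} {lk : ℕ → (ℕ → ℕ) → Bool} {M N : ℕ}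

/-- The first symbol of φ' marks its occurrence in φ, because symbols are not repeated. It
determines which relations outside φ' are set to true. -/
theorem models_based (hψ : ψ.IsSentence) (hφ : φ.IsSentence) (hfr : Friendly φ.form) (hA : A.On ψ.sig)
    (hlk : ∀ (R : ℕ) (hR : R < ψ.sig.rels.length) (f : ℕ → ℕ), lk R f = A.rel ψ.sig.rels[R].1
      ((List.range ψ.sig.rels[R].2.length).map fun p => f p % A.card (ψ.sig.rels[R].2.getD p 0)))
    (hM : ∀ s ∈ ψ.sig.sorts, A.card s ≤ M) (hMN : M ≤ N) {q : Quant} {V : List Var} {φ' : Formula}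
    (hφ' : SimpleForm q V φ') (hsub : Subformula φ' φ.form) (hb : BasedOn q V φ' ψ.form) :
    A.Models ψ.form ↔ (ruleStruc φ.sig (φ.sig.rels.map (basedRule ψ.sig.rels φ'.atoms ψ.form.atoms
      (φ.form.trues (φ'.symbols.headD 0)))) cd lk M N).Models φ.form := by
  obtain ⟨s₀, hs₀⟩ := List.exists_mem_of_ne_nil _ hψ.wf.sorts_ne
  have hM0 : 0 < M := (hA _ hs₀).trans_le (hM _ hs₀)
  have hn : φ.form.symbols.Nodup := hfr.1.2
  have hsubl := (Replaced.atoms_sublist hsub).1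
  have hn' : (φ'.atoms.map Prod.fst).Nodup := by
    rw [← Formula.map_fst_atoms] at hn
    exact hn.sublist (hsubl.map _)
  refine (sat_of_subformula hsub hfr.2.1 hn (fun s => hM0.trans_le hMN) (R₀ := φ'.symbols.headD 0) ?_ ?_
    (fun g => ?_) _).symm
  · have : φ'.symbols ≠ [] := by
      rw [← Formula.map_fst_atoms]
      simpa using φ'.atoms_ne_nil
    rcases h : φ'.symbols with _ | ⟨R, l⟩
    · exact absurd h this
    · simp
  · intro R hR hR' b
    obtain ⟨args, ha⟩ := Formula.mem_symbols.1 hR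
    rw [ruleStruc_rel (r := (R, args.map Prod.snd)) hφ.wf _ (hφ.isOver.mem_rels ha), basedRule,
      decide_eq_false (by rwa [Formula.map_fst_atoms]), cond_false, ruleBit_const]
  -- The translated formula is the sentence ψ, so the truth of φ' in the new structure does not
  -- depend on the assignment.
  · refine (sat_of_restricted (A := A) hb.2.2 (fun p hp g => ?_) (fun v hv => ?_) g).trans
      (sat_congr _ _ fun v hv => by simp [hb.2.1] at hv)
    · have hz := List.of_mem_zip hp
      have hargs := hb.2.2.args p hp
      obtain ⟨⟨R, args⟩, ⟨R', args'⟩⟩ := p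
      have hfind := findAtom_eq hn' hp
      have hmem : R ∈ φ'.atoms.map Prod.fst := List.mem_map_of_mem hz.1
      rw [ruleStruc_rel (r := (R, args.map Prod.snd)) hφ.wf _ (hφ.isOver.mem_rels (hsubl.subset hz.1)),
        basedRule, decide_eq_true hmem, cond_true, hfind.1, hfind.2]
      refine ruleBit_copy hψ.wf hlk (hψ.isOver.mem_rels hz.2) hM0 (hM0.trans_le hMN) (by simp) (by simp) ?_ g
      intro p hp
      -- The variables of the atom of ψ occur in the atom of φ', so each argument can be fetched
      -- from one of its positions.
      have hin : args'[p] ∈ args := by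
        have : args'[p] ∈ args'.toFinset := by simp
        rw [hargs] at this
        simpa using (Finset.mem_inter.1 this).1
      rw [List.getD_eq_getElem _ _ (by simpa using hp), List.getElem_map]
      have hlt := List.idxOf_lt_length_of_mem hin
      refine ⟨by simpa using hlt, ?_⟩
      rw [List.getD_eq_getElem _ _ hlt, List.getElem_idxOf]
    · rw [hφ'.quantified, ← hb.1.quantified] at hv
      have := hψ.isOver.quantified hv
      exact ⟨hA _ this, (hM _ this).trans hMN⟩

/-- Symbols outside φ' keep their meaning in `A`. The number of atoms of ψ bounds the number of
pairs, which makes room for all codes M j + c; the additional 1 gives M ≤ N, as needed for residues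
to be onto. -/
theorem models_pair (hψ : ψ.IsSentence) (hφ : φ.IsSentence) (hfr : Friendly φ.form) (hA : A.On ψ.sig)
    (hcd : ∀ s ∈ ψ.sig.sorts, cd (ψ.sig.sorts.idxOf s) = A.card s)
    (hlk : ∀ (R : ℕ) (hR : R < ψ.sig.rels.length) (f : ℕ → ℕ), lk R f = A.rel ψ.sig.rels[R].1
      ((List.range ψ.sig.rels[R].2.length).map fun p => f p % A.card (ψ.sig.rels[R].2.getD p 0)))
    (hM : ∀ s ∈ ψ.sig.sorts, A.card s ≤ M) (hMN : (ψ.form.atoms.length + 1) * M ≤ N) {q : Quant} {V : List Var}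
    {φ' ψ' : Formula} (hφ' : SimpleForm q V φ') (hpair : PairJunction q φ'.free ψ')
    (hrep : Replaced φ' ψ' φ.form ψ.form) :
    A.Models ψ.form ↔ (ruleStruc φ.sig (φ.sig.rels.map (pairRule ψ.sig.sorts ψ.sig.rels q.isAll V
      φ'.atoms ψ'.atoms)) cd lk M N).Models φ.form := by
  obtain ⟨s₀, hs₀⟩ := List.exists_mem_of_ne_nil _ hψ.wf.sorts_ne
  have hM0 : 0 < M := (hA _ hs₀).trans_le (hM _ hs₀)
  have hMN' : ψ.form.atoms.length * M + M ≤ N := by rwa [add_mul, one_mul] at hMN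
  have hn : φ.form.symbols.Nodup := hfr.1.2
  have hsubl := hrep.atoms_sublist
  have hn' : (φ'.atoms.map Prod.fst).Nodup := by
    rw [← Formula.map_fst_atoms] at hn
    exact hn.sublist (hsubl.1.map _)
  obtain ⟨T, _, hT, hj⟩ := hpair
  have hψ'a : ψ'.atoms = T.map fun e => (e.1, [e.2.1, e.2.2]) := by
    rw [hj.atoms, List.flatMap_map]
    simp only [Formula.atoms]
    exact (List.map_eq_flatMap ..).symm
  have hTrel : ∀ e ∈ T, (e.1, [e.2.1.2, e.2.2.2]) ∈ ψ.sig.rels := fun e he => by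
    have : (e.1, [e.2.1, e.2.2]) ∈ ψ'.atoms := by
      rw [hψ'a]
      exact List.mem_map_of_mem (f := fun e : ℕ × Var × Var => (e.1, [e.2.1, e.2.2])) he
    exact hψ.isOver.mem_rels (hsubl.2.subset this)
  have hTl : T.length ≤ ψ.form.atoms.length := by
    have := hsubl.2.length_le
    rwa [hψ'a, List.length_map] at this
  refine ((sat_of_replaced hrep hn (fun a ha hR hψa g => ?_) (fun v hv => ?_)
    (sat_pair hψ.wf hA hcd hlk hM (N := N) hφ' T (fun e he => ?_) hj hTrel ?_ (fun s => rfl)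
      fun a ha g => ?_) _).trans
    (sat_congr _ _ fun v hv => by simp)).symm
  · rw [ruleStruc_rel (r := (a.1, a.2.map Prod.snd)) hφ.wf _ (hφ.isOver.mem_rels ha), pairRule,
      decide_eq_false (by rwa [Formula.map_fst_atoms]), cond_false]
    refine ruleBit_copy hψ.wf hlk (hψ.isOver.mem_rels hψa) hM0 (by omega) (by simp) (by simp) ?_ g
    intro p hp
    rw [List.getD_eq_getElem _ _ (by simpa using hp), List.getElem_range]
    exact ⟨by simpa using hp, List.getD_eq_getElem _ _ hp⟩
  · have := hψ.isOver.quantified hv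
    exact ⟨hA _ this, (hM _ this).trans (show M ≤ N by omega)⟩
  · have := (hT {e.2.1, e.2.2}).1 (List.mem_map_of_mem (f := fun t : ℕ × Var × Var => {t.2.1, t.2.2}) he)
    rw [Finset.mem_powersetCard] at this
    exact ⟨this.1 (by simp), this.1 (by simp)⟩
  · exact (Nat.mul_le_mul_right _ hTl).trans (by omega)
  · have hmem : a.1 ∈ φ'.atoms.map Prod.fst := List.mem_map_of_mem ha
    have hfind := findAtom_eq hn' (mem_zip_self ha)
    rw [ruleStruc_rel (r := (a.1, a.2.map Prod.snd)) hφ.wf _ (hφ.isOver.mem_rels (hsubl.1.subset ha)), pairRule,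
      decide_eq_true hmem, cond_true, hfind.1, ← hψ'a]
    simp only [List.length_map]

end
end Accordion

namespace Accordion
open Encodable

/-! ### Formulas as numbers -/

namespace Formula

/-- The number of a formula. -/
def toNat : Formula → ℕ
  | atom R args => 6 * encode (R, args)
  | neg φ => 6 * φ.toNat + 1
  | and φ ψ => 6 * Nat.pair φ.toNat ψ.toNat + 2
  | or φ ψ => 6 * Nat.pair φ.toNat ψ.toNat + 3
  | ex v φ => 6 * Nat.pair (encode v) φ.toNat + 4
  | all v φ => 6 * Nat.pair (encode v) φ.toNat + 5

theorem toNat_injective : Function.Injective toNat := by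
  intro φ
  induction φ with
  | atom R args =>
    intro ψ h
    cases ψ with
    | atom R' args' =>
      have := encode_injective (show encode (R, args) = encode (R', args') by simp only [toNat] at h; omega)
      rw [Prod.mk.injEq] at this
      rw [this.1, this.2]
    | _ => simp only [toNat] at h; omega
  | neg φ ih =>
    intro ψ h
    cases ψ with
    | neg ψ => rw [ih (show φ.toNat = ψ.toNat by simp only [toNat] at h; omega)]
    | _ => simp only [toNat] at h; omega
  | and φ φ' ih ih' =>
    intro ψ h
    cases ψ with
    | and ψ ψ' =>
      have := Nat.pair_eq_pair.1 (show Nat.pair φ.toNat φ'.toNat = Nat.pair ψ.toNat ψ'.toNat by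
        simp only [toNat] at h; omega)
      rw [ih this.1, ih' this.2]
    | _ => simp only [toNat] at h; omega
  | or φ φ' ih ih' =>
    intro ψ h
    cases ψ with
    | or ψ ψ' =>
      have := Nat.pair_eq_pair.1 (show Nat.pair φ.toNat φ'.toNat = Nat.pair ψ.toNat ψ'.toNat by
        simp only [toNat] at h; omega)
      rw [ih this.1, ih' this.2]
    | _ => simp only [toNat] at h; omega
  | ex v φ ih =>
    intro ψ h
    cases ψ with
    | ex w ψ =>
      have := Nat.pair_eq_pair.1 (show Nat.pair (encode v) φ.toNat = Nat.pair (encode w) ψ.toNat by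
        simp only [toNat] at h; omega)
      rw [encode_injective this.1, ih this.2]
    | _ => simp only [toNat] at h; omega
  | all v φ ih =>
    intro ψ h
    cases ψ with
    | all w ψ =>
      have := Nat.pair_eq_pair.1 (show Nat.pair (encode v) φ.toNat = Nat.pair (encode w) ψ.toNat by
        simp only [toNat] at h; omega)
      rw [encode_injective this.1, ih this.2]
    | _ => simp only [toNat] at h; omega

/-- Strong induction: the remainder modulo 6 gives the constructor, and the quotient or its unpaired
components code the parts. Surjectivity means that every number is a code, so no test for validity
is needed. -/
theorem toNat_surjective : Function.Surjective toNat := by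
  intro n
  induction n using Nat.strong_induction_on with
  | h n ih =>
    obtain ⟨m, hm⟩ : ∃ m, n / 6 = m := ⟨_, rfl⟩
    have h1 := Nat.unpair_left_le m
    have h2 := Nat.unpair_right_le m
    rcases (by omega : n = 6 * m ∨ n = 6 * m + 1 ∨ n = 6 * m + 2 ∨ n = 6 * m + 3 ∨ n = 6 * m + 4 ∨
      n = 6 * m + 5) with rfl | rfl | rfl | rfl | rfl | rfl
    · exact ⟨atom (Denumerable.ofNat (ℕ × List Var) m).1 (Denumerable.ofNat (ℕ × List Var) m).2, by
        rw [toNat, Prod.mk.eta, Denumerable.encode_ofNat]⟩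
    · obtain ⟨φ, h⟩ := ih m (by omega)
      exact ⟨neg φ, by rw [toNat, h]⟩
    · obtain ⟨φ, h⟩ := ih m.unpair.1 (by omega)
      obtain ⟨ψ, h'⟩ := ih m.unpair.2 (by omega)
      exact ⟨and φ ψ, by rw [toNat, h, h', Nat.pair_unpair]⟩
    · obtain ⟨φ, h⟩ := ih m.unpair.1 (by omega)
      obtain ⟨ψ, h'⟩ := ih m.unpair.2 (by omega)
      exact ⟨or φ ψ, by rw [toNat, h, h', Nat.pair_unpair]⟩
    · obtain ⟨ψ, h'⟩ := ih m.unpair.2 (by omega)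
      exact ⟨ex (Denumerable.ofNat Var m.unpair.1) ψ, by
        rw [toNat, h', Denumerable.encode_ofNat, Nat.pair_unpair]⟩
    · obtain ⟨ψ, h'⟩ := ih m.unpair.2 (by omega)
      exact ⟨all (Denumerable.ofNat Var m.unpair.1) ψ, by
        rw [toNat, h', Denumerable.encode_ofNat, Nat.pair_unpair]⟩

/-- Formulas correspond to numbers. -/
noncomputable def equivNat : Formula ≃ ℕ := Equiv.ofBijective toNat ⟨toNat_injective, toNat_surjective⟩

noncomputable instance : Primcodable Formula := Primcodable.ofEquiv ℕ equivNat

theorem encode_eq (φ : Formula) : Encodable.encode φ = φ.toNat := rfl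

theorem primrec_toNat : Primrec toNat := Primrec.encode

theorem primrec_equivNat_symm : Primrec equivNat.symm := Primrec.of_equiv_symm

theorem equivNat_symm_toNat (φ : Formula) : equivNat.symm φ.toNat = φ := equivNat.symm_apply_apply φ

theorem primrec_of_toNat {α : Type} [Primcodable α] {f : α → Formula} (h : Primrec fun a => (f a).toNat) :
    Primrec f :=
  (primrec_equivNat_symm.comp h).of_eq fun a => equivNat_symm_toNat (f a)

section constructors
variable {α : Type} [Primcodable α]

theorem primrec_atom {f : α → ℕ × List Var} (hf : Primrec f) : Primrec fun a => atom (f a).1 (f a).2 :=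
  primrec_of_toNat (Primrec.nat_mul.comp (.const 6) (Primrec.encode.comp hf))

theorem primrec_neg {f : α → Formula} (hf : Primrec f) : Primrec fun a => neg (f a) :=
  primrec_of_toNat (Primrec.succ.comp (Primrec.nat_mul.comp (.const 6) (primrec_toNat.comp hf)))

theorem primrec_and {f g : α → Formula} (hf : Primrec f) (hg : Primrec g) : Primrec fun a => and (f a) (g a) :=
  primrec_of_toNat (Primrec.nat_add.comp (Primrec.nat_mul.comp (.const 6)
    (Primrec₂.natPair.comp (primrec_toNat.comp hf) (primrec_toNat.comp hg))) (.const 2))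

theorem primrec_or {f g : α → Formula} (hf : Primrec f) (hg : Primrec g) : Primrec fun a => or (f a) (g a) :=
  primrec_of_toNat (Primrec.nat_add.comp (Primrec.nat_mul.comp (.const 6)
    (Primrec₂.natPair.comp (primrec_toNat.comp hf) (primrec_toNat.comp hg))) (.const 3))

theorem primrec_ex {f : α → Var} {g : α → Formula} (hf : Primrec f) (hg : Primrec g) :
    Primrec fun a => ex (f a) (g a) :=
  primrec_of_toNat (Primrec.nat_add.comp (Primrec.nat_mul.comp (.const 6)
    (Primrec₂.natPair.comp (Primrec.encode.comp hf) (primrec_toNat.comp hg))) (.const 4))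

theorem primrec_all {f : α → Var} {g : α → Formula} (hf : Primrec f) (hg : Primrec g) :
    Primrec fun a => all (f a) (g a) :=
  primrec_of_toNat (Primrec.nat_add.comp (Primrec.nat_mul.comp (.const 6)
    (Primrec₂.natPair.comp (Primrec.encode.comp hf) (primrec_toNat.comp hg))) (.const 5))

end constructors

/-- The constructor, as a number, and the parts of a formula. -/
def kind (φ : Formula) : ℕ := φ.toNat % 6
def body (φ : Formula) : ℕ := φ.toNat / 6
noncomputable def sub (φ : Formula) : Formula := equivNat.symm φ.body
noncomputable def left (φ : Formula) : Formula := equivNat.symm φ.body.unpair.1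
noncomputable def right (φ : Formula) : Formula := equivNat.symm φ.body.unpair.2
def var (φ : Formula) : Var := Denumerable.ofNat Var φ.body.unpair.1
def data (φ : Formula) : ℕ × List Var := Denumerable.ofNat (ℕ × List Var) φ.body

theorem primrec_kind : Primrec kind := Primrec.nat_mod.comp primrec_toNat (.const 6)
theorem primrec_body : Primrec body := Primrec.nat_div.comp primrec_toNat (.const 6)
theorem primrec_sub : Primrec sub := primrec_equivNat_symm.comp primrec_body
theorem primrec_left : Primrec left :=
  primrec_equivNat_symm.comp (Primrec.fst.comp (Primrec.unpair.comp primrec_body))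
theorem primrec_right : Primrec right :=
  primrec_equivNat_symm.comp (Primrec.snd.comp (Primrec.unpair.comp primrec_body))
theorem primrec_var : Primrec var :=
  (Primrec.ofNat Var).comp (Primrec.fst.comp (Primrec.unpair.comp primrec_body))
theorem primrec_data : Primrec data := (Primrec.ofNat (ℕ × List Var)).comp primrec_body

theorem parts_atom (R : ℕ) (args : List Var) : (atom R args).kind = 0 ∧ (atom R args).data = (R, args) := by
  refine ⟨by simp only [kind, toNat]; omega, ?_⟩
  rw [data, body, toNat, Nat.mul_div_cancel_left _ (by omega), Denumerable.ofNat_encode]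

theorem parts_neg (φ : Formula) : (neg φ).kind = 1 ∧ (neg φ).sub = φ := by
  refine ⟨by simp only [kind, toNat]; omega, ?_⟩
  rw [sub, body, toNat, show (6 * φ.toNat + 1) / 6 = φ.toNat by omega, equivNat_symm_toNat]

theorem parts_and (φ ψ : Formula) : (and φ ψ).kind = 2 ∧ (and φ ψ).left = φ ∧ (and φ ψ).right = ψ := by
  have e : (and φ ψ).body = Nat.pair φ.toNat ψ.toNat := by simp only [body, toNat]; omega
  refine ⟨by simp only [kind, toNat]; omega, ?_, ?_⟩
  · rw [left, e, Nat.unpair_pair, equivNat_symm_toNat]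
  · rw [right, e, Nat.unpair_pair, equivNat_symm_toNat]

theorem parts_or (φ ψ : Formula) : (or φ ψ).kind = 3 ∧ (or φ ψ).left = φ ∧ (or φ ψ).right = ψ := by
  have e : (or φ ψ).body = Nat.pair φ.toNat ψ.toNat := by simp only [body, toNat]; omega
  refine ⟨by simp only [kind, toNat]; omega, ?_, ?_⟩
  · rw [left, e, Nat.unpair_pair, equivNat_symm_toNat]
  · rw [right, e, Nat.unpair_pair, equivNat_symm_toNat]

theorem parts_ex (v : Var) (φ : Formula) : (ex v φ).kind = 4 ∧ (ex v φ).var = v ∧ (ex v φ).right = φ := by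
  have e : (ex v φ).body = Nat.pair (encode v) φ.toNat := by simp only [body, toNat]; omega
  refine ⟨by simp only [kind, toNat]; omega, ?_, ?_⟩
  · rw [var, e, Nat.unpair_pair, Denumerable.ofNat_encode]
  · rw [right, e, Nat.unpair_pair, equivNat_symm_toNat]

theorem parts_all (v : Var) (φ : Formula) : (all v φ).kind = 5 ∧ (all v φ).var = v ∧ (all v φ).right = φ := by
  have e : (all v φ).body = Nat.pair (encode v) φ.toNat := by simp only [body, toNat]; omega
  refine ⟨by simp only [kind, toNat]; omega, ?_, ?_⟩
  · rw [var, e, Nat.unpair_pair, Denumerable.ofNat_encode]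
  · rw [right, e, Nat.unpair_pair, equivNat_symm_toNat]

/-- Parts have smaller numbers, so recursion over formulas is recursion on a numerical measure. -/
theorem toNat_lt (φ ψ : Formula) (v : Var) : φ.toNat < (neg φ).toNat ∧ φ.toNat < (and φ ψ).toNat ∧
    ψ.toNat < (and φ ψ).toNat ∧ φ.toNat < (or φ ψ).toNat ∧ ψ.toNat < (or φ ψ).toNat ∧
    φ.toNat < (ex v φ).toNat ∧ φ.toNat < (all v φ).toNat := by
  have h1 := Nat.left_le_pair φ.toNat ψ.toNat
  have h2 := Nat.right_le_pair φ.toNat ψ.toNat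
  have h3 := Nat.right_le_pair (encode v) φ.toNat
  simp only [toNat]
  omega

/-- Recursion over lists of smaller formulas. -/
theorem primrec_children {α σ : Type} [Primcodable α] [Primcodable σ] {F : α → Formula → σ}
    {ch : Formula → List Formula} {g : α → Formula × List σ → σ} (hch : Primrec ch) (hg : Primrec₂ g)
    (hlt : ∀ φ, ∀ ψ ∈ ch φ, ψ.toNat < φ.toNat) (h : ∀ a φ, F a φ = g a (φ, (ch φ).map (F a))) :
    Primrec₂ F :=
  Primrec.nat_omega_rec F (m := fun _ φ => φ.toNat) (l := fun _ φ => ch φ)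
    (g := fun a p => some (g a p)) (primrec_toNat.comp .snd) (hch.comp .snd)
    (Primrec.option_some.comp hg) (fun _ φ ψ hψ => hlt φ ψ hψ) fun a φ => by rw [h a φ]

/-- The immediate subformulas. -/
def children : Formula → List Formula
  | atom _ _ => []
  | neg φ => [φ]
  | and φ ψ => [φ, ψ]
  | or φ ψ => [φ, ψ]
  | ex _ φ => [φ]
  | all _ φ => [φ]

/-- Definition by cases on the outermost constructor is a case distinction on `kind`, with the
arguments recovered by primitive recursive functions. -/
theorem primrec_cases {α σ : Type} [Primcodable α] [Primcodable σ] {F : α → Formula → σ}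
    {fa : α × (ℕ × List Var) → σ} {fn : α × Formula → σ} {fand f_or : α × (Formula × Formula) → σ}
    {fex fall : α × (Var × Formula) → σ} (hfa : Primrec fa) (hfn : Primrec fn) (hfand : Primrec fand)
    (hfor : Primrec f_or) (hfex : Primrec fex) (hfall : Primrec fall)
    (ha : ∀ a R args, F a (atom R args) = fa (a, (R, args))) (hn : ∀ a φ, F a (neg φ) = fn (a, φ))
    (hand : ∀ a φ ψ, F a (and φ ψ) = fand (a, (φ, ψ))) (hor : ∀ a φ ψ, F a (or φ ψ) = f_or (a, (φ, ψ)))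
    (hex : ∀ a v φ, F a (ex v φ) = fex (a, (v, φ))) (hall : ∀ a v φ, F a (all v φ) = fall (a, (v, φ))) :
    Primrec₂ F := by
  have hk (n : ℕ) : PrimrecPred fun p : α × Formula => p.2.kind = n :=
    Primrec.eq.comp (primrec_kind.comp .snd) (.const n)
  have h : Primrec fun p : α × Formula => if p.2.kind = 0 then fa (p.1, p.2.data) else
      if p.2.kind = 1 then fn (p.1, p.2.sub) else if p.2.kind = 2 then fand (p.1, (p.2.left, p.2.right)) else
      if p.2.kind = 3 then f_or (p.1, (p.2.left, p.2.right)) else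
      if p.2.kind = 4 then fex (p.1, (p.2.var, p.2.right)) else fall (p.1, (p.2.var, p.2.right)) := by
    refine .ite (hk 0) (hfa.comp (.pair .fst (primrec_data.comp .snd))) (.ite (hk 1)
      (hfn.comp (.pair .fst (primrec_sub.comp .snd))) (.ite (hk 2) (hfand.comp (.pair .fst (.pair
        (primrec_left.comp .snd) (primrec_right.comp .snd)))) (.ite (hk 3) (hfor.comp (.pair .fst (.pair
        (primrec_left.comp .snd) (primrec_right.comp .snd)))) (.ite (hk 4) (hfex.comp (.pair .fst (.pair
        (primrec_var.comp .snd) (primrec_right.comp .snd)))) (hfall.comp (.pair .fst (.pair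
        (primrec_var.comp .snd) (primrec_right.comp .snd))))))))
  refine h.of_eq fun p => ?_
  obtain ⟨a, φ⟩ := p
  cases φ with
  | atom R args => simp only [parts_atom, ha, if_true]
  | neg φ => simp only [parts_neg, hn, if_true, one_ne_zero, if_false]
  | and φ ψ => simp only [parts_and, hand, if_true, if_false, Nat.reduceEqDiff, OfNat.ofNat_ne_zero, OfNat.ofNat_ne_one]
  | or φ ψ => simp only [parts_or, hor, if_true, if_false, Nat.reduceEqDiff, OfNat.ofNat_ne_zero, OfNat.ofNat_ne_one]
  | ex v φ => simp only [parts_ex, hex, if_true, if_false, Nat.reduceEqDiff, OfNat.ofNat_ne_zero, OfNat.ofNat_ne_one]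
  | all v φ => simp only [parts_all, hall, if_false, Nat.reduceEqDiff, OfNat.ofNat_ne_zero, OfNat.ofNat_ne_one]

theorem primrec_children_list : Primrec children := by
  have h : Primrec₂ fun (_ : Unit) φ => children φ :=
    primrec_cases (fa := fun _ => []) (fn := fun p => [p.2]) (fand := fun p => [p.2.1, p.2.2])
      (f_or := fun p => [p.2.1, p.2.2]) (fex := fun p => [p.2.2]) (fall := fun p => [p.2.2]) (.const [])
      (Primrec.list_cons.comp .snd (.const []))
      (Primrec.list_cons.comp (Primrec.fst.comp .snd) (Primrec.list_cons.comp (Primrec.snd.comp .snd) (.const [])))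
      (Primrec.list_cons.comp (Primrec.fst.comp .snd) (Primrec.list_cons.comp (Primrec.snd.comp .snd) (.const [])))
      (Primrec.list_cons.comp (Primrec.snd.comp .snd) (.const []))
      (Primrec.list_cons.comp (Primrec.snd.comp .snd) (.const []))
      (fun _ _ _ => rfl) (fun _ _ => rfl) (fun _ _ _ => rfl) (fun _ _ _ => rfl) (fun _ _ _ => rfl) fun _ _ _ => rfl
  exact h.comp (.const ()) .id

theorem children_lt (φ : Formula) : ∀ ψ ∈ children φ, ψ.toNat < φ.toNat := by
  intro ψ hψ
  cases φ with
  | atom R args => simp [children] at hψ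
  | neg φ =>
    obtain rfl : ψ = φ := by simpa [children] using hψ
    exact (toNat_lt ψ ψ (0, 0)).1
  | and φ φ' =>
    have := toNat_lt φ φ' (0, 0)
    rcases (by simpa [children] using hψ : ψ = φ ∨ ψ = φ') with rfl | rfl <;> simp only [this]
  | or φ φ' =>
    have := toNat_lt φ φ' (0, 0)
    rcases (by simpa [children] using hψ : ψ = φ ∨ ψ = φ') with rfl | rfl <;> simp only [this]
  | ex v φ =>
    obtain rfl : ψ = φ := by simpa [children] using hψ
    exact (toNat_lt ψ ψ v).2.2.2.2.2.1
  | all v φ =>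
    obtain rfl : ψ = φ := by simpa [children] using hψ
    exact (toNat_lt ψ ψ v).2.2.2.2.2.2

/-- Structural recursion. -/
theorem primrec_rec {α σ : Type} [Primcodable α] [Primcodable σ] [Inhabited σ] {F : α → Formula → σ}
    {fa : α × (ℕ × List Var) → σ} {fn : α × (Formula × σ) → σ}
    {fand f_or : α × ((Formula × Formula) × (σ × σ)) → σ}
    {fex fall : α × ((Var × Formula) × σ) → σ} (hfa : Primrec fa) (hfn : Primrec fn) (hfand : Primrec fand)
    (hfor : Primrec f_or) (hfex : Primrec fex) (hfall : Primrec fall)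
    (ha : ∀ a R args, F a (atom R args) = fa (a, (R, args)))
    (hn : ∀ a φ, F a (neg φ) = fn (a, (φ, F a φ)))
    (hand : ∀ a φ ψ, F a (and φ ψ) = fand (a, ((φ, ψ), (F a φ, F a ψ))))
    (hor : ∀ a φ ψ, F a (or φ ψ) = f_or (a, ((φ, ψ), (F a φ, F a ψ))))
    (hex : ∀ a v φ, F a (ex v φ) = fex (a, ((v, φ), F a φ)))
    (hall : ∀ a v φ, F a (all v φ) = fall (a, ((v, φ), F a φ))) : Primrec₂ F := by
  -- `G` receives the values at the immediate subformulas as a list, in the order of `children`.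
  let G : α × List σ → Formula → σ := fun p φ => match φ with
    | atom R args => fa (p.1, (R, args))
    | neg φ => fn (p.1, (φ, p.2.getI 0))
    | and φ ψ => fand (p.1, ((φ, ψ), (p.2.getI 0, p.2.getI 1)))
    | or φ ψ => f_or (p.1, ((φ, ψ), (p.2.getI 0, p.2.getI 1)))
    | ex v φ => fex (p.1, ((v, φ), p.2.getI 0))
    | all v φ => fall (p.1, ((v, φ), p.2.getI 0))
  have h0 {β : Type} [Primcodable β] (n : ℕ) : Primrec fun q : (α × List σ) × β => q.1.2.getI n :=
    Primrec.list_getI.comp (Primrec.snd.comp .fst) (.const n)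
  have h1 {β : Type} [Primcodable β] : Primrec fun q : (α × List σ) × β => q.1.1 := Primrec.fst.comp .fst
  have hG : Primrec₂ G := primrec_cases (fa := fun q => fa (q.1.1, q.2))
    (fn := fun q => fn (q.1.1, (q.2, q.1.2.getI 0)))
    (fand := fun q => fand (q.1.1, (q.2, (q.1.2.getI 0, q.1.2.getI 1))))
    (f_or := fun q => f_or (q.1.1, (q.2, (q.1.2.getI 0, q.1.2.getI 1))))
    (fex := fun q => fex (q.1.1, (q.2, q.1.2.getI 0)))
    (fall := fun q => fall (q.1.1, (q.2, q.1.2.getI 0)))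
    (hfa.comp (h1.pair .snd)) (hfn.comp (h1.pair (Primrec.pair .snd (h0 0))))
    (hfand.comp (h1.pair (Primrec.pair .snd ((h0 0).pair (h0 1)))))
    (hfor.comp (h1.pair (Primrec.pair .snd ((h0 0).pair (h0 1)))))
    (hfex.comp (h1.pair (Primrec.pair .snd (h0 0)))) (hfall.comp (h1.pair (Primrec.pair .snd (h0 0))))
    (fun _ _ _ => rfl) (fun _ _ => rfl) (fun _ _ _ => rfl) (fun _ _ _ => rfl) (fun _ _ _ => rfl) fun _ _ _ => rfl
  refine primrec_children (g := fun a p => G (a, p.2) p.1) primrec_children_list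
    (hG.comp (Primrec.pair .fst (Primrec.snd.comp .snd)) (Primrec.fst.comp .snd)) children_lt fun a φ => ?_
  cases φ with
  | atom R args => exact ha a R args
  | neg φ => exact hn a φ
  | and φ ψ => exact hand a φ ψ
  | or φ ψ => exact hor a φ ψ
  | ex v φ => exact hex a v φ
  | all v φ => exact hall a v φ

end Formula
end Accordion

namespace Accordion
open Encodable

/-! ### Primitive recursive predicates on lists -/

section lists
variable {α β : Type} [Primcodable α] [Primcodable β]

theorem primrecPred_forall {f : α → List β} {p : α → β → Prop} (hf : Primrec f) (hp : PrimrecRel p) :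
    PrimrecPred fun a => ∀ b ∈ f a, p a b :=
  (PrimrecRel.forall_mem_list (R := fun b a => p a b) (hp.comp .snd .fst)).comp hf .id

theorem primrecPred_exists {f : α → List β} {p : α → β → Prop} (hf : Primrec f) (hp : PrimrecRel p) :
    PrimrecPred fun a => ∃ b ∈ f a, p a b :=
  (PrimrecRel.exists_mem_list (R := fun b a => p a b) (hp.comp .snd .fst)).comp hf .id

theorem primrec_filter {f : α → List β} {p : α → β → Prop} [∀ a b, Decidable (p a b)] (hf : Primrec f)
    (hp : PrimrecRel p) : Primrec fun a => (f a).filter fun b => decide (p a b) :=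
  (PrimrecRel.listFilter (R := fun b a => p a b) (hp.comp .snd .fst)).comp hf .id

theorem primrecPred_mem {f : α → β} {g : α → List β} (hf : Primrec f) (hg : Primrec g) :
    PrimrecPred fun a => f a ∈ g a :=
  (primrecPred_exists (p := fun a b => f a = b) hg
    (Primrec.eq.comp (hf.comp .fst) .snd)).of_eq fun a => by simp

theorem primrecPred_subset {f g : α → List β} (hf : Primrec f) (hg : Primrec g) :
    PrimrecPred fun a => f a ⊆ g a :=
  (primrecPred_forall (p := fun a b => b ∈ g a) hf (primrecPred_mem .snd (hg.comp .fst))).of_eq fun _ => Iff.rfl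

theorem primrecPred_toFinset_eq [DecidableEq β] {f g : α → List β} (hf : Primrec f) (hg : Primrec g) :
    PrimrecPred fun a => (f a).toFinset = (g a).toFinset :=
  ((primrecPred_subset hf hg).and (primrecPred_subset hg hf)).of_eq fun a => by
    simp only [Finset.ext_iff, List.mem_toFinset, List.subset_def]
    exact ⟨fun h b => ⟨fun hb => h.1 hb, fun hb => h.2 hb⟩, fun h => ⟨fun hb => (h _).1 hb, fun hb => (h _).2 hb⟩⟩

theorem primrecPred_nodup [DecidableEq β] {f : α → List β} (hf : Primrec f) : PrimrecPred fun a => (f a).Nodup :=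
  (primrecPred_forall (p := fun a b => ((f a).filter fun c => decide (c = b)).length ≤ 1) hf
    (Primrec.nat_le.comp (Primrec.list_length.comp (primrec_filter (p := fun (q : α × β) c => c = q.2)
      (hf.comp .fst) (Primrec.eq.comp .snd (Primrec.snd.comp .fst)))) (.const 1))).of_eq fun a => by
    rw [List.nodup_iff_count_le_one]
    refine ⟨fun h b => ?_, fun h b _ => ?_⟩
    · by_cases hb : b ∈ f a
      · rw [List.count_eq_length_filter]
        convert h b hb using 4
        exact beq_eq_decide _ _
      · rw [List.count_eq_zero_of_not_mem hb]
        exact Nat.zero_le _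
    · refine (le_of_eq ?_).trans (h b)
      rw [List.count_eq_length_filter]
      congr 2

end lists

/-! ### Quantifiers as data -/

def Quant.equivBool : Quant ≃ Bool where
  toFun := Quant.isAll
  invFun b := bif b then .all else .ex
  left_inv q := by cases q <;> rfl
  right_inv b := by cases b <;> rfl

instance : Primcodable Quant := Primcodable.ofEquiv Bool Quant.equivBool

theorem Quant.primrec_isAll : Primrec Quant.isAll := Primrec.of_equiv

theorem Quant.primrec_dual : Primrec Quant.dual :=
  (Primrec.cond Quant.primrec_isAll (.const .ex) (.const .all)).of_eq fun q => by cases q <;> rfl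

namespace Formula

instance : DecidableEq Formula := fun φ ψ => decidable_of_iff (φ.toNat = ψ.toNat) toNat_injective.eq_iff

theorem primrec_fold {σ : Type} [Primcodable σ] [Inhabited σ] {F : Formula → σ} {fa : ℕ × List Var → σ}
    {fn : Formula × σ → σ} {fand f_or : (Formula × Formula) × (σ × σ) → σ} {fex fall : (Var × Formula) × σ → σ}
    (hfa : Primrec fa) (hfn : Primrec fn) (hfand : Primrec fand)
    (hfor : Primrec f_or) (hfex : Primrec fex) (hfall : Primrec fall)
    (ha : ∀ R args, F (atom R args) = fa (R, args))
    (hn : ∀ φ, F (neg φ) = fn (φ, F φ))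
    (hand : ∀ φ ψ, F (and φ ψ) = fand ((φ, ψ), (F φ, F ψ)))
    (hor : ∀ φ ψ, F (or φ ψ) = f_or ((φ, ψ), (F φ, F ψ)))
    (hex : ∀ v φ, F (ex v φ) = fex ((v, φ), F φ))
    (hall : ∀ v φ, F (all v φ) = fall ((v, φ), F φ)) : Primrec F :=
  (primrec_rec (F := fun (_ : Unit) φ => F φ) (hfa.comp .snd) (hfn.comp .snd) (hfand.comp .snd) (hfor.comp .snd)
    (hfex.comp .snd) (hfall.comp .snd) (fun _ => ha) (fun _ => hn) (fun _ => hand) (fun _ => hor) (fun _ => hex)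
    fun _ => hall).comp (.const ()) .id

section
open Primrec
variable {β γ σ : Type} [Primcodable β] [Primcodable γ] [Primcodable σ]

theorem primrec_append₂ : Primrec fun p : β × (List σ × List σ) => p.2.1 ++ p.2.2 :=
  list_append.comp (fst.comp snd) (snd.comp snd)

theorem primrec_append₃ : Primrec fun p : β × (γ × (List σ × List σ)) => p.2.2.1 ++ p.2.2.2 :=
  list_append.comp (fst.comp (snd.comp snd)) (snd.comp (snd.comp snd))

/-- The free variables, as a list. -/
def freeList : Formula → List Var
  | atom _ args => args
  | neg φ => φ.freeList
  | and φ ψ => φ.freeList ++ ψ.freeList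
  | or φ ψ => φ.freeList ++ ψ.freeList
  | ex v φ => φ.freeList.filter fun x => decide (x ≠ v)
  | all v φ => φ.freeList.filter fun x => decide (x ≠ v)

theorem toFinset_freeList (φ : Formula) : φ.freeList.toFinset = φ.free := by
  induction φ with
  | atom R args => rfl
  | neg φ ih => exact ih
  | and φ ψ h1 h2 => rw [freeList, List.toFinset_append, h1, h2, free]
  | or φ ψ h1 h2 => rw [freeList, List.toFinset_append, h1, h2, free]
  | ex v φ ih => ext; simp [freeList, free, ← ih, and_comm]
  | all v φ ih => ext; simp [freeList, free, ← ih, and_comm]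

theorem mem_freeList {φ : Formula} {v : Var} : v ∈ φ.freeList ↔ v ∈ φ.free := by
  rw [← toFinset_freeList, List.mem_toFinset]

theorem primrec_freeList : Primrec freeList := by
  have h : Primrec fun p : (Var × Formula) × List Var => p.2.filter fun x => decide (x ≠ p.1.1) :=
    primrec_filter (p := fun (p : (Var × Formula) × List Var) x => x ≠ p.1.1) snd
      (Primrec.eq.comp snd (fst.comp (fst.comp fst))).not
  exact primrec_fold snd snd primrec_append₂ primrec_append₂ h h (fun _ _ => rfl) (fun _ => rfl) (fun _ _ => rfl)
    (fun _ _ => rfl) (fun _ _ => rfl) fun _ _ => rfl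

theorem primrec_atoms : Primrec atoms :=
  primrec_fold (list_cons.comp .id (const [])) snd primrec_append₂ primrec_append₂ snd snd (fun _ _ => rfl)
    (fun _ => rfl) (fun _ _ => rfl) (fun _ _ => rfl) (fun _ _ => rfl) fun _ _ => rfl

theorem primrec_symbols : Primrec symbols :=
  (list_map primrec_atoms (Primrec.fst.comp snd).to₂).of_eq map_fst_atoms

theorem primrec_quantified : Primrec quantified :=
  primrec_fold (const []) snd primrec_append₂ primrec_append₂ (list_cons.comp (fst.comp fst) snd)
    (list_cons.comp (fst.comp fst) snd) (fun _ _ => rfl) (fun _ => rfl) (fun _ _ => rfl) (fun _ _ => rfl)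
    (fun _ _ => rfl) fun _ _ => rfl

theorem primrec_code : Primrec code := by
  refine primrec_fold (fa := fun p => 0 :: p.1 :: p.2.length :: p.2.flatMap fun v => [v.1, v.2])
    (fn := fun p => 1 :: p.2) (fand := fun p => 2 :: (p.2.1 ++ p.2.2)) (f_or := fun p => 3 :: (p.2.1 ++ p.2.2))
    (fex := fun p => 4 :: p.1.1.1 :: p.1.1.2 :: p.2) (fall := fun p => 5 :: p.1.1.1 :: p.1.1.2 :: p.2)
    ?_ (list_cons.comp (const 1) snd) (list_cons.comp (const 2) primrec_append₂)
    (list_cons.comp (const 3) primrec_append₂) ?_ ?_ (fun _ _ => rfl) (fun _ => rfl) (fun _ _ => rfl)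
    (fun _ _ => rfl) (fun _ _ => rfl) fun _ _ => rfl
  · exact list_cons.comp (const 0) (list_cons.comp fst (list_cons.comp (list_length.comp snd)
      (list_flatMap snd (list_cons.comp (fst.comp snd) (list_cons.comp (snd.comp snd) (const []))).to₂)))
  · exact list_cons.comp (const 4) (list_cons.comp (fst.comp (fst.comp fst))
      (list_cons.comp (snd.comp (fst.comp fst)) snd))
  · exact list_cons.comp (const 5) (list_cons.comp (fst.comp (fst.comp fst))
      (list_cons.comp (snd.comp (fst.comp fst)) snd))

theorem primrec_trues : Primrec₂ trues := by
  have h {f : ℕ × ((Formula × Formula) × (List ℕ × List ℕ)) → List ℕ}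
      {g : ℕ × ((Formula × Formula) × (List ℕ × List ℕ)) → List ℕ} (hf : Primrec f) (hg : Primrec g) :
      Primrec fun p : ℕ × ((Formula × Formula) × (List ℕ × List ℕ)) =>
        bif decide (p.1 ∈ p.2.1.1.symbols) then f p else g p :=
    cond (primrecPred_mem fst (primrec_symbols.comp (fst.comp (fst.comp snd)))).decide hf hg
  exact primrec_rec (fa := fun _ => []) (fn := fun p => p.2.2)
    (fand := fun p => bif decide (p.1 ∈ p.2.1.1.symbols) then p.2.1.2.symbols ++ p.2.2.1 else
      p.2.1.1.symbols ++ p.2.2.2)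
    (f_or := fun p => bif decide (p.1 ∈ p.2.1.1.symbols) then p.2.2.1 else p.2.2.2)
    (fex := fun p => p.2.2) (fall := fun p => p.2.2) (const []) (snd.comp snd)
    (h (list_append.comp (primrec_symbols.comp (snd.comp (fst.comp snd))) (fst.comp (snd.comp snd)))
      (list_append.comp (primrec_symbols.comp (fst.comp (fst.comp snd))) (snd.comp (snd.comp snd))))
    (h (fst.comp (snd.comp snd)) (snd.comp (snd.comp snd))) (snd.comp snd) (snd.comp snd)
    (fun _ _ _ => rfl) (fun _ _ => rfl) (fun _ _ _ => rfl) (fun _ _ _ => rfl) (fun _ _ _ => rfl) fun _ _ _ => rfl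

/-- The formula without its atoms. -/
def shape : Formula → Formula
  | atom _ _ => atom 0 []
  | neg φ => neg φ.shape
  | and φ ψ => and φ.shape ψ.shape
  | or φ ψ => or φ.shape ψ.shape
  | ex v φ => ex v φ.shape
  | all v φ => all v φ.shape

instance : Inhabited Formula := ⟨atom 0 []⟩

theorem primrec_shape : Primrec shape :=
  primrec_fold (const (atom 0 [])) (primrec_neg snd) (primrec_and (fst.comp snd) (snd.comp snd))
    (primrec_or (fst.comp snd) (snd.comp snd)) (primrec_ex (fst.comp fst) snd) (primrec_all (fst.comp fst) snd)
    (fun _ _ => rfl) (fun _ => rfl) (fun _ _ => rfl) (fun _ _ => rfl) (fun _ _ => rfl) fun _ _ => rfl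

/-- The parts of a conjunction (for `∃`) or disjunction (for `∀`). -/
def juncts (q : Quant) : Formula → List Formula
  | and φ ψ => bif q.isAll then [and φ ψ] else φ.juncts q ++ ψ.juncts q
  | or φ ψ => bif q.isAll then φ.juncts q ++ ψ.juncts q else [or φ ψ]
  | φ => [φ]

theorem primrec_singleton {f : β → σ} (hf : Primrec f) : Primrec fun b => [f b] :=
  list_cons.comp hf (const [])

theorem primrec_juncts : Primrec₂ juncts := by
  have h : Primrec fun p : Quant × ((Formula × Formula) × (List Formula × List Formula)) => p.1.isAll :=
    Quant.primrec_isAll.comp fst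
  exact primrec_rec (fa := fun p => [atom p.2.1 p.2.2]) (fn := fun p => [neg p.2.1])
    (fand := fun p => bif p.1.isAll then [and p.2.1.1 p.2.1.2] else p.2.2.1 ++ p.2.2.2)
    (f_or := fun p => bif p.1.isAll then p.2.2.1 ++ p.2.2.2 else [or p.2.1.1 p.2.1.2])
    (fex := fun p => [ex p.2.1.1 p.2.1.2]) (fall := fun p => [all p.2.1.1 p.2.1.2])
    (primrec_singleton (primrec_atom snd)) (primrec_singleton (primrec_neg (fst.comp snd)))
    (cond h (primrec_singleton (primrec_and (fst.comp (fst.comp snd)) (snd.comp (fst.comp snd)))) primrec_append₃)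
    (cond h primrec_append₃ (primrec_singleton (primrec_or (fst.comp (fst.comp snd)) (snd.comp (fst.comp snd)))))
    (primrec_singleton (primrec_ex (fst.comp (fst.comp snd)) (snd.comp (fst.comp snd))))
    (primrec_singleton (primrec_all (fst.comp (fst.comp snd)) (snd.comp (fst.comp snd))))
    (fun _ _ _ => rfl) (fun _ _ => rfl) (fun _ _ _ => rfl) (fun _ _ _ => rfl) (fun _ _ _ => rfl) fun _ _ _ => rfl

/-- The leading block of quantifiers, and the formula behind it. -/
def block (q : Quant) : Formula → List Var × Formula
  | ex v φ => bif q.isAll then ([], ex v φ) else (v :: (φ.block q).1, (φ.block q).2)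
  | all v φ => bif q.isAll then (v :: (φ.block q).1, (φ.block q).2) else ([], all v φ)
  | φ => ([], φ)

theorem primrec_block : Primrec₂ block := by
  have h : Primrec fun p : Quant × ((Var × Formula) × (List Var × Formula)) => p.1.isAll :=
    Quant.primrec_isAll.comp fst
  have h' : Primrec fun p : Quant × ((Var × Formula) × (List Var × Formula)) => (p.2.1.1 :: p.2.2.1, p.2.2.2) :=
    (list_cons.comp (fst.comp (fst.comp snd)) (fst.comp (snd.comp snd))).pair (snd.comp (snd.comp snd))
  exact primrec_rec (fa := fun p => ([], atom p.2.1 p.2.2)) (fn := fun p => ([], neg p.2.1))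
    (fand := fun p => ([], and p.2.1.1 p.2.1.2)) (f_or := fun p => ([], or p.2.1.1 p.2.1.2))
    (fex := fun p => bif p.1.isAll then ([], ex p.2.1.1 p.2.1.2) else (p.2.1.1 :: p.2.2.1, p.2.2.2))
    (fall := fun p => bif p.1.isAll then (p.2.1.1 :: p.2.2.1, p.2.2.2) else ([], all p.2.1.1 p.2.1.2))
    (pair (const []) (primrec_atom snd)) (pair (const []) (primrec_neg (fst.comp snd)))
    (pair (const []) (primrec_and (fst.comp (fst.comp snd)) (snd.comp (fst.comp snd))))
    (pair (const []) (primrec_or (fst.comp (fst.comp snd)) (snd.comp (fst.comp snd))))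
    (cond h (pair (const []) (primrec_ex (fst.comp (fst.comp snd)) (snd.comp (fst.comp snd)))) h')
    (cond h h' (pair (const []) (primrec_all (fst.comp (fst.comp snd)) (snd.comp (fst.comp snd)))))
    (fun _ _ _ => rfl) (fun _ _ => rfl) (fun _ _ _ => rfl) (fun _ _ _ => rfl) (fun _ _ _ => rfl) fun _ _ _ => rfl

/-- The subformulas. -/
def subs : Formula → List Formula
  | atom R args => [atom R args]
  | neg φ => neg φ :: φ.subs
  | and φ ψ => and φ ψ :: (φ.subs ++ ψ.subs)
  | or φ ψ => or φ ψ :: (φ.subs ++ ψ.subs)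
  | ex v φ => ex v φ :: φ.subs
  | all v φ => all v φ :: φ.subs

theorem primrec_subs : Primrec subs :=
  primrec_fold (fa := fun p => [atom p.1 p.2]) (fn := fun p => neg p.1 :: p.2)
    (fand := fun p => and p.1.1 p.1.2 :: (p.2.1 ++ p.2.2)) (f_or := fun p => or p.1.1 p.1.2 :: (p.2.1 ++ p.2.2))
    (fex := fun p => ex p.1.1 p.1.2 :: p.2) (fall := fun p => all p.1.1 p.1.2 :: p.2)
    (primrec_singleton (primrec_atom .id)) (list_cons.comp (primrec_neg fst) snd)
    (list_cons.comp (primrec_and (fst.comp fst) (snd.comp fst)) primrec_append₂)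
    (list_cons.comp (primrec_or (fst.comp fst) (snd.comp fst)) primrec_append₂)
    (list_cons.comp (primrec_ex (fst.comp fst) (snd.comp fst)) snd)
    (list_cons.comp (primrec_all (fst.comp fst) (snd.comp fst)) snd)
    (fun _ _ => rfl) (fun _ => rfl) (fun _ _ => rfl) (fun _ _ => rfl) (fun _ _ => rfl) fun _ _ => rfl

/-- The results of replacing an occurrence of the first formula of a pair with the second. -/
def replacements (p : Formula × Formula) : Formula → List Formula
  | atom R args => if atom R args = p.1 then [p.2] else []
  | neg φ => (if neg φ = p.1 then [p.2] else []) ++ (φ.replacements p).map neg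
  | and φ ψ => (if and φ ψ = p.1 then [p.2] else []) ++
      ((φ.replacements p).map (and · ψ) ++ (ψ.replacements p).map (and φ ·))
  | or φ ψ => (if or φ ψ = p.1 then [p.2] else []) ++
      ((φ.replacements p).map (or · ψ) ++ (ψ.replacements p).map (or φ ·))
  | ex v φ => (if ex v φ = p.1 then [p.2] else []) ++ (φ.replacements p).map (ex v)
  | all v φ => (if all v φ = p.1 then [p.2] else []) ++ (φ.replacements p).map (all v)

theorem mem_replacements {p : Formula × Formula} {φ ψ : Formula} :
    ψ ∈ φ.replacements p ↔ Replaced p.1 p.2 φ ψ := by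
  obtain ⟨θ, θ'⟩ := p
  have h0 {χ ψ : Formula} (h : ψ ∈ if χ = θ then [θ'] else []) : Replaced θ θ' χ ψ := by
    split_ifs at h with h1
    · rw [h1, List.mem_singleton.1 h]
      exact .here
    · simp at h
  constructor
  · intro h
    induction φ generalizing ψ with
    | atom R args => exact h0 h
    | neg φ ih =>
      rcases List.mem_append.1 h with h | h
      · exact h0 h
      · obtain ⟨χ, hχ, rfl⟩ := List.mem_map.1 h
        exact .neg (ih hχ)
    | and φ φ' ih ih' =>
      rcases List.mem_append.1 h with h | h
      · exact h0 h
      · rcases List.mem_append.1 h with h | h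
        · obtain ⟨χ, hχ, rfl⟩ := List.mem_map.1 h
          exact .andLeft _ (ih hχ)
        · obtain ⟨χ, hχ, rfl⟩ := List.mem_map.1 h
          exact .andRight _ (ih' hχ)
    | or φ φ' ih ih' =>
      rcases List.mem_append.1 h with h | h
      · exact h0 h
      · rcases List.mem_append.1 h with h | h
        · obtain ⟨χ, hχ, rfl⟩ := List.mem_map.1 h
          exact .orLeft _ (ih hχ)
        · obtain ⟨χ, hχ, rfl⟩ := List.mem_map.1 h
          exact .orRight _ (ih' hχ)
    | ex v φ ih =>
      rcases List.mem_append.1 h with h | h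
      · exact h0 h
      · obtain ⟨χ, hχ, rfl⟩ := List.mem_map.1 h
        exact .ex v (ih hχ)
    | all v φ ih =>
      rcases List.mem_append.1 h with h | h
      · exact h0 h
      · obtain ⟨χ, hχ, rfl⟩ := List.mem_map.1 h
        exact .all v (ih hχ)
  · intro h
    induction h with
    | here => cases θ <;> simp [replacements]
    | neg _ ih => exact List.mem_append_right _ (List.mem_map_of_mem ih)
    | andLeft _ _ ih => exact List.mem_append_right _ (List.mem_append_left _ (List.mem_map.2 ⟨_, ih, rfl⟩))
    | andRight _ _ ih => exact List.mem_append_right _ (List.mem_append_right _ (List.mem_map.2 ⟨_, ih, rfl⟩))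
    | orLeft _ _ ih => exact List.mem_append_right _ (List.mem_append_left _ (List.mem_map.2 ⟨_, ih, rfl⟩))
    | orRight _ _ ih => exact List.mem_append_right _ (List.mem_append_right _ (List.mem_map.2 ⟨_, ih, rfl⟩))
    | ex _ _ ih => exact List.mem_append_right _ (List.mem_map_of_mem ih)
    | all _ _ ih => exact List.mem_append_right _ (List.mem_map_of_mem ih)

theorem primrec_replacements : Primrec₂ replacements := by
  have h0 {β : Type} [Primcodable β] {f : (Formula × Formula) × β → Formula} (hf : Primrec f) :
      Primrec fun a : (Formula × Formula) × β => if f a = a.1.1 then [a.1.2] else [] :=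
    ite (Primrec.eq.comp hf (fst.comp fst)) (primrec_singleton (snd.comp fst)) (const [])
  have h1 : Primrec fun a : (Formula × Formula) × ((Formula × Formula) × (List Formula × List Formula)) =>
      a.2.1.1 := fst.comp (fst.comp snd)
  have h2 : Primrec fun a : (Formula × Formula) × ((Formula × Formula) × (List Formula × List Formula)) =>
      a.2.1.2 := snd.comp (fst.comp snd)
  have h3 : Primrec fun a : (Formula × Formula) × ((Var × Formula) × List Formula) =>
      a.2.1.1 := fst.comp (fst.comp snd)
  have h4 : Primrec fun a : (Formula × Formula) × ((Var × Formula) × List Formula) =>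
      a.2.1.2 := snd.comp (fst.comp snd)
  exact primrec_rec (fa := fun a => if atom a.2.1 a.2.2 = a.1.1 then [a.1.2] else [])
    (fn := fun a => (if neg a.2.1 = a.1.1 then [a.1.2] else []) ++ a.2.2.map neg)
    (fand := fun a => (if and a.2.1.1 a.2.1.2 = a.1.1 then [a.1.2] else []) ++
      (a.2.2.1.map (and · a.2.1.2) ++ a.2.2.2.map (and a.2.1.1 ·)))
    (f_or := fun a => (if or a.2.1.1 a.2.1.2 = a.1.1 then [a.1.2] else []) ++
      (a.2.2.1.map (or · a.2.1.2) ++ a.2.2.2.map (or a.2.1.1 ·)))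
    (fex := fun a => (if ex a.2.1.1 a.2.1.2 = a.1.1 then [a.1.2] else []) ++ a.2.2.map (ex a.2.1.1))
    (fall := fun a => (if all a.2.1.1 a.2.1.2 = a.1.1 then [a.1.2] else []) ++ a.2.2.map (all a.2.1.1))
    (h0 (primrec_atom snd))
    (list_append.comp (h0 (primrec_neg (fst.comp snd))) (list_map (snd.comp snd) (primrec_neg snd).to₂))
    (list_append.comp (h0 (primrec_and h1 h2)) (list_append.comp
      (list_map (fst.comp (snd.comp snd)) (primrec_and snd (h2.comp fst)).to₂)
      (list_map (snd.comp (snd.comp snd)) (primrec_and (h1.comp fst) snd).to₂)))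
    (list_append.comp (h0 (primrec_or h1 h2)) (list_append.comp
      (list_map (fst.comp (snd.comp snd)) (primrec_or snd (h2.comp fst)).to₂)
      (list_map (snd.comp (snd.comp snd)) (primrec_or (h1.comp fst) snd).to₂)))
    (list_append.comp (h0 (primrec_ex h3 h4)) (list_map (snd.comp snd) (primrec_ex (h3.comp fst) snd).to₂))
    (list_append.comp (h0 (primrec_all h3 h4)) (list_map (snd.comp snd) (primrec_all (h3.comp fst) snd).to₂))
    (fun _ _ _ => rfl) (fun _ _ => rfl) (fun _ _ _ => rfl) (fun _ _ _ => rfl) (fun _ _ _ => rfl) fun _ _ _ => rfl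

end
end Formula
end Accordion

namespace Accordion
open Encodable

/-! ### Blocks and junctions -/

theorem Quant.dual_dual (q : Quant) : q.dual.dual = q := by cases q <;> rfl

theorem juncts_junct (q : Quant) (φ ψ : Formula) : (q.junct φ ψ).juncts q = φ.juncts q ++ ψ.juncts q := by
  cases q <;> rfl

/-- The parts of any presentation are refined by the finest one, so a junction can be analysed
without guessing a presentation. -/
theorem JunctionOf.juncts {q : Quant} {L : List Formula} {χ : Formula} (h : JunctionOf q L χ) :
    χ.juncts q = L.flatMap (Formula.juncts q) := by
  induction h with
  | single φ => simp
  | append _ _ h1 h2 => rw [juncts_junct, h1, h2, List.flatMap_append]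

theorem junctionOf_juncts (q : Quant) (φ : Formula) : JunctionOf q (φ.juncts q) φ := by
  induction φ with
  | and φ ψ h1 h2 =>
    cases q
    · exact .append h1 h2
    · exact .single _
  | or φ ψ h1 h2 =>
    cases q
    · exact .single _
    · exact .append h1 h2
  | _ => exact .single _

theorem block_bind (q : Quant) (v : Var) (φ : Formula) :
    (q.bind v φ).block q = (v :: (φ.block q).1, (φ.block q).2) := by
  cases q <;> rfl

theorem block_binds (q : Quant) (V : List Var) (φ : Formula) :
    (q.binds V φ).block q = (V ++ (φ.block q).1, (φ.block q).2) := by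
  induction V with
  | nil => rfl
  | cons v V ih =>
    change (q.bind v (q.binds V φ)).block q = _
    rw [block_bind, ih]
    rfl

theorem binds_block (q : Quant) (φ : Formula) : q.binds (φ.block q).1 (φ.block q).2 = φ := by
  induction φ with
  | ex v φ ih =>
    cases q
    · exact congrArg (Formula.ex v) ih
    · rfl
  | all v φ ih =>
    cases q
    · rfl
    · exact congrArg (Formula.all v) ih
  | _ => rfl

theorem block_cases (q : Quant) (φ : Formula) : φ.block q = ([], φ) ∨ ∃ v φ', φ = q.bind v φ' := by
  cases φ with
  | ex v φ =>
    cases q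
    · exact Or.inr ⟨v, φ, rfl⟩
    · exact Or.inl rfl
  | all v φ =>
    cases q
    · exact Or.inl rfl
    · exact Or.inr ⟨v, φ, rfl⟩
  | _ => exact Or.inl rfl

/-- Together with the analogous bound for blocks, this gives the descent for the recursion which
decides layeredness. -/
theorem juncts_toNat_le (q : Quant) (φ : Formula) : ∀ ψ ∈ φ.juncts q, ψ.toNat ≤ φ.toNat := by
  induction φ with
  | and φ φ' h1 h2 =>
    intro ψ hψ
    have := Formula.toNat_lt φ φ' (0, 0)
    cases q
    · rcases List.mem_append.1 hψ with h | h
      · exact (h1 ψ h).trans this.2.1.le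
      · exact (h2 ψ h).trans this.2.2.1.le
    · exact (congrArg Formula.toNat (List.mem_singleton.1 hψ)).le
  | or φ φ' h1 h2 =>
    intro ψ hψ
    have := Formula.toNat_lt φ φ' (0, 0)
    cases q
    · exact (congrArg Formula.toNat (List.mem_singleton.1 hψ)).le
    · rcases List.mem_append.1 hψ with h | h
      · exact (h1 ψ h).trans this.2.2.2.1.le
      · exact (h2 ψ h).trans this.2.2.2.2.1.le
  | _ => exact fun ψ hψ => (congrArg Formula.toNat (List.mem_singleton.1 hψ)).le

theorem block_toNat_le (q : Quant) (φ : Formula) : (φ.block q).2.toNat ≤ φ.toNat := by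
  induction φ with
  | ex v φ ih =>
    cases q
    · exact ih.trans (Formula.toNat_lt φ φ v).2.2.2.2.2.1.le
    · exact le_rfl
  | all v φ ih =>
    cases q
    · exact le_rfl
    · exact ih.trans (Formula.toNat_lt φ φ v).2.2.2.2.2.2.le
  | _ => exact le_rfl

/-! ### Connected sets of edges -/

theorem EdgesConnected.mono {X Y : Finset Var} {E : Finset (Finset Var)} (h : EdgesConnected X E) (hXY : X ⊆ Y) :
    EdgesConnected Y E := by
  refine SimpleGraph.Connected.mono ?_ h
  intro e e' hadj
  rw [SimpleGraph.fromRel_adj] at hadj ⊢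
  have hsub (a b : Finset Var) : X ∩ a ∩ b ⊆ Y ∩ a ∩ b :=
    Finset.inter_subset_inter_right (Finset.inter_subset_inter_right hXY)
  exact ⟨hadj.1, hadj.2.imp (fun h => h.mono (hsub _ _)) fun h => h.mono (hsub _ _)⟩

theorem edgesConnected_of_subsingleton (X : Finset Var) {E : Finset (Finset Var)} (hne : E.Nonempty)
    (h : ∀ e ∈ E, ∀ e' ∈ E, e = e') : EdgesConnected X E := by
  obtain ⟨e, he⟩ := hne
  have : Nonempty {e // e ∈ E} := ⟨⟨e, he⟩⟩
  refine ⟨fun a b => ?_⟩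
  rw [Subtype.ext (h a.1 a.2 b.1 b.2)]

/-- Two edges are equal or have a common element in `X`. -/
def Touch (X e e' : List Var) : Prop := e.toFinset = e'.toFinset ∨ ∃ x ∈ X, x ∈ e ∧ x ∈ e'

/-- Connectedness as a finite test: no proper part of the list of edges is non-empty and closed
under adjacency. `Touch` includes equality of the underlying sets, because one edge may be listed
several times, as different lists. -/
theorem edgesConnected_iff (X : List Var) (E : List (List Var)) :
    EdgesConnected X.toFinset (E.map List.toFinset).toFinset ↔
      E ≠ [] ∧ ∀ T ∈ E.sublists', T ≠ [] → (∀ e ∈ E, ∀ t ∈ T, Touch X e t → e ∈ T) → E ⊆ T := by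
  have hmem {e : List Var} (he : e ∈ E) : e.toFinset ∈ (E.map List.toFinset).toFinset := by
    rw [List.mem_toFinset]
    exact List.mem_map_of_mem he
  have hmem' (a : {e // e ∈ (E.map List.toFinset).toFinset}) : ∃ e ∈ E, e.toFinset = a.1 := by
    simpa only [List.mem_toFinset, List.mem_map] using a.2
  constructor
  · intro h
    obtain ⟨a⟩ := h.nonempty
    obtain ⟨e, he, _⟩ := hmem' a
    refine ⟨List.ne_nil_of_mem he, fun T hT hne hcl e he => ?_⟩
    rw [List.mem_sublists'] at hT
    obtain ⟨t, ht⟩ := List.exists_mem_of_ne_nil T hne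
    have htE := hT.subset ht
    have hr := h.preconnected ⟨_, hmem htE⟩ ⟨_, hmem he⟩
    rw [SimpleGraph.reachable_iff_reflTransGen] at hr
    have key : ∀ b, Relation.ReflTransGen (SimpleGraph.fromRel fun e e' :
        {e // e ∈ (E.map List.toFinset).toFinset} => (X.toFinset ∩ e.1 ∩ e'.1).Nonempty).Adj ⟨_, hmem htE⟩ b →
        ∀ e ∈ E, e.toFinset = b.1 → e ∈ T := by
      intro b hb
      induction hb with
      | refl => exact fun e he h => hcl e he t ht (Or.inl h)
      | @tail b c _ hadj ih =>
        intro e he hec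
        obtain ⟨f, hf, hfb⟩ := hmem' b
        refine hcl e he f (ih f hf hfb) (Or.inr ?_)
        have hadj' : (X.toFinset ∩ b.1 ∩ c.1).Nonempty := by
          rw [SimpleGraph.fromRel_adj] at hadj
          rcases hadj.2 with h | h
          · exact h
          · rwa [Finset.inter_right_comm] at h
        obtain ⟨x, hx⟩ := hadj'
        simp only [Finset.mem_inter, ← hec, ← hfb, List.mem_toFinset] at hx
        exact ⟨x, hx.1.1, hx.2, hx.1.2⟩
    exact key _ hr e he rfl
  · rintro ⟨hne, h⟩
    obtain ⟨e₀, he₀⟩ := List.exists_mem_of_ne_nil E hne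
    have : Nonempty {e // e ∈ (E.map List.toFinset).toFinset} := ⟨⟨_, hmem he₀⟩⟩
    refine ⟨fun a b => ?_⟩
    classical
    let G := SimpleGraph.fromRel fun e e' :
        {e // e ∈ (E.map List.toFinset).toFinset} => (X.toFinset ∩ e.1 ∩ e'.1).Nonempty
    -- The closed part to test is the one of all edges reachable from `a`.
    let P : List Var → Prop := fun e => ∃ he : e ∈ E, G.Reachable a ⟨_, hmem he⟩
    have hT := h (E.filter fun e => decide (P e)) (List.mem_sublists'.2 List.filter_sublist) ?_ ?_
    · obtain ⟨e, he, hb⟩ := hmem' b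
      have := hT he
      rw [List.mem_filter, decide_eq_true_eq] at this
      obtain ⟨-, _, hr⟩ := this
      have eb : (⟨_, hmem he⟩ : {e // e ∈ (E.map List.toFinset).toFinset}) = b := Subtype.ext hb
      rwa [eb] at hr
    · obtain ⟨e, he, ha⟩ := hmem' a
      have ea : (⟨_, hmem he⟩ : {e // e ∈ (E.map List.toFinset).toFinset}) = a := Subtype.ext ha
      refine List.ne_nil_of_mem (a := e) (List.mem_filter.2 ⟨he, decide_eq_true ⟨he, ?_⟩⟩)
      rw [ea]
    · intro e he t ht htouch
      rw [List.mem_filter, decide_eq_true_eq] at ht ⊢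
      obtain ⟨htE, _, hr⟩ := ht
      refine ⟨he, he, ?_⟩
      by_cases heq : e.toFinset = t.toFinset
      · have : (⟨_, hmem he⟩ : {e // e ∈ (E.map List.toFinset).toFinset}) = ⟨_, hmem htE⟩ := Subtype.ext heq
        rwa [this]
      · obtain ⟨x, hx, hxe, hxt⟩ := htouch.resolve_left heq
        refine hr.trans (SimpleGraph.Adj.reachable ?_)
        rw [SimpleGraph.fromRel_adj]
        refine ⟨fun h => heq (congrArg Subtype.val h).symm, Or.inl ⟨x, ?_⟩⟩
        simp only [Finset.mem_inter, List.mem_toFinset]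
        exact ⟨⟨hx, hxt⟩, hxe⟩

theorem primrec_sublists {α : Type} [Primcodable α] : Primrec (List.sublists' : List α → List (List α)) := by
  refine (Primrec.list_foldr (f := fun l : List α => l) (g := fun _ => ([[]] : List (List α)))
    (h := fun _ p => p.2 ++ p.2.map (p.1 :: ·)) .id (.const _) (Primrec.list_append.comp (Primrec.snd.comp .snd)
      (Primrec.list_map (Primrec.snd.comp .snd) (Primrec.list_cons.comp (Primrec.fst.comp (Primrec.snd.comp .fst))
        .snd).to₂)).to₂).of_eq fun l => ?_
  induction l with
  | nil => rfl
  | cons a l ih => rw [List.sublists'_cons, ← ih, List.foldr_cons]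

theorem primrecPred_edgesConnected {α : Type} [Primcodable α] {X : α → List Var} {E : α → List (List Var)}
    (hX : Primrec X) (hE : Primrec E) :
    PrimrecPred fun a => EdgesConnected (X a).toFinset ((E a).map List.toFinset).toFinset := by
  have htouch : PrimrecPred fun b : ((α × List (List Var)) × List Var) × List Var => Touch (X b.1.1.1) b.1.2 b.2 := by
    refine (primrecPred_toFinset_eq (Primrec.snd.comp .fst) .snd).or
      (primrecPred_exists (hX.comp (Primrec.fst.comp (Primrec.fst.comp .fst))) ?_)
    exact (primrecPred_mem .snd (Primrec.snd.comp (Primrec.fst.comp .fst))).and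
      (primrecPred_mem .snd (Primrec.snd.comp .fst))
  have hcl : PrimrecPred fun b : α × List (List Var) => ∀ e ∈ E b.1, ∀ t ∈ b.2, Touch (X b.1) e t → e ∈ b.2 := by
    refine primrecPred_forall (hE.comp .fst) (primrecPred_forall (Primrec.snd.comp .fst) ?_)
    refine (htouch.not.or (primrecPred_mem (Primrec.snd.comp .fst) (Primrec.snd.comp (Primrec.fst.comp .fst)))).of_eq
      fun b => ?_
    exact imp_iff_not_or.symm
  refine ((Primrec.eq.comp hE (.const [])).not.and (primrecPred_forall
    (p := fun a T => T = [] ∨ (¬∀ e ∈ E a, ∀ t ∈ T, Touch (X a) e t → e ∈ T) ∨ E a ⊆ T) (primrec_sublists.comp hE)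
    ((Primrec.eq.comp Primrec.snd (.const [])).or (hcl.not.or
      (primrecPred_subset (hE.comp .fst) .snd))))).of_eq fun a => ?_
  rw [edgesConnected_iff]
  refine and_congr_right fun _ => forall₂_congr fun T _ => ?_
  tauto

/-! ### Layered formulas -/

/-- One quantifier is enough, since a formula layered for one quantifier is layered for the other.
-/
def Lay (φ : Formula) : Prop := LayeredBy .ex φ

/-- A layered formula forms a block of one part with no quantified variables, for the other
quantifier: a single edge is connected. -/
theorem LayeredBy.dual {q : Quant} {φ : Formula} (h : LayeredBy q φ) : LayeredBy q.dual φ := by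
  refine LayeredBy.block q.dual [] [φ] φ ?_ (by simp) ?_ (.single φ)
  · intro ψ hψ
    rw [List.mem_singleton.1 hψ, Quant.dual_dual]
    exact h
  · exact edgesConnected_of_subsingleton _ ⟨φ.free, by simp⟩ (by simp)

theorem layeredBy_iff (q : Quant) (φ : Formula) : LayeredBy q φ ↔ Lay φ := by
  cases q
  · rfl
  · exact ⟨LayeredBy.dual, LayeredBy.dual⟩

theorem lay_block (q : Quant) {X : List Var} {L : List Formula} {χ : Formula} (h1 : ∀ φ ∈ L, Lay φ)
    (h2 : ∀ x ∈ X, ∃ φ ∈ L, x ∈ φ.free) (h3 : EdgesConnected X.toFinset (L.map Formula.free).toFinset)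
    (h4 : JunctionOf q L χ) : Lay (q.binds X χ) :=
  (layeredBy_iff q _).1 (.block q X L χ (fun φ hφ => (layeredBy_iff _ _).2 (h1 φ hφ)) h2 h3 h4)

theorem lay_nil (q : Quant) {L : List Formula} {χ : Formula} (h1 : ∀ φ ∈ L, Lay φ)
    (h2 : ∀ φ ∈ L, ∀ ψ ∈ L, φ.free = ψ.free) (h4 : JunctionOf q L χ) : Lay χ := by
  refine lay_block q (X := []) h1 (by simp) (edgesConnected_of_subsingleton _ ?_ ?_) h4
  · obtain ⟨φ, hφ⟩ := List.exists_mem_of_ne_nil _ h4.ne_nil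
    exact ⟨φ.free, by simpa using ⟨φ, hφ, rfl⟩⟩
  · intro e he e' he'
    simp only [List.mem_toFinset, List.mem_map] at he he'
    obtain ⟨φ, hφ, rfl⟩ := he
    obtain ⟨ψ, hψ, rfl⟩ := he'
    exact h2 φ hφ ψ hψ

/-- A block with quantifiers does not have the shape of a junction, so X = ∅, and connectedness
means that the parts have equal sets of free variables. Then each side of the junction is itself
layered. -/
theorem lay_junct {q : Quant} {φ ψ : Formula} :
    Lay (q.junct φ ψ) ↔ Lay φ ∧ Lay ψ ∧ φ.free = ψ.free := by
  constructor
  · have key : ∀ p θ, LayeredBy p θ → ∀ (q : Quant) (φ ψ : Formula), θ = q.junct φ ψ → Lay φ ∧ Lay ψ ∧ φ.free = ψ.free := by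
      intro p θ h
      induction h with
      | atom => intro q φ ψ h; cases q <;> simp [Quant.junct] at h
      | negAtom => intro q φ ψ h; cases q <;> simp [Quant.junct] at h
      | block p X L χ hl hs hc hj ih =>
        intro q φ ψ h
        rcases X with _ | ⟨x, X⟩
        · change χ = _ at h
          have hfree : ∀ θ ∈ L, ∀ θ' ∈ L, θ.free = θ'.free := fun θ hθ θ' hθ' =>
            hc.eq_of_empty (by simpa using ⟨θ, hθ, rfl⟩) (by simpa using ⟨θ', hθ', rfl⟩)
          have hl' : ∀ θ ∈ L, Lay θ := fun θ hθ => (layeredBy_iff _ _).1 (hl θ hθ)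
          cases hj with
          | single => exact ih χ (by simp) q φ ψ h
          | @append L₁ L₂ χ₁ χ₂ hj₁ hj₂ =>
            obtain ⟨rfl, rfl⟩ : χ₁ = φ ∧ χ₂ = ψ := by
              cases p <;> cases q <;> simp_all [Quant.junct]
            have hm₁ {θ} (h : θ ∈ L₁) : θ ∈ L₁ ++ L₂ := List.mem_append_left _ h
            have hm₂ {θ} (h : θ ∈ L₂) : θ ∈ L₁ ++ L₂ := List.mem_append_right _ h
            refine ⟨lay_nil p (fun θ h => hl' θ (hm₁ h)) (fun θ h θ' h' => hfree θ (hm₁ h) θ' (hm₁ h')) hj₁,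
              lay_nil p (fun θ h => hl' θ (hm₂ h)) (fun θ h θ' h' => hfree θ (hm₂ h) θ' (hm₂ h')) hj₂, ?_⟩
            obtain ⟨θ₁, h₁⟩ := List.exists_mem_of_ne_nil _ hj₁.ne_nil
            obtain ⟨θ₂, h₂⟩ := List.exists_mem_of_ne_nil _ hj₂.ne_nil
            ext v
            rw [hj₁.mem_free, hj₂.mem_free]
            constructor
            · rintro ⟨θ, hθ, hv⟩
              exact ⟨θ₂, h₂, hfree θ (hm₁ hθ) θ₂ (hm₂ h₂) ▸ hv⟩
            · rintro ⟨θ, hθ, hv⟩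
              exact ⟨θ₁, h₁, hfree θ (hm₂ hθ) θ₁ (hm₁ h₁) ▸ hv⟩
        · cases p <;> cases q <;> simp [Quant.junct, Quant.binds, Quant.bind] at h
    exact fun h => key _ _ h q φ ψ rfl
  · rintro ⟨h1, h2, h3⟩
    refine lay_nil q (L := [φ] ++ [ψ]) ?_ ?_ (.append (.single φ) (.single ψ))
    · simp [h1, h2]
    · simp [h3]

theorem lay_neg {φ : Formula} : Lay (.neg φ) ↔ φ.IsAtom := by
  constructor
  · have key : ∀ p θ, LayeredBy p θ → ∀ φ, θ = .neg φ → φ.IsAtom := by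
      intro p θ h
      induction h with
      | atom => intro φ h; simp at h
      | negAtom _ R args => intro φ h; exact ⟨R, args, by simpa using h.symm⟩
      | block p X L χ hl hs hc hj ih =>
        intro φ h
        rcases X with _ | ⟨x, X⟩
        · change χ = _ at h
          cases hj with
          | single => exact ih χ (by simp) φ h
          | append => cases p <;> simp [Quant.junct] at h
        · cases p <;> simp [Quant.binds, Quant.bind] at h
    exact fun h => key _ _ h φ rfl
  · rintro ⟨R, args, rfl⟩
    exact .negAtom _ R args

/-- By `lay_junct` the two sides of a layered junction have the same free variables; descending,
this holds for all parts. -/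
theorem Lay.juncts (q : Quant) {φ : Formula} (h : Lay φ) : ∀ ψ ∈ φ.juncts q, Lay ψ ∧ ψ.free = φ.free := by
  have hsingle : ∀ {φ}, Lay φ → ∀ ψ ∈ [φ], Lay ψ ∧ ψ.free = φ.free := by
    intro φ h ψ hψ
    rw [List.mem_singleton.1 hψ]
    exact ⟨h, rfl⟩
  have hap : ∀ φ₁ φ₂, (Lay φ₁ → ∀ ψ ∈ φ₁.juncts q, Lay ψ ∧ ψ.free = φ₁.free) →
      (Lay φ₂ → ∀ ψ ∈ φ₂.juncts q, Lay ψ ∧ ψ.free = φ₂.free) → Lay (q.junct φ₁ φ₂) →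
      ∀ ψ ∈ φ₁.juncts q ++ φ₂.juncts q, Lay ψ ∧ ψ.free = φ₁.free ∪ φ₂.free := by
    intro φ₁ φ₂ h1 h2 h ψ hψ
    obtain ⟨l1, l2, e⟩ := lay_junct.1 h
    rw [← e, Finset.union_self]
    rcases List.mem_append.1 hψ with hψ | hψ
    · exact h1 l1 ψ hψ
    · rw [e]
      exact h2 l2 ψ hψ
  induction φ with
  | and φ₁ φ₂ h1 h2 =>
    cases q
    · exact hap φ₁ φ₂ h1 h2 h
    · exact hsingle h
  | or φ₁ φ₂ h1 h2 =>
    cases q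
    · exact hsingle h
    · exact hap φ₁ φ₂ h1 h2 h
  | _ => exact hsingle h

/-- The condition on the parts of a formula which starts with a block of quantifiers. -/
def BlockLay (q : Quant) (X : List Var) (L : List Formula) : Prop :=
  (∀ φ ∈ L, Lay φ) ∧ (∀ x ∈ X, ∃ φ ∈ L, x ∈ φ.free) ∧ EdgesConnected X.toFinset (L.map Formula.free).toFinset

/-- A formula may be layered through several splittings of its leading quantifiers and of the
junction behind them. The maximal block with the finest junction can always be used: refining the
parts does not change the set of edges, and merging nested blocks of the same quantifier keeps
connectedness, as more variables may be used. -/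
theorem lay_bind {q : Quant} {v : Var} {φ : Formula} :
    Lay (q.bind v φ) ↔ BlockLay q (v :: (φ.block q).1) ((φ.block q).2.juncts q) := by
  constructor
  · have key : ∀ p θ, LayeredBy p θ → ∀ (q : Quant) (v : Var) (φ : Formula), θ = q.bind v φ →
        BlockLay q (v :: (φ.block q).1) ((φ.block q).2.juncts q) := by
      intro p θ h
      induction h with
      | atom => intro q v φ h; cases q <;> simp [Quant.bind] at h
      | negAtom => intro q v φ h; cases q <;> simp [Quant.bind] at h
      | block p X L χ hl hs hc hj ih =>
        intro q v φ h
        replace hl : ∀ θ ∈ L, Lay θ := fun θ hθ => (layeredBy_iff _ _).1 (hl θ hθ)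
        rcases X with _ | ⟨x, X⟩
        · change χ = _ at h
          cases hj with
          | single => exact ih χ (by simp) q v φ h
          | append => cases p <;> cases q <;> simp [Quant.junct, Quant.bind] at h
        · change p.bind x (p.binds X χ) = _ at h
          obtain ⟨rfl, rfl, rfl⟩ : p = q ∧ x = v ∧ p.binds X χ = φ := by
            cases p <;> cases q <;> simp_all [Quant.bind]
          rw [block_binds]
          -- If `χ` starts with the same quantifier, it is the only part of the junction, and its
          -- block is merged with the outer one.
          rcases block_cases p χ with e | ⟨y, χ', rfl⟩
          · rw [e, List.append_nil, hj.juncts]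
            refine ⟨?_, ?_, ?_⟩
            · intro θ hθ
              obtain ⟨ψ, hψ, hθ⟩ := List.mem_flatMap.1 hθ
              exact ((hl ψ hψ).juncts p θ hθ).1
            · intro y hy
              obtain ⟨ψ, hψ, hyψ⟩ := hs y hy
              obtain ⟨θ, hθ⟩ := List.exists_mem_of_ne_nil _ (junctionOf_juncts p ψ).ne_nil
              exact ⟨θ, List.mem_flatMap.2 ⟨ψ, hψ, hθ⟩, ((hl ψ hψ).juncts p θ hθ).2 ▸ hyψ⟩
            · convert hc using 1
              ext e
              simp only [List.mem_toFinset, List.mem_map, List.mem_flatMap]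
              constructor
              · rintro ⟨θ, ⟨ψ, hψ, hθ⟩, rfl⟩
                exact ⟨ψ, hψ, ((hl ψ hψ).juncts p θ hθ).2.symm⟩
              · rintro ⟨ψ, hψ, rfl⟩
                obtain ⟨θ, hθ⟩ := List.exists_mem_of_ne_nil _ (junctionOf_juncts p ψ).ne_nil
                exact ⟨θ, ⟨ψ, hψ, hθ⟩, ((hl ψ hψ).juncts p θ hθ).2⟩
          · obtain rfl : L = [p.bind y χ'] := JunctionOf.of_binds (V := [y]) (by simp) hj
            obtain ⟨i1, i2, i3⟩ := ih _ (by simp) p y χ' rfl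
            rw [block_bind]
            refine ⟨i1, ?_, i3.mono ?_⟩
            · intro z hz
              rw [← List.cons_append, List.mem_append] at hz
              rcases hz with hz | hz
              · obtain ⟨ψ, hψ, hzψ⟩ := hs z hz
                rw [List.mem_singleton.1 hψ] at hzψ
                rw [← (junctionOf_juncts p _).mem_free]
                -- A variable free in the quantified part is free in the formula behind its
                -- quantifiers, and hence in one of the finest parts.
                have : p.bind y χ' = p.binds (y :: (χ'.block p).1) (χ'.block p).2 :=
                  congrArg (p.bind y) (binds_block p χ').symm
                rw [this, Quant.free_binds, Finset.mem_sdiff] at hzψ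
                exact hzψ.1
              · exact i2 z hz
            · intro z hz
              rw [List.mem_toFinset] at hz ⊢
              rw [← List.cons_append]
              exact List.mem_append_right _ hz
    exact fun h => key _ _ h q v φ rfl
  · rintro ⟨h1, h2, h3⟩
    have := lay_block q h1 h2 h3 (junctionOf_juncts q _)
    rwa [show q.binds (v :: (φ.block q).1) (φ.block q).2 = q.bind v φ from
      congrArg (q.bind v) (binds_block q φ)] at this

end Accordion

namespace Accordion
open Encodable Primrec

/-! ### The syntactic notions are decidable -/

/-- The parts which have to be layered. -/
def layParts : Formula → List Formula
  | .and φ ψ => [φ, ψ]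
  | .or φ ψ => [φ, ψ]
  | .ex _ φ => (φ.block .ex).2.juncts .ex
  | .all _ φ => (φ.block .all).2.juncts .all
  | _ => []

def BlockCond (q : Quant) (v : Var) (φ : Formula) : Prop :=
  (∀ x ∈ v :: (φ.block q).1, ∃ ψ ∈ (φ.block q).2.juncts q, x ∈ ψ.freeList) ∧
    EdgesConnected (v :: (φ.block q).1).toFinset
      ((((φ.block q).2.juncts q).map Formula.freeList).map List.toFinset).toFinset

/-- The condition on the parts. -/
def LayCond : Formula → Prop
  | .atom _ _ => True
  | .neg φ => φ.kind = 0
  | .and φ ψ => φ.freeList.toFinset = ψ.freeList.toFinset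
  | .or φ ψ => φ.freeList.toFinset = ψ.freeList.toFinset
  | .ex v φ => BlockCond .ex v φ
  | .all v φ => BlockCond .all v φ

theorem isAtom_iff (φ : Formula) : φ.IsAtom ↔ φ.kind = 0 := by
  constructor
  · rintro ⟨R, args, rfl⟩
    exact (Formula.parts_atom R args).1
  · intro h
    cases φ with
    | atom R args => exact ⟨R, args, rfl⟩
    | neg φ => simp [Formula.parts_neg] at h
    | and φ ψ => simp [Formula.parts_and] at h
    | or φ ψ => simp [Formula.parts_or] at h
    | ex v φ => simp [Formula.parts_ex] at h
    | all v φ => simp [Formula.parts_all] at h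

theorem lay_bind_iff (q : Quant) (v : Var) (φ : Formula) :
    Lay (q.bind v φ) ↔ BlockCond q v φ ∧ ∀ ψ ∈ (φ.block q).2.juncts q, Lay ψ := by
  rw [lay_bind, BlockLay, BlockCond, List.map_map, and_comm]
  simp only [Formula.mem_freeList]
  rw [show List.toFinset ∘ Formula.freeList = Formula.free from funext Formula.toFinset_freeList]

/-- The decision procedure: a primitive recursive condition on the formula, and layeredness of
finitely many formulas with smaller numbers. -/
theorem lay_iff (φ : Formula) : Lay φ ↔ LayCond φ ∧ ∀ ψ ∈ layParts φ, Lay ψ := by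
  have hj (q : Quant) (φ ψ : Formula) : Lay (q.junct φ ψ) ↔
      φ.freeList.toFinset = ψ.freeList.toFinset ∧ ∀ θ ∈ [φ, ψ], Lay θ := by
    rw [lay_junct, Formula.toFinset_freeList, Formula.toFinset_freeList]
    simp only [List.forall_mem_cons, List.not_mem_nil, false_imp_iff, implies_true, and_true]
    tauto
  cases φ with
  | atom R args => exact ⟨fun _ => ⟨trivial, by simp [layParts]⟩, fun _ => .atom _ R args⟩
  | neg φ => simp [lay_neg, isAtom_iff, LayCond, layParts]
  | and φ ψ => exact hj .ex φ ψ
  | or φ ψ => exact hj .all φ ψ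
  | ex v φ => exact lay_bind_iff .ex v φ
  | all v φ => exact lay_bind_iff .all v φ

theorem layParts_lt (φ : Formula) : ∀ ψ ∈ layParts φ, ψ.toNat < φ.toNat := by
  intro ψ hψ
  cases φ with
  | atom R args => simp [layParts] at hψ
  | neg φ => simp [layParts] at hψ
  | and φ φ' =>
    have := Formula.toNat_lt φ φ' (0, 0)
    rcases (by simpa [layParts] using hψ : ψ = φ ∨ ψ = φ') with rfl | rfl <;> simp only [this]
  | or φ φ' =>
    have := Formula.toNat_lt φ φ' (0, 0)
    rcases (by simpa [layParts] using hψ : ψ = φ ∨ ψ = φ') with rfl | rfl <;> simp only [this]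
  | ex v φ =>
    exact ((juncts_toNat_le _ _ ψ hψ).trans (block_toNat_le _ φ)).trans_lt (Formula.toNat_lt φ φ v).2.2.2.2.2.1
  | all v φ =>
    exact ((juncts_toNat_le _ _ ψ hψ).trans (block_toNat_le _ φ)).trans_lt (Formula.toNat_lt φ φ v).2.2.2.2.2.2

section
variable {α : Type} [Primcodable α]

theorem primrec_blockVars {q : α → Quant} {f : α → Formula} (hq : Primrec q) (hf : Primrec f) :
    Primrec fun a => ((f a).block (q a)).1 := fst.comp (Formula.primrec_block.comp hq hf)

theorem primrec_blockParts {q : α → Quant} {f : α → Formula} (hq : Primrec q) (hf : Primrec f) :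
    Primrec fun a => ((f a).block (q a)).2.juncts (q a) :=
  Formula.primrec_juncts.comp hq (snd.comp (Formula.primrec_block.comp hq hf))

theorem primrecPred_blockCond (q : Quant) : PrimrecPred fun p : α × (Var × Formula) => BlockCond q p.2.1 p.2.2 := by
  have hX : Primrec fun p : α × (Var × Formula) => p.2.1 :: (p.2.2.block q).1 :=
    list_cons.comp (fst.comp snd) (primrec_blockVars (const q) (snd.comp snd))
  have hL : Primrec fun p : α × (Var × Formula) => (p.2.2.block q).2.juncts q :=
    primrec_blockParts (const q) (snd.comp snd)
  have hmem : PrimrecPred fun b : ((α × (Var × Formula)) × Var) × Formula => b.1.2 ∈ b.2.freeList :=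
    primrecPred_mem (snd.comp fst) (Formula.primrec_freeList.comp snd)
  have hex : PrimrecRel fun (a : α × (Var × Formula)) x =>
      ∃ ψ ∈ (a.2.2.block q).2.juncts q, x ∈ ψ.freeList := primrecPred_exists (hL.comp fst) hmem
  refine (primrecPred_forall hX hex).and ?_
  exact primrecPred_edgesConnected hX (list_map hL (Formula.primrec_freeList.comp snd).to₂)

theorem primrec_layParts : Primrec layParts := by
  have hp {f g : Unit × (Formula × Formula) → Formula} (hf : Primrec f) (hg : Primrec g) :
      Primrec fun p => [f p, g p] := list_cons.comp hf (list_cons.comp hg (const []))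
  have h : Primrec₂ fun (_ : Unit) φ => layParts φ :=
    Formula.primrec_cases (fa := fun _ => []) (fn := fun _ => []) (fand := fun p => [p.2.1, p.2.2])
      (f_or := fun p => [p.2.1, p.2.2]) (fex := fun p => (p.2.2.block .ex).2.juncts .ex)
      (fall := fun p => (p.2.2.block .all).2.juncts .all) (const []) (const [])
      (hp (fst.comp snd) (snd.comp snd)) (hp (fst.comp snd) (snd.comp snd))
      (primrec_blockParts (const _) (snd.comp snd)) (primrec_blockParts (const _) (snd.comp snd))
      (fun _ _ _ => rfl) (fun _ _ => rfl) (fun _ _ _ => rfl) (fun _ _ _ => rfl) (fun _ _ _ => rfl) fun _ _ _ => rfl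
  exact h.comp (const ()) .id

open Classical in
theorem primrecPred_layCond : PrimrecPred LayCond := by
  have hj : PrimrecPred fun p : Unit × (Formula × Formula) => p.2.1.freeList.toFinset = p.2.2.freeList.toFinset :=
    primrecPred_toFinset_eq (Formula.primrec_freeList.comp (fst.comp snd))
      (Formula.primrec_freeList.comp (snd.comp snd))
  have h : Primrec₂ fun (_ : Unit) φ => decide (LayCond φ) :=
    Formula.primrec_cases (fa := fun _ => true) (fn := fun p => decide (p.2.kind = 0))
      (fand := fun p => decide (p.2.1.freeList.toFinset = p.2.2.freeList.toFinset))
      (f_or := fun p => decide (p.2.1.freeList.toFinset = p.2.2.freeList.toFinset))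
      (fex := fun p => decide (BlockCond .ex p.2.1 p.2.2)) (fall := fun p => decide (BlockCond .all p.2.1 p.2.2))
      (const true) (PrimrecPred.decide (Primrec.eq.comp (Formula.primrec_kind.comp snd) (const 0))) hj.decide hj.decide
      (primrecPred_blockCond .ex).decide (primrecPred_blockCond .all).decide
      (fun _ _ _ => decide_eq_true trivial) (fun _ _ => decide_eq_decide.2 Iff.rfl)
      (fun _ _ _ => decide_eq_decide.2 Iff.rfl) (fun _ _ _ => decide_eq_decide.2 Iff.rfl)
      (fun _ _ _ => decide_eq_decide.2 Iff.rfl) fun _ _ _ => decide_eq_decide.2 Iff.rfl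
  exact Primrec.primrecPred (h.comp (const ()) .id)

open Classical in
theorem primrecPred_lay : PrimrecPred Lay := by
  have hall : PrimrecPred fun p : Formula × List Bool => LayCond p.1 ∧ ∀ b ∈ p.2, b = true :=
    (primrecPred_layCond.comp fst).and (primrecPred_forall (p := fun _ b => b = true) snd
      (Primrec.eq.comp snd (const true)))
  have h : Primrec₂ fun (_ : Unit) φ => decide (Lay φ) :=
    Formula.primrec_children (g := fun _ p => decide (LayCond p.1 ∧ ∀ b ∈ p.2, b = true)) primrec_layParts
      (hall.decide.comp snd).to₂ layParts_lt fun _ φ => by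
        rw [decide_eq_decide, lay_iff]
        simp
  exact Primrec.primrecPred (h.comp (const ()) .id)

/-! ### Friendly and simple formulas -/

theorem mem_subs {φ' φ : Formula} : φ' ∈ φ.subs ↔ Subformula φ' φ := by
  constructor
  · intro h
    induction φ with
    | atom R args =>
      rw [Formula.subs, List.mem_singleton] at h
      exact h ▸ .here
    | neg φ ih =>
      rcases List.mem_cons.1 h with rfl | h
      · exact .here
      · exact .neg (ih h)
    | and φ ψ h1 h2 =>
      rcases List.mem_cons.1 h with rfl | h
      · exact .here
      · rcases List.mem_append.1 h with h | h
        · exact .andLeft _ (h1 h)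
        · exact .andRight _ (h2 h)
    | or φ ψ h1 h2 =>
      rcases List.mem_cons.1 h with rfl | h
      · exact .here
      · rcases List.mem_append.1 h with h | h
        · exact .orLeft _ (h1 h)
        · exact .orRight _ (h2 h)
    | ex v φ ih =>
      rcases List.mem_cons.1 h with rfl | h
      · exact .here
      · exact .ex v (ih h)
    | all v φ ih =>
      rcases List.mem_cons.1 h with rfl | h
      · exact .here
      · exact .all v (ih h)
  -- The result is generalised so that induction over the replacement applies.
  · have key : ∀ θ, Replaced φ' φ' φ θ → φ' ∈ φ.subs := by
      intro θ h
      induction h with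
      | here => cases φ' <;> simp [Formula.subs]
      | _ => simp_all [Formula.subs]
    exact key φ

theorem Replaced.mem_subs {φ' ψ' φ ψ : Formula} (h : Replaced φ' ψ' φ ψ) : ψ' ∈ ψ.subs := by
  induction h with
  | here => cases ψ' <;> simp [Formula.subs]
  | _ => simp_all [Formula.subs]

theorem positive_iff (φ : Formula) : φ.Positive ↔ ∀ ψ ∈ φ.subs, ψ.kind ≠ 1 := by
  induction φ with
  | atom R args => simp [Formula.Positive, Formula.subs, Formula.parts_atom]
  | neg φ => simp [Formula.Positive, Formula.subs, Formula.parts_neg]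
  | and φ ψ h1 h2 => simp [Formula.Positive, Formula.subs, Formula.parts_and, h1, h2, or_imp, forall_and]
  | or φ ψ h1 h2 => simp [Formula.Positive, Formula.subs, Formula.parts_or, h1, h2, or_imp, forall_and]
  | ex v φ ih => simp [Formula.Positive, Formula.subs, Formula.parts_ex, ih]
  | all v φ ih => simp [Formula.Positive, Formula.subs, Formula.parts_all, ih]

theorem primrecPred_friendly : PrimrecPred Friendly := by
  have hl : PrimrecPred fun φ : Formula => φ.quantified.Nodup ∧ ∀ v ∈ φ.quantified, v ∉ φ.freeList :=
    (primrecPred_nodup Formula.primrec_quantified).and (primrecPred_forall (p := fun (φ : Formula) v => v ∉ φ.freeList)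
      Formula.primrec_quantified (primrecPred_mem snd (Formula.primrec_freeList.comp fst)).not)
  refine ((hl.and (primrecPred_nodup Formula.primrec_symbols)).and ((primrecPred_forall (p := fun (_ : Formula) (ψ : Formula) => ψ.kind ≠ 1)
    Formula.primrec_subs (Primrec.eq.comp (Formula.primrec_kind.comp snd) (const 1)).not).and primrecPred_lay)).of_eq
    fun φ => ?_
  simp only [Friendly, Formula.Loose, Formula.VariableLoose, Formula.SymbolLoose, Layered, positive_iff,
    layeredBy_iff, Formula.mem_freeList]
  have : Nonempty Quant := ⟨.ex⟩
  simp only [exists_const]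
  tauto

theorem block_of_quantified (q : Quant) {χ : Formula} (h : χ.quantified = []) : χ.block q = ([], χ) := by
  rcases block_cases q χ with e | ⟨v, φ, rfl⟩
  · exact e
  · cases q <;> simp [Quant.bind, Formula.quantified] at h

/-- The list V is determined by the formula: the matrix is quantifier-free, so V is the whole
leading block. -/
theorem simpleForm_iff (q : Quant) (V : List Var) (φ : Formula) : SimpleForm q V φ ↔
    Friendly φ ∧ V = (φ.block q).1 ∧ ∀ α ∈ (φ.block q).2.juncts q, α.kind = 0 := by
  constructor
  · rintro ⟨h, L, χ, hL, hj, rfl⟩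
    have hχ : χ.quantified = [] := by
      rw [hj.quantified, List.flatMap_eq_nil_iff]
      intro α hα
      obtain ⟨R, args, rfl⟩ := hL α hα
      rfl
    rw [block_binds, block_of_quantified q hχ, List.append_nil, hj.juncts]
    refine ⟨h, rfl, fun α hα => ?_⟩
    obtain ⟨β, hβ, hα⟩ := List.mem_flatMap.1 hα
    obtain ⟨R, args, rfl⟩ := hL β hβ
    rw [← isAtom_iff]
    exact ⟨R, args, List.mem_singleton.1 hα⟩
  · rintro ⟨h, rfl, hL⟩
    exact ⟨h, _, _, fun α hα => (isAtom_iff α).2 (hL α hα), junctionOf_juncts q _, (binds_block q φ).symm⟩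

theorem primrecPred_simpleForm {q : α → Quant} {V : α → List Var} {f : α → Formula} (hq : Primrec q)
    (hV : Primrec V) (hf : Primrec f) : PrimrecPred fun a => SimpleForm (q a) (V a) (f a) :=
  ((primrecPred_friendly.comp hf).and ((Primrec.eq.comp hV (primrec_blockVars hq hf)).and
    (primrecPred_forall (p := fun _ α => α.kind = 0) (primrec_blockParts hq hf)
      (Primrec.eq.comp (Formula.primrec_kind.comp snd) (const 0))))).of_eq fun _ => (simpleForm_iff _ _ _).symm

theorem length_atoms_of_shape {φ ψ : Formula} (h : φ.shape = ψ.shape) : φ.atoms.length = ψ.atoms.length := by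
  have key (φ : Formula) : φ.atoms.length = φ.shape.atoms.length := by
    induction φ <;> simp_all [Formula.atoms, Formula.shape]
  rw [key φ, h, ← key ψ]

/-- The relation leaves everything but the atoms unchanged, so it is equality of the shapes and a
condition on corresponding atoms, both of which can be tested. -/
theorem atomsRestricted_iff (V : Finset Var) (φ ψ : Formula) : AtomsRestricted V φ ψ ↔
    φ.shape = ψ.shape ∧ ∀ p ∈ φ.atoms.zip ψ.atoms, p.2.2.toFinset = p.1.2.toFinset ∩ V := by
  constructor
  · intro h
    induction h with
    | atom R R' args args' h => simpa [Formula.shape, Formula.atoms] using h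
    | neg _ ih => exact ⟨congrArg (Formula.neg) ih.1, ih.2⟩
    | and _ _ i1 i2 =>
      refine ⟨congrArg₂ Formula.and i1.1 i2.1, ?_⟩
      rw [Formula.atoms, Formula.atoms, List.zip_append (length_atoms_of_shape i1.1), List.forall_mem_append]
      exact ⟨i1.2, i2.2⟩
    | or _ _ i1 i2 =>
      refine ⟨congrArg₂ Formula.or i1.1 i2.1, ?_⟩
      rw [Formula.atoms, Formula.atoms, List.zip_append (length_atoms_of_shape i1.1), List.forall_mem_append]
      exact ⟨i1.2, i2.2⟩
    | ex v _ ih => exact ⟨congrArg (Formula.ex v) ih.1, ih.2⟩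
    | all v _ ih => exact ⟨congrArg (Formula.all v) ih.1, ih.2⟩
  · rintro ⟨h, hp⟩
    induction φ generalizing ψ with
    | atom R args =>
      cases ψ with
      | atom R' args' => exact .atom _ _ _ _ (hp ((R, args), (R', args')) (by simp [Formula.atoms]))
      | _ => simp [Formula.shape] at h
    | neg φ ih =>
      cases ψ with
      | neg ψ => exact .neg (ih ψ (by simpa [Formula.shape] using h) hp)
      | _ => simp [Formula.shape] at h
    | and φ φ' h1 h2 =>
      cases ψ with
      | and ψ ψ' =>
        have e : φ.shape = ψ.shape ∧ φ'.shape = ψ'.shape := by simpa [Formula.shape] using h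
        rw [Formula.atoms, Formula.atoms, List.zip_append (length_atoms_of_shape e.1), List.forall_mem_append] at hp
        exact .and (h1 ψ e.1 hp.1) (h2 ψ' e.2 hp.2)
      | _ => simp [Formula.shape] at h
    | or φ φ' h1 h2 =>
      cases ψ with
      | or ψ ψ' =>
        have e : φ.shape = ψ.shape ∧ φ'.shape = ψ'.shape := by simpa [Formula.shape] using h
        rw [Formula.atoms, Formula.atoms, List.zip_append (length_atoms_of_shape e.1), List.forall_mem_append] at hp
        exact .or (h1 ψ e.1 hp.1) (h2 ψ' e.2 hp.2)
      | _ => simp [Formula.shape] at h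
    | ex v φ ih =>
      cases ψ with
      | ex w ψ =>
        have e : v = w ∧ φ.shape = ψ.shape := by simpa [Formula.shape] using h
        exact e.1 ▸ .ex v (ih ψ e.2 hp)
      | _ => simp [Formula.shape] at h
    | all v φ ih =>
      cases ψ with
      | all w ψ =>
        have e : v = w ∧ φ.shape = ψ.shape := by simpa [Formula.shape] using h
        exact e.1 ▸ .all v (ih ψ e.2 hp)
      | _ => simp [Formula.shape] at h

theorem primrecPred_atomsRestricted {V : α → List Var} {f g : α → Formula} (hV : Primrec V) (hf : Primrec f)
    (hg : Primrec g) : PrimrecPred fun a => AtomsRestricted (V a).toFinset (f a) (g a) := by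
  have hat {f : α → Formula} (hf : Primrec f) : Primrec fun p : α × ℕ => ((f p.1).atoms.getD p.2 (0, [])).2 :=
    snd.comp ((list_getD (0, [])).comp (Formula.primrec_atoms.comp (hf.comp fst)) snd)
  refine ((Primrec.eq.comp (Formula.primrec_shape.comp hf) (Formula.primrec_shape.comp hg)).and
    (primrecPred_forall (p := fun a i => ((g a).atoms.getD i (0, [])).2.toFinset =
      ((((f a).atoms.getD i (0, [])).2).filter fun v => decide (v ∈ V a)).toFinset)
      (list_range.comp (list_length.comp (Formula.primrec_atoms.comp hf))) (primrecPred_toFinset_eq (hat hg)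
        (primrec_filter (p := fun (p : α × ℕ) v => v ∈ V p.1) (hat hf) (primrecPred_mem snd
          (hV.comp (fst.comp fst))))))).of_eq fun a => ?_
  rw [atomsRestricted_iff]
  refine and_congr_right fun hs => ?_
  have hl := length_atoms_of_shape hs
  have e (l : List Var) : (l.filter fun v => decide (v ∈ V a)).toFinset = l.toFinset ∩ (V a).toFinset := by
    ext v
    simp
  simp only [e, List.mem_range]
  rw [List.forall_mem_iff_getElem]
  simp only [List.length_zip, ← hl, min_self, List.getElem_zip]
  refine forall₂_congr fun i hi => ?_
  rw [List.getD_eq_getElem _ _ (hl ▸ hi), List.getD_eq_getElem _ _ hi]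

theorem nodup_map_iff {β γ : Type} [DecidableEq γ] (k : β → γ) (l : List β) :
    (l.map k).Nodup ↔ ∀ a ∈ l, (l.filter fun b => decide (k b = k a)).length ≤ 1 := by
  have e (c : γ) : (l.map k).count c = (l.filter fun b => decide (k b = c)).length := by
    rw [List.count, List.countP_map, List.countP_eq_length_filter]
    congr 2
  rw [List.nodup_iff_count_le_one]
  constructor
  · exact fun h a _ => (e (k a)).symm.trans_le (h (k a))
  · intro h c
    by_cases hc : c ∈ l.map k
    · obtain ⟨a, ha, rfl⟩ := List.mem_map.1 hc
      exact (e (k a)).trans_le (h a ha)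
    · rw [List.count_eq_zero_of_not_mem hc]
      exact Nat.zero_le _

/-- The list of triples can be read off from the atoms of the formula, so no search is needed: the
atoms have two distinct arguments from F, every two-element subset is covered, and no subset appears
twice. -/
theorem pairJunction_iff (q : Quant) (F : List Var) (ψ : Formula) : PairJunction q F.toFinset ψ ↔
    (∀ α ∈ ψ.juncts q.dual, α.kind = 0) ∧
    (∀ a ∈ ψ.atoms, a.2.length = 2 ∧ a.2.Nodup ∧ a.2 ⊆ F) ∧
    (∀ x ∈ F, ∀ y ∈ F, x = y ∨ ∃ a ∈ ψ.atoms, x ∈ a.2 ∧ y ∈ a.2) ∧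
    ∀ a ∈ ψ.atoms, (ψ.atoms.filter fun b => decide (b.2.toFinset = a.2.toFinset)).length ≤ 1 := by
  rw [← nodup_map_iff (fun a : ℕ × List Var => a.2.toFinset)]
  constructor
  · rintro ⟨T, h1, h2, h3⟩
    have hat : ψ.atoms = T.map fun t => (t.1, [t.2.1, t.2.2]) := by
      rw [h3.atoms, List.flatMap_map, List.map_eq_flatMap]
      rfl
    have hF : ∀ t ∈ T, t.2.1 ≠ t.2.2 ∧ t.2.1 ∈ F ∧ t.2.2 ∈ F := by
      intro t ht
      have h := (h2 _).1 (List.mem_map_of_mem ht)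
      rw [Finset.mem_powersetCard] at h
      refine ⟨fun e => ?_, ?_, ?_⟩
      · rw [e] at h
        simp at h
      · simpa using h.1 (Finset.mem_insert_self _ _)
      · simpa using h.1 (Finset.mem_insert_of_mem (Finset.mem_singleton_self _))
    refine ⟨?_, ?_, ?_, ?_⟩
    · rw [h3.juncts]
      intro α hα
      obtain ⟨β, hβ, hα⟩ := List.mem_flatMap.1 hα
      obtain ⟨t, -, rfl⟩ := List.mem_map.1 hβ
      rw [List.mem_singleton.1 hα]
      exact (Formula.parts_atom _ _).1
    · rw [hat]
      intro a ha
      obtain ⟨t, ht, rfl⟩ := List.mem_map.1 ha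
      have := hF t ht
      simp [this]
    · intro x hx y hy
      rw [or_iff_not_imp_left]
      intro hxy
      obtain ⟨t, ht, e⟩ := List.mem_map.1 ((h2 {x, y}).2 (by
        rw [Finset.mem_powersetCard, Finset.card_pair hxy]
        simp [Finset.insert_subset_iff, hx, hy]))
      refine ⟨(t.1, [t.2.1, t.2.2]), hat ▸ List.mem_map_of_mem ht, ?_⟩
      rw [Finset.ext_iff] at e
      have e1 := (e x).2 (by simp)
      have e2 := (e y).2 (by simp)
      simp only [Finset.mem_insert, Finset.mem_singleton] at e1 e2
      simp only [List.mem_cons, List.not_mem_nil, or_false]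
      exact ⟨e1, e2⟩
    · rw [hat, List.map_map]
      convert h1 using 2
      funext t
      simp
  · rintro ⟨h1, h2, h3, h4⟩
    have hL : ψ.juncts q.dual = ψ.atoms.map fun a => .atom a.1 a.2 := by
      rw [(junctionOf_juncts q.dual ψ).atoms, List.map_flatMap]
      conv_lhs => rw [← List.flatMap_singleton' (ψ.juncts q.dual)]
      refine List.flatMap_congr fun α hα => ?_
      obtain ⟨R, args, rfl⟩ := (isAtom_iff α).2 (h1 α hα)
      rfl
    have hpair : ∀ a ∈ ψ.atoms, ∃ x y, a.2 = [x, y] ∧ x ≠ y ∧ x ∈ F ∧ y ∈ F := by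
      intro a ha
      obtain ⟨hl, hn, hs⟩ := h2 a ha
      obtain ⟨x, y, e⟩ := List.length_eq_two.1 hl
      rw [e] at hn hs
      refine ⟨x, y, e, by simpa using hn, hs (by simp), hs (by simp)⟩
    have hset : ∀ a ∈ ψ.atoms, ({a.2.getD 0 (0, 0), a.2.getD 1 (0, 0)} : Finset Var) = a.2.toFinset := by
      intro a ha
      obtain ⟨x, y, e, -⟩ := hpair a ha
      simp [e]
    have hmap : (ψ.atoms.map fun a => (a.1, a.2.getD 0 (0, 0), a.2.getD 1 (0, 0))).map
        (fun t => ({t.2.1, t.2.2} : Finset Var)) = ψ.atoms.map fun a => a.2.toFinset := by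
      rw [List.map_map]
      exact List.map_congr_left hset
    refine ⟨ψ.atoms.map fun a => (a.1, a.2.getD 0 (0, 0), a.2.getD 1 (0, 0)), ?_, ?_, ?_⟩
    · rwa [hmap]
    · intro e
      rw [hmap, List.mem_map, Finset.mem_powersetCard]
      constructor
      · rintro ⟨a, ha, rfl⟩
        obtain ⟨x, y, e, hxy, hx, hy⟩ := hpair a ha
        rw [e]
        simp [Finset.insert_subset_iff, hxy, hx, hy]
      · rintro ⟨hs, hc⟩
        obtain ⟨x, y, hxy, rfl⟩ := Finset.card_eq_two.1 hc
        simp only [Finset.insert_subset_iff, Finset.singleton_subset_iff, List.mem_toFinset] at hs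
        obtain ⟨a, ha, hxa, hya⟩ := (h3 x hs.1 y hs.2).resolve_left hxy
        refine ⟨a, ha, ?_⟩
        obtain ⟨z, w, e, hzw, -⟩ := hpair a ha
        rw [e] at hxa hya ⊢
        simp only [List.mem_cons, List.not_mem_nil, or_false] at hxa hya
        rcases hxa with rfl | rfl <;> rcases hya with rfl | rfl
        · exact absurd rfl hxy
        · simp
        · simp [Finset.pair_comm]
        · exact absurd rfl hxy
    · rw [List.map_map]
      have := junctionOf_juncts q.dual ψ
      rw [hL] at this
      convert this using 1
      refine List.map_congr_left fun a ha => ?_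
      obtain ⟨x, y, e, -⟩ := hpair a ha
      simp [e]

theorem primrecPred_pairJunction {q : α → Quant} {F : α → List Var} {f : α → Formula} (hq : Primrec q)
    (hF : Primrec F) (hf : Primrec f) : PrimrecPred fun a => PairJunction (q a) (F a).toFinset (f a) := by
  have hA := Formula.primrec_atoms.comp hf
  refine PrimrecPred.of_eq ?_ fun a => (pairJunction_iff _ _ _).symm
  refine (primrecPred_forall (p := fun _ α => α.kind = 0)
    (Formula.primrec_juncts.comp (Quant.primrec_dual.comp hq) hf)
    (Primrec.eq.comp (Formula.primrec_kind.comp snd) (const 0))).and (.and (primrecPred_forall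
      (p := fun a (b : ℕ × List Var) => b.2.length = 2 ∧ b.2.Nodup ∧ b.2 ⊆ F a) hA
      ((Primrec.eq.comp (list_length.comp (snd.comp snd)) (const 2)).and ((primrecPred_nodup (snd.comp snd)).and
        (primrecPred_subset (snd.comp snd) (hF.comp fst))))) (.and ?_ ?_))
  · refine primrecPred_forall (p := fun a x => ∀ y ∈ F a, x = y ∨ ∃ b ∈ (f a).atoms, x ∈ b.2 ∧ y ∈ b.2) hF
      (primrecPred_forall (p := fun (b : α × Var) y => b.2 = y ∨ ∃ c ∈ (f b.1).atoms, b.2 ∈ c.2 ∧ y ∈ c.2)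
      (hF.comp fst) ((Primrec.eq.comp (snd.comp fst) snd).or (primrecPred_exists
        (p := fun (b : (α × Var) × Var) (c : ℕ × List Var) => b.1.2 ∈ c.2 ∧ b.2 ∈ c.2)
        (hA.comp (fst.comp fst)) (.and (primrecPred_mem (snd.comp (fst.comp fst)) (snd.comp snd))
          (primrecPred_mem (snd.comp fst) (snd.comp snd))))))
  · exact primrecPred_forall (p := fun a b => ((f a).atoms.filter fun c =>
      decide (c.2.toFinset = b.2.toFinset)).length ≤ 1) hA (Primrec.nat_le.comp (list_length.comp
        (primrec_filter (p := fun (p : α × (ℕ × List Var)) (c : ℕ × List Var) => c.2.toFinset = p.2.2.toFinset)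
          (hA.comp fst) (primrecPred_toFinset_eq (snd.comp snd) (snd.comp (snd.comp fst))))) (const 1))

theorem primrecPred_replaced {θ θ' f g : α → Formula} (hθ : Primrec θ) (hθ' : Primrec θ') (hf : Primrec f)
    (hg : Primrec g) : PrimrecPred fun a => Replaced (θ a) (θ' a) (f a) (g a) :=
  (primrecPred_mem hg (Formula.primrec_replacements.comp (hθ.pair hθ') hf)).of_eq fun _ =>
    Formula.mem_replacements

theorem primrecPred_basedOn {q : α → Quant} {V : α → List Var} {f g : α → Formula} (hq : Primrec q)
    (hV : Primrec V) (hf : Primrec f) (hg : Primrec g) : PrimrecPred fun a => BasedOn (q a) (V a) (f a) (g a) :=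
  ((primrecPred_simpleForm hq hV hg).and ((Primrec.eq.comp (Formula.primrec_freeList.comp hg) (const [])).and
    (primrecPred_atomsRestricted hV hf hg))).of_eq fun a => by
    rw [BasedOn, ← Formula.toFinset_freeList, List.toFinset_eq_empty_iff]

end
end Accordion

namespace Accordion
open Encodable Primrec

/-! ### The rules are computable from the formulas -/

section rules
variable {α : Type} [Primcodable α]

theorem primrec_relIdx {rels : α → List (ℕ × List ℕ)} {R : α → ℕ} (hrels : Primrec rels) (hR : Primrec R) :
    Primrec fun a => relIdx (rels a) (R a) :=
  list_idxOf.comp hR (list_map hrels (fst.comp snd).to₂)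

theorem primrec_findAtom {as as' : α → List (ℕ × List Var)} {R : α → ℕ} (has : Primrec as) (has' : Primrec as')
    (hR : Primrec R) : Primrec fun a => findAtom (as a) (as' a) (R a) :=
  (list_getD (0, [])).comp has' (list_idxOf.comp hR (list_map has (fst.comp snd).to₂))

theorem primrec_idxOf {v : α → Var} {l : α → List Var} (hv : Primrec v) (hl : Primrec l) :
    Primrec fun a => (l a).idxOf (v a) :=
  (list_idxOf.comp hv hl).of_eq fun a => by
    have : (instBEqOfDecidableEq : BEq Var) = instBEqProd := lawful_beq_subsingleton _ _
    rw [this]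

variable {rels : α → List (ℕ × List ℕ)} {as as' : α → List (ℕ × List Var)} {r : α → ℕ × List ℕ}

theorem primrec_basedRule {tr : α → List ℕ} (hrels : Primrec rels) (has : Primrec as) (has' : Primrec as')
    (htr : Primrec tr) (hr : Primrec r) : Primrec fun a => basedRule (rels a) (as a) (as' a) (tr a) (r a) := by
  have hR := fst.comp hr
  have hl := list_length.comp (snd.comp hr)
  have h1 := primrec_findAtom has has' hR
  have h2 := primrec_findAtom has has hR
  have hc : Primrec fun a => decide ((r a).1 ∈ (as a).map Prod.fst) :=
    (primrecPred_mem hR (list_map has (fst.comp snd).to₂)).decide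
  have hk : Primrec fun a => (([], [(relIdx (rels a) (findAtom (as a) (as' a) (r a).1).1,
      (findAtom (as a) (as' a) (r a).1).2.map fun v => (findAtom (as a) (as a) (r a).1).2.idxOf v)]) : Clause) :=
    (const []).pair (Formula.primrec_singleton ((primrec_relIdx hrels (fst.comp h1)).pair
      (list_map (snd.comp h1) (primrec_idxOf snd (snd.comp (h2.comp fst))).to₂)))
  exact cond hc ((hl.pair (const false)).pair ((const []).pair (Formula.primrec_singleton hk)))
    ((hl.pair (primrecPred_mem hR htr).decide).pair ((const []).pair (const [])))

theorem primrec_pairClause {sorts : α → List ℕ} {len : α → ℕ} {args : α → List Var} {E : α → ℕ × List Var}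
    (hsorts : Primrec sorts) (hrels : Primrec rels) (hlen : Primrec len) (hargs : Primrec args) (hE : Primrec E) :
    Primrec fun a => pairClause (sorts a) (rels a) (len a) (args a) (E a) := by
  have hv (i : ℕ) : Primrec fun a => (E a).2.getD i (0, 0) := (list_getD (0, 0)).comp (snd.comp hE) (const i)
  have hf (i : ℕ) : Primrec fun a => (List.range (len a)).filter fun p =>
      decide ((args a).getD p (0, 0) = (E a).2.getD i (0, 0)) :=
    primrec_filter (p := fun a p => (args a).getD p (0, 0) = (E a).2.getD i (0, 0)) (list_range.comp hlen)
      (Primrec.eq.comp ((list_getD (0, 0)).comp (hargs.comp fst) snd) ((hv i).comp fst))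
  have h1 : Primrec fun p : α × ℕ => ((sorts p.1).idxOf ((E p.1).2.getD 0 (0, 0)).2, p.2) :=
    (list_idxOf.comp (snd.comp ((hv 0).comp fst)) (hsorts.comp fst)).pair snd
  have h2 : Primrec fun p : α × ℕ => (relIdx (rels p.1) (E p.1).1, [len p.1, p.2]) :=
    ((primrec_relIdx hrels (fst.comp hE)).comp fst).pair (list_cons.comp (hlen.comp fst) (Formula.primrec_singleton snd))
  exact (list_map (hf 0) h1.to₂).pair (list_map (hf 1) h2.to₂)

theorem primrec_pairRule {sorts : α → List ℕ} {ng : α → Bool} {V : α → List Var} (hsorts : Primrec sorts)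
    (hrels : Primrec rels) (hng : Primrec ng) (hV : Primrec V) (has : Primrec as) (has' : Primrec as')
    (hr : Primrec r) : Primrec fun a => pairRule (sorts a) (rels a) (ng a) (V a) (as a) (as' a) (r a) := by
  have hR := fst.comp hr
  have hl := list_length.comp (snd.comp hr)
  have h2 := snd.comp (primrec_findAtom has has hR)
  have hc : Primrec fun a => decide ((r a).1 ∈ (as a).map Prod.fst) :=
    (primrecPred_mem hR (list_map has (fst.comp snd).to₂)).decide
  have hf : Primrec fun a => (List.range (r a).2.length).filter fun p =>
      decide ((findAtom (as a) (as a) (r a).1).2.getD p (0, 0) ∈ V a) :=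
    primrec_filter (p := fun a p => (findAtom (as a) (as a) (r a).1).2.getD p (0, 0) ∈ V a) (list_range.comp hl)
      (primrecPred_mem ((list_getD (0, 0)).comp (h2.comp fst) snd) (hV.comp fst))
  have hk : Primrec fun a => ([([], [(relIdx (rels a) (r a).1, List.range (r a).2.length)])] : List Clause) :=
    Formula.primrec_singleton ((const []).pair (Formula.primrec_singleton ((primrec_relIdx hrels hR).pair (list_range.comp hl))))
  exact cond hc ((hl.pair hng).pair (hf.pair (list_map has' (primrec_pairClause (hsorts.comp fst) (hrels.comp fst)
    (hl.comp fst) (h2.comp fst) snd).to₂))) ((hl.pair (const false)).pair ((const []).pair hk))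

end rules

/-! ### Sentences as data -/

/-- A sentence with its signature as a tuple. -/
def SigFormula.equiv : SigFormula ≃ (List ℕ × List (ℕ × List ℕ)) × Formula where
  toFun φ := ((φ.sig.sorts, φ.sig.rels), φ.form)
  invFun p := ⟨⟨p.1.1, p.1.2⟩, p.2⟩
  left_inv _ := rfl
  right_inv _ := rfl

noncomputable instance : Primcodable SigFormula := Primcodable.ofEquiv _ SigFormula.equiv

theorem primrec_sorts : Primrec fun φ : SigFormula => φ.sig.sorts :=
  fst.comp (fst.comp (Primrec.of_equiv (e := SigFormula.equiv)))

theorem primrec_rels : Primrec fun φ : SigFormula => φ.sig.rels :=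
  snd.comp (fst.comp (Primrec.of_equiv (e := SigFormula.equiv)))

theorem primrec_form : Primrec SigFormula.form := snd.comp (Primrec.of_equiv (e := SigFormula.equiv))

theorem primrec_natsStr : Primrec natsStr := by
  have h : Primrec fun p : List ℕ × ℕ => List.replicate p.2 true :=
    (list_map (list_range.comp snd) (const true).to₂).of_eq fun p => by simp
  have h' : Primrec fun p : List ℕ × ℕ => List.replicate p.2 true ++ [false] := list_append.comp h (const [false])
  exact list_flatMap .id h'.to₂

theorem primrec_sigEncode : Primrec SigFormula.encode := by
  refine primrec_natsStr.comp (list_append.comp ?_ (Formula.primrec_code.comp primrec_form))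
  refine list_cons.comp (list_length.comp primrec_sorts) (list_append.comp primrec_sorts
    (list_cons.comp (list_length.comp primrec_rels) (list_flatMap primrec_rels ?_)))
  exact (list_cons.comp (fst.comp snd) (list_cons.comp (list_length.comp (snd.comp snd)) (snd.comp snd))).to₂

/-- A bound for the numbers of objects with codes of a given length. -/
def codeBound (n : ℕ) : ℕ := Nat.rec 0 (fun _ m => 6 * Nat.pair m m + 6) n

theorem primrec_codeBound : Primrec codeBound :=
  nat_rec₁ 0 (nat_add.comp (nat_mul.comp (const 6) (Primrec₂.natPair.comp snd snd)) (const 6)).to₂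

theorem codeBound_succ (n : ℕ) : codeBound (n + 1) = 6 * Nat.pair (codeBound n) (codeBound n) + 6 := rfl

theorem codeBound_lt (n : ℕ) : codeBound n < codeBound (n + 1) := by
  have := Nat.left_le_pair (codeBound n) (codeBound n)
  rw [codeBound_succ]
  omega

theorem codeBound_mono : StrictMono codeBound := strictMono_nat_of_lt_succ codeBound_lt

theorem pair_mono {a b c d : ℕ} (h : a ≤ c) (h' : b ≤ d) : Nat.pair a b ≤ Nat.pair c d := by
  rcases h.eq_or_lt with rfl | h
  · rcases h'.eq_or_lt with rfl | h'
    · exact le_rfl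
    · exact (Nat.pair_lt_pair_right _ h').le
  · refine (Nat.pair_lt_pair_left b h).le.trans ?_
    rcases h'.eq_or_lt with rfl | h'
    · exact le_rfl
    · exact (Nat.pair_lt_pair_right _ h').le

/-- `codeBound` grows fast enough to absorb one pairing step with each additional symbol of an
encoding. -/
theorem pair_le_codeBound {a b m n l : ℕ} (ha : a ≤ codeBound m) (hb : b ≤ codeBound n) (h : m + n + 1 ≤ l) :
    6 * Nat.pair a b + 6 ≤ codeBound l := by
  have h1 := ha.trans (codeBound_mono.monotone (show m ≤ m + n by omega))
  have h2 := hb.trans (codeBound_mono.monotone (show n ≤ m + n by omega))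
  refine le_trans ?_ (codeBound_mono.monotone h)
  rw [codeBound_succ]
  have := pair_mono h1 h2
  omega

theorem length_natsStr_cons (n : ℕ) (l : List ℕ) : (natsStr (n :: l)).length = n + 1 + (natsStr l).length := by
  simp [natsStr]
  omega

theorem length_natsStr_append (l l' : List ℕ) :
    (natsStr (l ++ l')).length = (natsStr l).length + (natsStr l').length := by
  simp [natsStr]

/-- Each element contributes one pairing, which is paid for by the one symbol that its string has in
excess of `m`. -/
theorem encode_list_le {β : Type} [Encodable β] {c : β → List ℕ} (l : List β)
    (h : ∀ b, ∃ m, encode b ≤ codeBound m ∧ m + 1 ≤ (natsStr (c b)).length) :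
    encode l ≤ codeBound (natsStr (l.flatMap c)).length := by
  induction l with
  | nil => simp
  | cons b l ih =>
    obtain ⟨m, h1, h2⟩ := h b
    rw [List.flatMap_cons, length_natsStr_append, Encodable.encode_list_cons]
    have := pair_le_codeBound h1 ih (l := (natsStr (c b)).length + (natsStr (l.flatMap c)).length) (by omega)
    omega

theorem encode_nats_le (l : List ℕ) : encode l ≤ codeBound (natsStr l).length := by
  have := encode_list_le (c := fun n : ℕ => [n]) l fun n =>
    ⟨n, codeBound_mono.le_apply, by simp [natsStr]⟩
  rwa [show (l.flatMap fun n => [n]) = l from List.flatMap_singleton' l] at this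

theorem encode_var_le (v : Var) : encode v ≤ codeBound (v.1 + v.2 + 1) := by
  have := pair_le_codeBound (codeBound_mono.le_apply (x := v.1)) (codeBound_mono.le_apply (x := v.2)) le_rfl
  rw [show encode v = Nat.pair v.1 v.2 from rfl]
  omega

theorem encode_formula_le (φ : Formula) : encode φ ≤ codeBound (natsStr φ.code).length := by
  rw [Formula.encode_eq]
  induction φ with
  | atom R args =>
    have h1 := encode_list_le (c := fun v : Var => [v.1, v.2]) args fun v =>
      ⟨_, encode_var_le v, by simp [natsStr]; omega⟩
    have := pair_le_codeBound (codeBound_mono.le_apply (x := R)) h1 le_rfl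
    simp only [Formula.code, Formula.toNat, length_natsStr_cons]
    rw [show encode (R, args) = Nat.pair R (encode args) from rfl]
    refine le_trans (by omega) (this.trans (codeBound_mono.monotone ?_))
    omega
  | neg φ ih =>
    have := pair_le_codeBound ih (Nat.zero_le (codeBound 0)) le_rfl
    have h := Nat.left_le_pair φ.toNat 0
    simp only [Formula.code, Formula.toNat, length_natsStr_cons]
    refine le_trans (by omega) (this.trans (codeBound_mono.monotone ?_))
    omega
  | and φ ψ h1 h2 =>
    have := pair_le_codeBound h1 h2 le_rfl
    simp only [Formula.code, Formula.toNat, length_natsStr_cons, length_natsStr_append]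
    refine le_trans (by omega) (this.trans (codeBound_mono.monotone ?_))
    omega
  | or φ ψ h1 h2 =>
    have := pair_le_codeBound h1 h2 le_rfl
    simp only [Formula.code, Formula.toNat, length_natsStr_cons, length_natsStr_append]
    refine le_trans (by omega) (this.trans (codeBound_mono.monotone ?_))
    omega
  | ex v φ ih =>
    have := pair_le_codeBound (encode_var_le v) ih le_rfl
    simp only [Formula.code, Formula.toNat, length_natsStr_cons]
    refine le_trans (by omega) (this.trans (codeBound_mono.monotone ?_))
    omega
  | all v φ ih =>
    have := pair_le_codeBound (encode_var_le v) ih le_rfl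
    simp only [Formula.code, Formula.toNat, length_natsStr_cons]
    refine le_trans (by omega) (this.trans (codeBound_mono.monotone ?_))
    omega

/-- A sentence with a given encoding has a number bounded in terms of the length of the encoding, so
bounded search replaces a parser. -/
theorem encode_sigFormula_le (φ : SigFormula) : encode φ ≤ codeBound φ.encode.length := by
  have h1 := encode_nats_le φ.sig.sorts
  have h2 := encode_list_le (c := fun R : ℕ × List ℕ => R.1 :: R.2.length :: R.2) φ.sig.rels fun R => by
    have := pair_le_codeBound (codeBound_mono.le_apply (x := R.1)) (encode_nats_le R.2) le_rfl
    refine ⟨R.1 + (natsStr R.2).length + 1, ?_, by simp only [length_natsStr_cons]; omega⟩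
    rw [show encode R = Nat.pair R.1 (encode R.2) from rfl]
    omega
  have h3 := pair_le_codeBound h1 h2 le_rfl
  have h3' : Nat.pair (encode φ.sig.sorts) (encode φ.sig.rels) ≤ _ := le_trans (by omega) h3
  have h4 := pair_le_codeBound h3' (encode_formula_le φ.form) le_rfl
  rw [show encode φ = Nat.pair (Nat.pair (encode φ.sig.sorts) (encode φ.sig.rels)) (encode φ.form) from rfl]
  refine le_trans (by omega) (h4.trans (codeBound_mono.monotone ?_))
  rw [SigFormula.encode, Signature.code]
  simp only [List.cons_append, List.append_assoc, length_natsStr_cons, length_natsStr_append]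
  omega

/-- The list of the at most one sentence with a given encoding. -/
noncomputable def sentences (u : Str) : List SigFormula :=
  ((List.range (codeBound u.length + 1)).filterMap decode).filter fun φ => decide (φ.encode = u)

theorem mem_sentences {u : Str} {φ : SigFormula} : φ ∈ sentences u ↔ φ.encode = u := by
  rw [sentences, List.mem_filter, decide_eq_true_eq, and_iff_right_iff_imp]
  rintro rfl
  exact List.mem_filterMap.2 ⟨encode φ, List.mem_range.2 (Nat.lt_succ_of_le (encode_sigFormula_le φ)), encodek φ⟩

theorem primrec_sentences : Primrec sentences :=
  primrec_filter (p := fun u (φ : SigFormula) => φ.encode = u)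
    (listFilterMap (list_range.comp (succ.comp (primrec_codeBound.comp list_length))) (Primrec.decode.comp snd).to₂)
    (Primrec.eq.comp (primrec_sigEncode.comp snd) fst)

theorem over_iff (σ : Signature) (φ : Formula) : φ.Over σ ↔
    (∀ a ∈ φ.atoms, (a.1, a.2.map Prod.snd) ∈ σ.rels) ∧ ∀ v ∈ φ.quantified, v.2 ∈ σ.sorts := by
  induction φ with
  | atom R args => simp [Formula.Over, Formula.atoms, Formula.quantified]
  | neg φ ih => exact ih
  | and φ ψ h1 h2 =>
    simp only [Formula.Over, Formula.atoms, Formula.quantified, List.forall_mem_append, h1, h2]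
    tauto
  | or φ ψ h1 h2 =>
    simp only [Formula.Over, Formula.atoms, Formula.quantified, List.forall_mem_append, h1, h2]
    tauto
  | ex v φ ih =>
    simp only [Formula.Over, Formula.atoms, Formula.quantified, List.forall_mem_cons, ih]
    tauto
  | all v φ ih =>
    simp only [Formula.Over, Formula.atoms, Formula.quantified, List.forall_mem_cons, ih]
    tauto

theorem primrecPred_isSentence : PrimrecPred SigFormula.IsSentence := by
  have hwf : PrimrecPred fun φ : SigFormula => φ.sig.sorts ≠ [] ∧ φ.sig.sorts.Nodup ∧
      (φ.sig.rels.map Prod.fst).Nodup ∧ ∀ r ∈ φ.sig.rels, r.2 ⊆ φ.sig.sorts :=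
    (Primrec.eq.comp primrec_sorts (const [])).not.and ((primrecPred_nodup primrec_sorts).and
      ((primrecPred_nodup (list_map primrec_rels (fst.comp snd).to₂)).and
        (primrecPred_forall (p := fun (φ : SigFormula) (r : ℕ × List ℕ) => r.2 ⊆ φ.sig.sorts) primrec_rels
          (primrecPred_subset (snd.comp snd) (primrec_sorts.comp fst)))))
  have hov : PrimrecPred fun φ : SigFormula => (∀ a ∈ φ.form.atoms, (a.1, a.2.map Prod.snd) ∈ φ.sig.rels) ∧
      ∀ v ∈ φ.form.quantified, v.2 ∈ φ.sig.sorts :=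
    (primrecPred_forall (p := fun (φ : SigFormula) (a : ℕ × List Var) => (a.1, a.2.map Prod.snd) ∈ φ.sig.rels)
      (Formula.primrec_atoms.comp primrec_form) (primrecPred_mem ((fst.comp snd).pair
        (list_map (snd.comp snd) (snd.comp snd).to₂)) (primrec_rels.comp fst))).and
    (primrecPred_forall (p := fun (φ : SigFormula) (v : Var) => v.2 ∈ φ.sig.sorts)
      (Formula.primrec_quantified.comp primrec_form) (primrecPred_mem (snd.comp snd) (primrec_sorts.comp fst)))
  refine (hwf.and (hov.and (Primrec.eq.comp (Formula.primrec_freeList.comp primrec_form) (const [])))).of_eq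
    fun φ => ?_
  rw [← over_iff, ← List.toFinset_eq_empty_iff, Formula.toFinset_freeList]
  constructor
  · rintro ⟨⟨h1, h2, h3, h4⟩, h5, h6⟩
    exact ⟨⟨h1, h2, h3, fun R w hR s hs => h4 (R, w) hR hs⟩, h5, h6⟩
  · rintro ⟨⟨h1, h2, h3, h4⟩, h5, h6⟩
    exact ⟨⟨h1, h2, h3, fun r hr s hs => h4 r.1 r.2 hr s hs⟩, h5, h6⟩

/-- Friendly sentences of arity at most `k`. -/
def Admissible (k : ℕ) (φ : SigFormula) : Prop := φ.IsSentence ∧ Friendly φ.form ∧ φ.ArityLE k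

theorem primrecPred_admissible (k : ℕ) : PrimrecPred (Admissible k) := by
  refine primrecPred_isSentence.and ((primrecPred_friendly.comp primrec_form).and ?_)
  refine (primrecPred_forall (p := fun (_ : SigFormula) (r : ℕ × List ℕ) => r.2.length ≤ k) primrec_rels
    (nat_le.comp (list_length.comp (snd.comp snd)) (const k))).of_eq fun φ => ?_
  exact ⟨fun h R w hR => h (R, w) hR, fun h r hr => h r.1 r.2 hr⟩

/-! ### The set of pairs is decidable -/

/-- A pair of sentences, a quantifier, a subformula of the second and a subformula of the first sentence. -/
abbrev Witness := (SigFormula × SigFormula) × (Quant × (Formula × Formula))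

namespace Witness

/-- For a simple subformula the quantified variables are its leading block, so they need not be part
of the witness. -/
def vars (c : Witness) : List Var := (c.2.2.1.block c.2.1).1

def Based (c : Witness) : Prop := BasedOn c.2.1 c.vars c.2.2.1 c.1.1.form

/-- The last component matters only for replacements; for a sentence based on the subformula it is a
filler. -/
def Good (k : ℕ) (c : Witness) : Prop :=
  (Admissible k c.1.1 ∧ Admissible k c.1.2) ∧ SimpleForm c.2.1 c.vars c.2.2.1 ∧
    (c.Based ∨ PairJunction c.2.1 c.2.2.1.freeList.toFinset c.2.2.2 ∧
      Replaced c.2.2.1 c.2.2.2 c.1.2.form c.1.1.form)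

/-- A finite search space: the replacing formula of a replacement is a subformula of the first
sentence. -/
noncomputable def all (x : Str × Str) : List Witness :=
  (sentences x.1).flatMap fun ψ => (sentences x.2).flatMap fun φ => [Quant.ex, Quant.all].flatMap fun q =>
    φ.form.subs.flatMap fun φ' => ψ.form.subs.map fun ψ' => ((ψ, φ), (q, (φ', ψ')))

theorem mem_all {x : Str × Str} {c : Witness} : c ∈ all x ↔ c.1.1.encode = x.1 ∧ c.1.2.encode = x.2 ∧
    Subformula c.2.2.1 c.1.2.form ∧ Subformula c.2.2.2 c.1.1.form := by
  obtain ⟨⟨ψ, φ⟩, q, φ', ψ'⟩ := c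
  simp only [all, List.mem_flatMap, List.mem_map, mem_sentences, mem_subs, Prod.mk.injEq]
  constructor
  · rintro ⟨_, h1, _, h2, _, _, _, h3, _, h4, ⟨rfl, rfl⟩, _, rfl, rfl⟩
    exact ⟨h1, h2, h3, h4⟩
  · rintro ⟨h1, h2, h3, h4⟩
    exact ⟨_, h1, _, h2, q, by cases q <;> simp, _, h3, _, h4, ⟨rfl, rfl⟩, rfl, rfl, rfl⟩

theorem primrec_first : Primrec fun c : Witness => c.1.1 := fst.comp fst
theorem primrec_second : Primrec fun c : Witness => c.1.2 := snd.comp fst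
theorem primrec_quant : Primrec fun c : Witness => c.2.1 := fst.comp snd
theorem primrec_old : Primrec fun c : Witness => c.2.2.1 := fst.comp (snd.comp snd)
theorem primrec_new : Primrec fun c : Witness => c.2.2.2 := snd.comp (snd.comp snd)

theorem primrec_vars : Primrec vars := primrec_blockVars primrec_quant primrec_old

theorem primrecPred_based : PrimrecPred Based :=
  primrecPred_basedOn primrec_quant primrec_vars primrec_old (primrec_form.comp primrec_first)

theorem primrecPred_good (k : ℕ) : PrimrecPred (Good k) :=
  (((primrecPred_admissible k).comp primrec_first).and ((primrecPred_admissible k).comp primrec_second)).and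
    ((primrecPred_simpleForm primrec_quant primrec_vars primrec_old).and (primrecPred_based.or
      ((primrecPred_pairJunction primrec_quant (Formula.primrec_freeList.comp primrec_old) primrec_new).and
        (primrecPred_replaced primrec_old primrec_new (primrec_form.comp primrec_second) (primrec_form.comp primrec_first)))))

theorem primrec_all : Primrec all := by
  have h1 : Primrec fun p : ((((Str × Str) × SigFormula) × SigFormula) × Quant) × Formula =>
      p.1.1.1.2.form.subs.map fun ψ' => (((p.1.1.1.2, p.1.1.2), (p.1.2, (p.2, ψ'))) : Witness) := by
    refine list_map (Formula.primrec_subs.comp (primrec_form.comp (snd.comp (fst.comp (fst.comp fst))))) ?_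
    exact (((snd.comp (fst.comp (fst.comp (fst.comp fst)))).pair (snd.comp (fst.comp (fst.comp fst)))).pair
      ((snd.comp (fst.comp fst)).pair ((snd.comp fst).pair snd))).to₂
  have h2 : Primrec fun p : (((Str × Str) × SigFormula) × SigFormula) × Quant => p.1.2.form.subs.flatMap fun φ' =>
      p.1.1.2.form.subs.map fun ψ' => (((p.1.1.2, p.1.2), (p.2, (φ', ψ'))) : Witness) :=
    list_flatMap (Formula.primrec_subs.comp (primrec_form.comp (snd.comp fst))) h1.to₂
  have h3 : Primrec fun p : ((Str × Str) × SigFormula) × SigFormula => [Quant.ex, Quant.all].flatMap fun q =>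
      p.2.form.subs.flatMap fun φ' => p.1.2.form.subs.map fun ψ' => (((p.1.2, p.2), (q, (φ', ψ'))) : Witness) :=
    list_flatMap (const [Quant.ex, Quant.all]) h2.to₂
  have h4 : Primrec fun p : (Str × Str) × SigFormula => (sentences p.1.2).flatMap fun φ =>
      [Quant.ex, Quant.all].flatMap fun q => φ.form.subs.flatMap fun φ' => p.2.form.subs.map fun ψ' =>
        (((p.2, φ), (q, (φ', ψ'))) : Witness) :=
    list_flatMap (primrec_sentences.comp (snd.comp fst)) h3.to₂
  exact list_flatMap (primrec_sentences.comp fst) h4.to₂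

theorem primrec_positions : Primrec fun φ : SigFormula => Reader.positions φ.sig := by
  have h : Primrec fun p : (SigFormula × (ℕ × List ℕ)) × ℕ => p.1.1.sig.sorts.idxOf p.2 :=
    list_idxOf.comp snd (primrec_sorts.comp (fst.comp fst))
  have h' : Primrec fun p : SigFormula × (ℕ × List ℕ) => p.2.2.map fun s => p.1.sig.sorts.idxOf s :=
    list_map (snd.comp snd) h.to₂
  exact (list_length.comp primrec_sorts).pair (list_map primrec_rels h'.to₂)

open Classical in
/-- The rule for a relation of the second signature. -/
noncomputable def rule (c : Witness) (r : ℕ × List ℕ) : Rule := bif decide c.Based then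
      basedRule c.1.1.sig.rels c.2.2.1.atoms c.1.1.form.atoms (c.1.2.form.trues (c.2.2.1.symbols.headD 0)) r
    else pairRule c.1.1.sig.sorts c.1.1.sig.rels c.2.1.isAll c.vars c.2.2.1.atoms c.2.2.2.atoms r

open Classical in
theorem primrec_rule : Primrec fun p : Witness × (ℕ × List ℕ) => rule p.1 p.2 := by
  have hψ : Primrec fun p : Witness × (ℕ × List ℕ) => p.1.1.1 := primrec_first.comp fst
  have hφ : Primrec fun p : Witness × (ℕ × List ℕ) => p.1.1.2 := primrec_second.comp fst
  have hφ' : Primrec fun p : Witness × (ℕ × List ℕ) => p.1.2.2.1 := primrec_old.comp fst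
  have hψ' : Primrec fun p : Witness × (ℕ × List ℕ) => p.1.2.2.2 := primrec_new.comp fst
  have hs : Primrec fun p : Witness × (ℕ × List ℕ) => p.1.2.2.1.symbols.headD 0 :=
    ((list_getD 0).comp (Formula.primrec_symbols.comp hφ') (const 0)).of_eq fun p => by
      cases p.1.2.2.1.symbols <;> rfl
  have h1 : Primrec fun p : Witness × (ℕ × List ℕ) => basedRule p.1.1.1.sig.rels p.1.2.2.1.atoms
      p.1.1.1.form.atoms (p.1.1.2.form.trues (p.1.2.2.1.symbols.headD 0)) p.2 :=
    primrec_basedRule (primrec_rels.comp hψ) (Formula.primrec_atoms.comp hφ')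
      (Formula.primrec_atoms.comp (primrec_form.comp hψ))
      (Formula.primrec_trues.comp hs (primrec_form.comp hφ)) snd
  have h2 : Primrec fun p : Witness × (ℕ × List ℕ) => pairRule p.1.1.1.sig.sorts p.1.1.1.sig.rels p.1.2.1.isAll
      p.1.vars p.1.2.2.1.atoms p.1.2.2.2.atoms p.2 :=
    primrec_pairRule (primrec_sorts.comp hψ) (primrec_rels.comp hψ)
      (Quant.primrec_isAll.comp (primrec_quant.comp fst)) (primrec_vars.comp fst)
      (Formula.primrec_atoms.comp hφ') (Formula.primrec_atoms.comp hψ') snd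
  exact cond (primrecPred_based.comp fst).decide h1 h2

/-- The instructions for computing the structure on the signature of the second sentence. -/
noncomputable def plan (c : Witness) : Plan :=
  (Reader.positions c.1.1.sig, ((c.1.2.sig.sorts.length, c.1.1.form.atoms.length + 1),
    c.1.2.sig.rels.map c.rule))

theorem primrec_plan : Primrec plan :=
  (primrec_positions.comp primrec_first).pair (((list_length.comp (primrec_sorts.comp primrec_second)).pair
    (succ.comp (list_length.comp (Formula.primrec_atoms.comp (primrec_form.comp primrec_first))))).pair
      (list_map (primrec_rels.comp primrec_second) primrec_rule.to₂))

open Classical in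
/-- The witnesses for membership in the set of pairs. -/
noncomputable def good (k : ℕ) (x : Str × Str) : List Witness := (all x).filter fun c => decide (Good k c)

open Classical in
theorem primrec_good (k : ℕ) : Primrec (good k) :=
  primrec_filter (p := fun _ c => Good k c) primrec_all ((primrecPred_good k).comp snd)

theorem mem_pairSet {k : ℕ} {x : Str × Str} : x ∈ pairSet k ↔ good k x ≠ [] := by
  classical
  constructor
  · rintro ⟨ψ, φ, h1, h2, ⟨q, V, φ', hs, hsub, h⟩, rfl⟩
    have hV : V = (φ'.block q).1 := ((simpleForm_iff q V φ').1 hs).2.1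
    subst hV
    have key : ∃ ψ', Subformula ψ' ψ.form ∧ (BasedOn q (φ'.block q).1 φ' ψ.form ∨
        PairJunction q φ'.freeList.toFinset ψ' ∧ Replaced φ' ψ' φ.form ψ.form) := by
      rcases h with h | ⟨ψ', h, h'⟩
      -- Any subformula would do as the unused component.
      · exact ⟨ψ.form, .here, Or.inl h⟩
      · rw [← Formula.toFinset_freeList] at h
        exact ⟨ψ', mem_subs.1 h'.mem_subs, Or.inr ⟨h, h'⟩⟩
    obtain ⟨ψ', hψ', h⟩ := key
    exact List.ne_nil_of_mem (a := ((ψ, φ), (q, (φ', ψ')))) (List.mem_filter.2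
      ⟨mem_all.2 ⟨rfl, rfl, hsub, hψ'⟩, decide_eq_true ⟨⟨h1, h2⟩, hs, h⟩⟩)
  · intro h
    obtain ⟨c, hc⟩ := List.exists_mem_of_ne_nil _ h
    rw [good, List.mem_filter, mem_all, decide_eq_true_eq] at hc
    obtain ⟨⟨e1, e2, hsub, -⟩, ⟨h1, h2⟩, hs, h⟩ := hc
    rw [Formula.toFinset_freeList] at h
    exact ⟨c.1.1, c.1.2, h1, h2, ⟨c.2.1, c.vars, c.2.2.1, hs, hsub, h.imp id fun h => ⟨_, h⟩⟩,
      Prod.ext e1.symm e2.symm⟩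

/-- The instructions for a pair of strings. -/
noncomputable def planOf (k : ℕ) (x : Str × Str) : Plan := ((good k x).map plan).headI

theorem primrec_planOf (k : ℕ) : Primrec (planOf k) :=
  list_headI.comp (list_map (primrec_good k) (primrec_plan.comp snd).to₂)

theorem exists_planOf {k : ℕ} {x : Str × Str} (h : x ∈ pairSet k) : ∃ c : Witness, Good k c ∧
    Subformula c.2.2.1 c.1.2.form ∧ x = (c.1.1.encode, c.1.2.encode) ∧ planOf k x = c.plan := by
  classical
  rw [mem_pairSet] at h
  obtain ⟨c, l, e⟩ := List.exists_cons_of_ne_nil h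
  have hc : c ∈ good k x := e ▸ List.mem_cons_self
  rw [good, List.mem_filter, mem_all, decide_eq_true_eq] at hc
  refine ⟨c, hc.2, hc.1.2.2.1, Prod.ext hc.1.1.symm hc.1.2.1.symm, ?_⟩
  rw [planOf, e]
  rfl

theorem primrecPred_pairSet (k : ℕ) : PrimrecPred fun x => x ∈ pairSet k :=
  (Primrec.eq.comp (primrec_good k) (const [])).not.of_eq fun _ => mem_pairSet.symm

end Witness
end Accordion

namespace Accordion
open Primrec

/-! ### Structures with the same encoding -/

theorem eq_of_flatMap_eq {α β : Type} {l : List α} {f g : α → List β} (h : l.flatMap f = l.flatMap g)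
    (hl : ∀ a ∈ l, (f a).length = (g a).length) : ∀ a ∈ l, f a = g a := by
  induction l with
  | nil => simp
  | cons a l ih =>
    have := List.append_inj h (hl a (by simp))
    rw [List.forall_mem_cons]
    exact ⟨this.1, ih this.2 fun b hb => hl b (by simp [hb])⟩

/-- Bounded quantification keeps all values inside the universes, so satisfaction inspects only
sizes of listed sorts and entries of the tables. -/
theorem sat_iff_of_tables {A B : Struc} {σ : Signature} (hc : ∀ s ∈ σ.sorts, A.card s = B.card s)
    (hr : ∀ R ∈ σ.rels, ∀ b ∈ tuples A.card R.2, A.rel R.1 b = B.rel R.1 b) {φ : Formula} (hφ : φ.Over σ)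
    {g : Var → ℕ} (hg : ∀ v ∈ φ.free, g v < A.card v.2) : φ.Sat A g ↔ φ.Sat B g := by
  induction φ generalizing g with
  | atom R args =>
    simp only [Formula.Sat]
    rw [hr (R, args.map Prod.snd) hφ]
    have : ∀ l : List Var, (∀ v ∈ l, g v < A.card v.2) → l.map g ∈ tuples A.card (l.map Prod.snd) := by
      intro l hl
      induction l with
      | nil => simp [tuples]
      | cons v l ih =>
        simp only [List.map_cons, tuples, List.mem_flatMap, List.mem_map, List.mem_range]
        exact ⟨g v, hl v (by simp), _, ih fun x hx => hl x (by simp [hx]), rfl⟩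
    exact this args fun v hv => hg v (List.mem_toFinset.2 hv)
  | neg φ ih => exact not_congr (ih hφ hg)
  | and φ ψ h1 h2 =>
    exact and_congr (h1 hφ.1 fun v hv => hg v (Finset.mem_union_left _ hv))
      (h2 hφ.2 fun v hv => hg v (Finset.mem_union_right _ hv))
  | or φ ψ h1 h2 =>
    exact or_congr (h1 hφ.1 fun v hv => hg v (Finset.mem_union_left _ hv))
      (h2 hφ.2 fun v hv => hg v (Finset.mem_union_right _ hv))
  | ex v φ ih =>
    simp only [Formula.Sat, ← hc v.2 hφ.1]
    refine exists_congr fun a => and_congr_right fun ha => ih hφ.2 fun x hx => ?_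
    rcases eq_or_ne x v with rfl | hne
    · simpa using ha
    · rw [Function.update_of_ne hne]
      exact hg x (Finset.mem_erase.2 ⟨hne, hx⟩)
  | all v φ ih =>
    simp only [Formula.Sat, ← hc v.2 hφ.1]
    refine forall_congr' fun a => imp_congr_right fun ha => ih hφ.2 fun x hx => ?_
    rcases eq_or_ne x v with rfl | hne
    · simpa using ha
    · rw [Function.update_of_ne hne]
      exact hg x (Finset.mem_erase.2 ⟨hne, hx⟩)

theorem models_iff_of_encode_eq {A B : Struc} {φ : SigFormula} (hφ : φ.IsSentence)
    (h : A.encode φ.sig = B.encode φ.sig) : A.Models φ.form ↔ B.Models φ.form := by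
  obtain ⟨h1, h2⟩ := natsStr_append_inj (by simp) h
  rw [List.map_inj_left] at h1
  have ht : ∀ R ∈ φ.sig.rels, tuples A.card R.2 = tuples B.card R.2 := fun R hR => by
    simpa using tuples_congr (g := id) fun s hs => h1 s (hφ.wf.arity_sorts R.1 R.2 hR s hs)
  refine sat_iff_of_tables h1 (fun R hR => ?_) hφ.isOver fun v hv => by simp [hφ.closed] at hv
  have := eq_of_flatMap_eq h2 (fun R hR => by simp [ht R hR]) R hR
  rwa [← ht R hR, List.map_inj_left] at this

/-- Membership speaks of some structure with the given encoding; structures with the same encoding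
satisfy the same sentences over the signature. -/
theorem mem_MCs_iff {φ : SigFormula} (hφ : φ.IsSentence) {A : Struc} (hA : A.On φ.sig) :
    (φ.encode, A.encode φ.sig) ∈ MCs ↔ A.Models φ.form := by
  constructor
  · rintro ⟨φ', A', -, -, h, hm⟩
    rw [Prod.mk.injEq] at h
    obtain rfl := SigFormula.encode_injective h.1
    exact (models_iff_of_encode_eq hφ h.2).2 hm
  · exact fun h => ⟨φ, A, hφ, hA, rfl, h⟩

/-! ### The measure -/

theorem le_maxCard (A : Struc) {σ : Signature} {s : ℕ} (hs : s ∈ σ.sorts) : A.card s ≤ A.maxCard σ :=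
  Finset.le_sup (f := A.card) (List.mem_toFinset.2 hs)

theorem maxCard_le_length (A : Struc) (σ : Signature) : A.maxCard σ ≤ (A.encode σ).length := by
  refine Finset.sup_le fun s hs => ?_
  rw [Reader.length_encode]
  have h1 : A.card s ≤ (σ.sorts.map A.card).sum :=
    List.le_sum_of_mem (List.mem_map_of_mem (List.mem_toFinset.1 hs))
  have h2 (l : List ℕ) : l.sum ≤ (natsStr l).length := by simp [natsStr]
  have := h2 (σ.sorts.map A.card)
  omega

/-- Each sort contributes its size and a delimiter, and each table has at most as many entries as
there are k-tuples over a set of one element more than the largest universe; the additional element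
keeps the power monotone in the exponent. -/
theorem length_encode_le {A : Struc} {σ : Signature} {k : ℕ} (hσ : σ.WellFormed) (hk : ∀ R ∈ σ.rels, R.2.length ≤ k) :
    (A.encode σ).length ≤ (σ.sorts.length + σ.rels.length) *
      (A.maxCard σ + 1 + (A.maxCard σ + 1) ^ k) := by
  have h1 : (natsStr (σ.sorts.map A.card)).length ≤ σ.sorts.length * (A.maxCard σ + 1) := by
    have : ∀ l : List ℕ, (∀ n ∈ l, n ≤ A.maxCard σ) → (natsStr l).length ≤ l.length * (A.maxCard σ + 1) := by
      intro l hl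
      induction l with
      | nil => simp [natsStr]
      | cons n l ih =>
        rw [List.forall_mem_cons] at hl
        have := ih hl.2
        rw [length_natsStr_cons, List.length_cons, add_mul]
        omega
    simpa using this (σ.sorts.map A.card) (by simpa using fun s hs => le_maxCard A hs)
  have h2 : (σ.rels.map fun R => (R.2.map A.card).prod).sum ≤ σ.rels.length * (A.maxCard σ + 1) ^ k := by
    refine (List.sum_le_card_nsmul _ ((A.maxCard σ + 1) ^ k) ?_).trans (by simp)
    intro n hn
    obtain ⟨R, hR, rfl⟩ := List.mem_map.1 hn
    refine (List.prod_le_pow_card _ (A.maxCard σ + 1) ?_).trans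
      (Nat.pow_le_pow_right (Nat.succ_pos _) (by simpa using hk R hR))
    intro n hn
    obtain ⟨s, hs, rfl⟩ := List.mem_map.1 hn
    exact (le_maxCard A (hσ.arity_sorts R.1 R.2 hR s hs)).trans (Nat.le_succ _)
  rw [Reader.length_encode]
  nlinarith [Nat.zero_le (σ.sorts.length * (A.maxCard σ + 1) ^ k), Nat.zero_le (σ.rels.length * (A.maxCard σ + 1))]

theorem length_le_length_encode (φ : SigFormula) : φ.sig.sorts.length + φ.sig.rels.length ≤ φ.encode.length := by
  simp only [SigFormula.encode, Signature.code, List.cons_append, List.append_assoc, length_natsStr_cons,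
    length_natsStr_append]
  have : ∀ l : List ℕ, l.length ≤ (natsStr l).length := by
    intro l
    induction l with
    | nil => simp
    | cons n l ih => rw [length_natsStr_cons, List.length_cons]; omega
  have := this φ.sig.sorts
  omega

/-- The number of sorts and relation symbols is at most the length of the encoded sentence, and
provides the factor f; the exponent k provides the polynomial. On other pairs the measure is the
length itself, where the added 1 keeps the factor positive. -/
theorem isMeasure_maxSortSize (k : ℕ) : IsMeasure (maxSortSize k) := by
  refine ⟨fun s => s.length + 1, (Polynomial.X + 1) + (Polynomial.X + 1) ^ k,
    (succ.comp list_length).to_comp, fun s y => ?_⟩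
  simp only [Polynomial.eval_add, Polynomial.eval_pow, Polynomial.eval_X, Polynomial.eval_one]
  by_cases h : ∃ d : SigFormula × Struc, Encodes k (s, y) d.1 d.2
  · obtain ⟨⟨φ, A⟩, h⟩ := h
    rw [maxSortSize_eq h]
    obtain ⟨hφ, hk, -, h⟩ := h
    rw [Prod.mk.injEq] at h
    obtain ⟨rfl, rfl⟩ := h
    refine ⟨maxCard_le_length _ _, (length_encode_le hφ.wf fun R hR => hk R.1 R.2 hR).trans ?_⟩
    exact Nat.mul_le_mul_right _ ((length_le_length_encode φ).trans (Nat.le_succ _))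
  · rw [maxSortSize, dif_neg h]
    refine ⟨le_rfl, ?_⟩
    nlinarith [Nat.zero_le (s.length * (y.length + 1)), Nat.zero_le ((s.length + 1) * (y.length + 1) ^ k)]

/-! ### The structure computed from a witness -/

namespace Witness
variable {k : ℕ} {c : Witness} {y : Str}

/-- The word read by the machine. -/
def word (c : Witness) (y : Str) : List (Option Bool) := tripleWord (c.1.1.encode, c.1.2.encode, y)

/-- The structure computed from the third string. -/
noncomputable def struc (k : ℕ) (c : Witness) (y : Str) : Struc :=
  ruleStruc c.1.2.sig c.plan.2.2 (Reader.card (c.word y)) (Reader.lookup k (c.word y) c.plan.1)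
    (Reader.total (c.word y) c.plan.1.1) (Reader.size (c.word y) c.plan)

theorem rule_of_based (h : c.Based) (r : ℕ × List ℕ) : c.rule r = basedRule c.1.1.sig.rels c.2.2.1.atoms
    c.1.1.form.atoms (c.1.2.form.trues (c.2.2.1.symbols.headD 0)) r := by
  classical
  rw [rule, decide_eq_true h, cond_true]

theorem rule_of_not_based (h : ¬ c.Based) (r : ℕ × List ℕ) : c.rule r = pairRule c.1.1.sig.sorts c.1.1.sig.rels
    c.2.1.isAll c.vars c.2.2.1.atoms c.2.2.2.atoms r := by
  classical
  rw [rule, decide_eq_false h, cond_false]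

theorem rule_arity (c : Witness) (r : ℕ × List ℕ) : (c.rule r).1.1 = r.2.length := by
  by_cases h : c.Based
  · rw [rule_of_based h, basedRule]
    cases decide (r.1 ∈ c.2.2.1.atoms.map Prod.fst) <;> rfl
  · rw [rule_of_not_based h, pairRule]
    cases decide (r.1 ∈ c.2.2.1.atoms.map Prod.fst) <;> rfl

theorem result_eq (hc : c.Good k) (hv : Reader.valid k (c.word y) (Reader.positions c.1.1.sig) = true) :
    Reader.result k (c.word y) c.plan = (c.struc k y).encode c.1.2.sig := by
  refine Reader.result_eq hc.1.2.1.wf (fun R hR => hc.1.2.2.2 R.1 R.2 hR) rfl (by simp [plan]) (fun i hi => ?_) hv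
  rw [List.getD_eq_getElem _ _ (by simpa [plan] using hi)]
  simp only [plan, List.getElem_map]
  exact c.rule_arity _

theorem valid {A : Struc} (hc : c.Good k) (hA : A.On c.1.1.sig) (hy : y = A.encode c.1.1.sig) :
    Reader.valid k (c.word y) (Reader.positions c.1.1.sig) = true :=
  Reader.valid_encode hc.1.1.1.wf hA hy fun R hR => hc.1.1.2.2 R.1 R.2 hR

theorem card_le_total {A : Struc} (hy : y = A.encode c.1.1.sig)
    {s : ℕ} (hs : s ∈ c.1.1.sig.sorts) :
    A.card s ≤ Reader.total (c.word y) c.1.1.sig.sorts.length := by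
  rw [← Reader.card_idxOf (u := c.1.1.encode) (u' := c.1.2.encode) hy hs]
  exact Finset.single_le_sum (f := Reader.card (c.word y)) (fun _ _ => Nat.zero_le _)
    (Finset.mem_range.2 (List.idxOf_lt_length_of_mem hs))

theorem total_le {A : Struc} (hy : y = A.encode c.1.1.sig) : Reader.total (c.word y) c.1.1.sig.sorts.length ≤
    c.1.1.sig.sorts.length * A.maxCard c.1.1.sig := by
  refine (Finset.sum_le_card_nsmul _ _ (A.maxCard c.1.1.sig) fun i hi => ?_).trans (by simp)
  rw [Finset.mem_range] at hi
  rw [word, (Reader.card_eq (u := c.1.1.encode) (u' := c.1.2.encode) hy i (by simpa using hi)).1, List.getElem_map]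
  exact le_maxCard A (List.getElem_mem hi)

theorem struc_on {A : Struc} (hc : c.Good k) (hA : A.On c.1.1.sig) (hy : y = A.encode c.1.1.sig) :
    (c.struc k y).On c.1.2.sig := by
  intro _ _
  obtain ⟨s, hs⟩ := List.exists_mem_of_ne_nil _ hc.1.1.1.wf.sorts_ne
  exact Nat.mul_pos (Nat.succ_pos _) ((hA s hs).trans_le (card_le_total hy hs))

theorem maxCard_struc_le {A : Struc} (hy : y = A.encode c.1.1.sig) : (c.struc k y).maxCard c.1.2.sig ≤
    (c.1.1.form.atoms.length + 1) * c.1.1.sig.sorts.length * A.maxCard c.1.1.sig := by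
  refine Finset.sup_le fun _ _ => ?_
  rw [mul_assoc]
  exact Nat.mul_le_mul_left _ (total_le hy)

theorem models_struc {A : Struc} (hc : c.Good k) (hA : A.On c.1.1.sig) (hy : y = A.encode c.1.1.sig)
    (hsub : Subformula c.2.2.1 c.1.2.form) :
    A.Models c.1.1.form ↔ (c.struc k y).Models c.1.2.form := by
  have hk : ∀ R ∈ c.1.1.sig.rels, R.2.length ≤ k := fun R hR => hc.1.1.2.2 R.1 R.2 hR
  have hlk : ∀ (R : ℕ) (hR : R < c.1.1.sig.rels.length) (f : ℕ → ℕ),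
      Reader.lookup k (c.word y) c.plan.1 R f = _ := fun R hR f =>
    Reader.lookup_eq (u := c.1.1.encode) (u' := c.1.2.encode) hc.1.1.1.wf hA hy hk hR f
  have hM : ∀ s ∈ c.1.1.sig.sorts, A.card s ≤ Reader.total (c.word y) c.plan.1.1 := fun s hs =>
    card_le_total hy hs
  rw [struc]
  by_cases hb : c.Based
  · have e : c.plan.2.2 = c.1.2.sig.rels.map (basedRule c.1.1.sig.rels c.2.2.1.atoms c.1.1.form.atoms
        (c.1.2.form.trues (c.2.2.1.symbols.headD 0))) :=
      List.map_congr_left fun r _ => rule_of_based hb r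
    rw [e]
    exact models_based hc.1.1.1 hc.1.2.1 hc.1.2.2.1 hA hlk hM
      -- The factor is one more than a number of atoms, so M ≤ N.
      (Nat.le_mul_of_pos_left _ (Nat.succ_pos _)) hc.2.1 hsub hb
  · have e : c.plan.2.2 = c.1.2.sig.rels.map (pairRule c.1.1.sig.sorts c.1.1.sig.rels c.2.1.isAll c.vars
        c.2.2.1.atoms c.2.2.2.atoms) :=
      List.map_congr_left fun r _ => rule_of_not_based hb r
    obtain ⟨hp, hr⟩ := hc.2.2.resolve_left hb
    rw [Formula.toFinset_freeList] at hp
    rw [e]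
    exact models_pair hc.1.1.1 hc.1.2.1 hc.1.2.2.1 hA (fun s hs => Reader.card_idxOf hy hs) hlk hM le_rfl
      hc.2.1 hp hr

/-- Strings which do not encode a structure are mapped to the empty string. -/
theorem result_nil (hv : Reader.valid k (c.word y) (Reader.positions c.1.1.sig) = false) :
    Reader.result k (c.word y) c.plan = [] := by
  rw [Reader.result, show c.plan.1 = Reader.positions c.1.1.sig from rfl, hv, cond_false]

theorem encode_ne_nil {σ : Signature} (hσ : σ.WellFormed) (A : Struc) : A.encode σ ≠ [] := by
  obtain ⟨s, l, e⟩ := List.exists_cons_of_ne_nil hσ.sorts_ne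
  simp [Struc.encode, e, natsStr]

/-- The validity test of the reader recognises exactly the encodings of structures on the first
signature, so these are the two possible behaviours. -/
theorem struc_cases (hc : c.Good k) (y : Str) :
    (∃ A : Struc, A.On c.1.1.sig ∧ y = A.encode c.1.1.sig ∧
      Reader.result k (c.word y) c.plan = (c.struc k y).encode c.1.2.sig) ∨
    (¬ ∃ A : Struc, A.On c.1.1.sig ∧ y = A.encode c.1.1.sig) ∧ Reader.result k (c.word y) c.plan = [] := by
  rcases hv : Reader.valid k (c.word y) (Reader.positions c.1.1.sig) with _ | _
  · refine Or.inr ⟨?_, result_nil hv⟩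
    rintro ⟨A, hA, hy⟩
    rw [valid hc hA hy] at hv
    exact absurd hv (by simp)
  · obtain ⟨A, hA, hy⟩ := Reader.exists_struc hc.1.1.1.wf (fun R hR => hc.1.1.2.2 R.1 R.2 hR) hv
    exact Or.inl ⟨A, hA, hy, result_eq hc hv⟩

/-- On encodings of structures this is the equivalence of the two sentences. Otherwise neither pair
is in the language: an encoding is never empty, as a signature has at least one sort. -/
theorem correct (hc : c.Good k) (hsub : Subformula c.2.2.1 c.1.2.form) (y : Str) :
    (c.1.1.encode, y) ∈ MCs ↔ (c.1.2.encode, Reader.result k (c.word y) c.plan) ∈ MCs := by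
  rcases struc_cases hc y with ⟨A, hA, hy, e⟩ | ⟨hno, e⟩
  · rw [e, mem_MCs_iff hc.1.2.1 (struc_on hc hA hy), ← models_struc hc hA hy hsub, ← mem_MCs_iff hc.1.1.1 hA, ← hy]
  · rw [e]
    refine iff_of_false ?_ ?_
    · rintro ⟨ψ, A, -, hA, h, -⟩
      rw [Prod.mk.injEq] at h
      obtain rfl := SigFormula.encode_injective h.1
      exact hno ⟨A, hA, h.2⟩
    · rintro ⟨ψ, A, hψ, -, h, -⟩
      rw [Prod.mk.injEq] at h
      exact encode_ne_nil hψ.wf A h.2.symm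

/-- For a structure, every new universe has the size of the sum of the old ones times a factor, and
the sum is at most the number of sorts times the maximum. The empty string has measure 0. -/
theorem maxSortSize_result_le (hc : c.Good k) (y : Str) :
    maxSortSize k (c.1.2.encode, Reader.result k (c.word y) c.plan) ≤
      (c.1.1.form.atoms.length + 1) * c.1.1.sig.sorts.length * maxSortSize k (c.1.1.encode, y) := by
  rcases struc_cases hc y with ⟨A, hA, hy, e⟩ | ⟨-, e⟩
  · rw [e, maxSortSize_eq ⟨hc.1.2.1, hc.1.2.2.2, struc_on hc hA hy, rfl⟩,
      maxSortSize_eq ⟨hc.1.1.1, hc.1.1.2.2, hA, congrArg _ hy⟩]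
    exact maxCard_struc_le hy
  · obtain ⟨_, _, _, h⟩ := isMeasure_maxSortSize k
    have := (h c.1.2.encode []).1
    rw [e]
    simp only [List.length_nil, Nat.le_zero] at this
    rw [this]
    exact Nat.zero_le _

end Witness

/-! ### The accordion reduction. -/

/-- The mapping of the reduction. -/
noncomputable def reduction (k : ℕ) : Str × Str × Str →. Str := fun x =>
  ⟨(x.1, x.2.1) ∈ pairSet k, fun _ => Reader.result k (tripleWord x) (Witness.planOf k (x.1, x.2.1))⟩

theorem mem_reduction {k : ℕ} {u u' y z : Str} (hz : z ∈ reduction k (u, u', y)) : ∃ c : Witness, c.Good k ∧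
    Subformula c.2.2.1 c.1.2.form ∧ u = c.1.1.encode ∧ u' = c.1.2.encode ∧
    Witness.planOf k (u, u') = c.plan ∧ z = Reader.result k (c.word y) c.plan := by
  obtain ⟨h, rfl⟩ := hz
  obtain ⟨c, hc, hsub, e, hp⟩ := Witness.exists_planOf h
  obtain ⟨rfl, rfl⟩ := Prod.mk.inj e
  refine ⟨c, hc, hsub, rfl, rfl, hp, ?_⟩
  change Reader.result k _ (Witness.planOf k _) = _
  rw [hp]
  rfl

theorem isAccordionReduction_reduction (k : ℕ) :
    IsAccordionReduction MCs (pairSet k) (maxSortSize k) (reduction k) where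
  enumerable := (Witness.primrecPred_pairSet k).computablePred.to_re
  measure := isMeasure_maxSortSize k
  dom _ _ _ := Iff.rfl
  fpt := by
    obtain ⟨f, p, M, hf, h⟩ := exists_machine (Witness.primrec_planOf k) (Reader.polyEmits_result k)
    refine ⟨f, p, M, hf, ?_⟩
    rintro ⟨u, u', y⟩ z ⟨_, rfl⟩
    exact h u u' y
  measureLinear := by
    -- The bound is read off from the plan: the factor for the sizes times the number of sorts of
    -- the first signature.
    refine ⟨fun x => ⟨x ∈ pairSet k, fun _ =>
      (Witness.planOf k x).2.1.2 * (Witness.planOf k x).1.1⟩, ?_, fun _ => Iff.rfl, ?_⟩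
    · have h1 : Primrec fun x => (Witness.planOf k x).2.1.2 * (Witness.planOf k x).1.1 :=
        nat_mul.comp (snd.comp (fst.comp (snd.comp (Witness.primrec_planOf k))))
          (fst.comp (fst.comp (Witness.primrec_planOf k)))
      refine ((Partrec.map (Witness.primrecPred_pairSet k).computablePred.to_re
        (h1.to_comp.comp Computable.fst).to₂)).of_eq fun x => ?_
      refine Part.ext' ?_ fun _ _ => rfl
      simp [Part.assert]
    · intro u u' y b hb z hz
      obtain ⟨_, rfl⟩ := hb
      obtain ⟨c, hc, -, rfl, rfl, hp, rfl⟩ := mem_reduction hz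
      simp only [hp]
      exact Witness.maxSortSize_result_le hc y
  correct u u' y z hz := by
    obtain ⟨c, hc, hsub, rfl, rfl, -, rfl⟩ := mem_reduction hz
    exact Witness.correct hc hsub y

end Accordion

theorem mainTheorem7 (k : ℕ) :
    ∃ r : Accordion.Str × Accordion.Str × Accordion.Str →. Accordion.Str,
      Accordion.IsAccordionReduction Accordion.MCs (Accordion.pairSet k)
        (Accordion.maxSortSize k) r ∧
      ∀ (ψ φ : Accordion.SigFormula) (A : Accordion.Struc),
        A.On ψ.sig → ∀ z ∈ r (ψ.encode, φ.encode, A.encode ψ.sig),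
          ∃ B : Accordion.Struc, B.On φ.sig ∧ z = B.encode φ.sig := by
  refine ⟨_, Accordion.isAccordionReduction_reduction k, fun ψ φ A hA z hz => ?_⟩
  obtain ⟨c, hc, -, h1, h2, -, rfl⟩ := Accordion.mem_reduction hz
  obtain rfl := Accordion.SigFormula.encode_injective h1
  obtain rfl := Accordion.SigFormula.encode_injective h2
  exact ⟨_, Accordion.Witness.struc_on hc hA rfl,
    Accordion.Witness.result_eq hc (Accordion.Witness.valid hc hA rfl)⟩
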